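/- Let $n\ge 1$. For $z=(z_1,\dots,z_n)\in(\mathbb C\setminus\{0\})^n$ put $u_i=z_1+z_1z_2+\dots+z_1z_2\cdots z_i$ (so $z_k=\frac{u_k-u_{k-1}}{u_{k-1}-u_{k-2}}$ with $u_0=0$, $u_{-1}=-1$) and $u=\mathrm{diag}(u_1,\dots,u_n)$. Call $z$ regular if the $u_i$ are pairwise distinct. For an $n\times n$ matrix $A$ let $(\mathrm{ad}_u^{-1}A)_{ij}=A_{ij}/(u_i-u_j)$ for $i\ne j$ and $0$ for $i=j$. The $n$-th isomonodromy equation is $$\frac{\partial\Phi}{\partial z_k}=\big[\mathrm{ad}_u^{-1}\mathrm{ad}_{\partial u/\partial z_k}\Phi,\ \Phi\big],\qquad k=1,\dots,n,$$ for a holomorphic $n\times n$ matrix function $\Phi$. Solutions are considered as (multi-valued) functions of $z$, that is, as functions of $w=(\log z_1,\dots,\log z_n)$, on open sets of regular points. *The series $\mathcal s_k$.* Let $\delta_kA$ keep the upper left $k\times k$ block and the diagonal of $A$ and replace the other entries by $0$; write $z^{\mathrm{ad}A}X=z^AXz^{-A}$, $\mathrm{da}(A)X=AX+XA$, and $\delta_k'=\delta_k-\delta_{k-1}$.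 Let $U_{(k)}$ be the diagonal matrix whose $i$-th entry is $\frac{u_{k-1}-u_i}{u_{k-1}-u_{k-2}}$ for $i\le k-2$ and $0$ otherwise. For a matrix $\Phi_{k-1}$ with $A=\delta_{k-1}\Phi_{k-1}$ let $\mathcal s_k(\Phi_{k-1})=\sum_{m\ge0}z_k^{-m}\phi_{k,m}(z_k)$, where $\phi_{k,0}=z_k^{-\mathrm{ad}A}\Phi_{k-1}$ and, for $m\ge 0$, $$\delta_{k-1}\phi_{k,m+1}=z_k^{m+1}\!\int^{z_k}\! z_k^{-(m+1)}b_{m+2}\,\frac{dz_k}{z_k},\qquad z_k^{\mathrm{ad}A}\phi_{k,m+1}=z_k^{m+1}\!\int^{z_k}\! z_k^{-(m+1)}a_{m+2}\,\frac{dz_k}{z_k},$$ $$b_{m+2}=\sum_{p=1}^{m+1}\sum_{i+j=m+1-p}(-1)^p\big[U_{(k)}^p,\ \delta_k'\phi_{k,i}\cdot\delta_k'\phi_{k,j}\big],$$ $$a_{m+2}=\sum_{\substack{i+j=m+1\\ i<m+1}}z_k^{\mathrm{ad}A}[\phi_{k,i},\delta_{k-1}\phi_{k,j}]+\sum_{p=1}^{m+1}\sum_{i+j=m+1-p}(-1)^pz_k^{\mathrm{ad}A}\big[\mathrm{da}(U_{(k)}^p)\,\delta_k'\phi_{k,i},\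 \phi_{k,j}\big].$$ Here $\int^z$ is the formal primitive without constant term: $\int^z z^c(\ln z)^t\frac{dz}{z}$ is $(\frac{d}{dc})^t\frac{z^c}{c}$ for $c\ne0$ and $\frac{(\ln z)^{t+1}}{t+1}$ for $c=0$. *Shrinking solutions.* A constant matrix $\Phi_0$ satisfies the boundary condition if for every $1\le k\le n-1$ any two eigenvalues $\lambda,\mu$ of its upper left $k\times k$ submatrix satisfy $|\mathrm{Re}(\lambda-\mu)|<1$. A solution is a shrinking solution if it equals $\mathcal s_n\circ\mathcal s_{n-1}\circ\dots\circ\mathcal s_1(\Phi_0)$ near $z_1,\dots,z_n\to\infty$ for some $\Phi_0$ satisfying the boundary condition. *Statement.* Let $z^{(0)}\in(\mathbb R\setminus\{0\})^n$ be a regular point, with a choice of logarithms $w^{(0)}$, such that the connected component $C$ of $z^{(0)}$ in the set of regular points of $(\mathbb R\setminus\{0\})^n$ contains points at which all $|z_k|$ are arbitrarily large; equivalently, for every $k$, the real number $u_k$ is the largest or the smallest of $u_1,\dots,u_k$ at $z^{(0)}$. Let $\Phi$ be a solution of the $n$-th isomonodromy equation on an open set containing $w^{(0)}$ for which $\Phi(w^{(0)})$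 is skew-Hermitian. Then $\Phi$ is a shrinking solution. More precisely, there is a constant matrix $\Phi_0$ satisfying the boundary condition such that for every $\theta>\max_k|\mathrm{Im}\,w^{(0)}_k|$ there are continuous functions $R_k(w_1,\dots,w_{k-1})$, $k=1,\dots,n$, such that the germ of $\Phi$ at $w^{(0)}$ extends to a holomorphic solution $\Psi$ on an open set containing $C$ (lifted through $w^{(0)}$) and the region $$D=\{w\in\mathbb C^n:\ |\mathrm{Im}\,w_k|<\theta,\ \mathrm{Re}\,w_k>R_k(w_1,\dots,w_{k-1})\ \text{for all } k\},$$ and at every point of $D$ the series $\mathcal s_1(\Phi_0)$, $\mathcal s_2(\mathcal s_1(\Phi_0))$, $\dots$ converge absolutely and $\Psi=\mathcal s_n\circ\dots\circ\mathcal s_1(\Phi_0)$. -/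

import Mathlib

open scoped Matrix Topology

noncomputable section

namespace Isomonodromy

variable {n : ℕ}

/- Coordinates. A point `w : Fin n → ℂ` records logarithms `w k = log z_{k+1}` of the coordinates
`z_k = (u_k - u_{k-1}) / (u_{k-1} - u_{k-2})` (with `u_0 = 0`, `u_{-1} = -1`), that is, a point of
the universal cover of the space of nonzero `z_1, …, z_n`. Powers of `z_k` are single valued in `w`.
Index `k : Fin n` stands for the index `k + 1` of the usual 1-based numbering. -/

/-- The numbers `u_i = z_1 + z_1 z_2 + ⋯ + z_1 z_2 ⋯ z_i`. -/
def u (w : Fin n → ℂ) (i : Fin n) : ℂ :=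
  ∑ l ∈ Finset.univ.filter (· ≤ i), ∏ j ∈ Finset.univ.filter (· ≤ l), Complex.exp (w j)

/-- The points over the complement of the fat diagonal. -/
def regular (n : ℕ) : Set (Fin n → ℂ) := {w | Function.Injective (u w)}

/-- The operator `ad_u⁻¹`: divide the `(i, j)` entry by `u_i - u_j`, and kill the diagonal. -/
def adInv (v : Fin n → ℂ) (A : Matrix (Fin n) (Fin n) ℂ) : Matrix (Fin n) (Fin n) ℂ :=
  fun i j => if i = j then 0 else A i j / (v i - v j)

/-- The partial derivative of `u` (as a vector) in the coordinate `w k`. -/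
def partialU (w : Fin n → ℂ) (k : Fin n) : Fin n → ℂ :=
  fun i => deriv (fun t => u (Function.update w k t) i) (w k)

/-- Holomorphic solutions, on an open set `Ω` of regular points, of the isomonodromy equation
`∂Φ/∂w_k = [ad_u⁻¹ ad_{∂u/∂w_k} Φ, Φ]`, `k = 1, …, n`. Both sides are multiplied by `z_k` when one
passes from `∂/∂z_k` to `∂/∂w_k = z_k ∂/∂z_k`. -/
structure IsSolutionOn (Ω : Set (Fin n → ℂ))
    (Φ : (Fin n → ℂ) → Matrix (Fin n) (Fin n) ℂ) : Prop where
  isOpen : IsOpen Ω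
  subset_regular : Ω ⊆ regular n
  differentiableOn : ∀ i j, DifferentiableOn ℂ (fun w => Φ w i j) Ω
  equation : ∀ w ∈ Ω, ∀ k i j,
    HasDerivAt (fun t => Φ (Function.update w k t) i j)
      (⁅adInv (u w) ⁅Matrix.diagonal (partialU w k), Φ w⁆, Φ w⁆ i j) (w k)

/-- `δ_k A`: keep the upper left `k × k` block and the diagonal of `A`. -/
def delta (k : ℕ) (A : Matrix (Fin n) (Fin n) ℂ) : Matrix (Fin n) (Fin n) ℂ :=
  fun i j => if ((i : ℕ) < k ∧ (j : ℕ) < k) ∨ i = j then A i j else 0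

/-- The upper left `k × k` submatrix. -/
def upperLeft (A : Matrix (Fin n) (Fin n) ℂ) (k : ℕ) (hk : k ≤ n) : Matrix (Fin k) (Fin k) ℂ :=
  A.submatrix (Fin.castLE hk) (Fin.castLE hk)

/-- The boundary condition: for `k ≤ n - 1`, the real parts of any two eigenvalues of the upper
left `k × k` submatrix differ by less than `1`. -/
def BoundaryCondition (A : Matrix (Fin n) (Fin n) ℂ) : Prop :=
  ∀ (k : ℕ) (hk : k < n), ∀ a ∈ spectrum ℂ (upperLeft A k hk.le),
    ∀ b ∈ spectrum ℂ (upperLeft A k hk.le), |(a - b).re| < 1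

/-- `z ^ {ad A} X = z ^ A X z ^ {-A}` with `log z = s`. -/
def powAd (s : ℂ) (A X : Matrix (Fin n) (Fin n) ℂ) : Matrix (Fin n) (Fin n) ℂ :=
  NormedSpace.exp (s • A) * X * NormedSpace.exp (-(s • A))

/-- The diagonal matrix `U_(k+1)`, with entries `(u_k - u_i) / (u_k - u_{k-1})` in the places
`i ≤ k - 1` and `0` elsewhere (1-based), written as
`1 + z_k⁻¹ + z_k⁻¹ z_{k-1}⁻¹ + ⋯ + z_k⁻¹ ⋯ z_{i+2}⁻¹`. -/
def UMat (w : Fin n → ℂ) (k : Fin n) : Matrix (Fin n) (Fin n) ℂ :=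
  Matrix.diagonal fun i =>
    ∑ l ∈ Finset.univ.filter (fun l => i < l ∧ l < k),
      ∏ j ∈ Finset.univ.filter (fun j => l < j ∧ j < k), Complex.exp (-(w j))

/-- `F` is the formal primitive of `f` with respect to `dz / z = ds`, where `s = log z`:
`F` is a combination of terms `z ^ c (log z) ^ t` in which no constant term (`c = 0`, `t = 0`)
occurs, and `dF/ds = f`. There is at most one such `F`; for `f = z ^ c (log z) ^ t` it is
`(d/dc)^t (z ^ c / c)` if `c ≠ 0` and `(log z) ^ (t + 1) / (t + 1)` if `c = 0`. -/
def IsFormalPrimitive (F f : ℂ → Matrix (Fin n) (Fin n) ℂ) : Prop :=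
  ∀ i j, (fun s => F s i j) ∈ Submodule.span ℂ
      {g : ℂ → ℂ | ∃ (c : ℂ) (t : ℕ), (c ≠ 0 ∨ t ≠ 0) ∧ g = fun s => s ^ t * Complex.exp (c * s)} ∧
    ∀ s, HasDerivAt (fun s => F s i j) (f s i j) s

/-- The off-block part `(δ_{k+1} - δ_k) X`. -/
def cross (k : ℕ) (X : Matrix (Fin n) (Fin n) ℂ) : Matrix (Fin n) (Fin n) ℂ :=
  delta (k + 1) X - delta k X

/-- The right-hand side `b_{m+2}` of the recursion for the terms `φ_m`. -/
def bTerm (k : ℕ) (U : Matrix (Fin n) (Fin n) ℂ) (φ : ℕ → ℂ → Matrix (Fin n) (Fin n) ℂ)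
    (m : ℕ) (s : ℂ) : Matrix (Fin n) (Fin n) ℂ :=
  ∑ p ∈ Finset.Icc 1 (m + 1), ∑ ij ∈ Finset.HasAntidiagonal.antidiagonal (m + 1 - p),
    (-1 : ℂ) ^ p • ⁅U ^ p, cross k (φ ij.1 s) * cross k (φ ij.2 s)⁆

/-- The right-hand side `a_{m+2}` of the recursion for the terms `φ_m`. -/
def aTerm (k : ℕ) (U A : Matrix (Fin n) (Fin n) ℂ) (φ : ℕ → ℂ → Matrix (Fin n) (Fin n) ℂ)
    (m : ℕ) (s : ℂ) : Matrix (Fin n) (Fin n) ℂ :=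
  (∑ ij ∈ (Finset.HasAntidiagonal.antidiagonal (m + 1)).filter (fun ij => ij.1 < m + 1),
      powAd s A ⁅φ ij.1 s, delta k (φ ij.2 s)⁆) +
    ∑ p ∈ Finset.Icc 1 (m + 1), ∑ ij ∈ Finset.HasAntidiagonal.antidiagonal (m + 1 - p),
      (-1 : ℂ) ^ p •
        powAd s A ⁅U ^ p * cross k (φ ij.1 s) + cross k (φ ij.1 s) * U ^ p, φ ij.2 s⁆

/-- The functions `φ_m` of `s = log z_{k+1}` are the coefficients of the series
`s_{k+1}(Φ') = ∑ₘ z_{k+1} ^ {-m} φ_m` attached to the matrix `Φ'`: with `A = δ_k Φ'`,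
`φ_0 = z ^ {-ad A} Φ'`, `δ_k φ_{m+1} = z ^ {m+1} ∫ z ^ {-(m+1)} b_{m+2} dz/z` and
`z ^ {ad A} φ_{m+1} = z ^ {m+1} ∫ z ^ {-(m+1)} a_{m+2} dz/z`, with formal primitives. -/
structure IsSeriesTerms (k : ℕ) (U Φ' : Matrix (Fin n) (Fin n) ℂ)
    (φ : ℕ → ℂ → Matrix (Fin n) (Fin n) ℂ) : Prop where
  zero : ∀ s, φ 0 s = powAd (-s) (delta k Φ') Φ'
  delta_succ : ∀ m : ℕ, IsFormalPrimitive
    (fun s => Complex.exp (-((m : ℂ) + 1) * s) • delta k (φ (m + 1) s))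
    (fun s => Complex.exp (-((m : ℂ) + 1) * s) • bTerm k U φ m s)
  succ : ∀ m : ℕ, IsFormalPrimitive
    (fun s => Complex.exp (-((m : ℂ) + 1) * s) • powAd s (delta k Φ') (φ (m + 1) s))
    (fun s => Complex.exp (-((m : ℂ) + 1) * s) • aTerm k U (delta k Φ') φ m s)

/-- The series `s_{k+1}(Φ')` converges absolutely at the point `w`, with sum `X`. -/
def HasSeriesValue (k : Fin n) (w : Fin n → ℂ) (Φ' X : Matrix (Fin n) (Fin n) ℂ) : Prop :=
  ∃ φ : ℕ → ℂ → Matrix (Fin n) (Fin n) ℂ, IsSeriesTerms k (UMat w k) Φ' φ ∧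
    HasSum (fun m : ℕ => Complex.exp (-(m : ℂ) * w k) • φ m (w k)) X

/-- The value of `s_n ∘ ⋯ ∘ s_1 (Φ₀)` at the point `w` exists and is `X`. In the chain
`Φ₀ = Y 0, Y 1, …, Y n = X` the matrix `Y k` is the value of `s_k ∘ ⋯ ∘ s_1 (Φ₀)`, which depends
on the first `k` coordinates only. -/
def HasIteratedSeriesValue (Φ₀ : Matrix (Fin n) (Fin n) ℂ) (w : Fin n → ℂ)
    (X : Matrix (Fin n) (Fin n) ℂ) : Prop :=
  ∃ Y : ℕ → Matrix (Fin n) (Fin n) ℂ, Y 0 = Φ₀ ∧ Y n = X ∧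
    ∀ k : Fin n, HasSeriesValue k w (Y k) (Y (k + 1))

/-- The region `|arg z_k| < θ`, `log |z_k| > R_k(z_1, …, z_{k-1})` near the boundary point
`z_1, …, z_n → ∞`. -/
def regionAtInfinity (θ : ℝ) (R : (k : Fin n) → (Fin (k : ℕ) → ℂ) → ℝ) : Set (Fin n → ℂ) :=
  {w | ∀ k : Fin n, |(w k).im| < θ ∧
    R k (fun j : Fin (k : ℕ) => w (Fin.castLE k.isLt.le j)) < (w k).re}

/-- Points all of whose coordinates `z_k = exp (w k)` are real (and nonzero). -/
def IsRealPoint (w : Fin n → ℂ) : Prop := ∀ k, ∃ m : ℤ, (w k).im = m * Real.pi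

/-- The connected component of a real regular point `w₀` among the real regular points:
the signs of the `z_k` and the order of the real numbers `u_1, …, u_n` are those at `w₀`
(in the coordinates `u` this is an open convex cone). -/
def realComponent (w₀ : Fin n → ℂ) : Set (Fin n → ℂ) :=
  {w | (∀ k, (w k).im = (w₀ k).im) ∧
    ∀ i j, (u w i).re < (u w j).re ↔ (u w₀ i).re < (u w₀ j).re}

/-- The real component of `w₀` has `z_1, …, z_n → ∞` as a boundary point, i.e. it contains points
at which all `|z_k|` are arbitrarily large: each `u_k` is the largest or the smallest among
`u_1, …, u_k`. -/
def ReachesInfinity (w₀ : Fin n → ℂ) : Prop :=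
  ∀ k, (∀ j, j < k → (u w₀ j).re < (u w₀ k).re) ∨ (∀ j, j < k → (u w₀ k).re < (u w₀ j).re)

/-- The solution with germ `Φ` at the real point `w₀` is a shrinking solution: there is a matrix
`Φ₀` with the boundary condition such that, for every angle `θ`, the germ continues to a
holomorphic solution `Ψ` on an open set containing the real component of `w₀` and a region
`|arg z_k| < θ`, `|z_k|` large, at infinity, and `Ψ = s_n ∘ ⋯ ∘ s_1 (Φ₀)` on this region.
(The component and the region are connected and meet each other, so that `Ψ` is determined
there by `Φ`.) -/
def IsShrinkingAt (w₀ : Fin n → ℂ) (Φ : (Fin n → ℂ) → Matrix (Fin n) (Fin n) ℂ) : Prop :=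
  ∃ Φ₀ : Matrix (Fin n) (Fin n) ℂ, BoundaryCondition Φ₀ ∧
    ∀ θ : ℝ, (∀ k, |(w₀ k).im| < θ) →
      ∃ R : (k : Fin n) → (Fin (k : ℕ) → ℂ) → ℝ, (∀ k, Continuous (R k)) ∧
        ∃ (Ω : Set (Fin n → ℂ)) (Ψ : (Fin n → ℂ) → Matrix (Fin n) (Fin n) ℂ),
          IsSolutionOn Ω Ψ ∧ realComponent w₀ ⊆ Ω ∧ regionAtInfinity θ R ⊆ Ω ∧
            Ψ =ᶠ[𝓝 w₀] Φ ∧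
            ∀ w ∈ regionAtInfinity θ R, HasIteratedSeriesValue Φ₀ w (Ψ w)

end Isomonodromy

end

/-!
The isomonodromy equation of size `n` is the top of a hierarchy. The equation of level `k` reads
`dΦ = [N_k(Φ), Φ]`, where `N_k(Φ)` multiplies the off-diagonal entries of `δ_k Φ` by
`d log (u_a - u_b)` and subtracts `(∑_{j < k} dw_j) δ_k Φ` (`lax`, `iso`). It is integrable
(`isFlat_iso`), its right-hand side involves the first `k` coordinates only, and at level `0` it
vanishes. The equations of levels `k + 1` and `k` differ by the term `-dw_k δ_k Φ` and by terms
of size `exp (-Re w_k)` (`lax_succ`, `norm_epsCoeff_le`).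

On the real component of `w₀` the numbers `u_a` are real, so `N_n(Φ)` is skew-Hermitian when
`Φ` is, and the Frobenius norm of a skew-Hermitian solution is constant. The
solution therefore cannot blow up and extends to the whole component, which is star-shaped in the
coordinates `u` (`exists_solution_near_component`). As the component reaches infinity, it is a tower:
each `Re w_k` ranges over a set that is unbounded above and depends on the previous coordinates
(`mem_tower_iff_mem_realComponent`).

*Descent.* Let `Y` be a solution of level `k + 1` on the real slice. As `w_k → ∞` the matrix `δ_k Y`
has a limit `A`, and `z_k ^ {ad A} Y` has a limit, which solves the equation of level `k`
(`isSliceSol_descend`, with the rate of convergence in `exists_asymptotic_descend`). The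
eigenvalues of the blocks stay on the imaginary axis, since this passes to limits and to conjugate
matrices (`ImagSpectrum`). At the bottom there remains a constant `Φ₀` whose blocks have imaginary
eigenvalues, which is more than the boundary condition asks
(`boundaryCondition_of_imagSpectrum`).

*The series.* When `exp (t δ_k Φ')` is bounded for real `t`, the operators `d/ds - m` with `m ≥ 1`
are invertible on the functions generated by powers of `s` and exponentials of imaginary rate.
This gives the terms of the series (`exists_terms`), where the two prescriptions for the block part
turn out to agree, and a gain of `1 / m` that makes them grow at most geometrically, uniformly on
strips (`exists_norm_terms_le`). The sum solves the equation of level `k + 1` in the direction of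
`w_k`, because `UMat w k / z_k` enters through a geometric series
(`exists_series_solution`, `had_epsCoeff_single`). A solution in this direction is determined by its
leading term `z_k ^ {-ad A} Φ'` (`eq_of_asymptotic`): each use of the equation improves the estimate
for the difference of two solutions, and the constants are those of an exponential series.

*Ascent.* From the real slice, solutions are continued along straight segments in imaginary
direction; integrability makes the result a solution in all directions (`lift`,
`hasFDerivAt_lift`). Where the limit of level `k` continues, its leading term solves the equation of
level `k + 1` up to an exponentially small error along the segment, so the solution of
level `k + 1` continues as well once `Re w_k` is large, and stays close to the leading term
(`exists_ascent`). By uniqueness it is the sum of the series. Induction on the level provides the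
region at infinity, with continuous bounds obtained by a partition of unity
(`exists_region`).
-/

open Set Filter

namespace Isomonodromy

/-! ### Ordinary differential equations on the unit interval -/

section ODE

variable {E : Type*} [NormedAddCommGroup E] [NormedSpace ℝ E]

/-- The radial retraction onto the closed ball of radius `a` around the origin. -/
noncomputable def radialRetraction (a : ℝ) (x : E) : E := (a / max a ‖x‖) • x

theorem radialRetraction_of_norm_le {a : ℝ} (ha : 0 < a) {x : E} (hx : ‖x‖ ≤ a) :
    radialRetraction a x = x := by
  rw [radialRetraction, max_eq_left hx, div_self ha.ne', one_smul]

theorem norm_radialRetraction_le {a : ℝ} (ha : 0 < a) (x : E) : ‖radialRetraction a x‖ ≤ a := by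
  have h : 0 < max a ‖x‖ := lt_max_of_lt_left ha
  rw [radialRetraction, norm_smul, Real.norm_of_nonneg (by positivity), div_mul_eq_mul_div,
    div_le_iff₀ h]
  exact mul_le_mul_of_nonneg_left (le_max_right _ _) ha.le

theorem norm_radialRetraction_le_norm {a : ℝ} (ha : 0 < a) (x : E) :
    ‖radialRetraction a x‖ ≤ ‖x‖ := by
  have h : 0 < max a ‖x‖ := lt_max_of_lt_left ha
  rw [radialRetraction, norm_smul, Real.norm_of_nonneg (by positivity)]
  exact mul_le_of_le_one_left (norm_nonneg _) ((div_le_one h).2 (le_max_left _ _))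

/-- In a general normed space the radial retraction is Lipschitz with constant `2`. -/
theorem norm_radialRetraction_sub_le {a : ℝ} (ha : 0 < a) (x y : E) :
    ‖radialRetraction a x - radialRetraction a y‖ ≤ 2 * ‖x - y‖ := by
  have hx : 0 < max a ‖x‖ := lt_max_of_lt_left ha
  have hy : 0 < max a ‖y‖ := lt_max_of_lt_left ha
  have hsplit : radialRetraction a x - radialRetraction a y =
      (a / max a ‖x‖) • (x - y) + (a / max a ‖x‖ - a / max a ‖y‖) • y := by
    simp only [radialRetraction, smul_sub, sub_smul]; abel
  have h1 : ‖(a / max a ‖x‖) • (x - y)‖ ≤ ‖x - y‖ := by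
    rw [norm_smul, Real.norm_of_nonneg (by positivity)]
    exact mul_le_of_le_one_left (norm_nonneg _) ((div_le_one hx).2 (le_max_left _ _))
  have h2 : ‖(a / max a ‖x‖ - a / max a ‖y‖) • y‖ ≤ ‖x - y‖ := by
    have e : a / max a ‖x‖ - a / max a ‖y‖ =
        (a / max a ‖x‖) * ((max a ‖y‖ - max a ‖x‖) / max a ‖y‖) := by
      field_simp
    rw [norm_smul, e, norm_mul, Real.norm_of_nonneg (show 0 ≤ a / max a ‖x‖ by positivity),
      norm_div, Real.norm_of_nonneg hy.le]
    have h3 : ‖max a ‖y‖ - max a ‖x‖‖ ≤ ‖x - y‖ := by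
      rw [max_comm a, max_comm a, Real.norm_eq_abs, norm_sub_rev x y]
      exact (abs_max_sub_max_le_abs ‖y‖ ‖x‖ a).trans (abs_norm_sub_norm_le y x)
    calc a / max a ‖x‖ * (‖max a ‖y‖ - max a ‖x‖‖ / max a ‖y‖) * ‖y‖
        = (a / max a ‖x‖) * (‖y‖ / max a ‖y‖) * ‖max a ‖y‖ - max a ‖x‖‖ := by ring
      _ ≤ 1 * 1 * ‖x - y‖ := by
          gcongr
          · exact (div_le_one hx).2 (le_max_left _ _)
          · exact (div_le_one hy).2 (le_max_right _ _)
      _ = ‖x - y‖ := by ring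
  rw [hsplit, two_mul]
  exact (norm_add_le _ _).trans (add_le_add h1 h2)

theorem gronwallBound_le_mul_exp {δ K ε t : ℝ} (hK : 0 ≤ K) (hε : 0 ≤ ε) (hδ : 0 ≤ δ)
    (ht : t ≤ 1) : gronwallBound δ K ε t ≤ (δ + ε) * Real.exp K := by
  have h1 : Real.exp (K * t) ≤ Real.exp K := Real.exp_le_exp.2 (mul_le_of_le_one_right hK ht)
  have h1' : 1 ≤ Real.exp K := Real.one_le_exp hK
  rcases hK.eq_or_lt with rfl | hK'
  · rw [gronwallBound_K0]
    simp only [Real.exp_zero, mul_one]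
    nlinarith
  · rw [gronwallBound_of_K_ne_0 hK'.ne']
    have h2 : Real.exp K - 1 ≤ K * Real.exp K := by
      have := Real.add_one_le_exp (-K)
      have h3 : Real.exp (-K) * Real.exp K = 1 := by rw [← Real.exp_add]; simp
      nlinarith [Real.exp_pos K]
    have h4 : ε / K * (Real.exp (K * t) - 1) ≤ ε * Real.exp K := by
      rw [div_mul_eq_mul_div, div_le_iff₀ hK', mul_assoc]
      exact mul_le_mul_of_nonneg_left (by linarith) hε
    nlinarith

theorem exists_solution_of_lipschitz_of_bounded [CompleteSpace E] {v : ℝ → E → E} {K B : ℝ}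
    (hK : 0 ≤ K) (hB : 0 ≤ B)
    (hlip : ∀ t ∈ Icc (0 : ℝ) 1, ∀ x y, ‖v t x - v t y‖ ≤ K * ‖x - y‖)
    (hcont : ∀ x, ContinuousOn (fun t => v t x) (Icc (0 : ℝ) 1))
    (hbound : ∀ t ∈ Icc (0 : ℝ) 1, ∀ x, ‖v t x‖ ≤ B) (x₀ : E) :
    ∃ x : ℝ → E, x 0 = x₀ ∧
      ∀ t ∈ Icc (0 : ℝ) 1, HasDerivWithinAt x (v t (x t)) (Icc 0 1) t := by
  have hPL : IsPicardLindelof v (⟨0, by simp⟩ : Icc (0 : ℝ) 1) x₀ ⟨B, hB⟩ 0 ⟨B, hB⟩ ⟨K, hK⟩ := by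
    refine ⟨fun t ht => ?_, fun x _ => hcont x, fun t ht x _ => hbound t ht x, ?_⟩
    · refine LipschitzOnWith.of_dist_le_mul fun x _ y _ => ?_
      rw [dist_eq_norm, dist_eq_norm]
      exact hlip t ht x y
    · simp
  exact hPL.exists_eq_forall_mem_Icc_hasDerivWithinAt₀

theorem HasDerivWithinAt.Ici_of_Icc {f : ℝ → E} {f' : E} {a b t : ℝ} (ht : t ∈ Ico a b)
    (h : HasDerivWithinAt f f' (Icc a b) t) : HasDerivWithinAt f f' (Ici t) t :=
  h.mono_of_mem_nhdsWithin (Icc_mem_nhdsGE_of_mem ht)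

theorem norm_le_of_deriv_Icc {x x' : ℝ → E} {K ε δ : ℝ} (hK : 0 ≤ K) (hε : 0 ≤ ε)
    (hx : ∀ t ∈ Icc (0 : ℝ) 1, HasDerivWithinAt x (x' t) (Icc 0 1) t)
    (h0 : ‖x 0‖ ≤ δ) (hb : ∀ t ∈ Icc (0 : ℝ) 1, ‖x' t‖ ≤ K * ‖x t‖ + ε) :
    ∀ t ∈ Icc (0 : ℝ) 1, ‖x t‖ ≤ (δ + ε) * Real.exp K := by
  intro t ht
  have := norm_le_gronwallBound_of_norm_deriv_right_le (f := x) (f' := x') (δ := δ) (K := K)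
    (ε := ε) (a := 0) (b := 1) (fun t ht => (hx t ht).continuousWithinAt)
    (fun t ht => HasDerivWithinAt.Ici_of_Icc ht (hx t (Ico_subset_Icc_self ht))) h0
    (fun t ht => hb t (Ico_subset_Icc_self ht)) t ht
  rw [sub_zero] at this
  exact this.trans (gronwallBound_le_mul_exp hK hε ((norm_nonneg _).trans h0) ht.2)

/-- An approximate solution `z` of an equation `y' = v(t, y)` that is Lipschitz near `z` is
shadowed by a true solution on the whole unit interval. The equation is modified far from `z` so
that it becomes bounded, and Grönwall's inequality shows that the solution does not get there. -/
theorem exists_solution_near_approx [CompleteSpace E] {v : ℝ → E → E} {z z' : ℝ → E}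
    {a δ ε K : ℝ} (y₀ : E) (ha : 0 < a) (hK : 0 ≤ K) (hε : 0 ≤ ε)
    (hz : ∀ t ∈ Icc (0 : ℝ) 1, HasDerivWithinAt z (z' t) (Icc 0 1) t)
    (hlip : ∀ t ∈ Icc (0 : ℝ) 1, ∀ x y, ‖x‖ ≤ a → ‖y‖ ≤ a →
      ‖v t (z t + x) - v t (z t + y)‖ ≤ K * ‖x - y‖)
    (hcont : ∀ x, ‖x‖ ≤ a → ContinuousOn (fun t => v t (z t + x) - z' t) (Icc 0 1))
    (hres : ∀ t ∈ Icc (0 : ℝ) 1, ‖v t (z t) - z' t‖ ≤ ε) (h0 : ‖y₀ - z 0‖ ≤ δ)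
    (hsmall : (δ + ε) * Real.exp K ≤ a) :
    ∃ y : ℝ → E, y 0 = y₀ ∧
      (∀ t ∈ Icc (0 : ℝ) 1, HasDerivWithinAt y (v t (y t)) (Icc 0 1) t) ∧
      ∀ t ∈ Icc (0 : ℝ) 1, ‖y t - z t‖ ≤ (δ + ε) * Real.exp K := by
  have hgrow : ∀ t ∈ Icc (0 : ℝ) 1, ∀ x,
      ‖v t (z t + radialRetraction a x) - z' t‖ ≤ K * ‖radialRetraction a x‖ + ε := by
    intro t ht x
    have h1 := hlip t ht _ 0 (norm_radialRetraction_le ha x) (by simpa using ha.le)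
    have h2 := hres t ht
    have e : v t (z t + radialRetraction a x) - z' t =
        (v t (z t + radialRetraction a x) - v t (z t + 0)) + (v t (z t) - z' t) := by
      rw [add_zero]; abel
    rw [e]
    refine (norm_add_le _ _).trans (add_le_add ?_ h2)
    simpa using h1
  -- the difference `x = y - z` is found from the equation composed with the retraction
  obtain ⟨x, hx0, hx⟩ := exists_solution_of_lipschitz_of_bounded
    (v := fun t x => v t (z t + radialRetraction a x) - z' t) (K := K * 2) (B := K * a + ε)
    (by positivity) (by positivity)
    (fun t ht x y => by
      have := hlip t ht _ _ (norm_radialRetraction_le ha x) (norm_radialRetraction_le ha y)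
      rw [sub_sub_sub_cancel_right]
      refine this.trans ?_
      rw [mul_assoc]
      exact mul_le_mul_of_nonneg_left (norm_radialRetraction_sub_le ha x y) hK)
    (fun x => hcont _ (norm_radialRetraction_le ha x))
    (fun t ht x => (hgrow t ht x).trans (by
      have := norm_radialRetraction_le ha x
      gcongr)) (y₀ - z 0)
  -- the solution stays in the ball of radius `a`, where the retraction is the identity
  have hsm : ∀ t ∈ Icc (0 : ℝ) 1, ‖x t‖ ≤ (δ + ε) * Real.exp K := by
    refine norm_le_of_deriv_Icc hK hε hx (by rwa [hx0]) fun t ht => (hgrow t ht _).trans ?_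
    have := norm_radialRetraction_le_norm ha (x t)
    gcongr
  refine ⟨fun t => z t + x t, by simp [hx0], fun t ht => ?_, fun t ht => by
    simpa using hsm t ht⟩
  have h := (hz t ht).fun_add (hx t ht)
  rw [radialRetraction_of_norm_le ha ((hsm t ht).trans hsmall)] at h
  simpa only [sub_add_cancel, add_sub_cancel] using h

end ODE

/-! ### Integrable systems of total differential equations -/

section Frobenius

variable {E M : Type*} [NormedAddCommGroup E] [NormedSpace ℂ E] [NormedAddCommGroup M]
  [NormedSpace ℂ M]

/-- A system `dy = F(w, y) dw` over an open set `U`, with continuously differentiable right-hand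
side and satisfying the Frobenius integrability condition: the derivative of `F(w, y) k` along the
horizontal lift `(v, F(w, y) v)` of a vector `v` is symmetric in `v` and `k`. -/
structure IsFlat (U : Set E) (F : E → M → E →L[ℂ] M) : Prop where
  isOpen : IsOpen U
  smooth : ∀ w ∈ U, ∀ y, ContDiffAt ℂ 1 (fun q : E × M => F q.1 q.2) (w, y)
  symm : ∀ w ∈ U, ∀ y v k,
    fderiv ℂ (fun q : E × M => F q.1 q.2) (w, y) (v, F w y v) k =
      fderiv ℂ (fun q : E × M => F q.1 q.2) (w, y) (k, F w y k) v

/-- The function `y` of `t ∈ [0, 1]` solves the system `dy = F(w, y) dw` along the segment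
`t ↦ p + t (q - p)` in `U`. -/
structure IsSegSol (U : Set E) (F : E → M → E →L[ℂ] M) (p q : E) (y : ℝ → M) : Prop where
  mem : ∀ t ∈ Icc (0 : ℝ) 1, p + t • (q - p) ∈ U
  deriv : ∀ t ∈ Icc (0 : ℝ) 1,
    HasDerivWithinAt y (F (p + t • (q - p)) (y t) (q - p)) (Icc 0 1) t

variable {U : Set E} {F : E → M → E →L[ℂ] M}

theorem IsSegSol.continuousOn {p q : E} {y : ℝ → M} (h : IsSegSol U F p q y) :
    ContinuousOn y (Icc 0 1) := fun t ht => (h.deriv t ht).continuousWithinAt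

theorem continuous_segment (p q : E) : Continuous fun t : ℝ => p + t • (q - p) := by fun_prop

theorem IsFlat.continuousAt (hF : IsFlat U F) {w : E} (hw : w ∈ U) (y : M) :
    ContinuousAt (fun q : E × M => F q.1 q.2) (w, y) := (hF.smooth w hw y).continuousAt

theorem IsFlat.continuousAt_fderiv (hF : IsFlat U F) {w : E} (hw : w ∈ U) (y : M) :
    ContinuousAt (fderiv ℂ (fun q : E × M => F q.1 q.2)) (w, y) :=
  ((hF.smooth w hw y).fderiv_right (m := 0) (by norm_num)).continuousAt

theorem IsFlat.hasFDerivAt (hF : IsFlat U F) {w : E} (hw : w ∈ U) (y : M) :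
    HasFDerivAt (fun q : E × M => F q.1 q.2)
      (fderiv ℂ (fun q : E × M => F q.1 q.2) (w, y)) (w, y) :=
  ((hF.smooth w hw y).differentiableAt (by norm_num)).hasFDerivAt

/-- The right-hand side is Lipschitz in `y`, uniformly over compact sets. -/
theorem IsFlat.exists_lipschitz [ProperSpace M] (hF : IsFlat U F) {Q : Set E}
    (hQ : IsCompact Q) (hQU : Q ⊆ U) (R : ℝ) :
    ∃ K : ℝ, 0 ≤ K ∧ ∀ w ∈ Q, ∀ y y' : M, ‖y‖ ≤ R → ‖y'‖ ≤ R →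
      ‖F w y - F w y'‖ ≤ K * ‖y - y'‖ := by
  have hc : IsCompact (Q ×ˢ Metric.closedBall (0 : M) R) :=
    hQ.prod (isCompact_closedBall _ _)
  obtain ⟨K, hK⟩ := hc.exists_bound_of_continuousOn
    (f := fderiv ℂ (fun q : E × M => F q.1 q.2)) (by
      rintro ⟨w, y⟩ ⟨hw, -⟩
      exact (hF.continuousAt_fderiv (hQU hw) y).continuousWithinAt)
  refine ⟨|K|, abs_nonneg _, fun w hw y y' hy hy' => ?_⟩
  refine Convex.norm_image_sub_le_of_norm_hasFDerivWithin_le (𝕜 := ℂ)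
    (s := Metric.closedBall (0 : M) R) (f := fun y => F w y)
    (f' := fun y => (fderiv ℂ (fun q : E × M => F q.1 q.2) (w, y)).comp
      (ContinuousLinearMap.inr ℂ E M)) (fun x _ => ?_) (fun x hx => ?_)
    (convex_closedBall _ _) (by simpa using hy') (by simpa using hy)
  · have h1 := hF.hasFDerivAt (hQU hw) x
    have h2 : HasFDerivAt (fun y : M => (w, y)) (ContinuousLinearMap.inr ℂ E M) x :=
      hasFDerivAt_prodMk_right w x
    exact (h1.comp x h2).hasFDerivWithinAt
  · refine (ContinuousLinearMap.opNorm_comp_le _ _).trans ?_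
    have h1 := (hK (w, x) ⟨hw, hx⟩).trans (le_abs_self K)
    have h2 : ‖ContinuousLinearMap.inr ℂ E M‖ ≤ 1 := ContinuousLinearMap.norm_inr_le_one ℂ E M
    calc _ ≤ |K| * 1 := by gcongr
      _ = |K| := mul_one _

theorem isCompact_segment_image (p q : E) :
    IsCompact ((fun t : ℝ => p + t • (q - p)) '' Icc 0 1) :=
  isCompact_Icc.image (continuous_segment p q)

theorem IsSegSol.eqOn [ProperSpace M] (hF : IsFlat U F) {p q : E} {y z : ℝ → M}
    (hy : IsSegSol U F p q y) (hz : IsSegSol U F p q z) (h0 : y 0 = z 0) :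
    EqOn y z (Icc 0 1) := by
  obtain ⟨R₁, hR₁⟩ := isCompact_Icc.exists_bound_of_continuousOn hy.continuousOn
  obtain ⟨R₂, hR₂⟩ := isCompact_Icc.exists_bound_of_continuousOn hz.continuousOn
  obtain ⟨K, hK, hlip⟩ := hF.exists_lipschitz (isCompact_segment_image p q)
    (by rintro _ ⟨t, ht, rfl⟩; exact hy.mem t ht) (max R₁ R₂)
  refine ODE_solution_unique_of_mem_Icc_right
    (v := fun t y => F (p + t • (q - p)) y (q - p))
    (s := fun _ => Metric.closedBall 0 (max R₁ R₂)) (K := (K * ‖q - p‖).toNNReal)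
    (fun t ht => LipschitzOnWith.of_dist_le_mul fun x hx x' hx' => ?_)
    hy.continuousOn (fun t ht => HasDerivWithinAt.Ici_of_Icc ht
      (hy.deriv t (Ico_subset_Icc_self ht)))
    (fun t ht => by simpa using Or.inl (hR₁ t (Ico_subset_Icc_self ht)))
    hz.continuousOn (fun t ht => HasDerivWithinAt.Ici_of_Icc ht
      (hz.deriv t (Ico_subset_Icc_self ht)))
    (fun t ht => by simpa using Or.inr (hR₂ t (Ico_subset_Icc_self ht))) h0
  rw [dist_eq_norm, dist_eq_norm, ← sub_apply]
  refine (ContinuousLinearMap.le_opNorm _ _).trans ?_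
  have := hlip _ ⟨t, Ico_subset_Icc_self ht, rfl⟩ x x' (by simpa using hx) (by simpa using hx')
  calc _ ≤ (K * ‖x - x'‖) * ‖q - p‖ := by gcongr
    _ = _ := by rw [Real.coe_toNNReal _ (by positivity)]; ring

/-- First order variation of a solution when the end point of the segment moves by `h`: by
flatness, `t ↦ y t + t F(p_t, y t) h` solves the equation along the moved segment up to `o(h)`. -/
theorem IsFlat.eventually_residual_le (hF : IsFlat U F) {p q : E} {y : ℝ → M}
    (hy : IsSegSol U F p q y) {ε : ℝ} (hε : 0 < ε) :
    ∀ᶠ h in 𝓝 (0 : E), ∀ t ∈ Icc (0 : ℝ) 1,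
      ‖F (p + t • (q - p) + t • h) (y t + t • F (p + t • (q - p)) (y t) h) (q - p + h) -
        (F (p + t • (q - p)) (y t) (q - p) + F (p + t • (q - p)) (y t) h +
          t • fderiv ℂ (fun q : E × M => F q.1 q.2) (p + t • (q - p), y t)
            (q - p, F (p + t • (q - p)) (y t) (q - p)) h)‖ ≤ ε * ‖h‖ := by
  set X : ℝ → E × M := fun t => (p + t • (q - p), y t) with hX
  set G : E × M → E →L[ℂ] M := fun q => F q.1 q.2 with hG
  set D := fderiv ℂ G with hD
  have hXc : ContinuousOn X (Icc 0 1) :=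
    (continuous_segment p q).continuousOn.prodMk hy.continuousOn
  have hGc : ContinuousOn (fun t => G (X t)) (Icc 0 1) := fun t ht =>
    (hF.continuousAt (hy.mem t ht) (y t)).comp_continuousWithinAt (f := X) (hXc t ht)
  obtain ⟨B, hB⟩ := isCompact_Icc.exists_bound_of_continuousOn hGc
  have hB0 : 0 ≤ B := (norm_nonneg _).trans (hB 0 (by simp))
  set v := q - p
  -- by compactness of `[0, 1]` it suffices to work near a given `t₀`; there `G` is strictly
  -- differentiable, which makes the estimate uniform in `t`
  have hloc : ∀ t₀ ∈ Icc (0 : ℝ) 1, ∀ᶠ z : E × ℝ in 𝓝 0 ×ˢ 𝓝[Icc 0 1] t₀,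
      ‖G (X z.2 + (z.2 • z.1, z.2 • G (X z.2) z.1)) (v + z.1) -
        (G (X z.2) v + G (X z.2) z.1 +
          z.2 • D (X z.2) (v, G (X z.2) v) z.1)‖ ≤ ε * ‖z.1‖ := by
    intro t₀ ht₀
    have hmem := hy.mem t₀ ht₀
    set C := 1 + B with hC
    have hC1 : 0 < C := by positivity
    obtain ⟨ε₁, hε₁, hε₁'⟩ : ∃ ε₁ > 0, ε₁ * C * (2 * (‖v‖ + 1)) ≤ ε / 2 := by
      refine ⟨ε / 2 / (C * (2 * (‖v‖ + 1))), by positivity, ?_⟩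
      field_simp; rfl
    have hXt : Tendsto (fun z : E × ℝ => X z.2) (𝓝 0 ×ˢ 𝓝[Icc 0 1] t₀) (𝓝 (X t₀)) :=
      (hXc t₀ ht₀).tendsto.comp tendsto_snd
    have hin : ∀ᶠ z : E × ℝ in 𝓝 0 ×ˢ 𝓝[Icc 0 1] t₀, z.2 ∈ Icc (0 : ℝ) 1 :=
      tendsto_snd.eventually self_mem_nhdsWithin
    have hz0 : Tendsto (fun z : E × ℝ => ‖z.1‖) (𝓝 0 ×ˢ 𝓝[Icc 0 1] t₀) (𝓝 0) := by
      have : Tendsto (fun z : E × ℝ => z.1) (𝓝 0 ×ˢ 𝓝[Icc 0 1] t₀) (𝓝 0) := tendsto_fst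
      simpa using this.norm
    have hξb : ∀ᶠ z : E × ℝ in 𝓝 0 ×ˢ 𝓝[Icc 0 1] t₀,
        ‖((z.2 • z.1, z.2 • G (X z.2) z.1) : E × M)‖ ≤ C * ‖z.1‖ := by
      filter_upwards [hin] with z hz
      have hzn : ‖z.2‖ ≤ 1 := by
        rw [Real.norm_eq_abs, abs_of_nonneg hz.1]; exact hz.2
      refine norm_prod_le_iff.2 ⟨?_, ?_⟩
      · rw [norm_smul]
        calc ‖z.2‖ * ‖z.1‖ ≤ 1 * ‖z.1‖ := by gcongr
          _ ≤ C * ‖z.1‖ := by gcongr; simp [hC, hB0]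
      · rw [norm_smul]
        calc ‖z.2‖ * ‖G (X z.2) z.1‖ ≤ 1 * (B * ‖z.1‖) := by
              gcongr
              exact (ContinuousLinearMap.le_opNorm _ _).trans (by gcongr; exact hB _ hz)
          _ ≤ C * ‖z.1‖ := by rw [one_mul]; gcongr; simp [hC]
    have hξ : Tendsto (fun z : E × ℝ => ((z.2 • z.1, z.2 • G (X z.2) z.1) : E × M))
        (𝓝 0 ×ˢ 𝓝[Icc 0 1] t₀) (𝓝 0) := by
      refine squeeze_zero_norm' hξb ?_
      simpa using hz0.const_mul C
    have hpair : Tendsto (fun z : E × ℝ =>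
        (X z.2 + (z.2 • z.1, z.2 • G (X z.2) z.1), X z.2))
        (𝓝 0 ×ˢ 𝓝[Icc 0 1] t₀) (𝓝 (X t₀, X t₀)) := by
      have h := hXt.add hξ
      rw [add_zero] at h
      exact h.prodMk_nhds hXt
    have hstrict := ((hF.smooth _ hmem (y t₀)).hasStrictFDerivAt (by norm_num)).isLittleO
    have h1 := hpair.eventually (hstrict.def hε₁)
    have h2 : ∀ᶠ z : E × ℝ in 𝓝 0 ×ˢ 𝓝[Icc 0 1] t₀, ‖D (X z.2) - D (X t₀)‖ ≤ ε₁ := by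
      have := (hF.continuousAt_fderiv hmem (y t₀)).tendsto.comp hXt
      have := ((tendsto_iff_norm_sub_tendsto_zero (E := E × M →L[ℂ] E →L[ℂ] M)).1 this).eventually (gt_mem_nhds hε₁)
      filter_upwards [this] with z hz using hz.le
    have h3 : ∀ᶠ z : E × ℝ in 𝓝 0 ×ˢ 𝓝[Icc 0 1] t₀, ‖D (X t₀)‖ * C * ‖z.1‖ ≤ ε / 2 := by
      have h := hz0.const_mul (‖D (X t₀)‖ * C)
      rw [mul_zero] at h
      filter_upwards [h.eventually (gt_mem_nhds (half_pos hε))] with z hz using hz.le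
    have h4 : ∀ᶠ z : E × ℝ in 𝓝 0 ×ˢ 𝓝[Icc 0 1] t₀, ‖z.1‖ ≤ 1 := by
      filter_upwards [hz0.eventually (gt_mem_nhds one_pos)] with z hz using hz.le
    filter_upwards [hin, hξb, h1, h2, h3, h4] with z hz hξz h1z h2z h3z h4z
    obtain ⟨h, t⟩ := z
    simp only at hz hξz h1z h2z h3z h4z ⊢
    set ξ : E × M := (t • h, t • G (X t) h) with hξdef
    rw [add_sub_cancel_left] at h1z
    -- flatness turns the term that varies `v` into the derivative along the displacement `ξ`
    have hflat : t • D (X t) (v, G (X t) v) h = D (X t) ξ v := by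
      have e : ξ = t • ((h, G (X t) h) : E × M) := rfl
      rw [e, ← Complex.coe_smul, ← Complex.coe_smul, map_smul, smul_apply]
      congr 1
      exact hF.symm _ (hy.mem t hz) (y t) v h
    have hsplit : G (X t + ξ) (v + h) - (G (X t) v + G (X t) h + t • D (X t) (v, G (X t) v) h) =
        (G (X t + ξ) - G (X t) - D (X t₀) ξ) (v + h) - (D (X t) - D (X t₀)) ξ v
          + D (X t₀) ξ h := by
      rw [hflat]
      simp only [sub_apply, map_add]
      abel
    rw [hsplit]
    have hvh : ‖v + h‖ ≤ ‖v‖ + 1 := (norm_add_le _ _).trans (by gcongr)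
    have b1 : ‖(G (X t + ξ) - G (X t) - D (X t₀) ξ) (v + h)‖ ≤
        ε₁ * (C * ‖h‖) * (‖v‖ + 1) := by
      refine (ContinuousLinearMap.le_opNorm _ _).trans ?_
      have h1z' : ‖G (X t + ξ) - G (X t) - D (X t₀) ξ‖ ≤ ε₁ * ‖ξ‖ := h1z
      calc _ ≤ (ε₁ * ‖ξ‖) * (‖v‖ + 1) := by gcongr
        _ ≤ _ := by gcongr
    have b2 : ‖(D (X t) - D (X t₀)) ξ v‖ ≤ ε₁ * (C * ‖h‖) * (‖v‖ + 1) := by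
      refine (ContinuousLinearMap.le_opNorm _ _).trans ?_
      have := ContinuousLinearMap.le_opNorm (D (X t) - D (X t₀)) ξ
      calc _ ≤ (‖D (X t) - D (X t₀)‖ * ‖ξ‖) * (‖v‖ + 1) := by gcongr; simp
        _ ≤ _ := by gcongr
    have b3 : ‖D (X t₀) ξ h‖ ≤ ε / 2 * ‖h‖ := by
      refine (ContinuousLinearMap.le_opNorm _ _).trans ?_
      have := ContinuousLinearMap.le_opNorm (D (X t₀)) ξ
      calc _ ≤ (‖D (X t₀)‖ * ‖ξ‖) * ‖h‖ := by gcongr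
        _ ≤ (‖D (X t₀)‖ * (C * ‖h‖)) * ‖h‖ := by gcongr
        _ = (‖D (X t₀)‖ * C * ‖h‖) * ‖h‖ := by ring
        _ ≤ _ := by gcongr
    calc _ ≤ _ := (norm_add_le _ _).trans (add_le_add_left (norm_sub_le _ _) _)
      _ ≤ ε₁ * (C * ‖h‖) * (‖v‖ + 1) + ε₁ * (C * ‖h‖) * (‖v‖ + 1) + ε / 2 * ‖h‖ := by gcongr
      _ = (ε₁ * C * (2 * (‖v‖ + 1))) * ‖h‖ + ε / 2 * ‖h‖ := by ring
      _ ≤ ε / 2 * ‖h‖ + ε / 2 * ‖h‖ := by gcongr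
      _ = ε * ‖h‖ := by ring
  have hall := isCompact_Icc.eventually_forall_of_forall_eventually (K := Icc (0 : ℝ) 1)
    (P := fun (h : E) t => t ∈ Icc (0 : ℝ) 1 →
      ‖G (X t + (t • h, t • G (X t) h)) (v + h) -
        (G (X t) v + G (X t) h + t • D (X t) (v, G (X t) v) h)‖ ≤ ε * ‖h‖) (x₀ := (0 : E))
    (fun t₀ ht₀ => by
      have h := hloc t₀ ht₀
      rw [← nhdsWithin_univ, ← nhdsWithin_prod_eq, eventually_nhdsWithin_iff] at h
      filter_upwards [h] with z hz hz2 using hz ⟨mem_univ _, hz2⟩)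
  filter_upwards [hall] with h hh t ht using hh t ht ht

theorem IsFlat.hasDerivWithinAt_comp_segment (hF : IsFlat U F) {p q : E} {y : ℝ → M}
    (hy : IsSegSol U F p q y) {t : ℝ} (ht : t ∈ Icc (0 : ℝ) 1) :
    HasDerivWithinAt (fun t : ℝ => F (p + t • (q - p)) (y t))
      (fderiv ℂ (fun q : E × M => F q.1 q.2) (p + t • (q - p), y t)
        (q - p, F (p + t • (q - p)) (y t) (q - p))) (Icc 0 1) t := by
  have h1 : HasDerivWithinAt (fun t : ℝ => p + t • (q - p)) (q - p) (Icc 0 1) t := by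
    simpa using (((hasDerivAt_id t).smul_const (q - p)).const_add p).hasDerivWithinAt
  have h2 := h1.prodMk (hy.deriv t ht)
  have h3 := ((hF.hasFDerivAt (hy.mem t ht) (y t)).restrictScalars ℝ).comp_hasDerivWithinAt t h2
  exact h3

theorem IsFlat.continuousOn_fderiv_comp_segment (hF : IsFlat U F) {p q : E} {y : ℝ → M}
    (hy : IsSegSol U F p q y) :
    ContinuousOn (fun t : ℝ => fderiv ℂ (fun q : E × M => F q.1 q.2) (p + t • (q - p), y t)
        (q - p, F (p + t • (q - p)) (y t) (q - p))) (Icc 0 1) := by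
  intro t ht
  have hX : ContinuousWithinAt (fun t : ℝ => (p + t • (q - p), y t)) (Icc 0 1) t :=
    (continuous_segment p q).continuousWithinAt.prodMk (hy.continuousOn t ht)
  have h1 := (hF.continuousAt_fderiv (hy.mem t ht) (y t)).comp_continuousWithinAt
    (f := fun t : ℝ => (p + t • (q - p), y t)) hX
  have h2 := (hF.continuousAt (hy.mem t ht) (y t)).comp_continuousWithinAt
    (f := fun t : ℝ => (p + t • (q - p), y t)) hX
  exact h1.clm_apply (continuousWithinAt_const.prodMk (h2.clm_apply continuousWithinAt_const))

/-- Solutions along `[p, q]` extend to solutions along `[p, q + h]` for small `h`, and the end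
value changes by `F(q, y) h + o(h)`. -/
theorem IsFlat.eventually_exists_isSegSol [ProperSpace E] [ProperSpace M] (hF : IsFlat U F)
    {p q : E} {y : ℝ → M} (hy : IsSegSol U F p q y) {ε : ℝ} (hε : 0 < ε) :
    ∀ᶠ h in 𝓝 (0 : E), ∃ z : ℝ → M, IsSegSol U F p (q + h) z ∧ z 0 = y 0 ∧
      ‖z 1 - y 1 - F q (y 1) h‖ ≤ ε * ‖h‖ := by
  obtain ⟨r, hr, hrU⟩ := (isCompact_segment_image p q).exists_cthickening_subset_open hF.isOpen
    (by rintro _ ⟨t, ht, rfl⟩; exact hy.mem t ht)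
  have hQ : IsCompact (Metric.cthickening r ((fun t : ℝ => p + t • (q - p)) '' Icc 0 1)) :=
    (isCompact_segment_image p q).cthickening
  have hFc : ContinuousOn (fun t : ℝ => F (p + t • (q - p)) (y t)) (Icc 0 1) := fun t ht =>
    (hF.hasDerivWithinAt_comp_segment hy ht).continuousWithinAt
  obtain ⟨B, hB⟩ := isCompact_Icc.exists_bound_of_continuousOn hFc
  have hB0 : 0 ≤ B := (norm_nonneg _).trans (hB 0 (by simp))
  obtain ⟨R, hR⟩ := isCompact_Icc.exists_bound_of_continuousOn hy.continuousOn
  obtain ⟨K₀, hK₀, hlip⟩ := hF.exists_lipschitz hQ hrU (R + B + 1)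
  -- `K` is a Lipschitz constant for the equation along all nearby segments; Grönwall's inequality
  -- multiplies errors by `exp K`, whence the choice of `ε₁`
  set K := K₀ * (‖q - p‖ + 1) with hK
  have hK0 : 0 ≤ K := by positivity
  set ε₁ := ε / Real.exp K with hε₁
  have hε₁0 : 0 < ε₁ := by positivity
  have hres := hF.eventually_residual_le hy hε₁0
  have hsmall : ∀ᶠ h in 𝓝 (0 : E), ‖h‖ ≤ min (min r 1) (1 / ε) := by
    have : Tendsto (fun h : E => ‖h‖) (𝓝 0) (𝓝 0) := by
      simpa using (tendsto_id (x := 𝓝 (0 : E))).norm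
    filter_upwards [this.eventually (gt_mem_nhds (show 0 < min (min r 1) (1 / ε) by positivity))]
      with h hh using hh.le
  filter_upwards [hres, hsmall] with h hres hsm
  have hhr : ‖h‖ ≤ r := hsm.trans ((min_le_left _ _).trans (min_le_left _ _))
  have hh1 : ‖h‖ ≤ 1 := hsm.trans ((min_le_left _ _).trans (min_le_right _ _))
  have hhε : ε * ‖h‖ ≤ 1 := by
    have := hsm.trans (min_le_right _ _)
    rwa [le_div_iff₀ hε, mul_comm] at this
  have hpt : ∀ t : ℝ, p + t • (q + h - p) = p + t • (q - p) + t • h := fun t => by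
    rw [add_assoc, ← smul_add]; congr 2; abel
  have hqp : q + h - p = q - p + h := by abel
  have hth : ∀ t ∈ Icc (0 : ℝ) 1, ‖t • h‖ ≤ ‖h‖ := fun t ht => by
    rw [norm_smul, Real.norm_of_nonneg ht.1]
    exact mul_le_of_le_one_left (norm_nonneg _) ht.2
  have hQmem : ∀ t ∈ Icc (0 : ℝ) 1, p + t • (q - p) + t • h ∈
      Metric.cthickening r ((fun t : ℝ => p + t • (q - p)) '' Icc 0 1) := fun t ht => by
    refine Metric.mem_cthickening_of_dist_le _ (p + t • (q - p)) _ _ ⟨t, ht, rfl⟩ ?_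
    rw [dist_eq_norm, add_sub_cancel_left]
    exact (hth t ht).trans hhr
  have hFh : ∀ t ∈ Icc (0 : ℝ) 1, ‖t • F (p + t • (q - p)) (y t) h‖ ≤ B := fun t ht => by
    rw [norm_smul, Real.norm_of_nonneg ht.1]
    calc t * ‖F (p + t • (q - p)) (y t) h‖ ≤ 1 * (B * 1) := by
          gcongr
          · exact ht.2
          · exact (ContinuousLinearMap.le_opNorm _ _).trans (by gcongr; exact hB t ht)
      _ = B := by ring
  -- the first order variation of `y` is shadowed by a true solution
  obtain ⟨z, hz0, hz, hzy⟩ := exists_solution_near_approx (v := fun t x =>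
      F (p + t • (q - p) + t • h) x (q - p + h))
    (z := fun t => y t + t • F (p + t • (q - p)) (y t) h)
    (z' := fun t => F (p + t • (q - p)) (y t) (q - p) + F (p + t • (q - p)) (y t) h +
          t • fderiv ℂ (fun q : E × M => F q.1 q.2) (p + t • (q - p), y t)
            (q - p, F (p + t • (q - p)) (y t) (q - p)) h)
    (a := 1) (δ := 0) (ε := ε₁ * ‖h‖) (K := K) (y 0) one_pos hK0 (by positivity)
    (fun t ht => by
      have h1 := (((ContinuousLinearMap.apply ℂ M h).restrictScalars ℝ).hasFDerivAt
        (x := F (p + t • (q - p)) (y t))).comp_hasDerivWithinAt t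
        (hF.hasDerivWithinAt_comp_segment hy ht)
      have h2 := (hasDerivAt_id t).hasDerivWithinAt (s := Icc 0 1)
      have h3 := (hy.deriv t ht).fun_add (h2.fun_smul h1)
      refine h3.congr_deriv ?_
      rw [one_smul, add_assoc, add_comm (F (p + t • (q - p)) (y t) h)]
      rfl)
    (fun t ht x x' hx hx' => by
      rw [← sub_apply]
      refine (ContinuousLinearMap.le_opNorm _ _).trans ?_
      have hb : ∀ x : M, ‖x‖ ≤ 1 → ‖y t + t • F (p + t • (q - p)) (y t) h + x‖ ≤ R + B + 1 :=
        fun x hx => (norm_add₃_le).trans (add_le_add_three (hR t ht) (hFh t ht) hx)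
      have h1 := hlip _ (hQmem t ht) _ _ (hb x hx) (hb x' hx')
      rw [add_sub_add_left_eq_sub] at h1
      have h2 : ‖q - p + h‖ ≤ ‖q - p‖ + 1 := (norm_add_le _ _).trans (by gcongr)
      calc _ ≤ (K₀ * ‖x - x'‖) * (‖q - p‖ + 1) := by gcongr
        _ = K * ‖x - x'‖ := by rw [hK]; ring)
    (fun x hx => by
      have hz : ContinuousOn (fun t : ℝ => y t + t • F (p + t • (q - p)) (y t) h + x) (Icc 0 1) :=
        (hy.continuousOn.add (continuousOn_id.smul (hFc.clm_apply continuousOn_const))).add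
          continuousOn_const
      refine ContinuousOn.sub (fun t ht => ?_) ?_
      · have h1 := (hF.continuousAt (hrU (hQmem t ht))
          (y t + t • F (p + t • (q - p)) (y t) h + x)).comp_continuousWithinAt
          (f := fun t : ℝ => (p + t • (q - p) + t • h,
            y t + t • F (p + t • (q - p)) (y t) h + x)) (s := Icc 0 1)
          ((by fun_prop : Continuous fun t : ℝ => p + t • (q - p) + t • h).continuousWithinAt.prodMk
            (hz t ht))
        exact h1.clm_apply continuousWithinAt_const
      · exact ((hFc.clm_apply continuousOn_const).add (hFc.clm_apply continuousOn_const)).add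
          (continuousOn_id.smul ((hF.continuousOn_fderiv_comp_segment hy).clm_apply
            continuousOn_const)))
    (fun t ht => hres t ht) (by simp)
    (by
      rw [zero_add, hε₁, div_mul_eq_mul_div, div_mul_cancel₀ _ (Real.exp_pos K).ne']
      exact hhε)
  refine ⟨z, ⟨fun t ht => ?_, fun t ht => ?_⟩, hz0, ?_⟩
  · rw [hpt]; exact hrU (hQmem t ht)
  · rw [hpt, hqp]; exact hz t ht
  · have h1 := hzy 1 (by simp)
    rw [zero_add, hε₁, div_mul_eq_mul_div, div_mul_cancel₀ _ (Real.exp_pos K).ne'] at h1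
    simpa [sub_sub] using h1

/-- The points `q` such that the system can be solved along `[p, q]` with initial value `y₀`. -/
def segDomain (U : Set E) (F : E → M → E →L[ℂ] M) (p : E) (y₀ : M) : Set E :=
  {q | ∃ y, IsSegSol U F p q y ∧ y 0 = y₀}

open Classical in
/-- The value at `q` of the solution along `[p, q]` with initial value `y₀` at `p`. -/
noncomputable def segValue (U : Set E) (F : E → M → E →L[ℂ] M) (p : E) (y₀ : M) (q : E) : M :=
  if h : q ∈ segDomain U F p y₀ then h.choose 1 else 0

theorem IsSegSol.segValue_eq [ProperSpace M] (hF : IsFlat U F) {p q : E} {y : ℝ → M}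
    (hy : IsSegSol U F p q y) : segValue U F p (y 0) q = y 1 := by
  have h : q ∈ segDomain U F p (y 0) := ⟨y, hy, rfl⟩
  rw [segValue, dif_pos h]
  exact h.choose_spec.1.eqOn hF hy h.choose_spec.2 (by simp)

theorem segDomain_subset {p : E} {y₀ : M} : segDomain U F p y₀ ⊆ U := by
  rintro q ⟨y, hy, -⟩
  simpa using hy.mem 1 (by simp)

theorem isOpen_segDomain [ProperSpace E] [ProperSpace M] (hF : IsFlat U F) (p : E) (y₀ : M) :
    IsOpen (segDomain U F p y₀) := by
  rw [isOpen_iff_mem_nhds]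
  rintro q ⟨y, hy, rfl⟩
  have h := hF.eventually_exists_isSegSol hy one_pos
  rw [← map_add_left_nhds_zero]
  rw [Filter.mem_map]
  filter_upwards [h] with h hh
  obtain ⟨z, hz, hz0, -⟩ := hh
  exact ⟨z, hz, hz0⟩

theorem hasFDerivAt_segValue [ProperSpace E] [ProperSpace M] (hF : IsFlat U F) {p : E} {y₀ : M}
    {q : E} (hq : q ∈ segDomain U F p y₀) :
    HasFDerivAt (segValue U F p y₀) (F q (segValue U F p y₀ q)) q := by
  obtain ⟨y, hy, rfl⟩ := hq
  rw [hy.segValue_eq hF, hasFDerivAt_iff_isLittleO_nhds_zero, Asymptotics.isLittleO_iff]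
  intro ε hε
  filter_upwards [hF.eventually_exists_isSegSol hy hε] with h hh
  obtain ⟨z, hz, hz0, hzb⟩ := hh
  rwa [hy.segValue_eq hF, ← hz0, hz.segValue_eq hF]

/-- A point of the segment `[p, q]` is again reached by solving along a segment from `p`. -/
theorem IsSegSol.restrict {p q : E} {y : ℝ → M} (hy : IsSegSol U F p q y) {s : ℝ}
    (hs : s ∈ Icc (0 : ℝ) 1) : IsSegSol U F p (p + s • (q - p)) (fun t => y (s * t)) := by
  have hst : ∀ t ∈ Icc (0 : ℝ) 1, s * t ∈ Icc (0 : ℝ) 1 := fun t ht =>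
    ⟨mul_nonneg hs.1 ht.1, mul_le_one₀ hs.2 ht.1 ht.2⟩
  have he : ∀ t : ℝ, p + t • (p + s • (q - p) - p) = p + (s * t) • (q - p) := fun t => by
    rw [add_sub_cancel_left, smul_smul, mul_comm]
  refine ⟨fun t ht => by rw [he]; exact hy.mem _ (hst t ht), fun t ht => ?_⟩
  rw [he, add_sub_cancel_left]
  have h1 : HasDerivWithinAt (fun t : ℝ => s * t) s (Icc 0 1) t := by
    simpa using ((hasDerivAt_id t).const_mul s).hasDerivWithinAt
  have h2 := (hy.deriv _ (hst t ht)).scomp t h1 hst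
  rw [ContinuousLinearMap.map_smul_of_tower]
  exact h2

theorem IsSegSol.mem_segDomain {p q : E} {y : ℝ → M} (hy : IsSegSol U F p q y) {s : ℝ}
    (hs : s ∈ Icc (0 : ℝ) 1) : p + s • (q - p) ∈ segDomain U F p (y 0) :=
  ⟨_, hy.restrict hs, by simp⟩

/-- A solution on an open set restricts to a solution along the segments in this set. -/
theorem isSegSol_of_hasFDerivAt {V : Set E} (hVU : V ⊆ U) {f : E → M}
    (hf : ∀ w ∈ V, HasFDerivAt f (F w (f w)) w) {p q : E}
    (hpq : ∀ t ∈ Icc (0 : ℝ) 1, p + t • (q - p) ∈ V) :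
    IsSegSol U F p q (fun t => f (p + t • (q - p))) := by
  refine ⟨fun t ht => hVU (hpq t ht), fun t ht => ?_⟩
  have h1 : HasDerivWithinAt (fun t : ℝ => p + t • (q - p)) (q - p) (Icc 0 1) t := by
    simpa using (((hasDerivAt_id t).smul_const (q - p)).const_add p).hasDerivWithinAt
  exact ((hf _ (hpq t ht)).restrictScalars ℝ).comp_hasDerivWithinAt t h1

end Frobenius

/-! ### Holomorphic extension of solutions from a real slice -/

section Slice

variable {n : ℕ} {M : Type*} [NormedAddCommGroup M] [NormedSpace ℂ M]

/-- The inclusion `ℝⁿ → ℂⁿ`. -/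
noncomputable def realEmb (n : ℕ) : (Fin n → ℝ) →L[ℝ] (Fin n → ℂ) :=
  ContinuousLinearMap.pi fun j => Complex.ofRealCLM.comp (ContinuousLinearMap.proj j)

@[simp] theorem realEmb_apply (x : Fin n → ℝ) (j : Fin n) : realEmb n x j = (x j : ℂ) := rfl

/-- The point of `ℂⁿ` with real part `x` and imaginary part `β`. -/
noncomputable def slice (β x : Fin n → ℝ) : Fin n → ℂ := fun j => (x j : ℂ) + (β j : ℂ) * Complex.I

/-- The vector of real parts. -/
def reVec (w : Fin n → ℂ) : Fin n → ℝ := fun j => (w j).re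

@[simp] theorem reVec_apply (w : Fin n → ℂ) (j : Fin n) : reVec w j = (w j).re := rfl

@[simp] theorem slice_re (β x : Fin n → ℝ) (j : Fin n) : (slice β x j).re = x j := by simp [slice]

@[simp] theorem slice_im (β x : Fin n → ℝ) (j : Fin n) : (slice β x j).im = β j := by simp [slice]

@[simp] theorem reVec_slice (β x : Fin n → ℝ) : reVec (slice β x) = x := by
  ext j; simp

theorem slice_reVec_eq {β : Fin n → ℝ} {w : Fin n → ℂ} (h : ∀ j, (w j).im = β j) :
    slice β (reVec w) = w := by
  ext j
  apply Complex.ext <;> simp [h]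

theorem continuous_reVec : Continuous (reVec : (Fin n → ℂ) → Fin n → ℝ) :=
  continuous_pi fun j => Complex.continuous_re.comp (continuous_apply j)

theorem hasFDerivAt_slice (β x : Fin n → ℝ) : HasFDerivAt (slice β) (realEmb n) x := by
  have : slice β = fun x => realEmb n x + slice β 0 := by
    ext x j; simp [slice]
  rw [this]
  exact (realEmb n).hasFDerivAt.add_const _

theorem continuous_slice (β : Fin n → ℝ) : Continuous (slice β) :=
  continuous_iff_continuousAt.2 fun x => (hasFDerivAt_slice β x).continuousAt

theorem slice_segment (β x x' : Fin n → ℝ) (t : ℝ) :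
    slice β x + t • (slice β x' - slice β x) = slice β (x + t • (x' - x)) := by
  ext j; simp [slice]; ring

theorem reVec_segment (β : Fin n → ℝ) (w : Fin n → ℂ) (t : ℝ) :
    reVec (slice β (reVec w) + t • (w - slice β (reVec w))) = reVec w := by
  ext j; simp

variable {U : Set (Fin n → ℂ)} {F : (Fin n → ℂ) → M → (Fin n → ℂ) →L[ℂ] M}

/-- `Y` solves the system `dy = F(w, y) dw` along the real slice over the point `x`. -/
def HasSliceDeriv (F : (Fin n → ℂ) → M → (Fin n → ℂ) →L[ℂ] M) (β : Fin n → ℝ)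
    (Y : (Fin n → ℝ) → M) (x : Fin n → ℝ) : Prop :=
  HasFDerivAt Y (((F (slice β x) (Y x)).restrictScalars ℝ).comp (realEmb n)) x

theorem isSegSol_of_hasSliceDeriv {β : Fin n → ℝ} {C : Set (Fin n → ℝ)} {Y : (Fin n → ℝ) → M}
    (hCU : ∀ x ∈ C, slice β x ∈ U) (hY : ∀ x ∈ C, HasSliceDeriv F β Y x) {x x' : Fin n → ℝ}
    (hx : ∀ t ∈ Icc (0 : ℝ) 1, x + t • (x' - x) ∈ C) :
    IsSegSol U F (slice β x) (slice β x') (fun t => Y (x + t • (x' - x))) := by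
  refine ⟨fun t ht => by rw [slice_segment]; exact hCU _ (hx t ht), fun t ht => ?_⟩
  have h1 : HasDerivWithinAt (fun t : ℝ => x + t • (x' - x)) (x' - x) (Icc 0 1) t := by
    simpa using (((hasDerivAt_id t).smul_const (x' - x)).const_add x).hasDerivWithinAt
  have h0 : HasFDerivAt Y _ (x + t • (x' - x)) := hY _ (hx t ht)
  have h2 := h0.comp_hasDerivWithinAt t h1
  rw [slice_segment]
  refine h2.congr_deriv ?_
  have : slice β x' - slice β x = realEmb n (x' - x) := by ext j; simp [slice]
  rw [this]
  rfl

theorem segValue_self [ProperSpace M] (hF : IsFlat U F) {p : Fin n → ℂ} (hp : p ∈ U) (y₀ : M) :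
    p ∈ segDomain U F p y₀ ∧ segValue U F p y₀ p = y₀ := by
  have h : IsSegSol U F p p (fun _ => y₀) :=
    ⟨fun t _ => by simpa using hp, fun t _ => by simpa using hasDerivWithinAt_const t _ y₀⟩
  exact ⟨⟨_, h, rfl⟩, h.segValue_eq hF⟩

/-- Solutions along the segments in imaginary direction starting from a solution on the real
slice fit together to a holomorphic solution. -/
theorem hasFDerivAt_segValue_slice [ProperSpace M] (hF : IsFlat U F) {β : Fin n → ℝ}
    {C : Set (Fin n → ℝ)} {Y : (Fin n → ℝ) → M} (hC : IsOpen C)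
    (hCU : ∀ x ∈ C, slice β x ∈ U) (hY : ∀ x ∈ C, HasSliceDeriv F β Y x)
    {q : Fin n → ℂ} (hqC : reVec q ∈ C)
    (hqs : q ∈ segDomain U F (slice β (reVec q)) (Y (reVec q))) :
    HasFDerivAt (fun w => segValue U F (slice β (reVec w)) (Y (reVec w)) w)
      (F q (segValue U F (slice β (reVec q)) (Y (reVec q)) q)) q := by
  set p := slice β (reVec q) with hp
  set y₀ := Y (reVec q) with hy₀
  have hpU : p ∈ U := hCU _ hqC
  set Ω := segDomain U F p y₀ with hΩ
  set g := segValue U F p y₀ with hg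
  have hΩo : IsOpen Ω := isOpen_segDomain hF p y₀
  have hgd : ∀ w ∈ Ω, HasFDerivAt g (F w (g w)) w := fun w hw => hasFDerivAt_segValue hF hw
  have hΩU : Ω ⊆ U := segDomain_subset
  have hseg : ∀ t ∈ Icc (0 : ℝ) 1, p + t • (q - p) ∈ Ω := by
    obtain ⟨y, hy, hy0⟩ := hqs
    intro t ht
    rw [hΩ, ← hy0]
    exact hy.mem_segDomain ht
  -- near `p` the function `g` agrees with `Y` on the slice
  have hslice : ∀ᶠ x' in 𝓝 (reVec q), g (slice β x') = Y x' := by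
    have h1 : ∀ᶠ x' in 𝓝 (reVec q), x' ∈ C ∧ slice β x' ∈ Ω :=
      (hC.eventually_mem hqC).and ((continuous_slice β).continuousAt.preimage_mem_nhds
  (hΩo.mem_nhds (segValue_self hF hpU y₀).1))
    obtain ⟨r, hr, hball⟩ := Metric.eventually_nhds_iff_ball.1 h1
    filter_upwards [Metric.ball_mem_nhds _ hr] with x' hx'
    have hconv : ∀ t ∈ Icc (0 : ℝ) 1, reVec q + t • (x' - reVec q) ∈ Metric.ball (reVec q) r :=
      fun t ht => (convex_ball _ _).add_smul_sub_mem (Metric.mem_ball_self hr) hx' ht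
    have s1 := isSegSol_of_hasSliceDeriv hCU hY (fun t ht => (hball _ (hconv t ht)).1)
    have s2 := isSegSol_of_hasFDerivAt hΩU hgd (p := p) (q := slice β x')
      (fun t ht => by rw [hp, slice_segment]; exact (hball _ (hconv t ht)).2)
    have := s2.eqOn hF s1 (by simpa using (segValue_self hF hpU y₀).2)
      (show (1 : ℝ) ∈ Icc (0 : ℝ) 1 by simp)
    simpa using this
  have hcont : Continuous fun w : Fin n → ℂ => slice β (reVec w) :=
    (continuous_slice β).comp continuous_reVec
  -- the segment that ends at a point close to `q` stays in the domain of `g`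
  have hnear : ∀ᶠ w in 𝓝 q, ∀ t ∈ Icc (0 : ℝ) 1,
      slice β (reVec w) + t • (w - slice β (reVec w)) ∈ Ω := by
    refine isCompact_Icc.eventually_forall_of_forall_eventually fun t ht => ?_
    have hc : Continuous fun z : (Fin n → ℂ) × ℝ =>
        slice β (reVec z.1) + z.2 • (z.1 - slice β (reVec z.1)) := by
      have h1 := hcont.comp (continuous_fst (X := Fin n → ℂ) (Y := ℝ))
      exact h1.add (continuous_snd.smul (continuous_fst.sub h1))
    exact hc.continuousAt.preimage_mem_nhds (hΩo.mem_nhds (hseg t ht))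
  have hre : ∀ᶠ w in 𝓝 q, g (slice β (reVec w)) = Y (reVec w) :=
    continuous_reVec.continuousAt.eventually hslice
  have heq : (fun w => segValue U F (slice β (reVec w)) (Y (reVec w)) w) =ᶠ[𝓝 q] g := by
    filter_upwards [hnear, hre] with w hw hw'
    have s := isSegSol_of_hasFDerivAt hΩU hgd hw
    have := s.segValue_eq hF
    simpa [hw'] using this
  exact (hgd q (by simpa using hseg 1 (by simp))).congr_of_eventuallyEq heq

end Slice

/-! ### The hierarchy of isomonodromy equations and its integrability -/

/-- Square complex matrices. -/
abbrev Mat (n : ℕ) : Type := Matrix (Fin n) (Fin n) ℂ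

open scoped Matrix.Norms.Frobenius

/-- The topology of the Frobenius norm on matrices; it agrees definitionally with the product
topology, but is the one that instance search has to find where norms are used. -/
@[reducible] noncomputable def frobeniusTopology (n : ℕ) : TopologicalSpace (Mat n) :=
  PseudoMetricSpace.toUniformSpace.toTopologicalSpace

/-- The uniform structure of the Frobenius norm on matrices. -/
@[reducible] noncomputable def frobeniusUniformSpace (n : ℕ) : UniformSpace (Mat n) :=
  PseudoMetricSpace.toUniformSpace

attribute [local instance] frobeniusTopology frobeniusUniformSpace

theorem completeSpace_mat (n : ℕ) : CompleteSpace (Mat n) := FiniteDimensional.complete ℂ (Mat n)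

attribute [local instance] completeSpace_mat

section Connection

variable {n : ℕ}

/-- The entrywise product of a matrix with an array of coefficients. -/
def had (c : Fin n → Fin n → ℂ) (Y : Mat n) : Mat n := Matrix.of fun a b => c a b * Y a b

@[simp] theorem had_apply (c : Fin n → Fin n → ℂ) (Y : Mat n) (a b : Fin n) :
    had c Y a b = c a b * Y a b := rfl

theorem had_eq_sum (c : Fin n → Fin n → ℂ) (Y : Mat n) :
    had c Y = ∑ a, ∑ b, c a b • Matrix.single a b (Y a b) := by
  conv_lhs => rw [Matrix.matrix_eq_sum_single (had c Y)]
  refine Finset.sum_congr rfl fun a _ => Finset.sum_congr rfl fun b _ => ?_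
  rw [had_apply, Matrix.smul_single, smul_eq_mul]

/-- The commutator of two matrices, as the plain expression `X * Y - Y * X`: a function of two
matrices, without reference to the Lie ring structure. -/
def br (X Y : Mat n) : Mat n := X * Y - Y * X

theorem br_eq_lie (X Y : Mat n) : br X Y = ⁅X, Y⁆ := rfl

theorem br_add_left (X X' Y : Mat n) : br (X + X') Y = br X Y + br X' Y := by
  simp only [br]; noncomm_ring

theorem br_sub_left (X X' Y : Mat n) : br (X - X') Y = br X Y - br X' Y := by
  simp only [br]; noncomm_ring

theorem br_sub_right (X Y Y' : Mat n) : br X (Y - Y') = br X Y - br X Y' := by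
  simp only [br]; noncomm_ring

theorem br_smul_left (c : ℂ) (X Y : Mat n) : br (c • X) Y = c • br X Y := by
  simp [br, smul_sub]

theorem br_smul_right (c : ℂ) (X Y : Mat n) : br X (c • Y) = c • br X Y := by
  simp [br, smul_sub]

theorem br_sum_left {ι : Type*} (s : Finset ι) (f : ι → Mat n) (Y : Mat n) :
    br (∑ i ∈ s, f i) Y = ∑ i ∈ s, br (f i) Y := by
  simp only [br, Finset.sum_mul, Finset.mul_sum, Finset.sum_sub_distrib]

theorem br_self (X : Mat n) : br X X = 0 := sub_self _

theorem br_br (X Y Z : Mat n) : br (br X Y) Z = br X (br Y Z) - br Y (br X Z) := by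
  simp only [br]; noncomm_ring

theorem br_comm (X Y : Mat n) : br X Y = -br Y X := by
  simp only [br]; abel

/-- The right-hand side `dw ↦ [ω ∘ Y, Y]` attached to an array of one-forms `ω`, where `ω ∘ Y` is
the entrywise product. -/
noncomputable def conn (ω : (Fin n → ℂ) → Fin n → Fin n → (Fin n → ℂ) →L[ℂ] ℂ)
    (w : Fin n → ℂ) (Y : Mat n) : (Fin n → ℂ) →L[ℂ] Mat n :=
  ∑ a, ∑ b, (ω w a b).smulRight (br ((Matrix.single a b (Y a b) : Mat n)) Y)

variable {ω : (Fin n → ℂ) → Fin n → Fin n → (Fin n → ℂ) →L[ℂ] ℂ}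

theorem conn_apply_eq_sum (w : Fin n → ℂ) (Y : Mat n) (h : Fin n → ℂ) :
    conn ω w Y h = ∑ a, ∑ b, ω w a b h • (br ((Matrix.single a b (Y a b) : Mat n)) Y) := by
  simp [conn, sum_apply]

theorem conn_apply (w : Fin n → ℂ) (Y : Mat n) (h : Fin n → ℂ) :
    conn ω w Y h = (br (had (fun a b => ω w a b h) Y) Y) := by
  simp only [conn_apply_eq_sum, had_eq_sum, br_sum_left, br_smul_left]

/-- The linear map that keeps only the entry `(a, b)`. -/
noncomputable def entryMap (a b : Fin n) : Mat n →L[ℂ] Mat n :=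
  LinearMap.toContinuousLinearMap
    ((Matrix.singleLinearMap ℂ a b).comp (Matrix.entryLinearMap ℂ ℂ a b))

theorem entryMap_apply (a b : Fin n) (Y : Mat n) :
    entryMap a b Y = Matrix.single a b (Y a b) := rfl

theorem contDiff_bracket_entry (a b : Fin n) :
    ContDiff ℂ 1 fun Y : Mat n => (br ((Matrix.single a b (Y a b) : Mat n)) Y) := by
  have h : ContDiff ℂ 1 fun Y : Mat n => entryMap a b Y := (entryMap a b).contDiff
  exact (h.mul contDiff_id).sub (contDiff_id.mul h)

theorem contDiffAt_conn {w : Fin n → ℂ} (hω : ∀ a b, ContDiffAt ℂ 1 (fun w => ω w a b) w)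
    (Y : Mat n) :
    ContDiffAt ℂ 1 (fun q : (Fin n → ℂ) × Mat n => conn ω q.1 q.2) (w, Y) := by
  unfold conn
  refine ContDiffAt.sum fun a _ => ContDiffAt.sum fun b _ => ?_
  refine ContDiffAt.smulRight ?_ ?_
  · exact (hω a b).comp (w, Y) contDiffAt_fst
  · exact (contDiff_bracket_entry a b).contDiffAt.comp (w, Y) contDiffAt_snd

theorem hasDerivAt_line {V : Type*} [NormedAddCommGroup V] [NormedSpace ℂ V] (x v : V) (t : ℂ) :
    HasDerivAt (fun t : ℂ => x + t • v) v t := by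
  simpa using ((hasDerivAt_id t).smul_const v).const_add x

/-- The derivative of the right-hand side along a line, by the product rule. -/
theorem hasDerivAt_conn_line {w : Fin n → ℂ} (hω : ∀ a b, ContDiffAt ℂ 1 (fun w => ω w a b) w)
    (Y : Mat n) (v k : Fin n → ℂ) (η : Mat n) :
    HasDerivAt (fun t : ℂ => conn ω (w + t • v) (Y + t • η) k)
      (br (had (fun a b => fderiv ℂ (fun w => ω w a b) w v k) Y) Y +
        (br (had (fun a b => ω w a b k) η) Y + br (had (fun a b => ω w a b k) Y) η)) 0 := by
  have hωl : ∀ a b, HasDerivAt (fun t : ℂ => ω (w + t • v) a b k)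
      (fderiv ℂ (fun w => ω w a b) w v k) 0 := by
    intro a b
    have e1 : HasFDerivAt (fun w => ω w a b) (fderiv ℂ (fun w => ω w a b) w)
        (w + (0 : ℂ) • v) := by
      simpa using ((hω a b).differentiableAt (by norm_num)).hasFDerivAt
    have e2 := e1.comp_hasDerivAt (0 : ℂ) (hasDerivAt_line w v 0)
    exact (ContinuousLinearMap.apply ℂ ℂ k).hasFDerivAt.comp_hasDerivAt (0 : ℂ) e2
  have hYl : HasDerivAt (fun t : ℂ => Y + t • η) η 0 := hasDerivAt_line Y η 0
  have hEl : ∀ a b, HasDerivAt (fun t : ℂ => entryMap a b (Y + t • η)) (entryMap a b η) 0 :=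
    fun a b => (entryMap a b).hasFDerivAt.comp_hasDerivAt (0 : ℂ) hYl
  have h2 : HasDerivAt (fun t : ℂ => ∑ a, ∑ b, ω (w + t • v) a b k •
        (entryMap a b (Y + t • η) * (Y + t • η) - (Y + t • η) * entryMap a b (Y + t • η)))
      (∑ a, ∑ b, (ω w a b k • (br (entryMap a b η) Y + br (entryMap a b Y) η) +
        fderiv ℂ (fun w => ω w a b) w v k • br (entryMap a b Y) Y)) 0 := by
    refine HasDerivAt.fun_sum fun a _ => HasDerivAt.fun_sum fun b _ => ?_
    have h3 := (hωl a b).fun_smul (((hEl a b).fun_mul hYl).fun_sub (hYl.fun_mul (hEl a b)))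
    refine h3.congr_deriv ?_
    simp only [zero_smul, add_zero, br]
    congr 2
    abel
  have e : (fun t : ℂ => conn ω (w + t • v) (Y + t • η) k) = fun t : ℂ => ∑ a, ∑ b,
      ω (w + t • v) a b k •
        (entryMap a b (Y + t • η) * (Y + t • η) - (Y + t • η) * entryMap a b (Y + t • η)) := by
    ext1 t
    rw [conn_apply_eq_sum]
    rfl
  rw [e]
  refine h2.congr_deriv ?_
  simp only [had_eq_sum, br_sum_left, br_smul_left, entryMap_apply, smul_add,
    Finset.sum_add_distrib]
  abel

theorem fderiv_conn_apply {w : Fin n → ℂ} (hω : ∀ a b, ContDiffAt ℂ 1 (fun w => ω w a b) w)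
    (Y : Mat n) (v k : Fin n → ℂ) (η : Mat n) :
    fderiv ℂ (fun q : (Fin n → ℂ) × Mat n => conn ω q.1 q.2) (w, Y) (v, η) k =
      br (had (fun a b => fderiv ℂ (fun w => ω w a b) w v k) Y) Y +
        (br (had (fun a b => ω w a b k) η) Y + br (had (fun a b => ω w a b k) Y) η) := by
  have hF := ((contDiffAt_conn hω Y).differentiableAt (by norm_num)).hasFDerivAt
  have hline := (hasDerivAt_line w v 0).prodMk (hasDerivAt_line Y η 0)
  have hp : ((w, Y) : (Fin n → ℂ) × Mat n) = (w + (0 : ℂ) • v, Y + (0 : ℂ) • η) := by simp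
  rw [hp] at hF
  have h1 := hF.comp_hasDerivAt (0 : ℂ) hline
  rw [← hp] at h1
  have h2 := (ContinuousLinearMap.apply ℂ (Mat n) k).hasFDerivAt.comp_hasDerivAt (0 : ℂ) h1
  exact h2.unique (hasDerivAt_conn_line hω Y v k η)

/-- Criterion for integrability: the forms are closed, and an algebraic identity holds. -/
theorem isFlat_conn {U : Set (Fin n → ℂ)} (hU : IsOpen U)
    (hω : ∀ w ∈ U, ∀ a b, ContDiffAt ℂ 1 (fun w => ω w a b) w)
    (hclosed : ∀ w ∈ U, ∀ a b v k,
      fderiv ℂ (fun w => ω w a b) w v k = fderiv ℂ (fun w => ω w a b) w k v)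
    (halg : ∀ w ∈ U, ∀ (Y : Mat n) v k,
      had (fun a b => ω w a b k) (br (had (fun a b => ω w a b v) Y) Y) -
        had (fun a b => ω w a b v) (br (had (fun a b => ω w a b k) Y) Y) +
        (br (had (fun a b => ω w a b k) Y) (had (fun a b => ω w a b v) Y)) = 0) :
    IsFlat U (conn ω) := by
  refine ⟨hU, fun w hw Y => contDiffAt_conn (hω w hw) Y, fun w hw Y v k => ?_⟩
  rw [fderiv_conn_apply (hω w hw), fderiv_conn_apply (hω w hw), conn_apply, conn_apply]
  simp_rw [hclosed w hw _ _ v k]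
  set T := had (fun a b => ω w a b k) Y
  set S := had (fun a b => ω w a b v) Y
  have h1 := halg w hw Y v k
  have h2 : had (fun a b => ω w a b k) (br S Y) =
      had (fun a b => ω w a b v) (br T Y) - (br T S) := by
    rw [← sub_eq_zero, ← h1]; abel
  rw [h2, br_sub_left, br_br T S Y]
  abel

/-- The coefficient of the equation of level `k` in the entry `(a, b)`: with `x` the values of
the functions `u`, with `p` their derivatives and `s` that of `∑ j < k, w j`. -/
noncomputable def levelCoeff (k : ℕ) (x p : Fin n → ℂ) (s : ℂ) (a b : Fin n) : ℂ :=
  if a = b then -s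
  else if (a : ℕ) < k ∧ (b : ℕ) < k then (p a - p b) / (x a - x b) - s else 0

theorem levelCoeff_symm (k : ℕ) (x p : Fin n → ℂ) (s : ℂ) (a b : Fin n) :
    levelCoeff k x p s a b = levelCoeff k x p s b a := by
  simp only [levelCoeff, eq_comm (a := a), and_comm (a := (a : ℕ) < k)]
  rw [← neg_sub (p a), ← neg_sub (x a), neg_div_neg_eq]

/-- The algebraic part of integrability, for the coefficient of `Y a d * Y d b`. If `a, b, d` are
distinct and less than `k`, it is an identity between fractions in `x a - x b`, `x a - x d` and
`x d - x b`; the terms in `s` and `t` cancel. Otherwise the terms vanish or cancel in pairs. -/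
theorem levelCoeff_identity (k : ℕ) (x p q : Fin n → ℂ) (s t : ℂ)
    (hx : ∀ a b : Fin n, (a : ℕ) < k → (b : ℕ) < k → a ≠ b → x a ≠ x b) (a b d : Fin n) :
    levelCoeff k x p s a b * (levelCoeff k x q t a d - levelCoeff k x q t d b) -
      levelCoeff k x q t a b * (levelCoeff k x p s a d - levelCoeff k x p s d b) +
      levelCoeff k x p s a d * levelCoeff k x q t d b -
      levelCoeff k x q t a d * levelCoeff k x p s d b = 0 := by
  have hdiag : ∀ (p : Fin n → ℂ) (s : ℂ) (a : Fin n), levelCoeff k x p s a a = -s := by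
    intro p s a; simp [levelCoeff]
  by_cases hab : a = b
  · subst hab
    rw [levelCoeff_symm k x q t d a, levelCoeff_symm k x p s d a]; ring
  by_cases had : a = d
  · subst had
    rw [hdiag, hdiag]; ring
  by_cases hdb : d = b
  · subst hdb
    rw [hdiag, hdiag]; ring
  by_cases h : (a : ℕ) < k ∧ (b : ℕ) < k ∧ (d : ℕ) < k
  · obtain ⟨ha, hb, hd⟩ := h
    have h1 : x a - x b ≠ 0 := sub_ne_zero.2 (hx a b ha hb hab)
    have h2 : x a - x d ≠ 0 := sub_ne_zero.2 (hx a d ha hd had)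
    have h3 : x d - x b ≠ 0 := sub_ne_zero.2 (hx d b hd hb hdb)
    simp only [levelCoeff, if_neg hab, if_neg had, if_neg hdb, ha, hb, hd, and_self, if_true]
    field_simp
    ring
  · have hz : ∀ (p : Fin n → ℂ) (s : ℂ) (a b : Fin n), a ≠ b → ¬((a : ℕ) < k ∧ (b : ℕ) < k) →
        levelCoeff k x p s a b = 0 := by
      intro p s a b h1 h2
      rw [levelCoeff, if_neg h1, if_neg h2]
    by_cases ha : (a : ℕ) < k
    · by_cases hb : (b : ℕ) < k
      · have hd : ¬ (d : ℕ) < k := fun hd => h ⟨ha, hb, hd⟩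
        simp [hz _ _ a d had (fun h => hd h.2), hz _ _ d b hdb (fun h => hd h.1)]
      · simp [hz _ _ a b hab (fun h => hb h.2), hz _ _ d b hdb (fun h => hb h.2)]
    · simp [hz _ _ a b hab (fun h => ha h.1), hz _ _ a d had (fun h => ha h.1)]

theorem had_levelCoeff_identity (k : ℕ) (x p q : Fin n → ℂ) (s t : ℂ)
    (hx : ∀ a b : Fin n, (a : ℕ) < k → (b : ℕ) < k → a ≠ b → x a ≠ x b) (Y : Mat n) :
    had (levelCoeff k x p s) (br (had (levelCoeff k x q t) Y) Y) -
      had (levelCoeff k x q t) (br (had (levelCoeff k x p s) Y) Y) +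
      (br (had (levelCoeff k x p s) Y) (had (levelCoeff k x q t) Y)) = 0 := by
  ext a b
  simp only [br, Matrix.add_apply, Matrix.sub_apply, had_apply, Matrix.mul_apply,
    Matrix.zero_apply]
  simp only [← Finset.sum_sub_distrib, Finset.mul_sum, ← Finset.sum_add_distrib]
  refine Finset.sum_eq_zero fun d _ => ?_
  linear_combination (Y a d * Y d b) * levelCoeff_identity k x p q s t hx a b d

variable (υ : (Fin n → ℂ) → Fin n → ℂ) (σ : (Fin n → ℂ) →L[ℂ] ℂ)

/-- The one-forms of the equation of level `k`, for functions `υ` of the coordinates in the place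
of the `u_i`, and with the linear form `σ` on the diagonal. -/
noncomputable def levelForm (k : ℕ) (w : Fin n → ℂ) (a b : Fin n) : (Fin n → ℂ) →L[ℂ] ℂ :=
  if a = b then -σ
  else if (a : ℕ) < k ∧ (b : ℕ) < k then
    (υ w a - υ w b)⁻¹ • fderiv ℂ (fun w => υ w a - υ w b) w - σ else 0

/-- Points at which the first `k` of the functions `υ` are pairwise distinct. -/
def levelRegular (k : ℕ) : Set (Fin n → ℂ) :=
  {w | ∀ a b : Fin n, (a : ℕ) < k → (b : ℕ) < k → a ≠ b → υ w a ≠ υ w b}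

variable {υ}

theorem isOpen_levelRegular (hυ : ContDiff ℂ 3 υ) (k : ℕ) : IsOpen (levelRegular υ k) := by
  simp only [levelRegular, Set.ofPred_forall]
  refine isOpen_iInter_of_finite fun a => isOpen_iInter_of_finite fun b => ?_
  refine isOpen_iInter_of_finite fun _ => isOpen_iInter_of_finite fun _ =>
    isOpen_iInter_of_finite fun _ => ?_
  exact isOpen_ne_fun ((continuous_apply a).comp hυ.continuous)
    ((continuous_apply b).comp hυ.continuous)

theorem contDiff_sub_apply (hυ : ContDiff ℂ 3 υ) (a b : Fin n) :
    ContDiff ℂ 3 fun w => υ w a - υ w b :=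
  (contDiff_pi.1 hυ a).sub (contDiff_pi.1 hυ b)

theorem fderiv_sub_apply (hυ : ContDiff ℂ 3 υ) (a b : Fin n) (w h : Fin n → ℂ) :
    fderiv ℂ (fun w => υ w a - υ w b) w h = fderiv ℂ υ w h a - fderiv ℂ υ w h b := by
  have hd : HasFDerivAt υ (fderiv ℂ υ w) w :=
    (hυ.differentiable (by norm_num) w).hasFDerivAt
  have ha := (hasFDerivAt_pi'.1 hd a).sub (hasFDerivAt_pi'.1 hd b)
  have := ha.fderiv
  rw [show (fun w => υ w a - υ w b) = ((fun x => υ x a) - fun x => υ x b) from rfl, this]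
  rfl

theorem levelForm_apply (hυ : ContDiff ℂ 3 υ) (k : ℕ) (w h : Fin n → ℂ) :
    (fun a b => levelForm υ σ k w a b h) = levelCoeff k (υ w) (fderiv ℂ υ w h) (σ h) := by
  ext a b
  simp only [levelForm, levelCoeff]
  split_ifs with h1 h2
  · rfl
  · rw [sub_apply, smul_apply, fderiv_sub_apply hυ, smul_eq_mul, inv_mul_eq_div]
  · rfl

theorem contDiffAt_levelForm (hυ : ContDiff ℂ 3 υ) {k : ℕ} {w : Fin n → ℂ}
    (hw : w ∈ levelRegular υ k) (a b : Fin n) :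
    ContDiffAt ℂ 1 (fun w => levelForm υ σ k w a b) w := by
  unfold levelForm
  split_ifs with h1 h2
  · exact contDiffAt_const
  · refine (ContDiffAt.smul (f := fun w => (υ w a - υ w b)⁻¹) ?_ ?_).sub contDiffAt_const
    · exact ((contDiff_sub_apply hυ a b).contDiffAt.of_le (by norm_num)).inv
        (sub_ne_zero.2 (hw a b h2.1 h2.2 h1))
    · exact ((contDiff_sub_apply hυ a b).fderiv_right (m := 1) (by norm_num)).contDiffAt
  · exact contDiffAt_const

/-- The one-forms are closed: off the diagonal they are logarithmic derivatives, up to a constant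
form. -/
theorem fderiv_levelForm_symm (hυ : ContDiff ℂ 3 υ) {k : ℕ} {w : Fin n → ℂ}
    (hw : w ∈ levelRegular υ k) (a b : Fin n) (v h : Fin n → ℂ) :
    fderiv ℂ (fun w => levelForm υ σ k w a b) w v h =
      fderiv ℂ (fun w => levelForm υ σ k w a b) w h v := by
  unfold levelForm
  split_ifs with h1 h2
  · simp
  · set f := fun w => υ w a - υ w b with hf
    have hfc : ContDiff ℂ 3 f := contDiff_sub_apply hυ a b
    have hne : f w ≠ 0 := sub_ne_zero.2 (hw a b h2.1 h2.2 h1)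
    have hfd : HasFDerivAt f (fderiv ℂ f w) w := (hfc.differentiable (by norm_num) w).hasFDerivAt
    have hfdd : HasFDerivAt (fderiv ℂ f) (fderiv ℂ (fderiv ℂ f) w) w :=
      (((hfc.fderiv_right (m := 1) (by norm_num)).differentiable (by norm_num)) w).hasFDerivAt
    have hsymm : fderiv ℂ (fderiv ℂ f) w v h = fderiv ℂ (fderiv ℂ f) w h v :=
      (hfc.contDiffAt.isSymmSndFDerivAt (by simp; norm_num)) v h
    have hinv : HasFDerivAt (fun w => (f w)⁻¹) (-(f w ^ 2)⁻¹ • fderiv ℂ f w) w := by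
      exact (hasDerivAt_inv hne).comp_hasFDerivAt w hfd
    have hall := (hinv.fun_smul hfdd).sub_const σ
    rw [show (fun w => (υ w a - υ w b)⁻¹ • fderiv ℂ f w - σ) =
      fun w => (f w)⁻¹ • fderiv ℂ f w - σ from rfl, hall.fderiv]
    simp only [add_apply, smul_apply, ContinuousLinearMap.smulRight_apply, hsymm, smul_eq_mul]
    ring
  · simp

/-- The equations of all levels are integrable. -/
theorem isFlat_level (hυ : ContDiff ℂ 3 υ) (k : ℕ) :
    IsFlat (levelRegular υ k) (conn (levelForm υ σ k)) := by
  refine isFlat_conn (isOpen_levelRegular hυ k) (fun w hw a b => contDiffAt_levelForm σ hυ hw a b)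
    (fun w hw a b v h => fderiv_levelForm_symm σ hυ hw a b v h) fun w hw Y v h => ?_
  rw [levelForm_apply σ hυ, levelForm_apply σ hυ]
  exact had_levelCoeff_identity k _ _ _ _ _ hw Y

end Connection

/-! ### The functions `u` and the passage between consecutive levels -/

section Levels

variable {n : ℕ}

/-- The linear form `w ↦ ∑ j ≤ l, w j`. -/
noncomputable def cum (l : Fin n) : (Fin n → ℂ) →L[ℂ] ℂ :=
  ∑ j ∈ Finset.univ.filter (· ≤ l), ContinuousLinearMap.proj j

theorem cum_apply (l : Fin n) (w : Fin n → ℂ) :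
    cum l w = ∑ j ∈ Finset.univ.filter (· ≤ l), w j := by
  simp [cum, sum_apply]

/-- The linear form `w ↦ ∑ j < k, w j`. -/
noncomputable def levelSum (n k : ℕ) : (Fin n → ℂ) →L[ℂ] ℂ :=
  ∑ j ∈ Finset.univ.filter (fun j : Fin n => (j : ℕ) < k), ContinuousLinearMap.proj j

theorem levelSum_apply (k : ℕ) (w : Fin n → ℂ) :
    levelSum n k w = ∑ j ∈ Finset.univ.filter (fun j : Fin n => (j : ℕ) < k), w j := by
  simp [levelSum, sum_apply]

theorem levelSum_succ (K : Fin n) (w : Fin n → ℂ) :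
    levelSum n (K + 1) w = levelSum n K w + w K := by
  rw [levelSum_apply, levelSum_apply, add_comm _ (w K), ← Finset.sum_insert (by simp)]
  refine Finset.sum_congr ?_ fun _ _ => rfl
  ext j
  simp only [Finset.mem_filter, Finset.mem_univ, true_and, Finset.mem_insert, Fin.ext_iff]
  omega

theorem levelSum_succ_eq_cum (K : Fin n) (w : Fin n → ℂ) :
    levelSum n (K + 1) w = cum K w := by
  rw [levelSum_apply, cum_apply]
  refine Finset.sum_congr ?_ fun _ _ => rfl
  ext j
  simp only [Finset.mem_filter, Finset.mem_univ, true_and, Fin.le_def]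
  omega

theorem u_eq (w : Fin n → ℂ) (i : Fin n) :
    u w i = ∑ l ∈ Finset.univ.filter (· ≤ i), Complex.exp (cum l w) := by
  simp only [u, cum_apply, Complex.exp_sum]

theorem contDiff_u : ContDiff ℂ 3 (u : (Fin n → ℂ) → Fin n → ℂ) := by
  refine contDiff_pi.2 fun i => ?_
  simp only [u_eq]
  exact ContDiff.sum fun l _ => (cum l).contDiff.cexp

theorem fderiv_u_apply (w h : Fin n → ℂ) (i : Fin n) :
    fderiv ℂ u w h i =
      ∑ l ∈ Finset.univ.filter (· ≤ i), Complex.exp (cum l w) * cum l h := by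
  have h1 : HasFDerivAt (u : (Fin n → ℂ) → Fin n → ℂ) (fderiv ℂ u w) w :=
    (contDiff_u.differentiable (by norm_num) w).hasFDerivAt
  have h2 : HasFDerivAt (fun w : Fin n → ℂ => u w i)
      (∑ l ∈ Finset.univ.filter (· ≤ i), Complex.exp (cum l w) • cum l) w := by
    simp only [u_eq]
    exact HasFDerivAt.fun_sum fun l _ => (cum l).hasFDerivAt.cexp
  have h3 := (hasFDerivAt_pi'.1 h1 i).unique h2
  have h4 := congrArg (fun L => L h) h3
  simp only [sum_apply, smul_apply, smul_eq_mul] at h4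
  exact h4

/-- The product of `exp (-w j)` over `l < j < K`. -/
noncomputable def tailProd (K : Fin n) (w : Fin n → ℂ) (l : Fin n) : ℂ :=
  ∏ j ∈ Finset.univ.filter (fun j => l < j ∧ j < K), Complex.exp (-(w j))

/-- The diagonal entries of `UMat w K`. -/
noncomputable def tailSum (K : Fin n) (w : Fin n → ℂ) (b : Fin n) : ℂ :=
  ∑ l ∈ Finset.univ.filter (fun l => b < l ∧ l < K), tailProd K w l

theorem UMat_eq (w : Fin n → ℂ) (K : Fin n) : UMat w K = Matrix.diagonal (tailSum K w) := rfl

theorem exp_cum_eq {l K : Fin n} (hl : l < K) (w : Fin n → ℂ) :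
    Complex.exp (cum l w) =
      Complex.exp (cum K w) * (Complex.exp (-(w K)) * tailProd K w l) := by
  have h1 : cum K w = cum l w +
      (∑ j ∈ Finset.univ.filter (fun j => l < j ∧ j < K), w j) + w K := by
    have hd : Disjoint (Finset.univ.filter (· ≤ l))
        (Finset.univ.filter (fun j => l < j ∧ j < K)) := by
      rw [Finset.disjoint_filter]
      intro j _ h1 h2
      exact absurd h2.1 (not_lt.2 h1)
    rw [cum_apply, cum_apply, ← Finset.sum_union hd, add_comm, ← Finset.sum_insert]
    · refine Finset.sum_congr ?_ fun _ _ => rfl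
      ext j
      simp only [Finset.mem_filter, Finset.mem_univ, true_and, Finset.mem_insert,
        Finset.mem_union, Fin.ext_iff, Fin.le_def, Fin.lt_def] at *
      omega
    · simp [hl]
  rw [tailProd, ← Complex.exp_sum, ← Complex.exp_add, ← Complex.exp_add, Finset.sum_neg_distrib,
    h1]
  congr 1
  ring

theorem sum_le_split {b K : Fin n} (hb : b < K) (f : Fin n → ℂ) :
    ∑ l ∈ Finset.univ.filter (· ≤ K), f l - ∑ l ∈ Finset.univ.filter (· ≤ b), f l =
      f K + ∑ l ∈ Finset.univ.filter (fun l => b < l ∧ l < K), f l := by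
  have hd : Disjoint (Finset.univ.filter (· ≤ b))
      (Finset.univ.filter (fun j => b < j ∧ j < K)) := by
    rw [Finset.disjoint_filter]
    intro j _ h1 h2
    exact absurd h2.1 (not_lt.2 h1)
  rw [sub_eq_iff_eq_add, add_assoc, add_comm (∑ l ∈ Finset.univ.filter (fun l => b < l ∧ l < K), f l),
    ← Finset.sum_union hd, ← Finset.sum_insert]
  · refine Finset.sum_congr ?_ fun _ _ => rfl
    ext j
    simp only [Finset.mem_filter, Finset.mem_univ, true_and, Finset.mem_insert,
      Finset.mem_union, Fin.ext_iff, Fin.le_def, Fin.lt_def] at *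
    omega
  · simp [hb]

/-- The difference `u_K - u_b` is `z_0 ⋯ z_K` times a factor that tends to `1` for `z_K → ∞`. -/
theorem u_sub_u {b K : Fin n} (hb : b < K) (w : Fin n → ℂ) :
    u w K - u w b =
      Complex.exp (cum K w) * (1 + Complex.exp (-(w K)) * tailSum K w b) := by
  rw [u_eq, u_eq, sum_le_split hb, tailSum, mul_add, mul_one, Finset.mul_sum, Finset.mul_sum]
  congr 1
  refine Finset.sum_congr rfl fun l hl => ?_
  rw [exp_cum_eq (Finset.mem_filter.1 hl).2.2]

theorem fderiv_u_sub {b K : Fin n} (hb : b < K) (w h : Fin n → ℂ) :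
    fderiv ℂ u w h K - fderiv ℂ u w h b = Complex.exp (cum K w) * (cum K h +
      Complex.exp (-(w K)) * ∑ l ∈ Finset.univ.filter (fun l => b < l ∧ l < K),
        tailProd K w l * cum l h) := by
  rw [fderiv_u_apply, fderiv_u_apply, sum_le_split hb, mul_add, Finset.mul_sum, Finset.mul_sum]
  congr 1
  refine Finset.sum_congr rfl fun l hl => ?_
  rw [exp_cum_eq (Finset.mem_filter.1 hl).2.2]
  ring

/-- The deviation of the coefficient of the equation of level `K + 1` in the entry `(K, b)` from
its limit for `Re (w K) → ∞`. -/
noncomputable def epsEntry (K : Fin n) (w h : Fin n → ℂ) (b : Fin n) : ℂ :=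
  Complex.exp (-(w K)) * (∑ l ∈ Finset.univ.filter (fun l => b < l ∧ l < K),
    tailProd K w l * (cum l h - cum K h)) / (1 + Complex.exp (-(w K)) * tailSum K w b)

/-- The entries `epsEntry` placed in row and column `K`. -/
noncomputable def epsCoeff (K : Fin n) (w h : Fin n → ℂ) (a b : Fin n) : ℂ :=
  if a = K ∧ b < K then epsEntry K w h b else if b = K ∧ a < K then epsEntry K w h a else 0

theorem epsEntry_eq {b K : Fin n} (hb : b < K) {w : Fin n → ℂ}
    (hw : 1 + Complex.exp (-(w K)) * tailSum K w b ≠ 0) (h : Fin n → ℂ) :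
    (fderiv ℂ u w h K - fderiv ℂ u w h b) / (u w K - u w b) = cum K h + epsEntry K w h b := by
  rw [u_sub_u hb, fderiv_u_sub hb, mul_div_mul_left _ _ (Complex.exp_ne_zero _), epsEntry,
    div_eq_iff hw, add_mul, div_mul_cancel₀ _ hw]
  simp only [mul_sub, Finset.sum_sub_distrib, ← Finset.sum_mul]
  rw [tailSum]
  ring

/-- The matrix `N` of the equation `dY = [N, Y]` of level `k`, in the direction `h`. -/
noncomputable def lax (k : ℕ) (w h : Fin n → ℂ) (Y : Mat n) : Mat n :=
  had (levelCoeff k (u w) (fderiv ℂ u w h) (levelSum n k h)) Y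

/-- The right-hand side of the equation of level `k` of the hierarchy. For `k = n` this is the
isomonodromy equation; the solutions `s_k ∘ ⋯ ∘ s_1 (Φ₀)` satisfy the equation of level `k`. -/
noncomputable def iso (n k : ℕ) : (Fin n → ℂ) → Mat n → (Fin n → ℂ) →L[ℂ] Mat n :=
  conn (levelForm u (levelSum n k) k)

theorem iso_apply (k : ℕ) (w h : Fin n → ℂ) (Y : Mat n) :
    iso n k w Y h = br (lax k w h Y) Y := by
  rw [iso, conn_apply, levelForm_apply _ contDiff_u, lax]

theorem isFlat_iso (k : ℕ) : IsFlat (levelRegular u k) (iso n k) :=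
  isFlat_level _ contDiff_u k

theorem lax_delta (k : ℕ) (w h : Fin n → ℂ) (Y : Mat n) :
    lax k w h (delta k Y) = lax k w h Y := by
  ext a b
  simp only [lax, had_apply, levelCoeff, delta]
  by_cases hab : a = b
  · simp [hab]
  · by_cases hk : (a : ℕ) < k ∧ (b : ℕ) < k
    · simp [hk]
    · simp [hab, hk]

/-- The matrices of the equations of levels `K` and `K + 1` differ by `-h_K δ_K Y`, which accounts
for the factor `z_K ^ {-ad A}`, and by the exponentially small `epsCoeff`. -/
theorem lax_succ {K : Fin n} {w : Fin n → ℂ}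
    (hw : ∀ b < K, 1 + Complex.exp (-(w K)) * tailSum K w b ≠ 0) (h : Fin n → ℂ) (Y : Mat n) :
    lax (K + 1) w h Y = lax K w h Y - h K • delta K Y + had (epsCoeff K w h) Y := by
  ext a b
  simp only [lax, Matrix.add_apply, Matrix.sub_apply, Matrix.smul_apply, had_apply, smul_eq_mul,
    levelCoeff, delta, levelSum_succ, epsCoeff]
  by_cases hab : a = b
  · subst hab
    have : ¬ (a = K ∧ a < K) := fun h => (h.1 ▸ h.2).false
    simp [this]; ring
  · simp only [hab, or_false]
    by_cases ha : (a : ℕ) < K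
    · have ha' : a ≠ K := fun h => by simp [h] at ha
      by_cases hb : (b : ℕ) < K
      · have hb' : b ≠ K := fun h => by simp [h] at hb
        simp [ha, hb, ha', hb', Nat.lt_succ_of_lt ha, Nat.lt_succ_of_lt hb]
        ring
      · by_cases hbK : b = K
        · subst hbK
          have haK : a < b := ha
          have e := epsEntry_eq haK (hw a haK) h
          rw [← neg_sub (fderiv ℂ u w h a), ← neg_sub (u w a), neg_div_neg_eq] at e
          simp [ha, ha', Nat.lt_succ_of_lt ha, haK, e, ← levelSum_succ_eq_cum, levelSum_succ]
        · have : ¬ (b : ℕ) < K + 1 := fun h => hbK (Fin.ext (by omega))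
          simp [ha', hb, hbK, this]
    · by_cases haK : a = K
      · subst haK
        by_cases hb : b < a
        · have e := epsEntry_eq hb (hw b hb) h
          have hb2 : (b : ℕ) < a := hb
          simp [hb, hb2, Nat.lt_succ_of_lt hb2, e, ← levelSum_succ_eq_cum, levelSum_succ]
        · have : ¬ (b : ℕ) < a + 1 := fun h => hab (Fin.ext (by
            have : ¬ (b : ℕ) < a := hb
            omega))
          simp [hb, this]
      · have h1 : ¬ (a : ℕ) < K + 1 := fun h => haK (Fin.ext (by omega))
        have h2 : ¬ a < K := ha
        simp [haK, h1, h2, ha]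

end Levels

/-! ### Norm estimates -/

section Norms

variable {n : ℕ}

theorem norm_had_le {c : Fin n → Fin n → ℂ} {B : ℝ} (hB : ∀ a b, ‖c a b‖ ≤ B) (hB0 : 0 ≤ B)
    (Y : Mat n) : ‖had c Y‖ ≤ B * ‖Y‖ := by
  rw [← Real.norm_of_nonneg hB0, ← norm_smul, Matrix.frobenius_norm_def, Matrix.frobenius_norm_def]
  refine Real.rpow_le_rpow (by positivity) ?_ (by norm_num)
  refine Finset.sum_le_sum fun a _ => Finset.sum_le_sum fun b _ => ?_
  refine Real.rpow_le_rpow (norm_nonneg _) ?_ (by norm_num)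
  rw [had_apply, norm_mul, Matrix.smul_apply, norm_smul, Real.norm_of_nonneg hB0]
  exact mul_le_mul_of_nonneg_right (hB a b) (norm_nonneg _)

theorem norm_br_le (X Y : Mat n) : ‖br X Y‖ ≤ 2 * ‖X‖ * ‖Y‖ := by
  refine (norm_sub_le _ _).trans ?_
  have h1 := norm_mul_le X Y
  have h2 := norm_mul_le Y X
  linarith

theorem delta_eq_had (k : ℕ) (Y : Mat n) :
    delta k Y = had (fun a b => if ((a : ℕ) < k ∧ (b : ℕ) < k) ∨ a = b then 1 else 0) Y := by
  ext a b
  simp only [delta, had_apply]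
  split_ifs <;> simp

theorem norm_delta_le (k : ℕ) (Y : Mat n) : ‖delta k Y‖ ≤ ‖Y‖ := by
  rw [delta_eq_had]
  refine (norm_had_le (B := 1) (fun a b => ?_) zero_le_one Y).trans (by rw [one_mul])
  split_ifs <;> simp

theorem norm_entry_le (Y : Mat n) (a b : Fin n) : ‖Y a b‖ ≤ ‖Y‖ := by
  rw [Matrix.frobenius_norm_def, ← Real.sqrt_eq_rpow]
  refine Real.le_sqrt_of_sq_le ?_
  simp only [Real.rpow_two]
  calc ‖Y a b‖ ^ 2 ≤ ∑ j, ‖Y a j‖ ^ 2 :=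
        Finset.single_le_sum (f := fun j => ‖Y a j‖ ^ 2) (fun _ _ => by positivity)
          (Finset.mem_univ b)
    _ ≤ ∑ i, ∑ j, ‖Y i j‖ ^ 2 :=
        Finset.single_le_sum (f := fun i => ∑ j, ‖Y i j‖ ^ 2) (fun _ _ => by positivity)
          (Finset.mem_univ a)

theorem delta_add (k : ℕ) (X Y : Mat n) : delta k (X + Y) = delta k X + delta k Y := by
  ext a b; simp only [delta, Matrix.add_apply]; split_ifs <;> simp

theorem delta_sub (k : ℕ) (X Y : Mat n) : delta k (X - Y) = delta k X - delta k Y := by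
  ext a b; simp only [delta, Matrix.sub_apply]; split_ifs <;> simp

theorem delta_smul (k : ℕ) (c : ℂ) (X : Mat n) : delta k (c • X) = c • delta k X := by
  ext a b; simp only [delta, Matrix.smul_apply]; split_ifs <;> simp

theorem delta_zero (k : ℕ) : delta k (0 : Mat n) = 0 := by
  ext a b; simp [delta]

theorem delta_sum {ι : Type*} (k : ℕ) (s : Finset ι) (f : ι → Mat n) :
    delta k (∑ i ∈ s, f i) = ∑ i ∈ s, delta k (f i) := by
  ext a b
  simp only [delta, Matrix.sum_apply]
  split_ifs <;> simp

theorem delta_delta {j k : ℕ} (hjk : j ≤ k) (X : Mat n) : delta j (delta k X) = delta j X := by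
  ext a b
  simp only [delta]
  split_ifs <;> first | rfl | (exfalso; omega)

theorem delta_delta' {j k : ℕ} (hjk : j ≤ k) (X : Mat n) : delta k (delta j X) = delta j X := by
  ext a b
  simp only [delta]
  split_ifs <;> first | rfl | (exfalso; omega)

/-- Multiplication by a matrix supported on the block commutes with `δ_k`. -/
theorem delta_mul_left {k : ℕ} {A : Mat n} (hA : delta k A = A) (X : Mat n) :
    delta k (A * X) = A * delta k X := by
  ext a b
  have hA' : ∀ d : Fin n, ¬(((a : ℕ) < k ∧ (d : ℕ) < k) ∨ a = d) → A a d = 0 := fun d hd => by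
    rw [← hA, delta, if_neg hd]
  simp only [delta, Matrix.mul_apply]
  by_cases h : ((a : ℕ) < k ∧ (b : ℕ) < k) ∨ a = b
  · rw [if_pos h]
    refine Finset.sum_congr rfl fun d _ => ?_
    by_cases hd : ((a : ℕ) < k ∧ (d : ℕ) < k) ∨ a = d
    · by_cases hdb : ((d : ℕ) < k ∧ (b : ℕ) < k) ∨ d = b
      · rw [if_pos hdb]
      · exfalso; omega
    · rw [hA' d hd]; simp
  · rw [if_neg h]
    symm
    refine Finset.sum_eq_zero fun d _ => ?_
    by_cases hd : ((a : ℕ) < k ∧ (d : ℕ) < k) ∨ a = d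
    · rw [if_neg (by omega), mul_zero]
    · rw [hA' d hd]; simp

theorem delta_mul_right {k : ℕ} {A : Mat n} (hA : delta k A = A) (X : Mat n) :
    delta k (X * A) = delta k X * A := by
  ext a b
  have hA' : ∀ d : Fin n, ¬(((d : ℕ) < k ∧ (b : ℕ) < k) ∨ d = b) → A d b = 0 := fun d hd => by
    rw [← hA, delta, if_neg hd]
  simp only [delta, Matrix.mul_apply]
  by_cases h : ((a : ℕ) < k ∧ (b : ℕ) < k) ∨ a = b
  · rw [if_pos h]
    refine Finset.sum_congr rfl fun d _ => ?_
    by_cases hd : ((d : ℕ) < k ∧ (b : ℕ) < k) ∨ d = b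
    · by_cases hdb : ((a : ℕ) < k ∧ (d : ℕ) < k) ∨ a = d
      · rw [if_pos hdb]
      · exfalso; omega
    · rw [hA' d hd]; simp
  · rw [if_neg h]
    symm
    refine Finset.sum_eq_zero fun d _ => ?_
    by_cases hd : ((d : ℕ) < k ∧ (b : ℕ) < k) ∨ d = b
    · rw [if_neg (by omega), zero_mul]
    · rw [hA' d hd]; simp

theorem delta_br {k : ℕ} {A : Mat n} (hA : delta k A = A) (X : Mat n) :
    delta k (br A X) = br A (delta k X) := by
  rw [br, br, delta_sub, delta_mul_left hA, delta_mul_right hA]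

theorem delta_lax (k : ℕ) (w h : Fin n → ℂ) (Y : Mat n) :
    delta k (lax k w h Y) = lax k w h Y := by
  ext a b
  simp only [delta]
  split_ifs with hab
  · rfl
  · simp only [not_or] at hab
    simp [lax, levelCoeff, hab.1, hab.2]

/-- The linear map `δ_k`. -/
noncomputable def deltaL (n k : ℕ) : Mat n →L[ℂ] Mat n :=
  LinearMap.toContinuousLinearMap
    { toFun := delta k, map_add' := delta_add k, map_smul' := fun c X => delta_smul k c X }

@[simp] theorem deltaL_apply (k : ℕ) (X : Mat n) : deltaL n k X = delta k X := rfl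

end Norms

/-! ### Comparison with the entrywise form of the isomonodromy equation -/

section Comparison

variable {n : ℕ}

theorem hasFDerivAt_of_entries {V : Type*} [NormedAddCommGroup V] [NormedSpace ℂ V]
    {f : V → Mat n} {f' : V →L[ℂ] Mat n} {x : V}
    (h : ∀ i j, HasFDerivAt (fun w => f w i j)
      ((LinearMap.toContinuousLinearMap (Matrix.entryLinearMap ℂ ℂ i j)).comp f') x) :
    HasFDerivAt f f' x := by
  have e : ∀ Y : Mat n, Y = ∑ i, ∑ j, Y i j • Matrix.single i j (1 : ℂ) := fun Y => by
    conv_lhs => rw [Matrix.matrix_eq_sum_single Y]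
    simp [Matrix.smul_single]
  have h1 : HasFDerivAt (fun w => ∑ i, ∑ j, f w i j • (Matrix.single i j (1 : ℂ) : Mat n)) _ x :=
    HasFDerivAt.fun_sum fun i _ => HasFDerivAt.fun_sum fun j _ =>
      (h i j).smul_const (Matrix.single i j (1 : ℂ) : Mat n)
  have h2 : (fun w => ∑ i, ∑ j, f w i j • (Matrix.single i j (1 : ℂ) : Mat n)) = f := by
    ext1 w; exact (e (f w)).symm
  rw [h2] at h1
  refine h1.congr_fderiv ?_
  ext1 v
  rw [e (f' v)]
  simp only [sum_apply, ContinuousLinearMap.smulRight_apply]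
  rfl

theorem HasFDerivAt.entry {V : Type*} [NormedAddCommGroup V] [NormedSpace ℂ V]
    {f : V → Mat n} {f' : V →L[ℂ] Mat n} {x : V} (h : HasFDerivAt f f' x) (i j : Fin n) :
    HasFDerivAt (fun w => f w i j)
      ((LinearMap.toContinuousLinearMap (Matrix.entryLinearMap ℂ ℂ i j)).comp f') x :=
  (LinearMap.toContinuousLinearMap (Matrix.entryLinearMap ℂ ℂ i j)).hasFDerivAt.comp x h

theorem hasDerivAt_update_apply (w : Fin n → ℂ) (k : Fin n) :
    HasDerivAt (fun t => Function.update w k t) (Pi.single k (1 : ℂ)) (w k) :=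
  hasDerivAt_update w k (w k)

theorem partialU_eq (w : Fin n → ℂ) (k : Fin n) :
    partialU w k = fderiv ℂ u w (Pi.single k 1) := by
  ext i
  have h1 : HasFDerivAt (u : (Fin n → ℂ) → Fin n → ℂ) (fderiv ℂ u w)
      (Function.update w k (w k)) := by
    rw [Function.update_eq_self]
    exact (contDiff_u.differentiable (by norm_num) w).hasFDerivAt
  have h2 := h1.comp_hasDerivAt (w k) (hasDerivAt_update_apply w k)
  exact (hasDerivAt_pi.1 h2 i).deriv

/-- On the level `n` the matrix `N` of the equation differs from `ad_u⁻¹ ad_p Y` by `s Y`, which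
commutes with `Y`. -/
theorem br_adInv_eq (x p : Fin n → ℂ) (s : ℂ) (Y : Mat n) :
    (⁅adInv x ⁅Matrix.diagonal p, Y⁆, Y⁆ : Mat n) = br (had (levelCoeff n x p s) Y) Y := by
  have e : adInv x ⁅Matrix.diagonal p, Y⁆ = had (levelCoeff n x p s) Y + s • Y := by
    ext a b
    simp only [adInv, Matrix.add_apply, had_apply, Matrix.smul_apply, levelCoeff, smul_eq_mul]
    by_cases hab : a = b
    · simp [hab]
    · simp only [if_neg hab, a.2, b.2, and_self, if_true, Ring.lie_def, Matrix.sub_apply,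
        Matrix.diagonal_mul, Matrix.mul_diagonal]
      ring
  rw [← br_eq_lie, e, br_add_left, br_smul_left, br_self, smul_zero, add_zero]

theorem levelRegular_u_eq : levelRegular u n = regular n := by
  ext w
  constructor
  · intro h a b hab
    by_contra hne
    exact h a b a.2 b.2 hne hab
  · intro h a b _ _ hne hab
    exact hne (h hab)

theorem IsSolutionOn.hasFDerivAt {Ω : Set (Fin n → ℂ)} {Φ : (Fin n → ℂ) → Mat n}
    (hΦ : IsSolutionOn Ω Φ) {w : Fin n → ℂ} (hw : w ∈ Ω) :
    HasFDerivAt Φ (iso n n w (Φ w)) w := by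
  refine hasFDerivAt_of_entries fun i j => ?_
  have hd : HasFDerivAt (fun w => Φ w i j) (fderiv ℂ (fun w => Φ w i j) w) w :=
    ((hΦ.differentiableOn i j).differentiableAt (hΦ.isOpen.mem_nhds hw)).hasFDerivAt
  refine hd.congr_fderiv (ContinuousLinearMap.coe_inj.1 (LinearMap.pi_ext' fun k => ?_))
  refine LinearMap.ext_ring ?_
  have hd' : HasFDerivAt (fun w => Φ w i j) (fderiv ℂ (fun w => Φ w i j) w)
      (Function.update w k (w k)) := by rwa [Function.update_eq_self]
  have h1 := hd'.comp_hasDerivAt (w k) (hasDerivAt_update_apply w k)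
  have h2 := h1.unique (hΦ.equation w hw k i j)
  rw [br_adInv_eq _ _ (levelSum n n (Pi.single k 1)), partialU_eq] at h2
  refine h2.trans ?_
  have h3 := iso_apply n w (Pi.single k 1) (Φ w)
  exact (congrFun (congrFun h3 i) j).symm

theorem isSolutionOn_of_hasFDerivAt {Ω : Set (Fin n → ℂ)} {Ψ : (Fin n → ℂ) → Mat n}
    (hΩ : IsOpen Ω) (hreg : Ω ⊆ levelRegular u n)
    (hΨ : ∀ w ∈ Ω, HasFDerivAt Ψ (iso n n w (Ψ w)) w) : IsSolutionOn Ω Ψ := by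
  refine ⟨hΩ, by rwa [← levelRegular_u_eq], fun i j w hw => ?_, fun w hw k i j => ?_⟩
  · exact (HasFDerivAt.entry (hΨ w hw) i j).differentiableAt.differentiableWithinAt
  · have h1 := HasFDerivAt.entry (hΨ w hw) i j
    have h1' : HasFDerivAt (fun w => Ψ w i j)
      ((LinearMap.toContinuousLinearMap (Matrix.entryLinearMap ℂ ℂ i j)).comp (iso n n w (Ψ w)))
      (Function.update w k (w k)) := by rwa [Function.update_eq_self]
    have h2 := h1'.comp_hasDerivAt (w k) (hasDerivAt_update_apply w k)
    rw [br_adInv_eq _ _ (levelSum n n (Pi.single k 1)), partialU_eq]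
    refine h2.congr_deriv ?_
    have h3 := iso_apply n w (Pi.single k 1) (Ψ w)
    exact congrFun (congrFun h3 i) j

end Comparison

/-! ### Skew-Hermitian solutions over the reals -/

section SkewHermitian

variable {n : ℕ}

theorem norm_sq_eq_trace (Y : Mat n) : ‖Y‖ ^ 2 = (Matrix.trace (Yᴴ * Y)).re := by
  rw [Matrix.frobenius_norm_def, ← Real.sqrt_eq_rpow, Real.sq_sqrt (by positivity)]
  simp only [Matrix.trace, Matrix.diag_apply, Matrix.mul_apply, Matrix.conjTranspose_apply,
    Complex.re_sum, Real.rpow_two]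
  rw [Finset.sum_comm]
  refine Finset.sum_congr rfl fun i _ => Finset.sum_congr rfl fun j _ => ?_
  rw [Complex.star_def, ← Complex.normSq_eq_conj_mul_self, Complex.ofReal_re,
    Complex.normSq_eq_norm_sq]

/-- `Re tr (gᴴ [N, g])` is half the derivative of `‖g‖²` under `g' = [N, g]`. -/
theorem trace_conjTranspose_mul_br_re {N : Mat n} (hN : Nᴴ = -N) (g : Mat n) :
    (Matrix.trace (gᴴ * br N g)).re = 0 := by
  have h : ∀ X : Mat n, Xᴴ = -X → (Matrix.trace X).re = 0 := by
    intro X hX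
    have h1 := Matrix.trace_conjTranspose X
    rw [hX, Matrix.trace_neg] at h1
    have h2 := congrArg Complex.re h1
    simp at h2
    linarith
  have e : Matrix.trace (gᴴ * br N g) = Matrix.trace (gᴴ * N * g) - Matrix.trace (g * N * gᴴ) := by
    rw [br, mul_sub, Matrix.trace_sub, mul_assoc gᴴ N g, Matrix.trace_mul_comm gᴴ (g * N)]
  rw [e, Complex.sub_re, h _ (by simp [Matrix.conjTranspose_mul, hN, mul_assoc]),
    h _ (by simp [Matrix.conjTranspose_mul, hN, mul_assoc]), sub_zero]

/-- The real linear map `Y ↦ Yᴴ`. -/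
noncomputable def conjTransposeL (n : ℕ) : Mat n →L[ℝ] Mat n :=
  LinearMap.toContinuousLinearMap
    { toFun := Matrix.conjTranspose
      map_add' := Matrix.conjTranspose_add
      map_smul' := fun c X => by
        ext a b
        simp [Matrix.conjTranspose_apply, Matrix.smul_apply] }

theorem conjTransposeL_apply (Y : Mat n) : conjTransposeL n Y = Yᴴ := rfl

/-- The real linear map `Y ↦ Re (tr Y)`. -/
noncomputable def reTraceL (n : ℕ) : Mat n →L[ℝ] ℝ :=
  LinearMap.toContinuousLinearMap
    { toFun := fun Y => (Matrix.trace Y).re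
      map_add' := fun X Y => by simp [Matrix.trace_add]
      map_smul' := fun c X => by simp [Matrix.trace_smul] }

theorem reTraceL_apply (Y : Mat n) : reTraceL n Y = (Matrix.trace Y).re := rfl

/-- An equation `y' = [N, y]` with skew-Hermitian `N` preserves the Frobenius norm. -/
theorem norm_eq_of_deriv_br {y N : ℝ → Mat n} {a b : ℝ}
    (hy : ∀ t ∈ Icc a b, HasDerivWithinAt y (br (N t) (y t)) (Icc a b) t)
    (hN : ∀ t ∈ Icc a b, (N t)ᴴ = -N t) : ∀ t ∈ Icc a b, ‖y t‖ = ‖y a‖ := by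
  intro t ht
  -- `‖y‖² = Re tr (yᴴ y)` has derivative zero
  have hq : ∀ t ∈ Icc a b, HasDerivWithinAt (fun t => ‖y t‖ ^ 2) 0 (Icc a b) t := by
    intro t ht
    have h1 : HasDerivWithinAt (fun t => conjTransposeL n (y t))
        (conjTransposeL n (br (N t) (y t))) (Icc a b) t :=
      (conjTransposeL n).hasFDerivAt.comp_hasDerivWithinAt t (hy t ht)
    have h2 : HasDerivWithinAt (fun t => reTraceL n (conjTransposeL n (y t) * y t)) _ (Icc a b) t :=
      (reTraceL n).hasFDerivAt.comp_hasDerivWithinAt t (h1.fun_mul (hy t ht))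
    have h3 : (fun t => reTraceL n (conjTransposeL n (y t) * y t)) = fun t => ‖y t‖ ^ 2 := by
      ext1 t; rw [norm_sq_eq_trace]; rfl
    rw [h3] at h2
    refine h2.congr_deriv ?_
    rw [map_add, reTraceL_apply, reTraceL_apply, conjTransposeL_apply, conjTransposeL_apply,
      trace_conjTranspose_mul_br_re (hN t ht), add_zero]
    have := trace_conjTranspose_mul_br_re (hN t ht) (y t)
    have e : (br (N t) (y t))ᴴ * y t = ((y t)ᴴ * br (N t) (y t))ᴴ := by
      rw [Matrix.conjTranspose_mul, Matrix.conjTranspose_conjTranspose]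
    rw [e, Matrix.trace_conjTranspose, Complex.star_def, Complex.conj_re, this]
  have hc := constant_of_derivWithin_zero
    (fun t ht => (hq t ht).differentiableWithinAt)
    (fun t ht => (hq t (Ico_subset_Icc_self ht)).derivWithin
      (uniqueDiffOn_Icc (ht.1.trans_lt ht.2) t (Ico_subset_Icc_self ht))) t ht
  exact (pow_left_inj₀ (norm_nonneg _) (norm_nonneg _) two_ne_zero).1 hc

theorem conjTranspose_had {c : Fin n → Fin n → ℂ} (hsymm : ∀ a b, c a b = c b a)
    (hreal : ∀ a b, (c a b).im = 0) {Y : Mat n} (hY : Yᴴ = -Y) : (had c Y)ᴴ = -had c Y := by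
  ext a b
  have h := congrFun (congrFun hY a) b
  rw [Matrix.conjTranspose_apply, Matrix.neg_apply] at h
  rw [Matrix.conjTranspose_apply, Matrix.neg_apply, had_apply, had_apply, star_mul', h, hsymm b a,
    Complex.star_def, Complex.conj_eq_iff_im.2 (hreal a b)]
  ring

theorem conjTranspose_br {X Y : Mat n} (hX : Xᴴ = -X) (hY : Yᴴ = -Y) : (br X Y)ᴴ = -br X Y := by
  rw [br, Matrix.conjTranspose_sub, Matrix.conjTranspose_mul, Matrix.conjTranspose_mul, hX, hY]
  simp

theorem had_sub (c : Fin n → Fin n → ℂ) (X Y : Mat n) : had c (X - Y) = had c X - had c Y := by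
  ext a b; simp; ring

theorem br_had_sub (c : Fin n → Fin n → ℂ) (X Y : Mat n) :
    br (had c X) X - br (had c Y) Y = br (had c (X - Y)) X + br (had c Y) (X - Y) := by
  rw [had_sub, br_sub_left, br_sub_right]; abel

theorem continuousOn_had {s : Set ℝ} {c : ℝ → Fin n → Fin n → ℂ}
    (hc : ∀ a b, ContinuousOn (fun t => c t a b) s) (Y : Mat n) :
    ContinuousOn (fun t => had (c t) Y) s := by
  simp only [had_eq_sum]
  exact continuousOn_finsetSum _ fun a _ => continuousOn_finsetSum _ fun b _ =>
    (hc a b).smul continuousOn_const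

/-- With real symmetric coefficients, the equation `y' = [c ∘ y, y]` has global skew-Hermitian
solutions, as the norm is preserved. -/
theorem exists_skew_solution {c : ℝ → Fin n → Fin n → ℂ}
    (hc : ∀ a b, ContinuousOn (fun t => c t a b) (Icc 0 1))
    (hsymm : ∀ t ∈ Icc (0 : ℝ) 1, ∀ a b, c t a b = c t b a)
    (hreal : ∀ t ∈ Icc (0 : ℝ) 1, ∀ a b, (c t a b).im = 0) {y₀ : Mat n} (hy₀ : y₀ᴴ = -y₀) :
    ∃ y : ℝ → Mat n, y 0 = y₀ ∧
      (∀ t ∈ Icc (0 : ℝ) 1, HasDerivWithinAt y (br (had (c t) (y t)) (y t)) (Icc 0 1) t) ∧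
      ∀ t ∈ Icc (0 : ℝ) 1, (y t)ᴴ = -y t := by
  obtain ⟨B, hB⟩ : ∃ B : ℝ, ∀ t ∈ Icc (0 : ℝ) 1, ‖c t‖ ≤ B :=
    isCompact_Icc.exists_bound_of_continuousOn
      (continuousOn_pi.2 fun a => continuousOn_pi.2 fun b => hc a b)
  have hB0 : 0 ≤ B := (norm_nonneg _).trans (hB 0 (by simp))
  have hcB : ∀ t ∈ Icc (0 : ℝ) 1, ∀ a b, ‖c t a b‖ ≤ B := fun t ht a b =>
    (norm_le_pi_norm (c t a) b).trans ((norm_le_pi_norm (c t) a).trans (hB t ht))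
  set R := ‖y₀‖ + 1 with hR
  have hR0 : 0 < R := by positivity
  -- projection to skew-Hermitian matrices followed by truncation
  set ρ : Mat n → Mat n := fun y => radialRetraction R ((1 / 2 : ℝ) • (y - yᴴ)) with hρ
  have hρR : ∀ y, ‖ρ y‖ ≤ R := fun y => norm_radialRetraction_le hR0 _
  have hρlip : ∀ x y, ‖ρ x - ρ y‖ ≤ 2 * ‖x - y‖ := by
    intro x y
    refine (norm_radialRetraction_sub_le hR0 _ _).trans ?_
    have e : (1 / 2 : ℝ) • (x - xᴴ) - (1 / 2 : ℝ) • (y - yᴴ) =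
        (1 / 2 : ℝ) • ((x - y) - (x - y)ᴴ) := by
      rw [Matrix.conjTranspose_sub, ← smul_sub]; congr 1; abel
    have h1 : ‖(x - y) - (x - y)ᴴ‖ ≤ ‖x - y‖ + ‖x - y‖ := by
      refine (norm_sub_le _ _).trans ?_
      rw [Matrix.frobenius_norm_conjTranspose]
    rw [e, norm_smul, Real.norm_of_nonneg (by norm_num)]
    linarith
  have hρskew : ∀ y, (ρ y)ᴴ = -ρ y := by
    intro y
    have : ∀ (r : ℝ) (X : Mat n), (r • X)ᴴ = r • Xᴴ := fun r X => by
      ext a b; simp [Matrix.conjTranspose_apply]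
    simp only [hρ, radialRetraction, this, Matrix.conjTranspose_sub,
      Matrix.conjTranspose_conjTranspose]
    rw [← smul_neg, ← smul_neg, neg_sub]
  obtain ⟨y, hy0, hy⟩ := exists_solution_of_lipschitz_of_bounded
    (v := fun t y => br (had (c t) (ρ y)) (ρ y)) (K := 8 * B * R) (B := 2 * (B * R) * R)
    (by positivity) (by positivity)
    (fun t ht x y => by
      rw [br_had_sub]
      have h1 := norm_br_le (had (c t) (ρ x - ρ y)) (ρ x)
      have h2 := norm_br_le (had (c t) (ρ y)) (ρ x - ρ y)
      have h3 := norm_had_le (hcB t ht) hB0 (ρ x - ρ y)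
      have h4 := norm_had_le (hcB t ht) hB0 (ρ y)
      calc _ ≤ _ := norm_add_le _ _
        _ ≤ 2 * (B * ‖ρ x - ρ y‖) * R + 2 * (B * R) * ‖ρ x - ρ y‖ := by
            refine add_le_add (h1.trans ?_) (h2.trans ?_)
            · gcongr; exact hρR x
            · gcongr; exact h4.trans (by gcongr; exact hρR y)
        _ = 4 * B * R * ‖ρ x - ρ y‖ := by ring
        _ ≤ 4 * B * R * (2 * ‖x - y‖) := by gcongr; exact hρlip x y
        _ = _ := by ring)
    (fun x => by
      have h := continuousOn_had hc (ρ x)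
      exact (h.mul continuousOn_const).sub (continuousOn_const.mul h))
    (fun t ht x => by
      refine (norm_br_le _ _).trans ?_
      have h4 := norm_had_le (hcB t ht) hB0 (ρ x)
      gcongr
      · exact h4.trans (by gcongr; exact hρR x)
      · exact hρR x) y₀
  -- the right-hand side of the modified equation is skew-Hermitian, hence so is `y`
  have hskew : ∀ t ∈ Icc (0 : ℝ) 1, (y t)ᴴ = -y t := by
    have hz : ∀ t ∈ Icc (0 : ℝ) 1,
        HasDerivWithinAt (fun t => conjTransposeL n (y t) + y t) 0 (Icc 0 1) t := by
      intro t ht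
      have h1 := ((conjTransposeL n).hasFDerivAt.comp_hasDerivWithinAt t (hy t ht)).add (hy t ht)
      refine h1.congr_deriv ?_
      rw [conjTransposeL_apply, conjTranspose_br
        (conjTranspose_had (hsymm t ht) (hreal t ht) (hρskew _)) (hρskew _), neg_add_cancel]
    intro t ht
    have := norm_le_of_deriv_Icc (K := 0) (ε := 0) (δ := 0) le_rfl le_rfl hz
      (by rw [hy0, conjTransposeL_apply, hy₀]; simp) (fun t _ => by simp) t ht
    rw [zero_add, zero_mul, norm_le_zero_iff, conjTransposeL_apply] at this
    exact eq_neg_of_add_eq_zero_left this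
  have hρy : ∀ t ∈ Icc (0 : ℝ) 1, ρ (y t) = radialRetraction R (y t) := by
    intro t ht
    simp only [hρ]
    rw [hskew t ht, sub_neg_eq_add, ← two_smul ℝ (y t), smul_smul]
    norm_num
  -- the modified equation still has the form `y' = [N, y]`, hence the truncation is not active
  have hnorm : ∀ t ∈ Icc (0 : ℝ) 1, ‖y t‖ = ‖y 0‖ := by
    refine norm_eq_of_deriv_br
      (N := fun t => (R / max R ‖y t‖) • had (c t) (ρ (y t))) (fun t ht => ?_) (fun t ht => ?_)
    · refine (hy t ht).congr_deriv ?_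
      set r : ℝ := R / max R ‖y t‖
      have hr : ρ (y t) = r • y t := hρy t ht
      generalize had (c t) (ρ (y t)) = T
      rw [hr]
      simp only [br]
      rw [smul_mul_assoc, mul_smul_comm, smul_mul_assoc, mul_smul_comm]
    · have h := conjTranspose_had (hsymm t ht) (hreal t ht) (hρskew (y t))
      have : ∀ (r : ℝ) (X : Mat n), (r • X)ᴴ = r • Xᴴ := fun r X => by
        ext a b; simp [Matrix.conjTranspose_apply]
      rw [this, h, smul_neg]
  refine ⟨y, hy0, fun t ht => ?_, hskew⟩
  have h1 := hy t ht
  rwa [hρy t ht, radialRetraction_of_norm_le hR0 (by rw [hnorm t ht, hy0, hR]; linarith)] at h1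

end SkewHermitian

/-! ### Continuation over the real component -/

section Component

variable {n : ℕ}

theorem u_im_eq_zero {w : Fin n → ℂ} (hw : IsRealPoint w) (i : Fin n) : (u w i).im = 0 := by
  have he : ∀ j, Complex.exp (w j) ∈ Complex.ofRealHom.fieldRange.toSubring := by
    intro j
    obtain ⟨m, hm⟩ := hw j
    have h : (Complex.exp (w j)).im = 0 := by
      rw [Complex.exp_im, hm, Real.sin_int_mul_pi, mul_zero]
    exact ⟨(Complex.exp (w j)).re, Complex.ext (by simp) (by simp [h])⟩
  have h : u w i ∈ Complex.ofRealHom.fieldRange.toSubring :=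
    sum_mem fun l _ => prod_mem fun j _ => he j
  obtain ⟨r, hr⟩ := h
  rw [← hr]
  exact Complex.ofReal_im r

theorem isRealPoint_of_mem_realComponent {w₀ w : Fin n → ℂ} (hreal : IsRealPoint w₀)
    (hw : w ∈ realComponent w₀) : IsRealPoint w := fun k => by
  rw [hw.1 k]; exact hreal k

theorem self_mem_realComponent (w₀ : Fin n → ℂ) : w₀ ∈ realComponent w₀ :=
  ⟨fun _ => rfl, fun _ _ => Iff.rfl⟩

theorem re_u_ne {w : Fin n → ℂ} (hw : IsRealPoint w) (hr : w ∈ levelRegular u n) {a b : Fin n}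
    (hab : a ≠ b) : (u w a).re ≠ (u w b).re := fun h =>
  hr a b a.2 b.2 hab (Complex.ext h (by rw [u_im_eq_zero hw, u_im_eq_zero hw]))

theorem levelCoeff_im {k : ℕ} {x p : Fin n → ℂ} {s : ℂ} (hx : ∀ a : Fin n, (x a).im = 0)
    (hp : ∀ a : Fin n, (p a).im = 0) (hs : s.im = 0) (a b : Fin n) :
    (levelCoeff k x p s a b).im = 0 := by
  obtain ⟨x, rfl⟩ : ∃ r : Fin n → ℝ, x = fun a => (r a : ℂ) :=
    ⟨fun a => (x a).re, by ext a; exact Complex.ext rfl (hx a)⟩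
  obtain ⟨p, rfl⟩ : ∃ r : Fin n → ℝ, p = fun a => (r a : ℂ) :=
    ⟨fun a => (p a).re, by ext a; exact Complex.ext rfl (hp a)⟩
  obtain ⟨s, rfl⟩ : ∃ r : ℝ, s = (r : ℂ) := ⟨s.re, Complex.ext rfl hs⟩
  simp only [levelCoeff]
  split_ifs
  · simp
  · norm_cast
  · simp

/-- In the coordinates `u` the real component is a convex cone, so that segments issuing from
`u w₀` reach all of it. -/
theorem segment_re_ne {w₀ w : Fin n → ℂ} (hreal : IsRealPoint w₀)
    (hr : w₀ ∈ levelRegular u n) (hw : w ∈ realComponent w₀) {t : ℝ} (ht : t ∈ Icc (0 : ℝ) 1)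
    {a b : Fin n} (hab : a ≠ b) :
    (u w₀ + t • (u w - u w₀)) a ≠ (u w₀ + t • (u w - u w₀)) b := by
  have key : ∀ a b, (u w₀ a).re < (u w₀ b).re →
      ((u w₀ + t • (u w - u w₀)) a).re < ((u w₀ + t • (u w - u w₀)) b).re := by
    intro a b h
    have h' := (hw.2 a b).2 h
    have e : ∀ a, ((u w₀ + t • (u w - u w₀)) a).re = (1 - t) * (u w₀ a).re + t * (u w a).re := by
      intro a; simp; ring
    rw [e, e]
    rcases ht.1.eq_or_lt with rfl | h0
    · simpa using h
    · have h1 : (1 - t) * (u w₀ a).re ≤ (1 - t) * (u w₀ b).re :=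
        mul_le_mul_of_nonneg_left h.le (by linarith [ht.2])
      have h2 : t * (u w a).re < t * (u w b).re := mul_lt_mul_of_pos_left h' h0
      linarith
  intro h
  rcases lt_or_gt_of_ne (re_u_ne hreal hr hab) with h1 | h1
  · exact (key a b h1).ne (by rw [h])
  · exact (key b a h1).ne (by rw [h])

/-- The equation of level `n` is pulled back from an equation in the coordinates `u`. -/
theorem iso_n_eq_comp (w : Fin n → ℂ) (Y : Mat n) :
    iso n n w Y = (conn (levelForm (fun x => x) 0 n) (u w) Y).comp (fderiv ℂ u w) := by
  ext1 h
  rw [iso_apply, lax, ContinuousLinearMap.comp_apply, conn_apply,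
    levelForm_apply 0 (contDiff_fun_id), fderiv_fun_id]
  have e : had (levelCoeff n (u w) (fderiv ℂ u w h) (levelSum n n h)) Y =
      had (levelCoeff n (u w) (fderiv ℂ u w h) 0) Y - levelSum n n h • Y := by
    ext a b
    simp only [had_apply, Matrix.sub_apply, Matrix.smul_apply, smul_eq_mul, levelCoeff, a.2, b.2,
      and_self, if_true]
    split_ifs <;> ring
  rw [e, br_sub_left, br_smul_left, br_self, smul_zero, sub_zero]
  simp

/-- A solution that is skew-Hermitian at a real point continues over the real component. -/
theorem exists_solution_near_component {Ω : Set (Fin n → ℂ)} {Φ : (Fin n → ℂ) → Mat n}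
    (hΦ : IsSolutionOn Ω Φ) {w₀ : Fin n → ℂ} (hw₀ : w₀ ∈ Ω) (hreal : IsRealPoint w₀)
    (hskew : (Φ w₀)ᴴ = -Φ w₀) :
    ∃ (Ω₁ : Set (Fin n → ℂ)) (Ψ : (Fin n → ℂ) → Mat n), IsOpen Ω₁ ∧ Ω₁ ⊆ levelRegular u n ∧
      (∀ w ∈ Ω₁, HasFDerivAt Ψ (iso n n w (Ψ w)) w) ∧ realComponent w₀ ⊆ Ω₁ ∧ Ψ =ᶠ[𝓝 w₀] Φ ∧
      ∀ w ∈ realComponent w₀, (Ψ w)ᴴ = -Ψ w := by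
  have hr : w₀ ∈ levelRegular u n := by rw [levelRegular_u_eq]; exact hΦ.subset_regular hw₀
  set F := conn (levelForm (fun x : Fin n → ℂ => x) 0 n) with hF
  set V := levelRegular (fun x : Fin n → ℂ => x) n with hV
  have hflat : IsFlat V F := isFlat_level 0 contDiff_fun_id n
  set D := segDomain V F (u w₀) (Φ w₀) with hD
  set Ψ : (Fin n → ℂ) → Mat n := fun w => segValue V F (u w₀) (Φ w₀) (u w) with hΨdef
  -- in the coordinates `u` the equation is solved along the segments issuing from `u w₀`; the
  -- coefficients are real and symmetric there
  have hseg : ∀ w ∈ realComponent w₀, ∃ y, IsSegSol V F (u w₀) (u w) y ∧ y 0 = Φ w₀ ∧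
      ∀ t ∈ Icc (0 : ℝ) 1, (y t)ᴴ = -y t := by
    intro w hw
    have him : ∀ (t : ℝ) a, ((u w₀ + t • (u w - u w₀)) a).im = 0 := fun t a => by
      simp [u_im_eq_zero hreal, u_im_eq_zero (isRealPoint_of_mem_realComponent hreal hw)]
    have him' : ∀ a, ((u w - u w₀) a).im = 0 := fun a => by
      simp [u_im_eq_zero hreal, u_im_eq_zero (isRealPoint_of_mem_realComponent hreal hw)]
    obtain ⟨y, hy0, hy, hys⟩ := exists_skew_solution
      (c := fun t => levelCoeff n (u w₀ + t • (u w - u w₀)) (u w - u w₀) 0)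
      (fun a b t ht => by
        by_cases hab : a = b
        · simpa [levelCoeff, hab] using continuousWithinAt_const
        · simp only [levelCoeff, if_neg hab, a.2, b.2, and_self, if_true]
          have hc : Continuous fun t : ℝ =>
              (u w₀ + t • (u w - u w₀)) a - (u w₀ + t • (u w - u w₀)) b := by
            simp only [Pi.add_apply, Pi.smul_apply]; fun_prop
          exact ((continuousWithinAt_const.div hc.continuousWithinAt
            (sub_ne_zero.2 (segment_re_ne hreal hr hw ht hab))).sub continuousWithinAt_const))
      (fun t _ a b => levelCoeff_symm _ _ _ _ _ _)
      (fun t _ a b => levelCoeff_im (him t) him' rfl a b) hskew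
    refine ⟨y, ⟨fun t ht a b _ _ hab => segment_re_ne hreal hr hw ht hab, fun t ht => ?_⟩, hy0, hys⟩
    refine (hy t ht).congr_deriv ?_
    rw [hF, conn_apply, levelForm_apply 0 contDiff_fun_id, fderiv_fun_id]
    rfl
  have hcomp : realComponent w₀ ⊆ u ⁻¹' D := fun w hw => by
    obtain ⟨y, hy, hy0, -⟩ := hseg w hw
    exact ⟨y, hy, hy0⟩
  have hDo : IsOpen (u ⁻¹' D) := (isOpen_segDomain hflat _ _).preimage contDiff_u.continuous
  have hDreg : u ⁻¹' D ⊆ levelRegular u n := fun w hw => (segDomain_subset hw : u w ∈ V)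
  have hderiv : ∀ w ∈ u ⁻¹' D, HasFDerivAt Ψ (iso n n w (Ψ w)) w := fun w hw => by
    rw [iso_n_eq_comp]
    exact (hasFDerivAt_segValue hflat hw).comp w
      (contDiff_u.differentiable (by norm_num) w).hasFDerivAt
  refine ⟨u ⁻¹' D, Ψ, hDo, hDreg, hderiv, hcomp, ?_, fun w hw => ?_⟩
  -- both functions solve the same equation along the segments issuing from `w₀` in a ball
  · have hm : ∀ᶠ w in 𝓝 w₀, w ∈ u ⁻¹' D ∧ w ∈ Ω :=
      (hDo.eventually_mem (hcomp (self_mem_realComponent w₀))).and (hΦ.isOpen.eventually_mem hw₀)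
    obtain ⟨r, hr0, hball⟩ := Metric.eventually_nhds_iff_ball.1 hm
    filter_upwards [Metric.ball_mem_nhds _ hr0] with w hw
    have hconv : ∀ t ∈ Icc (0 : ℝ) 1, w₀ + t • (w - w₀) ∈ Metric.ball w₀ r := fun t ht =>
      (convex_ball _ _).add_smul_sub_mem (Metric.mem_ball_self hr0) hw ht
    have hball' : Metric.ball w₀ r ⊆ levelRegular u n := fun w hw => hDreg (hball w hw).1
    have s1 := isSegSol_of_hasFDerivAt hball' (fun w hw => hderiv w (hball w hw).1) hconv
    have s2 := isSegSol_of_hasFDerivAt hball' (fun w hw => hΦ.hasFDerivAt (hball w hw).2) hconv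
    have h0 : Ψ w₀ = Φ w₀ := (segValue_self hflat (U := V)
      (fun a b ha hb hab => hr a b ha hb hab) (Φ w₀)).2
    have := s1.eqOn (isFlat_iso n) s2 (by simpa using h0)
      (show (1 : ℝ) ∈ Icc (0 : ℝ) 1 by simp)
    simpa using this
  · obtain ⟨y, hy, hy0, hys⟩ := hseg w hw
    have : Ψ w = y 1 := by rw [← hy.segValue_eq hflat, hy0]
    rw [this]
    exact hys 1 (by simp)

end Component

/-! ### Matrix exponentials and the operators `z ^ {ad A}` -/

section Exponential

variable {n : ℕ}

/-- The exponential of a matrix. -/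
noncomputable def ex (X : Mat n) : Mat n := NormedSpace.exp X

theorem powAd_eq_ex (s : ℂ) (A X : Mat n) : powAd s A X = ex (s • A) * X * ex (-(s • A)) := rfl

@[simp] theorem ex_zero : ex (0 : Mat n) = 1 := NormedSpace.exp_zero

theorem ex_add {X Y : Mat n} (h : Commute X Y) : ex (X + Y) = ex X * ex Y :=
  NormedSpace.exp_add_of_commute h

@[simp] theorem ex_neg_mul (X : Mat n) : ex (-X) * ex X = 1 := by
  rw [← ex_add (Commute.neg_left (Commute.refl X)), neg_add_cancel, ex_zero]

@[simp] theorem ex_mul_neg (X : Mat n) : ex X * ex (-X) = 1 := by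
  rw [← ex_add (Commute.neg_right (Commute.refl X)), add_neg_cancel, ex_zero]

theorem ex_conj {g g' : Mat n} (h : g * g' = 1) (X : Mat n) : ex (g * X * g') = g * ex X * g' :=
  NormedSpace.exp_units_conj (⟨g, g', h, mul_eq_one_comm.1 h⟩ : (Mat n)ˣ) X

theorem commute_ex {X Y : Mat n} (h : Commute X Y) : Commute X (ex Y) :=
  Commute.exp_right h

theorem hasFDerivAt_ex (X : Mat n) : HasFDerivAt ex (fderiv ℂ ex X) X :=
  (NormedSpace.exp_analytic (𝕂 := ℂ) X).differentiableAt.hasFDerivAt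

theorem continuous_ex : Continuous (ex : Mat n → Mat n) :=
  continuous_iff_continuousAt.2 fun X => (hasFDerivAt_ex X).continuousAt

theorem hasDerivAt_ex_smul (A : Mat n) (s : ℂ) :
    HasDerivAt (fun s : ℂ => ex (s • A)) (A * ex (s • A)) s := by
  have h : HasDerivAt (fun s : ℂ => ex (s • A)) (ex (s • A) * A) s := hasDerivAt_exp_smul_const A s
  rwa [← (commute_ex ((Commute.refl A).smul_right s)).eq] at h

/-- In a commuting direction the exponential has the derivative of the scalar exponential. -/
theorem fderiv_ex_of_commute {A X : Mat n} (h : Commute A X) :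
    fderiv ℂ ex X A = A * ex X := by
  have h1 : HasDerivAt (fun t : ℂ => X + t • A) A 0 := by
    simpa using ((hasDerivAt_id (0 : ℂ)).smul_const A).const_add X
  have h0 : HasFDerivAt ex (fderiv ℂ ex X) (X + (0 : ℂ) • A) := by simpa using hasFDerivAt_ex X
  have h2 := h0.comp_hasDerivAt (0 : ℂ) h1
  have h3 : HasDerivAt (fun t : ℂ => ex X * ex (t • A)) (ex X * (A * ex ((0 : ℂ) • A))) 0 :=
    (hasDerivAt_ex_smul A 0).const_mul _
  have h4 : (ex ∘ fun t : ℂ => X + t • A) = fun t : ℂ => ex X * ex (t • A) := by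
    ext1 t
    exact ex_add (h.symm.smul_right t)
  rw [h4] at h2
  rw [h2.unique h3, zero_smul, ex_zero, mul_one, (commute_ex h).eq]

/-- The exponential is equivariant under conjugation, so that its derivative commutes with inner
derivations. -/
theorem fderiv_ex_br (P X : Mat n) : fderiv ℂ ex X (br P X) = br P (ex X) := by
  have hc : ∀ Y : Mat n, HasDerivAt (fun t : ℂ => ex (t • P) * Y * ex (t • (-P))) (br P Y) 0 := by
    intro Y
    have := ((hasDerivAt_ex_smul P 0).mul_const Y).mul (hasDerivAt_ex_smul (-P) 0)
    refine this.congr_deriv ?_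
    simp [br, sub_eq_add_neg]
  have h0 : HasFDerivAt ex (fderiv ℂ ex X)
      ((fun t : ℂ => ex (t • P) * X * ex (t • (-P))) 0) := by simpa using hasFDerivAt_ex X
  have h2 := h0.comp_hasDerivAt (0 : ℂ) (hc X)
  have h3 : (ex ∘ fun t : ℂ => ex (t • P) * X * ex (t • (-P))) =
      fun t : ℂ => ex (t • P) * ex X * ex (t • (-P)) := by
    ext1 t
    exact ex_conj (by rw [smul_neg, ex_mul_neg]) X
  rw [h3] at h2
  exact h2.unique (hc (ex X))

theorem fderiv_ex_smul (P A : Mat n) (s s' : ℂ) :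
    fderiv ℂ ex (s • A) (s' • A + s • br P A) =
      s' • (A * ex (s • A)) + br P (ex (s • A)) := by
  rw [map_add, map_smul, fderiv_ex_of_commute ((Commute.refl A).smul_right s), ← br_smul_right,
    fderiv_ex_br]

theorem fderiv_ex_neg_smul (P A : Mat n) (s s' : ℂ) :
    fderiv ℂ ex (-(s • A)) (-(s' • A + s • br P A)) =
      -(s' • (ex (-(s • A)) * A)) + br P (ex (-(s • A))) := by
  have h := fderiv_ex_smul P A (-s) (-s')
  have hc : Commute A (ex (-(s • A))) := commute_ex (((Commute.refl A).smul_right s).neg_right)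
  rw [← hc.eq, ← neg_smul, neg_add, ← neg_smul, ← neg_smul, ← neg_smul]
  exact h

/-- The derivative of `E Y E⁻¹` with `E = exp (s A)`, when `A' = [P, A]`. -/
theorem deriv_powAd_identity {A E E' : Mat n} (hA : Commute A E') (P Y Y' : Mat n) (s' : ℂ) :
    ((s' • (A * E) + br P E) * Y + E * Y') * E' + E * Y * (-(s' • (E' * A)) + br P E') =
      s' • br A (E * Y * E') + br P (E * Y * E') + E * (Y' - br P Y) * E' := by
  rw [← hA.eq]
  simp only [br, mul_sub, sub_mul, add_mul, mul_add, smul_mul_assoc, mul_smul_comm, mul_neg,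
    smul_sub, ← mul_assoc]
  rw [mul_assoc (E * Y) E' A, ← hA.eq, ← mul_assoc]
  abel

theorem powAd_add_right (s : ℂ) (A X Y : Mat n) :
    powAd s A (X + Y) = powAd s A X + powAd s A Y := by
  simp only [powAd_eq_ex, mul_add, add_mul]

theorem powAd_sub_right (s : ℂ) (A X Y : Mat n) :
    powAd s A (X - Y) = powAd s A X - powAd s A Y := by
  simp only [powAd_eq_ex, mul_sub, sub_mul]

theorem powAd_smul_right (s c : ℂ) (A X : Mat n) : powAd s A (c • X) = c • powAd s A X := by
  simp only [powAd_eq_ex, mul_smul_comm, smul_mul_assoc]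

theorem powAd_mul (s : ℂ) (A X Y : Mat n) :
    powAd s A (X * Y) = powAd s A X * powAd s A Y := by
  simp only [powAd_eq_ex]
  calc _ = ex (s • A) * X * 1 * Y * ex (-(s • A)) := by rw [mul_one]; simp only [mul_assoc]
    _ = _ := by rw [← ex_neg_mul (s • A)]; simp only [mul_assoc]

theorem powAd_br (s : ℂ) (A X Y : Mat n) :
    powAd s A (br X Y) = br (powAd s A X) (powAd s A Y) := by
  rw [br, br, powAd_sub_right, powAd_mul, powAd_mul]

theorem ex_add_smul (s t : ℂ) (A : Mat n) : ex ((s + t) • A) = ex (s • A) * ex (t • A) := by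
  rw [add_smul, ex_add (((Commute.refl A).smul_left s).smul_right t)]

theorem powAd_powAd (s t : ℂ) (A X : Mat n) : powAd s A (powAd t A X) = powAd (s + t) A X := by
  simp only [powAd_eq_ex, ← neg_smul]
  rw [ex_add_smul, neg_add_rev, ex_add_smul]
  simp only [mul_assoc]

@[simp] theorem powAd_zero (A X : Mat n) : powAd 0 A X = X := by
  simp [powAd_eq_ex]

theorem powAd_neg_powAd (s : ℂ) (A X : Mat n) : powAd (-s) A (powAd s A X) = X := by
  rw [powAd_powAd, neg_add_cancel, powAd_zero]

theorem powAd_powAd_neg (s : ℂ) (A X : Mat n) : powAd s A (powAd (-s) A X) = X := by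
  rw [powAd_powAd, add_neg_cancel, powAd_zero]

theorem powAd_of_commute {A X : Mat n} (h : Commute A X) (s : ℂ) : powAd s A X = X := by
  rw [powAd_eq_ex, ← (commute_ex (h.symm.smul_right s)).eq, mul_assoc, ex_mul_neg, mul_one]

theorem powAd_self (s : ℂ) (A : Mat n) : powAd s A A = A := powAd_of_commute (Commute.refl A) s

theorem norm_powAd_le (s : ℂ) (A X : Mat n) :
    ‖powAd s A X‖ ≤ ‖ex (s • A)‖ * ‖X‖ * ‖ex (-(s • A))‖ := by
  rw [powAd_eq_ex]
  exact (norm_mul_le _ _).trans (by gcongr; exact norm_mul_le _ _)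

theorem hasDerivAt_powAd (s : ℂ) (A X : Mat n) :
    HasDerivAt (fun s => powAd s A X) (br A (powAd s A X)) s := by
  have hn : ∀ s : ℂ, -(s • A) = s • (-A) := fun s => (smul_neg s A).symm
  have h : HasDerivAt (fun s : ℂ => ex (s • A) * X * ex (s • (-A))) _ s :=
    ((hasDerivAt_ex_smul A s).mul_const X).mul (hasDerivAt_ex_smul (-A) s)
  have e : (fun s => powAd s A X) = fun s : ℂ => ex (s • A) * X * ex (s • (-A)) := by
    ext1 s; rw [powAd_eq_ex, hn]
  rw [e]
  refine h.congr_deriv ?_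
  have hc : Commute A (ex (s • (-A))) := commute_ex ((Commute.refl A).neg_right.smul_right s)
  simp only [powAd_eq_ex, hn, br, neg_mul, mul_neg]
  rw [mul_assoc _ _ A, ← hc.eq]
  simp only [mul_assoc, sub_eq_add_neg]

theorem delta_one (k : ℕ) : delta k (1 : Mat n) = 1 := by
  ext a b
  by_cases h : a = b <;> simp [delta, h]

theorem delta_pow {k : ℕ} {A : Mat n} (hA : delta k A = A) (m : ℕ) : delta k (A ^ m) = A ^ m := by
  induction m with
  | zero => rw [pow_zero, delta_one]
  | succ m ih => rw [pow_succ', delta_mul_left hA, ih]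

theorem delta_ex {k : ℕ} {A : Mat n} (hA : delta k A = A) : delta k (ex A) = ex A := by
  have h := NormedSpace.exp_series_hasSum_exp' (𝕂 := ℂ) A
  have h2 := h.mapL (deltaL n k)
  simp only [deltaL_apply, delta_smul, delta_pow hA] at h2
  exact h2.unique h

theorem delta_powAd {k : ℕ} {A : Mat n} (hA : delta k A = A) (s : ℂ) (X : Mat n) :
    delta k (powAd s A X) = powAd s A (delta k X) := by
  have h : delta k (s • A) = s • A := by rw [delta_smul, hA]
  have h' : delta k (-(s • A)) = -(s • A) := by rw [← neg_smul, delta_smul, hA]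
  rw [powAd_eq_ex, powAd_eq_ex, delta_mul_right (delta_ex h'), delta_mul_left (delta_ex h)]

theorem exists_norm_ex_le (M : ℝ) : ∃ B : ℝ, 0 ≤ B ∧ ∀ X : Mat n, ‖X‖ ≤ M → ‖ex X‖ ≤ B := by
  obtain ⟨B, hB⟩ := (isCompact_closedBall (0 : Mat n) M).exists_bound_of_continuousOn
    continuous_ex.continuousOn
  exact ⟨|B|, abs_nonneg _, fun X hX => (hB X (by simpa using hX)).trans (le_abs_self _)⟩

theorem conjTranspose_ex {A : Mat n} (hA : Aᴴ = -A) : (ex A)ᴴ = ex (-A) := by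
  rw [← hA]; exact (Matrix.exp_conjTranspose A).symm

theorem norm_ex_of_skew {A : Mat n} (hA : Aᴴ = -A) : ‖ex A‖ ≤ n + 1 := by
  have h : ‖ex A‖ ^ 2 = n := by
    rw [norm_sq_eq_trace, conjTranspose_ex hA, ex_neg_mul, Matrix.trace_one]
    simp
  nlinarith [norm_nonneg (ex A), (Nat.cast_nonneg n : (0 : ℝ) ≤ n)]

end Exponential

/-! ### The tower of real slices -/

section Tower

variable {n : ℕ}

/-- The points of the real slice with imaginary part `β` at which, for `K < k`, the sign of
`u_K - u_b`, `b < K`, is the sign of `z_0 ⋯ z_K`. -/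
def tower (β : Fin n → ℝ) (k : ℕ) : Set (Fin n → ℝ) :=
  {x | ∀ K : Fin n, (K : ℕ) < k → ∀ b < K,
    0 < (1 + Complex.exp (-(slice β x K)) * tailSum K (slice β x) b).re}

theorem tower_zero (β : Fin n → ℝ) : tower β 0 = univ := by
  ext x; simp [tower]

theorem continuous_tailSum (K b : Fin n) : Continuous fun w : Fin n → ℂ => tailSum K w b := by
  unfold tailSum tailProd; fun_prop

theorem isOpen_tower (β : Fin n → ℝ) (k : ℕ) : IsOpen (tower β k) := by
  simp only [tower, Set.ofPred_forall]
  refine isOpen_iInter_of_finite fun K => isOpen_iInter_of_finite fun _ =>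
    isOpen_iInter_of_finite fun b => isOpen_iInter_of_finite fun _ => ?_
  refine isOpen_lt continuous_const ?_
  have h1 : Continuous fun x : Fin n → ℝ => slice β x K :=
    (continuous_apply K).comp (continuous_slice β)
  have h2 : Continuous fun x : Fin n → ℝ => tailSum K (slice β x) b :=
    (continuous_tailSum K b).comp (continuous_slice β)
  fun_prop

theorem mem_levelRegular_of_ne {w : Fin n → ℂ} {k : ℕ}
    (h : ∀ K : Fin n, (K : ℕ) < k → ∀ b < K, 1 + Complex.exp (-(w K)) * tailSum K w b ≠ 0) :
    w ∈ levelRegular u k := by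
  have key : ∀ a b : Fin n, (a : ℕ) < k → b < a → u w a ≠ u w b := fun a b ha hb => by
    rw [← sub_ne_zero, u_sub_u hb]
    exact mul_ne_zero (Complex.exp_ne_zero _) (h a ha b hb)
  intro a b ha hb hab
  rcases lt_or_gt_of_ne hab with hlt | hlt
  · exact (key b a hb hlt).symm
  · exact key a b ha hlt

theorem slice_mem_levelRegular {β : Fin n → ℝ} {k : ℕ} {x : Fin n → ℝ} (hx : x ∈ tower β k) :
    slice β x ∈ levelRegular u k :=
  mem_levelRegular_of_ne fun K hK b hb h => by simpa [h] using hx K hK b hb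

theorem tailProd_congr {K : Fin n} {w w' : Fin n → ℂ} (h : ∀ j < K, w j = w' j) (l : Fin n) :
    tailProd K w l = tailProd K w' l := by
  unfold tailProd
  refine Finset.prod_congr rfl fun j hj => ?_
  rw [h j (Finset.mem_filter.1 hj).2.2]

theorem tailSum_congr {K : Fin n} {w w' : Fin n → ℂ} (h : ∀ j < K, w j = w' j) (b : Fin n) :
    tailSum K w b = tailSum K w' b := by
  unfold tailSum
  exact Finset.sum_congr rfl fun l _ => tailProd_congr h l

theorem u_congr {k : ℕ} {w w' : Fin n → ℂ} (h : ∀ j : Fin n, (j : ℕ) < k → w j = w' j) {b : Fin n}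
    (hb : (b : ℕ) < k) : u w b = u w' b := by
  refine Finset.sum_congr rfl fun l hl => Finset.prod_congr rfl fun j hj => ?_
  rw [h j]
  have h1 : l ≤ b := (Finset.mem_filter.1 hl).2
  have h2 : j ≤ l := (Finset.mem_filter.1 hj).2
  exact lt_of_le_of_lt (h2.trans h1) hb

theorem fderiv_u_congr {k : ℕ} {w w' : Fin n → ℂ} (h : ∀ j : Fin n, (j : ℕ) < k → w j = w' j)
    (v : Fin n → ℂ) {b : Fin n} (hb : (b : ℕ) < k) : fderiv ℂ u w v b = fderiv ℂ u w' v b := by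
  rw [fderiv_u_apply, fderiv_u_apply]
  refine Finset.sum_congr rfl fun l hl => ?_
  have h1 : l ≤ b := (Finset.mem_filter.1 hl).2
  rw [cum_apply l w, cum_apply l w', Finset.sum_congr rfl fun j hj => h j
    (lt_of_le_of_lt ((Finset.mem_filter.1 hj).2.trans h1) hb)]

/-- The equation of level `k` involves the first `k` coordinates only. -/
theorem lax_congr {k : ℕ} {w w' : Fin n → ℂ} (h : ∀ j : Fin n, (j : ℕ) < k → w j = w' j)
    (v : Fin n → ℂ) (Y : Mat n) : lax k w v Y = lax k w' v Y := by
  ext a b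
  simp only [lax, had_apply, levelCoeff]
  split_ifs with h1 h2
  · rfl
  · rw [u_congr h h2.1, u_congr h h2.2, fderiv_u_congr h v h2.1, fderiv_u_congr h v h2.2]
  · rfl

theorem levelSum_eq_zero {k : ℕ} {v : Fin n → ℂ} (h : ∀ j : Fin n, (j : ℕ) < k → v j = 0) :
    levelSum n k v = 0 := by
  rw [levelSum_apply]
  exact Finset.sum_eq_zero fun j hj => h j (Finset.mem_filter.1 hj).2

theorem fderiv_u_eq_zero {k : ℕ} (w : Fin n → ℂ) {v : Fin n → ℂ}
    (h : ∀ j : Fin n, (j : ℕ) < k → v j = 0) {b : Fin n} (hb : (b : ℕ) < k) :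
    fderiv ℂ u w v b = 0 := by
  rw [fderiv_u_apply]
  refine Finset.sum_eq_zero fun l hl => ?_
  have h1 : l ≤ b := (Finset.mem_filter.1 hl).2
  rw [cum_apply l v, Finset.sum_eq_zero fun j hj => h j
    (lt_of_le_of_lt ((Finset.mem_filter.1 hj).2.trans h1) hb), mul_zero]

theorem lax_eq_zero {k : ℕ} (w : Fin n → ℂ) {v : Fin n → ℂ}
    (h : ∀ j : Fin n, (j : ℕ) < k → v j = 0) (Y : Mat n) : lax k w v Y = 0 := by
  ext a b
  simp only [lax, had_apply, levelCoeff, levelSum_eq_zero h]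
  split_ifs with h1 h2
  · simp
  · simp [fderiv_u_eq_zero w h h2.1, fderiv_u_eq_zero w h h2.2]
  · simp

theorem norm_tailProd_le {K : Fin n} {w : Fin n → ℂ} {m : ℝ} (hm : 0 ≤ m)
    (hw : ∀ j < K, -m ≤ (w j).re) (l : Fin n) : ‖tailProd K w l‖ ≤ Real.exp (n * m) := by
  unfold tailProd
  rw [norm_prod]
  refine (Finset.prod_le_prod (g := fun _ => Real.exp m) (fun _ _ => norm_nonneg _)
    fun j hj => ?_).trans ?_
  · rw [Complex.norm_exp, Complex.neg_re]
    exact Real.exp_le_exp.2 (by linarith [hw j (Finset.mem_filter.1 hj).2.2])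
  · rw [Finset.prod_const, ← Real.exp_nat_mul]
    refine Real.exp_le_exp.2 (mul_le_mul_of_nonneg_right ?_ hm)
    exact_mod_cast (Finset.card_le_univ _).trans (by simp)

theorem norm_tailSum_le {K : Fin n} {w : Fin n → ℂ} {m : ℝ} (hm : 0 ≤ m)
    (hw : ∀ j < K, -m ≤ (w j).re) (b : Fin n) : ‖tailSum K w b‖ ≤ n * Real.exp (n * m) := by
  unfold tailSum
  refine (norm_sum_le _ _).trans ((Finset.sum_le_sum fun l _ => norm_tailProd_le hm hw l).trans ?_)
  rw [Finset.sum_const, nsmul_eq_mul]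
  refine mul_le_mul_of_nonneg_right ?_ (Real.exp_pos _).le
  exact_mod_cast (Finset.card_le_univ _).trans (by simp)

theorem norm_cum_le (l : Fin n) (v : Fin n → ℂ) : ‖cum l v‖ ≤ n * ‖v‖ := by
  rw [cum_apply]
  refine (norm_sum_le _ _).trans ((Finset.sum_le_sum fun j _ => norm_le_pi_norm v j).trans ?_)
  rw [Finset.sum_const, nsmul_eq_mul]
  refine mul_le_mul_of_nonneg_right ?_ (norm_nonneg _)
  exact_mod_cast (Finset.card_le_univ _).trans (by simp)

/-- The size of `Re (w K)` beyond which the deviation `epsCoeff` is controlled, when the real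
parts of the previous coordinates are at least `-m`. -/
noncomputable def farBound (n : ℕ) (m : ℝ) : ℝ := 2 * (n * Real.exp (n * m))

theorem farBound_nonneg (n : ℕ) (m : ℝ) : 0 ≤ farBound n m := by
  unfold farBound; positivity

theorem norm_exp_mul_tailSum_le {K : Fin n} {w : Fin n → ℂ} {m : ℝ} (hm : 0 ≤ m)
    (hw : ∀ j < K, -m ≤ (w j).re) (hK : farBound n m ≤ (w K).re) (b : Fin n) :
    ‖Complex.exp (-(w K)) * tailSum K w b‖ ≤ 1 / 2 := by
  rw [norm_mul, Complex.norm_exp, Complex.neg_re]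
  have h1 := norm_tailSum_le hm hw b
  have h2 : (w K).re ≤ Real.exp (w K).re := by linarith [Real.add_one_le_exp (w K).re]
  rw [Real.exp_neg, inv_mul_le_iff₀ (Real.exp_pos _)]
  unfold farBound at hK
  linarith

theorem half_le_re {a : ℂ} (h : ‖a‖ ≤ 1 / 2) : 1 / 2 ≤ (1 + a).re := by
  have := (abs_le.1 ((Complex.abs_re_le_norm a).trans h)).1
  simp only [Complex.add_re, Complex.one_re]
  linarith

/-- The coefficients of the equation of level `K + 1` approach their limits exponentially fast. -/
theorem norm_epsCoeff_le {K : Fin n} {w : Fin n → ℂ} {m : ℝ} (hm : 0 ≤ m)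
    (hw : ∀ j < K, -m ≤ (w j).re) (hK : farBound n m ≤ (w K).re) (v : Fin n → ℂ) (a b : Fin n) :
    ‖epsCoeff K w v a b‖ ≤ 2 * n * farBound n m * Real.exp (-(w K).re) * ‖v‖ := by
  have key : ∀ b, ‖epsEntry K w v b‖ ≤
      2 * n * farBound n m * Real.exp (-(w K).re) * ‖v‖ := by
    intro b
    have hden : 1 / 2 ≤ ‖1 + Complex.exp (-(w K)) * tailSum K w b‖ :=
      (half_le_re (norm_exp_mul_tailSum_le hm hw hK b)).trans (Complex.re_le_norm _)
    have hnum : ‖∑ l ∈ Finset.univ.filter (fun l => b < l ∧ l < K),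
        tailProd K w l * (cum l v - cum K v)‖ ≤ n * (Real.exp (n * m) * (2 * n * ‖v‖)) := by
      refine (norm_sum_le _ _).trans ((Finset.sum_le_sum
        (g := fun _ => Real.exp (n * m) * (2 * n * ‖v‖)) fun l _ => ?_).trans ?_)
      · rw [norm_mul]
        refine mul_le_mul (norm_tailProd_le hm hw l) ?_ (norm_nonneg _) (Real.exp_pos _).le
        refine (norm_sub_le _ _).trans ?_
        linarith [norm_cum_le l v, norm_cum_le K v]
      · rw [Finset.sum_const, nsmul_eq_mul]
        refine mul_le_mul_of_nonneg_right ?_ (by positivity)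
        exact_mod_cast (Finset.card_le_univ _).trans (by simp)
    rw [epsEntry, norm_div, norm_mul, Complex.norm_exp, Complex.neg_re,
      div_le_iff₀ (lt_of_lt_of_le (by norm_num) hden)]
    calc _ ≤ Real.exp (-(w K).re) * (n * (Real.exp (n * m) * (2 * n * ‖v‖))) := by gcongr
      _ = 2 * n * farBound n m * Real.exp (-(w K).re) * ‖v‖ * (1 / 2) := by
          unfold farBound; ring
      _ ≤ _ := by
          have := farBound_nonneg n m
          gcongr
  have h0 : 0 ≤ 2 * n * farBound n m * Real.exp (-(w K).re) * ‖v‖ := by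
    have := farBound_nonneg n m
    positivity
  unfold epsCoeff
  split_ifs
  · exact key b
  · exact key a
  · simpa using h0

/-- Raising the coordinate `K` leads from the slice of level `K` to that of level `K + 1`. -/
theorem mem_tower_succ_of_far {β : Fin n → ℝ} {K : Fin n} {x : Fin n → ℝ} {m : ℝ}
    (hx : x ∈ tower β K) (hm : 0 ≤ m) (hxm : ∀ j < K, -m ≤ x j) (hK : farBound n m ≤ x K) :
    x ∈ tower β (K + 1) := by
  intro J hJ b hb
  rcases Nat.lt_succ_iff_lt_or_eq.1 hJ with h | h
  · exact hx J h b hb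
  · obtain rfl : J = K := Fin.ext h
    exact lt_of_lt_of_le (by norm_num) (half_le_re
      (norm_exp_mul_tailSum_le hm (by simpa using hxm) (by simpa using hK) b))

theorem tower_congr {β x x' : Fin n → ℝ} {k : ℕ} (h : ∀ j : Fin n, (j : ℕ) < k → x j = x' j)
    (hx : x ∈ tower β k) : x' ∈ tower β k := by
  intro K hK b hb
  have e : ∀ j ≤ K, slice β x j = slice β x' j := fun j hj => by
    simp [slice, h j (lt_of_le_of_lt hj hK)]
  rw [← e K le_rfl, ← tailSum_congr fun j hj => e j hj.le]
  exact hx K hK b hb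

end Tower

/-! ### The real component as the top of the tower -/

section RealComponent

variable {n : ℕ}

theorem exp_im_eq_zero {w : ℂ} (h : ∃ m : ℤ, w.im = m * Real.pi) : (Complex.exp w).im = 0 := by
  obtain ⟨m, hm⟩ := h
  rw [Complex.exp_im, hm, Real.sin_int_mul_pi, mul_zero]

theorem re_mul_of_im {a b : ℂ} (h : a.im = 0) : (a * b).re = a.re * b.re := by simp [h]

theorem exp_cum_re_eq {w w' : Fin n → ℂ} (h : ∀ k, (w k).im = (w' k).im) (K : Fin n) :
    (Complex.exp (cum K w)).re =
      Real.exp ((cum K w).re - (cum K w').re) * (Complex.exp (cum K w')).re := by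
  have e : (cum K w).im = (cum K w').im := by
    simp only [cum_apply, Complex.im_sum, h]
  rw [Complex.exp_re, Complex.exp_re, e, ← mul_assoc, ← Real.exp_add]
  congr 2; ring_nf

theorem exp_cum_im_eq_zero {w : Fin n → ℂ} (hw : IsRealPoint w) (K : Fin n) :
    (Complex.exp (cum K w)).im = 0 := by
  choose m hm using hw
  refine exp_im_eq_zero ⟨∑ j ∈ Finset.univ.filter (· ≤ K), m j, ?_⟩
  rw [cum_apply, Complex.im_sum, Finset.sum_congr rfl fun j _ => hm j]
  push_cast
  rw [Finset.sum_mul]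

theorem u_sub_u_re {b K : Fin n} (hb : b < K) {w : Fin n → ℂ} (hw : IsRealPoint w) :
    (u w K).re - (u w b).re = (Complex.exp (cum K w)).re *
      (1 + Complex.exp (-(w K)) * tailSum K w b).re := by
  rw [← Complex.sub_re, u_sub_u hb, re_mul_of_im (exp_cum_im_eq_zero hw K)]

/-- Under the condition of reaching infinity, the real component is the top of the tower. -/
theorem mem_tower_iff_mem_realComponent {w₀ : Fin n → ℂ} (hreal : IsRealPoint w₀)
    (hinf : ReachesInfinity w₀) (x : Fin n → ℝ) :
    x ∈ tower (fun k => (w₀ k).im) n ↔ slice (fun k => (w₀ k).im) x ∈ realComponent w₀ := by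
  set β : Fin n → ℝ := fun k => (w₀ k).im with hβ
  have hreal' : IsRealPoint (slice β x) := fun k => by simpa [hβ] using hreal k
  have hne : ∀ (w : Fin n → ℂ), IsRealPoint w → ∀ K, (Complex.exp (cum K w)).re ≠ 0 :=
    fun w hw K h => Complex.exp_ne_zero (cum K w) (Complex.ext h (exp_cum_im_eq_zero hw K))
  have hexp := fun K => exp_cum_re_eq (w := slice β x) (w' := w₀) (fun k => by simp [hβ]) K
  -- at `w₀` the sign of `u_K - u_b` is that of `z_0 ⋯ z_K`, as for `b = K - 1`
  have h0 : ∀ K b : Fin n, b < K →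
      0 < (Complex.exp (cum K w₀)).re * ((u w₀ K).re - (u w₀ b).re) := by
    intro K b hb
    have hK0 : 0 < (K : ℕ) := lt_of_le_of_lt (Nat.zero_le _) hb
    obtain ⟨p, hp⟩ : ∃ p : Fin n, (p : ℕ) + 1 = K :=
      ⟨⟨K - 1, by omega⟩, by simp; omega⟩
    have hpK : p < K := by rw [Fin.lt_def]; omega
    have e : (u w₀ K).re - (u w₀ p).re = (Complex.exp (cum K w₀)).re := by
      rw [u_sub_u_re hpK hreal]
      have : tailSum K w₀ p = 0 := by
        unfold tailSum
        refine Finset.sum_eq_zero fun l hl => ?_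
        have := (Finset.mem_filter.1 hl).2
        rw [Fin.lt_def, Fin.lt_def] at this
        omega
      simp [this]
    rcases hinf K with h | h
    · exact mul_pos (by rw [← e]; exact sub_pos.2 (h p hpK)) (sub_pos.2 (h b hb))
    · exact mul_pos_of_neg_of_neg (by rw [← e]; exact sub_neg.2 (h p hpK)) (sub_neg.2 (h b hb))
  have hx : ∀ K b : Fin n, b < K →
      (0 < (1 + Complex.exp (-(slice β x K)) * tailSum K (slice β x) b).re ↔
        0 < (Complex.exp (cum K w₀)).re * ((u (slice β x) K).re - (u (slice β x) b).re)) := by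
    intro K b hb
    have e : ∀ r : ℝ, (Complex.exp (cum K w₀)).re * ((Complex.exp (cum K (slice β x))).re * r) =
        Real.exp ((cum K (slice β x)).re - (cum K w₀).re) * (Complex.exp (cum K w₀)).re ^ 2 * r := by
      intro r; rw [hexp K]; ring
    rw [u_sub_u_re hb hreal', e]
    exact (mul_pos_iff_of_pos_left (mul_pos (Real.exp_pos _)
      (sq_pos_of_ne_zero (hne w₀ hreal K)))).symm
  constructor
  · intro h
    refine ⟨fun k => by simp [hβ], ?_⟩
    have key : ∀ K b : Fin n, b < K → (((u (slice β x) b).re < (u (slice β x) K).re ↔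
        (u w₀ b).re < (u w₀ K).re) ∧ ((u (slice β x) K).re < (u (slice β x) b).re ↔
        (u w₀ K).re < (u w₀ b).re)) := by
      intro K b hb
      have h1 := (hx K b hb).1 (h K K.2 b hb)
      have h2 := h0 K b hb
      rcases lt_or_gt_of_ne (hne w₀ hreal K) with hs | hs
      · have h1' := neg_of_mul_pos_right h1 hs.le
        have h2' := neg_of_mul_pos_right h2 hs.le
        constructor <;> constructor <;> intro <;> linarith
      · have h1' := pos_of_mul_pos_right h1 hs.le
        have h2' := pos_of_mul_pos_right h2 hs.le
        constructor <;> constructor <;> intro <;> linarith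
    intro i j
    rcases lt_trichotomy i j with hij | rfl | hij
    · exact (key j i hij).1
    · simp
    · exact (key i j hij).2
  · intro h K _ b hb
    refine (hx K b hb).2 ?_
    have h2 := h0 K b hb
    rcases lt_or_gt_of_ne (hne w₀ hreal K) with hs | hs
    · have h2' := neg_of_mul_pos_right h2 hs.le
      exact mul_pos_of_neg_of_neg hs (sub_neg.2 ((h.2 K b).2 (sub_neg.1 h2')))
    · have h2' := pos_of_mul_pos_right h2 hs.le
      exact mul_pos hs (sub_pos.2 ((h.2 b K).2 (sub_pos.1 h2')))

end RealComponent

/-! ### Solutions on the real slices -/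

section SliceSolutions

variable {n : ℕ}

/-- The property `|Re l| ^ n ≤ |det (l - X)|` for all `l`: a closed condition, invariant under
conjugation, that confines the spectrum to the imaginary axis. -/
def ImagSpectrum (X : Mat n) : Prop :=
  ∀ l : ℂ, |l.re| ^ n ≤ ‖Matrix.det (Matrix.scalar (Fin n) l - X)‖

/-- A skew-Hermitian matrix is diagonalizable with imaginary eigenvalues, hence
`det (l - X)` is a product of `n` factors of absolute value at least `|Re l|`. -/
theorem imagSpectrum_of_skew {X : Mat n} (hX : Xᴴ = -X) : ImagSpectrum X := by
  intro l
  have hH : (Complex.I • X).IsHermitian := by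
    rw [Matrix.IsHermitian, Matrix.conjTranspose_smul, hX]
    simp
  have h1 : Matrix.scalar (Fin n) l - X =
      (-Complex.I) • (Matrix.scalar (Fin n) (Complex.I * l) - Complex.I • X) := by
    ext a b
    by_cases h : a = b
    · subst h
      simp [mul_sub, ← mul_assoc]
    · simp [h, ← mul_assoc]
  have h2 : Matrix.det (Matrix.scalar (Fin n) (Complex.I * l) - Complex.I • X) =
      ∏ i, (Complex.I * l - (hH.eigenvalues i : ℂ)) := by
    rw [← Matrix.eval_charpoly, hH.charpoly_eq, Polynomial.eval_prod]
    simp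
  rw [h1, Matrix.det_smul, h2, norm_mul, norm_pow, norm_neg, Complex.norm_I, one_pow, one_mul,
    norm_prod]
  have h3 : ∏ _i : Fin n, |l.re| = |l.re| ^ n := by simp
  rw [← h3]
  refine Finset.prod_le_prod (fun _ _ => abs_nonneg _) fun i _ => ?_
  refine le_trans ?_ (Complex.abs_im_le_norm _)
  simp

theorem imagSpectrum_conj {g g' X : Mat n} (h : g * g' = 1) (hX : ImagSpectrum X) :
    ImagSpectrum (g * X * g') := by
  intro l
  have e : Matrix.scalar (Fin n) l - g * X * g' = g * (Matrix.scalar (Fin n) l - X) * g' := by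
    have hc : g * Matrix.scalar (Fin n) l = Matrix.scalar (Fin n) l * g :=
      (Matrix.scalar_commute l (fun r => mul_comm _ _) g).eq.symm
    rw [mul_sub, sub_mul, hc, mul_assoc _ g g', h, mul_one]
  have hd : g.det * g'.det = 1 := by rw [← Matrix.det_mul, h, Matrix.det_one]
  rw [e, Matrix.det_mul, Matrix.det_mul, mul_right_comm, hd, one_mul]
  exact hX l

theorem imagSpectrum_of_tendsto {f : ℝ → Mat n} {X : Mat n} (hf : Tendsto f atTop (𝓝 X))
    (h : ∀ᶠ t in atTop, ImagSpectrum (f t)) : ImagSpectrum X := by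
  intro l
  have hc : Continuous fun X : Mat n => ‖Matrix.det (Matrix.scalar (Fin n) l - X)‖ :=
    ((continuous_const.sub continuous_id).matrix_det).norm
  exact ge_of_tendsto ((hc.tendsto X).comp hf) (h.mono fun t ht => ht l)

/-- All eigenvalues of the upper left submatrices are imaginary, since they are eigenvalues of
`δ_k A`. -/
theorem boundaryCondition_of_imagSpectrum {A : Mat n} (h : ∀ k, ImagSpectrum (delta k A)) :
    BoundaryCondition A := by
  intro k hk a ha b hb
  have key : ∀ a ∈ spectrum ℂ (upperLeft A k hk.le), a.re = 0 := by
    intro a ha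
    have hn : n ≠ 0 := by omega
    rw [Matrix.mem_spectrum_iff_isRoot_charpoly, Polynomial.IsRoot, Matrix.eval_charpoly] at ha
    obtain ⟨v, hv0, hv⟩ := Matrix.exists_mulVec_eq_zero_iff.2 ha
    have hdet : Matrix.det (Matrix.scalar (Fin n) a - delta k A) = 0 := by
      -- extend the eigenvector of the submatrix by zero
      refine Matrix.exists_mulVec_eq_zero_iff.1
        ⟨fun i => if h : (i : ℕ) < k then v ⟨i, h⟩ else 0, ?_, ?_⟩
      · intro h0
        refine hv0 (funext fun i => ?_)
        have := congrFun h0 (Fin.castLE hk.le i)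
        simpa using this
      · ext i
        have hvi : ∀ i : Fin k, a * v i - ∑ j, A (Fin.castLE hk.le i) (Fin.castLE hk.le j) * v j =
            0 := fun i => by
          have := congrFun hv i
          rw [Matrix.sub_mulVec, Pi.sub_apply, Matrix.scalar_apply, Matrix.mulVec_diagonal] at this
          exact this
        rw [Matrix.sub_mulVec, Pi.sub_apply, Matrix.scalar_apply, Matrix.mulVec_diagonal,
          Pi.zero_apply, Matrix.mulVec, dotProduct]
        by_cases hi : (i : ℕ) < k
        · rw [← Finset.sum_subset (Finset.subset_univ (Finset.univ.map (Fin.castLEEmb hk.le))),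
            Finset.sum_map]
          · simpa [delta, hi] using hvi ⟨i, hi⟩
          · intro j _ hj
            have : ¬ (j : ℕ) < k := fun h => hj (Finset.mem_map.2 ⟨⟨j, h⟩, by simp, by ext; simp⟩)
            simp [this]
        · rw [dif_neg hi, mul_zero, zero_sub, neg_eq_zero]
          refine Finset.sum_eq_zero fun j _ => ?_
          by_cases hij : i = j
          · subst hij; simp [hi]
          · simp [delta, hi, hij]
    have := h k a
    rw [hdet, norm_zero] at this
    have h2 : |a.re| = 0 := pow_eq_zero_iff hn |>.1 (le_antisymm this (by positivity))
    exact abs_eq_zero.1 h2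
  rw [Complex.sub_re, key a ha, key b hb]
  simp

/-- A function with exponentially decaying derivative converges at the same rate. -/
theorem exists_tendsto_of_norm_deriv_le_exp {E : Type*} [NormedAddCommGroup E] [NormedSpace ℝ E]
    [CompleteSpace E] {f f' : ℝ → E} {T₀ C : ℝ}
    (hf : ∀ t, T₀ ≤ t → HasDerivAt f (f' t) t) (hC : ∀ t, T₀ ≤ t → ‖f' t‖ ≤ C * Real.exp (-t)) :
    ∃ L, Tendsto f atTop (𝓝 L) ∧ ∀ t, T₀ ≤ t → ‖f t - L‖ ≤ C * Real.exp (-t) := by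
  have hC0 : 0 ≤ C := by
    have := (norm_nonneg _).trans (hC T₀ le_rfl)
    exact nonneg_of_mul_nonneg_left this (Real.exp_pos _)
  have key : ∀ s t, T₀ ≤ s → s ≤ t → ‖f t - f s‖ ≤ C * Real.exp (-s) := by
    intro s t hs hst
    have h1 := image_norm_le_of_norm_deriv_right_le_deriv_boundary
      (f := fun x => f x - f s) (f' := f') (a := s) (b := t)
      (B := fun x => C * (Real.exp (-s) - Real.exp (-x))) (B' := fun x => C * Real.exp (-x))
      (fun x hx => ((hf x (hs.trans hx.1)).sub_const _).continuousAt.continuousWithinAt)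
      (fun x hx => ((hf x (hs.trans hx.1)).sub_const _).hasDerivWithinAt) (by simp)
      (fun x => by
        have h := ((hasDerivAt_neg x).exp.const_sub (Real.exp (-s))).const_mul C
        refine h.congr_deriv (by ring))
      (fun x hx => hC x (hs.trans hx.1)) (right_mem_Icc.2 hst)
    refine h1.trans ?_
    gcongr
    linarith [Real.exp_pos (-t)]
  have hlim : Tendsto (fun t : ℝ => C * Real.exp (-t)) atTop (𝓝 0) := by
    simpa using (Real.tendsto_exp_neg_atTop_nhds_zero).const_mul C
  have hcau : CauchySeq f := by
    rw [Metric.cauchySeq_iff']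
    intro ε hε
    obtain ⟨N, hN⟩ := ((hlim.eventually (gt_mem_nhds hε)).and (eventually_ge_atTop T₀)).exists
    exact ⟨N, fun t ht => by rw [dist_eq_norm]; exact (key N t hN.2 ht).trans_lt hN.1⟩
  obtain ⟨L, hL⟩ := cauchySeq_tendsto_of_complete hcau
  refine ⟨L, hL, fun t ht => ?_⟩
  have h1 : Tendsto (fun t' => ‖f t - f t'‖) atTop (𝓝 ‖f t - L‖) := (hL.const_sub _).norm
  refine le_of_tendsto h1 ((eventually_ge_atTop t).mono fun t' ht' => ?_)
  rw [norm_sub_rev]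
  exact key t t' ht ht'

theorem conjTranspose_delta (k : ℕ) (X : Mat n) : (delta k X)ᴴ = delta k Xᴴ := by
  ext a b
  simp only [Matrix.conjTranspose_apply, delta]
  by_cases h : a = b
  · simp [h]
  · have h' : b ≠ a := fun e => h e.symm
    simp only [h, h', or_false, and_comm (a := (b : ℕ) < k)]
    split_ifs <;> simp

theorem delta_neg (k : ℕ) (X : Mat n) : delta k (-X) = -delta k X := by
  simpa using delta_smul k (-1) X

theorem skew_delta {k : ℕ} {X : Mat n} (hX : Xᴴ = -X) : (delta k X)ᴴ = -delta k X := by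
  rw [conjTranspose_delta, hX, delta_neg]

theorem fderiv_u_im {w v : Fin n → ℂ} (hw : IsRealPoint w) (hv : ∀ j, (v j).im = 0) (a : Fin n) :
    (fderiv ℂ u w v a).im = 0 := by
  rw [fderiv_u_apply, Complex.im_sum]
  refine Finset.sum_eq_zero fun l _ => ?_
  have h2 : (cum l v).im = 0 := by
    rw [cum_apply, Complex.im_sum]; exact Finset.sum_eq_zero fun j _ => hv j
  simp [Complex.mul_im, exp_cum_im_eq_zero hw, h2]

theorem levelSum_im (k : ℕ) {v : Fin n → ℂ} (hv : ∀ j, (v j).im = 0) : (levelSum n k v).im = 0 := by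
  rw [levelSum_apply, Complex.im_sum]; exact Finset.sum_eq_zero fun j _ => hv j

/-- At real points, in real directions, the Lax matrix is skew-Hermitian. -/
theorem conjTranspose_lax {k : ℕ} {w v : Fin n → ℂ} (hw : IsRealPoint w) (hv : ∀ j, (v j).im = 0)
    {Y : Mat n} (hY : (delta k Y)ᴴ = -delta k Y) : (lax k w v Y)ᴴ = -lax k w v Y := by
  rw [← lax_delta]
  exact conjTranspose_had (fun a b => levelCoeff_symm _ _ _ _ _ _)
    (levelCoeff_im (u_im_eq_zero hw) (fderiv_u_im hw hv) (levelSum_im k hv)) hY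

theorem lax_sub (k : ℕ) (w v : Fin n → ℂ) (X Y : Mat n) :
    lax k w v (X - Y) = lax k w v X - lax k w v Y := had_sub _ _ _

theorem norm_br_lax_sub_le {k : ℕ} {w v : Fin n → ℂ} {L M : ℝ} (hL0 : 0 ≤ L)
    (hL : ∀ X : Mat n, ‖lax k w v X‖ ≤ L * ‖X‖) {X Y : Mat n} (hX : ‖X‖ ≤ M) (hY : ‖Y‖ ≤ M) :
    ‖br (lax k w v X) X - br (lax k w v Y) Y‖ ≤ 4 * L * M * ‖X - Y‖ := by
  have e : br (lax k w v X) X - br (lax k w v Y) Y =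
      br (lax k w v (X - Y)) X + br (lax k w v Y) (X - Y) := br_had_sub _ _ _
  rw [e]
  have h1 := norm_br_le (lax k w v (X - Y)) X
  have h2 := norm_br_le (lax k w v Y) (X - Y)
  have h3 := hL (X - Y)
  have h4 := hL Y
  calc _ ≤ _ := norm_add_le _ _
    _ ≤ 2 * (L * ‖X - Y‖) * M + 2 * (L * M) * ‖X - Y‖ := by
        refine add_le_add (h1.trans ?_) (h2.trans ?_)
        · gcongr
        · gcongr; exact h4.trans (by gcongr)
    _ = _ := by ring

/-- Solutions of the equation of level `k` over the real slice with imaginary part `β`. Only the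
block `δ_k Y` has to be skew-Hermitian: the property of the whole matrix is lost under conjugation
by `z ^ A` with `z < 0`, while the position of the spectra is preserved. -/
structure IsSliceSol (β : Fin n → ℝ) (k : ℕ) (Y : (Fin n → ℝ) → Mat n) : Prop where
  deriv : ∀ x ∈ tower β k, HasSliceDeriv (iso n k) β Y x
  skew : ∀ x ∈ tower β k, (delta k (Y x))ᴴ = -delta k (Y x)
  spec : ∀ x ∈ tower β k, ∀ j, ImagSpectrum (delta j (Y x))

theorem realEmb_im (h : Fin n → ℝ) (j : Fin n) : (realEmb n h j).im = 0 := by simp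

theorem norm_realEmb_le (h : Fin n → ℝ) : ‖realEmb n h‖ ≤ ‖h‖ := by
  refine (pi_norm_le_iff_of_nonneg (norm_nonneg h)).2 fun j => ?_
  rw [realEmb_apply, Complex.norm_real]
  exact norm_le_pi_norm h j

theorem isRealPoint_slice {β : Fin n → ℝ} (hβ : ∀ k, ∃ m : ℤ, β k = m * Real.pi)
    (x : Fin n → ℝ) : IsRealPoint (slice β x) := fun k => by simpa using hβ k

/-- A solution of level `k` depends on the first `k` coordinates only. -/
theorem IsSliceSol.congr {β : Fin n → ℝ} {k : ℕ} {Y : (Fin n → ℝ) → Mat n}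
    (hY : IsSliceSol β k Y) {x x' : Fin n → ℝ} (hx : x ∈ tower β k)
    (h : ∀ j : Fin n, (j : ℕ) < k → x j = x' j) : Y x = Y x' := by
  have hmem : ∀ t : ℝ, x + t • (x' - x) ∈ tower β k := fun t =>
    tower_congr (fun j hj => by simp [h j hj]) hx
  have hd : ∀ t : ℝ, HasDerivAt (fun t : ℝ => Y (x + t • (x' - x))) 0 t := by
    intro t
    have h1 : HasDerivAt (fun t : ℝ => x + t • (x' - x)) (x' - x) t := by
      simpa using ((hasDerivAt_id t).smul_const (x' - x)).const_add x
    have h0 : HasFDerivAt Y _ (x + t • (x' - x)) := hY.deriv _ (hmem t)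
    have h2 := h0.comp_hasDerivAt t h1
    refine h2.congr_deriv ?_
    change iso n k _ _ (realEmb n (x' - x)) = 0
    rw [iso_apply, lax_eq_zero _ (fun j hj => by simp [h j hj])]
    simp [br]
  have := is_const_of_deriv_eq_zero (fun t => (hd t).differentiableAt) (fun t => (hd t).deriv) 0 1
  simpa using this

end SliceSolutions

/-! ### Limits in the last coordinate -/

section Descent

variable {n : ℕ} {β : Fin n → ℝ} {K : Fin n} {Y : (Fin n → ℝ) → Mat n}

/-- Add `T` to the coordinate `K`. -/
noncomputable def shift (K : Fin n) (T : ℝ) (x : Fin n → ℝ) : Fin n → ℝ :=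
  x + T • (Pi.single K (1 : ℝ) : Fin n → ℝ)

@[simp] theorem shift_self (K : Fin n) (T : ℝ) (x : Fin n → ℝ) : shift K T x K = x K + T := by
  simp [shift]

theorem shift_of_ne {K j : Fin n} (h : j ≠ K) (T : ℝ) (x : Fin n → ℝ) :
    shift K T x j = x j := by
  simp [shift, h]

theorem shift_of_lt {K j : Fin n} (h : (j : ℕ) < K) (T : ℝ) (x : Fin n → ℝ) :
    shift K T x j = x j := shift_of_ne (fun e => by simp [e] at h) T x

theorem norm_realEmb_single_le (K : Fin n) : ‖realEmb n (Pi.single K 1)‖ ≤ 1 := by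
  refine (norm_realEmb_le _).trans ((pi_norm_le_iff_of_nonneg zero_le_one).2 fun j => ?_)
  by_cases h : j = K
  · subst h; simp
  · simp [h]

theorem hasFDerivAt_shift (K : Fin n) (T : ℝ) (x : Fin n → ℝ) :
    HasFDerivAt (shift K T) (ContinuousLinearMap.id ℝ (Fin n → ℝ)) x :=
  (hasFDerivAt_id x).add_const _

theorem hasDerivAt_shift (K : Fin n) (T : ℝ) (x : Fin n → ℝ) :
    HasDerivAt (fun T => shift K T x) (Pi.single K 1) T := by
  have h := ((hasDerivAt_id T).smul_const (Pi.single K (1 : ℝ) : Fin n → ℝ)).const_add x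
  rw [one_smul] at h
  exact h

theorem continuous_shift (K : Fin n) (T : ℝ) : Continuous (shift K T) :=
  continuous_id.add continuous_const

theorem iso_succ {w : Fin n → ℂ} (hw : ∀ b < K, 1 + Complex.exp (-(w K)) * tailSum K w b ≠ 0)
    (X : Mat n) (v : Fin n → ℂ) :
    iso n (K + 1) w X v = br (lax K w v X) X - v K • br (delta K X) X +
      br (had (epsCoeff K w v) X) X := by
  rw [iso_apply, lax_succ hw, br_add_left, br_sub_left, br_smul_left]

theorem exists_norm_lax_le {k : ℕ} {Q : Set (Fin n → ℂ)} (hQ : IsCompact Q)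
    (hQr : Q ⊆ levelRegular u k) :
    ∃ L : ℝ, 0 ≤ L ∧ ∀ w ∈ Q, ∀ v X, ‖lax k w v X‖ ≤ L * ‖v‖ * ‖X‖ := by
  have hc : ContinuousOn (fun w => ∑ a, ∑ b, ‖levelForm u (levelSum n k) k w a b‖) Q :=
    continuousOn_finsetSum _ fun a _ => continuousOn_finsetSum _ fun b _ => fun w hw =>
      (contDiffAt_levelForm _ contDiff_u (hQr hw) a b).continuousAt.norm.continuousWithinAt
  obtain ⟨L, hL⟩ := hQ.exists_bound_of_continuousOn hc
  refine ⟨|L|, abs_nonneg _, fun w hw v X => ?_⟩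
  have e : lax k w v X = had (fun a b => levelForm u (levelSum n k) k w a b v) X := by
    rw [lax, levelForm_apply _ contDiff_u]
  rw [e]
  refine norm_had_le (fun a b => ?_) (by positivity) X
  refine (ContinuousLinearMap.le_opNorm _ _).trans ?_
  gcongr
  refine le_trans ?_ ((le_abs_self _).trans ((hL w hw).trans (le_abs_self L)))
  calc _ ≤ ∑ b, ‖levelForm u (levelSum n k) k w a b‖ :=
        Finset.single_le_sum (f := fun b => ‖levelForm u (levelSum n k) k w a b‖)
          (fun _ _ => norm_nonneg _) (Finset.mem_univ b)
    _ ≤ _ := Finset.single_le_sum (f := fun a => ∑ b, ‖levelForm u (levelSum n k) k w a b‖)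
          (fun _ _ => Finset.sum_nonneg fun _ _ => norm_nonneg _) (Finset.mem_univ a)

/-- Bounds over a set `B` of points of level `K`: after a shift of the coordinate `K` by at least
`T₀` the points lie in the slice of level `K + 1`, the deviation from the equation of level `K` is
`O(exp (-T))` with constant `c`, and `Y` is bounded by `M`. The constant `L` bounds the equation of
level `K`, and `κ` the operators `z_K ^ {ad A}` for the matrices `A` that can occur as limits. -/
structure FarBounds (β : Fin n → ℝ) (K : Fin n) (Y : (Fin n → ℝ) → Mat n)
    (B : Set (Fin n → ℝ)) (T₀ c L M κ : ℝ) : Prop where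
  c_nonneg : 0 ≤ c
  L_nonneg : 0 ≤ L
  M_nonneg : 0 ≤ M
  κ_nonneg : 0 ≤ κ
  mem : ∀ x ∈ B, x ∈ tower β K
  mem_succ : ∀ x ∈ B, ∀ T, T₀ ≤ T → shift K T x ∈ tower β (K + 1)
  eps : ∀ x ∈ B, ∀ T, T₀ ≤ T → ∀ v X,
    ‖had (epsCoeff K (slice β (shift K T x)) v) X‖ ≤ c * Real.exp (-T) * ‖v‖ * ‖X‖
  lax : ∀ x ∈ B, ∀ v X, ‖lax K (slice β x) v X‖ ≤ L * ‖v‖ * ‖X‖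
  norm : ∀ x ∈ B, ∀ T, T₀ ≤ T → ‖Y (shift K T x)‖ ≤ M
  exp : ∀ A : Mat n, Aᴴ = -A → ‖A‖ ≤ M → ∀ s : ℂ, s.im = β K →
    ‖ex (s • A)‖ ≤ κ ∧ ‖ex (-(s • A))‖ ≤ κ

/-- For skew-Hermitian `A` the matrix `exp (r A)` with real `r` is unitary, hence `exp (s A)` is
bounded as long as `Im s` is fixed. -/
theorem norm_ex_smul_le_of_skew (b M : ℝ) : ∃ κ : ℝ, 0 ≤ κ ∧ ∀ A : Mat n, Aᴴ = -A → ‖A‖ ≤ M →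
    ∀ s : ℂ, s.im = b → ‖ex (s • A)‖ ≤ κ ∧ ‖ex (-(s • A))‖ ≤ κ := by
  obtain ⟨B, hB0, hB⟩ := exists_norm_ex_le (n := n) (|b| * M)
  refine ⟨(n + 1) * B, by positivity, fun A hA hAM s hs => ?_⟩
  have hre : ∀ r : ℝ, ‖ex ((r : ℂ) • A)‖ ≤ n + 1 := fun r => norm_ex_of_skew (by
    rw [Matrix.conjTranspose_smul, hA]; simp)
  have him : ∀ r : ℝ, |r| = |b| → ‖ex (((r : ℂ) * Complex.I) • A)‖ ≤ B := fun r hr => hB _ (by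
    rw [norm_smul, norm_mul, Complex.norm_I, mul_one, Complex.norm_real, Real.norm_eq_abs, hr]
    gcongr)
  have key : ∀ r r' : ℝ, |r'| = |b| → ‖ex (((r : ℂ) + (r' : ℂ) * Complex.I) • A)‖ ≤ (n + 1) * B := by
    intro r r' h
    rw [ex_add_smul]
    exact (norm_mul_le _ _).trans (mul_le_mul (hre r) (him r' h) (norm_nonneg _) (by positivity))
  constructor
  · have := key s.re s.im (by rw [hs])
    rwa [Complex.re_add_im] at this
  · have := key (-s.re) (-s.im) (by rw [hs, abs_neg])
    have e : ((-s.re : ℝ) : ℂ) + ((-s.im : ℝ) : ℂ) * Complex.I = -s := by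
      apply Complex.ext <;> simp
    rwa [e, neg_smul] at this

theorem IsSliceSol.hasDerivAt_shift (hY : IsSliceSol β (K + 1) Y) {x : Fin n → ℝ} {T : ℝ}
    (hx : shift K T x ∈ tower β (K + 1)) :
    HasDerivAt (fun T => Y (shift K T x)) (iso n (K + 1) (slice β (shift K T x))
      (Y (shift K T x)) (realEmb n (Pi.single K 1))) T := by
  have h0 : HasFDerivAt Y _ (shift K T x) := hY.deriv _ hx
  exact h0.comp_hasDerivAt T (Isomonodromy.hasDerivAt_shift K T x)

/-- The Frobenius norm is constant in the coordinate `K`, as the equation has the form `Y' = [N, Y]`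
with skew-Hermitian `N`. -/
theorem IsSliceSol.norm_shift_eq (hβ : ∀ k, ∃ m : ℤ, β k = m * Real.pi)
    (hY : IsSliceSol β (K + 1) Y) {x : Fin n → ℝ} {T₀ : ℝ}
    (hx : ∀ T, T₀ ≤ T → shift K T x ∈ tower β (K + 1)) {T : ℝ} (hT : T₀ ≤ T) :
    ‖Y (shift K T x)‖ = ‖Y (shift K T₀ x)‖ := by
  refine norm_eq_of_deriv_br (y := fun T => Y (shift K T x)) (a := T₀) (b := T)
    (N := fun T => Isomonodromy.lax (K + 1) (slice β (shift K T x)) (realEmb n (Pi.single K 1))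
      (Y (shift K T x)))
    (fun t ht => ?_) (fun t ht => ?_) T (right_mem_Icc.2 hT)
  · rw [← iso_apply]
    exact (hY.hasDerivAt_shift (hx t ht.1)).hasDerivWithinAt
  · exact conjTranspose_lax (isRealPoint_slice hβ _) (realEmb_im _) (hY.skew _ (hx t ht.1))

theorem IsSliceSol.continuousAt {k : ℕ} (hY : IsSliceSol β k Y) {x : Fin n → ℝ}
    (hx : x ∈ tower β k) : ContinuousAt Y x := by
  have h0 : HasFDerivAt Y _ x := hY.deriv _ hx
  exact h0.continuousAt

theorem exists_farBounds (hβ : ∀ k, ∃ m : ℤ, β k = m * Real.pi) (hY : IsSliceSol β (K + 1) Y)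
    {x₀ : Fin n → ℝ} (hx₀ : x₀ ∈ tower β K) :
    ∃ r > 0, ∃ T₀ c L M κ : ℝ, FarBounds β K Y (Metric.closedBall x₀ r) T₀ c L M κ := by
  obtain ⟨r, hr, hball⟩ := Metric.nhds_basis_closedBall.mem_iff.1
    ((isOpen_tower β K).mem_nhds hx₀)
  set m := ‖x₀‖ + r with hm
  have hm0 : 0 ≤ m := by positivity
  set T₀ := farBound n m + m with hT₀
  have hxm : ∀ x ∈ Metric.closedBall x₀ r, ∀ j, -m ≤ x j := by
    intro x hx j
    have h1 : ‖x‖ ≤ m := by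
      have := norm_le_norm_add_norm_sub' x x₀
      rw [Metric.mem_closedBall, dist_eq_norm] at hx
      linarith
    have h2 := norm_le_pi_norm x j
    rw [Real.norm_eq_abs] at h2
    linarith [neg_abs_le (x j)]
  have hfar : ∀ x ∈ Metric.closedBall x₀ r, ∀ T, T₀ ≤ T → farBound n m ≤ shift K T x K := by
    intro x hx T hT
    rw [shift_self]
    linarith [hxm x hx K]
  have hxm' : ∀ x ∈ Metric.closedBall x₀ r, ∀ T, ∀ j < K, -m ≤ shift K T x j := by
    intro x hx T j hj
    rw [shift_of_lt hj]
    exact hxm x hx j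
  have hsucc : ∀ x ∈ Metric.closedBall x₀ r, ∀ T, T₀ ≤ T → shift K T x ∈ tower β (K + 1) :=
    fun x hx T hT => mem_tower_succ_of_far
      (tower_congr (fun j hj => (shift_of_lt hj T x).symm) (hball hx)) hm0 (hxm' x hx T)
      (hfar x hx T hT)
  obtain ⟨L, hL0, hL⟩ := exists_norm_lax_le (k := K)
    ((isCompact_closedBall x₀ r).image (continuous_slice β))
    (by rintro _ ⟨x, hx, rfl⟩; exact slice_mem_levelRegular (hball hx))
  have hc : ContinuousOn (fun x => Y (shift K T₀ x)) (Metric.closedBall x₀ r) := fun x hx =>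
    (ContinuousAt.comp (f := shift K T₀) (g := Y) (hY.continuousAt (hsucc x hx T₀ le_rfl))
      (continuous_shift K T₀).continuousAt).continuousWithinAt
  obtain ⟨M, hM⟩ := (isCompact_closedBall x₀ r).exists_bound_of_continuousOn hc
  have hM0 : 0 ≤ M := (norm_nonneg _).trans (hM x₀ (Metric.mem_closedBall_self hr.le))
  obtain ⟨κ, hκ0, hκ⟩ := norm_ex_smul_le_of_skew (n := n) (β K) M
  have hfb := farBound_nonneg n m
  refine ⟨r, hr, T₀, 2 * n * farBound n m * Real.exp m, L, M, κ, by positivity, hL0, hM0, hκ0,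
    fun x hx => hball hx, hsucc, fun x hx T hT v X => ?_, fun x hx v X => hL _ ⟨x, hx, rfl⟩ v X,
    fun x hx T hT => ?_, hκ⟩
  · refine norm_had_le (fun a b => ?_) (by positivity) X
    refine (norm_epsCoeff_le hm0 (by simpa using hxm' x hx T) (by simpa using hfar x hx T hT) v a
      b).trans ?_
    rw [slice_re, shift_self, mul_assoc _ (Real.exp m), ← Real.exp_add]
    gcongr
    linarith [hxm x hx K]
  · rw [hY.norm_shift_eq hβ (hsucc x hx) hT]
    exact hM x hx

theorem ne_zero_of_mem_tower {x : Fin n → ℝ} (hx : x ∈ tower β (K + 1)) (b : Fin n) (hb : b < K) :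
    1 + Complex.exp (-(slice β x K)) * tailSum K (slice β x) b ≠ 0 := fun h => by
  have := hx K (Nat.lt_succ_self _) b hb
  rw [h] at this
  exact lt_irrefl _ this

/-- The limit of the block `δ_K Y` in the direction of the coordinate `K`. -/
noncomputable def blockLimit (K : Fin n) (Y : (Fin n → ℝ) → Mat n) (x : Fin n → ℝ) : Mat n :=
  limUnder atTop fun T : ℝ => delta K (Y (shift K T x))

/-- The limit of `z_K ^ {ad A} Y` in the direction of the coordinate `K`, where `A` is the limit of
the block `δ_K Y`. -/
noncomputable def descend (β : Fin n → ℝ) (K : Fin n) (Y : (Fin n → ℝ) → Mat n) (x : Fin n → ℝ) :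
    Mat n :=
  limUnder atTop fun T : ℝ => powAd (slice β (shift K T x) K) (blockLimit K Y x) (Y (shift K T x))

variable {B : Set (Fin n → ℝ)} {T₀ c L M κ : ℝ}

theorem FarBounds.norm_eps_br_le (hB : FarBounds β K Y B T₀ c L M κ) {x : Fin n → ℝ} (hx : x ∈ B)
    {T : ℝ} (hT : T₀ ≤ T) (v : Fin n → ℂ) :
    ‖br (had (epsCoeff K (slice β (shift K T x)) v) (Y (shift K T x))) (Y (shift K T x))‖ ≤
      2 * c * M ^ 2 * Real.exp (-T) * ‖v‖ := by
  have h1 := hB.norm x hx T hT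
  have hc := hB.c_nonneg
  have hM := hB.M_nonneg
  calc _ ≤ 2 * ‖had (epsCoeff K (slice β (shift K T x)) v) (Y (shift K T x))‖ *
        ‖Y (shift K T x)‖ := norm_br_le _ _
    _ ≤ 2 * (c * Real.exp (-T) * ‖v‖ * M) * M := by
        gcongr
        exact (hB.eps x hx T hT v _).trans (by gcongr)
    _ = _ := by ring

/-- The block `δ_K Y` converges: its derivative in the coordinate `K` is exponentially small, since
the leading part `-[δ_K Y, Y]` of the equation has the block `-[δ_K Y, δ_K Y] = 0`. -/
theorem FarBounds.blockLimit_spec (hB : FarBounds β K Y B T₀ c L M κ)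
    (hY : IsSliceSol β (K + 1) Y) {x : Fin n → ℝ} (hx : x ∈ B) :
    Tendsto (fun T => delta K (Y (shift K T x))) atTop (𝓝 (blockLimit K Y x)) ∧
      ∀ T, T₀ ≤ T → ‖delta K (Y (shift K T x)) - blockLimit K Y x‖ ≤
        2 * c * M ^ 2 * Real.exp (-T) := by
  set e : Fin n → ℂ := realEmb n (Pi.single K 1) with he
  have hd : ∀ T, T₀ ≤ T → HasDerivAt (fun T => delta K (Y (shift K T x)))
      (delta K (br (had (epsCoeff K (slice β (shift K T x)) e) (Y (shift K T x)))
        (Y (shift K T x)))) T := by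
    intro T hT
    have hmem := hB.mem_succ x hx T hT
    have h1 := ((deltaL n K).restrictScalars ℝ).hasFDerivAt.comp_hasDerivAt T
      (hY.hasDerivAt_shift hmem)
    refine h1.congr_deriv ?_
    have h0 : ∀ j : Fin n, (j : ℕ) < K → e j = 0 := fun j hj => by
      rw [he, realEmb_apply, Pi.single_eq_of_ne (Fin.ne_of_lt (show j < K from hj))]; simp
    rw [ContinuousLinearMap.coe_restrictScalars', deltaL_apply, ← he,
      iso_succ (ne_zero_of_mem_tower hmem), lax_eq_zero _ h0, delta_add, delta_sub,
      delta_smul, delta_br (delta_delta le_rfl _), br_self]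
    simp [br, delta_zero]
  have hb : ∀ T, T₀ ≤ T → ‖delta K (br (had (epsCoeff K (slice β (shift K T x)) e)
      (Y (shift K T x))) (Y (shift K T x)))‖ ≤ 2 * c * M ^ 2 * Real.exp (-T) := by
    intro T hT
    refine (norm_delta_le _ _).trans ((hB.norm_eps_br_le hx hT e).trans ?_)
    have h1 : ‖e‖ ≤ 1 := norm_realEmb_single_le K
    have hc := hB.c_nonneg
    exact mul_le_of_le_one_right (by positivity) h1
  obtain ⟨A, hA, hA'⟩ := exists_tendsto_of_norm_deriv_le_exp hd hb
  have : blockLimit K Y x = A := hA.limUnder_eq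
  rw [this]
  exact ⟨hA, hA'⟩

end Descent

/-! ### Convergence and derivatives of the limit -/

section Descent

variable {n : ℕ} {β : Fin n → ℝ} {K : Fin n} {Y : (Fin n → ℝ) → Mat n}
variable {B : Set (Fin n → ℝ)} {T₀ c L M κ : ℝ}

/-- The derivative of `z ^ {ad A} Y` in a direction in which `A' = [P, A]`. -/
theorem exists_hasFDerivAt_powAd {V : Type*} [NormedAddCommGroup V] [NormedSpace ℝ V]
    {s : V → ℂ} {A Y : V → Mat n} {s' : V →L[ℝ] ℂ} {A' Y' : V →L[ℝ] Mat n} {x : V}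
    (hs : HasFDerivAt s s' x) (hA : HasFDerivAt A A' x) (hY : HasFDerivAt Y Y' x) :
    ∃ D : V →L[ℝ] Mat n, HasFDerivAt (fun x => powAd (s x) (A x) (Y x)) D x ∧
      ∀ h P, A' h = br P (A x) →
        D h = s' h • br (A x) (powAd (s x) (A x) (Y x)) + br P (powAd (s x) (A x) (Y x)) +
          powAd (s x) (A x) (Y' h - br P (Y x)) := by
  have hX := hs.smul hA
  have hE := ((hasFDerivAt_ex (s x • A x)).restrictScalars ℝ).comp x hX
  have hE' := ((hasFDerivAt_ex (-(s x • A x))).restrictScalars ℝ).comp x hX.neg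
  refine ⟨_, (hE.mul' hY).mul' hE', fun h P hP => ?_⟩
  have hX' : (s x • A' + s'.smulRight (A x)) h = s' h • A x + s x • br P (A x) := by
    rw [add_comm, add_apply, ContinuousLinearMap.smulRight_apply,
      smul_apply, hP]
  have hc : Commute (A x) (ex (-(s x • A x))) :=
    commute_ex (((Commute.refl (A x)).smul_right (s x)).neg_right)
  have e1 := fderiv_ex_smul P (A x) (s x) (s' h)
  have e2 := fderiv_ex_neg_smul P (A x) (s x) (s' h)
  have e3 := deriv_powAd_identity hc P (Y x) (Y' h) (s' h) (E := ex (s x • A x))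
  have e4 : ex (s x • A x) * (Y' h - br P (Y x)) * ex (-(s x • A x)) =
    powAd (s x) (A x) (Y' h - br P (Y x)) := rfl
  have e5 : ex (s x • A x) * Y x * ex (-(s x • A x)) = powAd (s x) (A x) (Y x) := rfl
  rw [e4, e5] at e3
  rw [← e3, ← e1, ← e2, ← hX']
  simp only [add_apply, smul_apply, smul_eq_mul,
    ContinuousLinearMap.comp_apply, ContinuousLinearMap.coe_restrictScalars',
    neg_apply, MulOpposite.smul_eq_mul_unop, MulOpposite.unop_op,
    Function.comp_apply, Pi.mul_apply]
  rw [add_comm]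
  congr 2
  rw [add_comm]
  rfl

/-- Limit of a family with exponentially converging derivatives. -/
theorem hasFDerivAt_of_exp_close {V E : Type*} [NormedAddCommGroup V] [NormedSpace ℝ V]
    [NormedAddCommGroup E] [NormedSpace ℝ E] {f : ℝ → V → E} {f' : ℝ → V → V →L[ℝ] E}
    {g : V → E} {g' : V → V →L[ℝ] E} {s : Set V} (hs : IsOpen s) {T₀ C : ℝ} (hC0 : 0 ≤ C)
    (hf : ∀ T, T₀ ≤ T → ∀ x ∈ s, HasFDerivAt (f T) (f' T x) x)
    (hC : ∀ T, T₀ ≤ T → ∀ x ∈ s, ∀ h, ‖f' T x h - g' x h‖ ≤ C * Real.exp (-T) * ‖h‖)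
    (hg : ∀ x ∈ s, Tendsto (fun T => f T x) atTop (𝓝 (g x))) {x : V} (hx : x ∈ s) :
    HasFDerivAt g (g' x) x := by
  have ht : Tendsto (fun m : ℕ => T₀ + (m : ℝ)) atTop atTop :=
    tendsto_atTop_add_const_left _ _ tendsto_natCast_atTop_atTop
  have hm : ∀ m : ℕ, T₀ ≤ T₀ + (m : ℝ) := fun m => le_add_of_nonneg_right m.cast_nonneg
  refine hasFDerivAt_of_tendstoUniformlyOn (l := atTop) (f := fun m : ℕ => f (T₀ + m))
    (f' := fun m : ℕ => f' (T₀ + m)) hs ?_ (fun m x hx => hf _ (hm m) x hx)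
    (fun x hx => (hg x hx).comp ht) hx
  rw [Metric.tendstoUniformlyOn_iff]
  intro ε hε
  have hlim : Tendsto (fun t : ℝ => C * Real.exp (-t)) atTop (𝓝 0) := by
    simpa using (Real.tendsto_exp_neg_atTop_nhds_zero).const_mul C
  filter_upwards [(hlim.comp ht).eventually (gt_mem_nhds hε)] with m hmε x hx
  rw [dist_comm, dist_eq_norm]
  refine lt_of_le_of_lt ?_ hmε
  exact ContinuousLinearMap.opNorm_le_bound _ (by simp only [Function.comp_apply]; positivity)
    fun h => hC _ (hm m) x hx h

theorem norm_le_of_tendsto_atTop {f : ℝ → Mat n} {A : Mat n} (hf : Tendsto f atTop (𝓝 A)) {M T₀ : ℝ}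
    (h : ∀ T, T₀ ≤ T → ‖f T‖ ≤ M) : ‖A‖ ≤ M :=
  le_of_tendsto hf.norm ((eventually_ge_atTop T₀).mono h)

theorem FarBounds.norm_blockLimit_le (hB : FarBounds β K Y B T₀ c L M κ)
    (hY : IsSliceSol β (K + 1) Y) {x : Fin n → ℝ} (hx : x ∈ B) : ‖blockLimit K Y x‖ ≤ M :=
  norm_le_of_tendsto_atTop (hB.blockLimit_spec hY hx).1
    fun T hT => (norm_delta_le _ _).trans (hB.norm x hx T hT)

theorem FarBounds.conjTranspose_blockLimit (hB : FarBounds β K Y B T₀ c L M κ)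
    (hY : IsSliceSol β (K + 1) Y) {x : Fin n → ℝ} (hx : x ∈ B) :
    (blockLimit K Y x)ᴴ = -blockLimit K Y x := by
  have h := (hB.blockLimit_spec hY hx).1
  have h1 := ((conjTransposeL n).continuous.tendsto _).comp h
  refine tendsto_nhds_unique (h1.congr' ?_) h.neg
  filter_upwards [eventually_ge_atTop T₀] with T hT
  have := skew_delta (k := K) (hY.skew _ (hB.mem_succ x hx T hT))
  rw [delta_delta (Nat.le_succ _)] at this
  exact this

theorem FarBounds.delta_blockLimit (hB : FarBounds β K Y B T₀ c L M κ)
    (hY : IsSliceSol β (K + 1) Y) {x : Fin n → ℝ} (hx : x ∈ B) :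
    delta K (blockLimit K Y x) = blockLimit K Y x := by
  have h := (hB.blockLimit_spec hY hx).1
  refine tendsto_nhds_unique (((deltaL n K).continuous.tendsto _).comp h) ?_
  simpa [Function.comp_def, delta_delta le_rfl] using h

theorem lax_slice_shift (x : Fin n → ℝ) (T : ℝ) (v : Fin n → ℂ) (X : Mat n) :
    lax K (slice β (shift K T x)) v X = lax K (slice β x) v X :=
  lax_congr (fun j hj => by simp [slice, shift_of_lt hj]) v X

theorem IsSliceSol.hasFDerivAt_shift (hY : IsSliceSol β (K + 1) Y) {x : Fin n → ℝ} {T : ℝ}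
    (hx : shift K T x ∈ tower β (K + 1)) :
    HasFDerivAt (fun x => Y (shift K T x)) (((iso n (K + 1) (slice β (shift K T x))
      (Y (shift K T x))).restrictScalars ℝ).comp (realEmb n)) x := by
  have h0 : HasFDerivAt Y _ (shift K T x) := hY.deriv _ hx
  exact h0.comp x (Isomonodromy.hasFDerivAt_shift K T x)

theorem FarBounds.norm_lax_realEmb (hB : FarBounds β K Y B T₀ c L M κ) {x : Fin n → ℝ} (hx : x ∈ B)
    (h : Fin n → ℝ) (X : Mat n) :
    ‖Isomonodromy.lax K (slice β x) (realEmb n h) X‖ ≤ L * ‖h‖ * ‖X‖ := by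
  have hL := hB.L_nonneg
  exact (hB.lax x hx _ X).trans (by gcongr; exact norm_realEmb_le h)

theorem FarBounds.norm_eps_realEmb (hB : FarBounds β K Y B T₀ c L M κ) {x : Fin n → ℝ} (hx : x ∈ B)
    {T : ℝ} (hT : T₀ ≤ T) (h : Fin n → ℝ) :
    ‖br (had (epsCoeff K (slice β (shift K T x)) (realEmb n h)) (Y (shift K T x)))
      (Y (shift K T x))‖ ≤ 2 * c * M ^ 2 * Real.exp (-T) * ‖h‖ := by
  have hc := hB.c_nonneg
  exact (hB.norm_eps_br_le hx hT _).trans (by gcongr; exact norm_realEmb_le h)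

/-- The limit of the block solves the equation of level `K`. -/
theorem FarBounds.hasSliceDeriv_blockLimit (hB : FarBounds β K Y B T₀ c L M κ)
    (hY : IsSliceSol β (K + 1) Y) {s : Set (Fin n → ℝ)} (hs : IsOpen s) (hsB : s ⊆ B)
    {x : Fin n → ℝ} (hx : x ∈ s) : HasSliceDeriv (iso n K) β (blockLimit K Y) x := by
  have hc := hB.c_nonneg
  have hL := hB.L_nonneg
  have hM := hB.M_nonneg
  refine hasFDerivAt_of_exp_close (T₀ := T₀) (C := 4 * L * M * (2 * c * M ^ 2) + 2 * c * M ^ 2)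
    (f := fun T x => delta K (Y (shift K T x)))
    (f' := fun T x => ((deltaL n K).restrictScalars ℝ).comp (((iso n (K + 1)
      (slice β (shift K T x)) (Y (shift K T x))).restrictScalars ℝ).comp (realEmb n)))
    (g' := fun x => ((iso n K (slice β x) (blockLimit K Y x)).restrictScalars ℝ).comp (realEmb n))
    hs (by positivity) (fun T hT x hx => ?_) (fun T hT x hx h => ?_)
    (fun x hx => (hB.blockLimit_spec hY (hsB hx)).1) hx
  · exact ((deltaL n K).restrictScalars ℝ).hasFDerivAt.comp x
      (hY.hasFDerivAt_shift (hB.mem_succ x (hsB hx) T hT))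
  · have hmem := hB.mem_succ x (hsB hx) T hT
    set Z := Y (shift K T x) with hZ
    set A := blockLimit K Y x with hA
    have e1 : (((deltaL n K).restrictScalars ℝ).comp (((iso n (K + 1)
        (slice β (shift K T x)) Z).restrictScalars ℝ).comp (realEmb n))) h =
        br (Isomonodromy.lax K (slice β x) (realEmb n h) (delta K Z)) (delta K Z) +
        delta K (br (had (epsCoeff K (slice β (shift K T x)) (realEmb n h)) Z) Z) := by
      change delta K (iso n (K + 1) (slice β (shift K T x)) Z (realEmb n h)) = _
      rw [iso_succ (ne_zero_of_mem_tower hmem), lax_slice_shift, delta_add, delta_sub, delta_smul,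
        delta_br (delta_delta le_rfl _), br_self, smul_zero, sub_zero, ← lax_delta,
        delta_br (by rw [lax_delta, delta_lax])]
    have e2 : (((iso n K (slice β x) A).restrictScalars ℝ).comp (realEmb n)) h =
        br (Isomonodromy.lax K (slice β x) (realEmb n h) A) A := iso_apply _ _ _ _
    rw [e1, e2, add_sub_right_comm]
    have h1 := norm_br_lax_sub_le (k := K) (w := slice β x) (v := realEmb n h)
      (L := L * ‖h‖) (M := M) (by positivity) (hB.norm_lax_realEmb (hsB hx) h)
      ((norm_delta_le K Z).trans (hB.norm x (hsB hx) T hT)) (hB.norm_blockLimit_le hY (hsB hx))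
    have h2 := (hB.blockLimit_spec hY (hsB hx)).2 T hT
    have h3 := (norm_delta_le K _).trans (hB.norm_eps_realEmb (hsB hx) hT h)
    calc _ ≤ _ := norm_add_le _ _
      _ ≤ 4 * (L * ‖h‖) * M * (2 * c * M ^ 2 * Real.exp (-T)) +
          2 * c * M ^ 2 * Real.exp (-T) * ‖h‖ := by
        refine add_le_add (h1.trans ?_) h3
        gcongr
      _ = _ := by ring

theorem FarBounds.norm_powAd_le (hB : FarBounds β K Y B T₀ c L M κ) {A : Mat n} (hA : Aᴴ = -A)
    (hAM : ‖A‖ ≤ M) {s : ℂ} (hs : s.im = β K) (X : Mat n) : ‖powAd s A X‖ ≤ κ ^ 2 * ‖X‖ := by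
  have h := hB.exp A hA hAM s hs
  have hκ := hB.κ_nonneg
  calc _ ≤ _ := Isomonodromy.norm_powAd_le s A X
    _ ≤ κ * ‖X‖ * κ := by gcongr; exacts [h.1, h.2]
    _ = _ := by ring

/-- The conjugate `z_K ^ {ad A} Y` converges: conjugation removes the leading part `-[A, Y]` of the
equation, and what remains is exponentially small. -/
theorem FarBounds.descend_spec (hB : FarBounds β K Y B T₀ c L M κ)
    (hY : IsSliceSol β (K + 1) Y) {x : Fin n → ℝ} (hx : x ∈ B) :
    Tendsto (fun T => powAd (slice β (shift K T x) K) (blockLimit K Y x) (Y (shift K T x))) atTop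
      (𝓝 (descend β K Y x)) ∧
      ∀ T, T₀ ≤ T → ‖powAd (slice β (shift K T x) K) (blockLimit K Y x) (Y (shift K T x)) -
        descend β K Y x‖ ≤ κ ^ 2 * (4 * c * M ^ 3 + 2 * c * M ^ 2) * Real.exp (-T) := by
  set A := blockLimit K Y x with hA
  set e : Fin n → ℂ := realEmb n (Pi.single K 1) with he
  have hAs := hB.conjTranspose_blockLimit hY hx
  have hAM := hB.norm_blockLimit_le hY hx
  have hc := hB.c_nonneg
  have hM := hB.M_nonneg
  have h0 : ∀ j : Fin n, (j : ℕ) < K → e j = 0 := fun j hj => by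
    rw [he, realEmb_apply, Pi.single_eq_of_ne (Fin.ne_of_lt (show j < K from hj))]; simp
  have heK : e K = 1 := by simp [he]
  have hs : ∀ T, HasFDerivAt (fun T : ℝ => slice β (shift K T x) K)
      (ContinuousLinearMap.toSpanSingleton ℝ (1 : ℂ)) T := by
    intro T
    have h1 : HasDerivAt (fun T : ℝ => ((T : ℂ) + ((x K : ℂ) + β K * Complex.I))) 1 T :=
      (Complex.ofRealCLM.hasDerivAt (x := T)).add_const _
    have h2 : (fun T : ℝ => slice β (shift K T x) K) =
        fun T : ℝ => ((T : ℂ) + ((x K : ℂ) + β K * Complex.I)) := by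
      ext T; simp [slice]; ring
    rw [h2]; exact h1.hasFDerivAt
  -- the derivative is the conjugate of `[A, Y] + Y'`
  have hd : ∀ T, T₀ ≤ T →
      HasDerivAt (fun T => powAd (slice β (shift K T x) K) A (Y (shift K T x)))
      (powAd (slice β (shift K T x) K) A (br (A - delta K (Y (shift K T x))) (Y (shift K T x)) +
        br (had (epsCoeff K (slice β (shift K T x)) e) (Y (shift K T x))) (Y (shift K T x)))) T := by
    intro T hT
    have hmem := hB.mem_succ x hx T hT
    obtain ⟨D, hD, hD'⟩ := exists_hasFDerivAt_powAd (hs T) (hasFDerivAt_const A T)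
      (hY.hasDerivAt_shift hmem).hasFDerivAt
    refine hD.hasDerivAt.congr_deriv ?_
    rw [hD' 1 0 (by simp [br])]
    rw [ContinuousLinearMap.toSpanSingleton_apply, ContinuousLinearMap.toSpanSingleton_apply,
      one_smul, one_smul, one_smul, iso_succ (ne_zero_of_mem_tower hmem), ← he,
      lax_eq_zero _ h0, heK, one_smul]
    have hz : ∀ X : Mat n, br 0 X = 0 := fun X => by simp [br]
    have hbA : br A (powAd (slice β (shift K T x) K) A (Y (shift K T x))) =
        powAd (slice β (shift K T x) K) A (br A (Y (shift K T x))) := by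
      rw [powAd_br, powAd_self]
    simp only [hz, add_zero, sub_zero, zero_sub]
    rw [hbA, ← powAd_add_right, br_sub_left]
    congr 1
    abel
  have hb : ∀ T, T₀ ≤ T → ‖powAd (slice β (shift K T x) K) A
      (br (A - delta K (Y (shift K T x))) (Y (shift K T x)) +
        br (had (epsCoeff K (slice β (shift K T x)) e) (Y (shift K T x))) (Y (shift K T x)))‖ ≤
      κ ^ 2 * (4 * c * M ^ 3 + 2 * c * M ^ 2) * Real.exp (-T) := by
    intro T hT
    refine (hB.norm_powAd_le hAs hAM (by simp) _).trans ?_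
    rw [mul_assoc (κ ^ 2)]
    refine mul_le_mul_of_nonneg_left ?_ (by positivity)
    have h1 := (hB.blockLimit_spec hY hx).2 T hT
    rw [norm_sub_rev] at h1
    have h2 := hB.norm_eps_br_le hx hT e
    have h3 := norm_realEmb_single_le K
    calc _ ≤ _ := norm_add_le _ _
      _ ≤ 2 * (2 * c * M ^ 2 * Real.exp (-T)) * M + 2 * c * M ^ 2 * Real.exp (-T) := by
        refine add_le_add ((norm_br_le _ _).trans ?_)
          (h2.trans (mul_le_of_le_one_right (by positivity) h3))
        gcongr
        exact hB.norm x hx T hT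
      _ = _ := by ring
  obtain ⟨Z, hZ, hZ'⟩ := exists_tendsto_of_norm_deriv_le_exp hd hb
  have : descend β K Y x = Z := hZ.limUnder_eq
  rw [this]
  exact ⟨hZ, hZ'⟩

theorem FarBounds.delta_descend (hB : FarBounds β K Y B T₀ c L M κ)
    (hY : IsSliceSol β (K + 1) Y) {x : Fin n → ℝ} (hx : x ∈ B) :
    delta K (descend β K Y x) = blockLimit K Y x := by
  set A := blockLimit K Y x with hA
  have hAd := hB.delta_blockLimit hY hx
  have h1 := ((deltaL n K).continuous.tendsto _).comp (hB.descend_spec hY hx).1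
  refine tendsto_nhds_unique h1 ?_
  have h2 : ∀ T, (deltaL n K ∘ fun T => powAd (slice β (shift K T x) K) A (Y (shift K T x))) T =
      A + powAd (slice β (shift K T x) K) A (delta K (Y (shift K T x)) - A) := by
    intro T
    rw [Function.comp_apply, deltaL_apply, delta_powAd hAd, powAd_sub_right, powAd_self]
    abel
  have h3 : Tendsto (fun T => powAd (slice β (shift K T x) K) A (delta K (Y (shift K T x)) - A))
      atTop (𝓝 0) := by
    have h4 := ((hB.blockLimit_spec hY hx).1.sub_const A).norm.const_mul (κ ^ 2)
    rw [← hA, sub_self, norm_zero, mul_zero] at h4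
    exact squeeze_zero_norm (fun T => hB.norm_powAd_le (hB.conjTranspose_blockLimit hY hx)
      (hB.norm_blockLimit_le hY hx) (by simp) _) h4
  have h5 := h3.const_add A
  rw [add_zero] at h5
  exact h5.congr fun T => (h2 T).symm

end Descent

/-! ### The limit solves the equation of the previous level -/

section Descent

variable {n : ℕ} {β : Fin n → ℝ} {K : Fin n} {Y : (Fin n → ℝ) → Mat n}
variable {B : Set (Fin n → ℝ)} {T₀ c L M κ : ℝ}

/-- The limit solves the equation of level `K`: the conjugates `f T` solve it up to exponentially
small terms. -/
theorem FarBounds.hasSliceDeriv_descend (hB : FarBounds β K Y B T₀ c L M κ)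
    (hY : IsSliceSol β (K + 1) Y) {s : Set (Fin n → ℝ)} (hs : IsOpen s) (hsB : s ⊆ B)
    {x : Fin n → ℝ} (hx : x ∈ s) : HasSliceDeriv (iso n K) β (descend β K Y) x := by
  have hc := hB.c_nonneg
  have hL := hB.L_nonneg
  have hM := hB.M_nonneg
  have hκ := hB.κ_nonneg
  set C₁ := 2 * c * M ^ 2 with hC₁
  set C₂ := κ ^ 2 * (4 * c * M ^ 3 + 2 * c * M ^ 2) with hC₂
  set f : ℝ → (Fin n → ℝ) → Mat n := fun T x =>
    powAd (slice β (shift K T x) K) (blockLimit K Y x) (Y (shift K T x)) with hf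
  have hD : ∀ T, T₀ ≤ T → ∀ x ∈ s, ∃ D : (Fin n → ℝ) →L[ℝ] Mat n, HasFDerivAt (f T) D x ∧
      ∀ h P, P = Isomonodromy.lax K (slice β x) (realEmb n h) (blockLimit K Y x) →
        D h = br P (f T x) + powAd (slice β (shift K T x) K) (blockLimit K Y x)
          ((h K : ℂ) • br (blockLimit K Y x - delta K (Y (shift K T x))) (Y (shift K T x)) +
          br (Isomonodromy.lax K (slice β x) (realEmb n h)
            (delta K (Y (shift K T x)) - blockLimit K Y x)) (Y (shift K T x)) +
          br (had (epsCoeff K (slice β (shift K T x)) (realEmb n h)) (Y (shift K T x)))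
            (Y (shift K T x))) := by
    intro T hT x hx
    have hmem := hB.mem_succ x (hsB hx) T hT
    have hs' : HasFDerivAt (fun x => slice β (shift K T x) K)
        ((ContinuousLinearMap.proj (R := ℝ) (φ := fun _ : Fin n => ℂ) K).comp (realEmb n)) x :=
      (ContinuousLinearMap.proj (R := ℝ) (φ := fun _ : Fin n => ℂ) K).hasFDerivAt.comp x
        ((hasFDerivAt_slice β (shift K T x)).comp x (hasFDerivAt_shift K T x))
    obtain ⟨D, hD, hD'⟩ := exists_hasFDerivAt_powAd hs'
      (hB.hasSliceDeriv_blockLimit hY hs hsB hx) (hY.hasFDerivAt_shift hmem)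
    refine ⟨D, hD, fun h P hP => ?_⟩
    have hA' : (((iso n K (slice β x) (blockLimit K Y x)).restrictScalars ℝ).comp (realEmb n)) h =
        br P (blockLimit K Y x) := by rw [hP]; exact iso_apply _ _ _ _
    have hY' : (((iso n (K + 1) (slice β (shift K T x)) (Y (shift K T x))).restrictScalars ℝ).comp
        (realEmb n)) h =
        br (Isomonodromy.lax K (slice β x) (realEmb n h) (delta K (Y (shift K T x))))
          (Y (shift K T x)) - (h K : ℂ) • br (delta K (Y (shift K T x))) (Y (shift K T x)) +
        br (had (epsCoeff K (slice β (shift K T x)) (realEmb n h)) (Y (shift K T x)))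
            (Y (shift K T x)) := by
      change iso n (K + 1) (slice β (shift K T x)) (Y (shift K T x)) (realEmb n h) = _
      rw [iso_succ (ne_zero_of_mem_tower hmem), lax_slice_shift, lax_delta, realEmb_apply]
    have hs'h : ((ContinuousLinearMap.proj (R := ℝ) (φ := fun _ : Fin n => ℂ) K).comp
        (realEmb n)) h = (h K : ℂ) := rfl
    rw [hD' h P hA', hY', hs'h, add_comm (_ • _), add_assoc]
    congr 1
    have hbA : br (blockLimit K Y x) (f T x) = powAd (slice β (shift K T x) K) (blockLimit K Y x)
        (br (blockLimit K Y x) (Y (shift K T x))) := by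
      rw [hf, powAd_br, powAd_self]
    change (h K : ℂ) • br (blockLimit K Y x) (f T x) + _ = _
    rw [hbA, ← powAd_smul_right, ← powAd_add_right, lax_sub, br_sub_left, br_sub_left, hP, smul_sub]
    congr 1
    abel
  refine hasFDerivAt_of_exp_close (T₀ := T₀)
    (C := 2 * (L * M) * C₂ + κ ^ 2 * (2 * C₁ * M + 2 * (L * C₁) * M + 2 * c * M ^ 2))
    (f := f) (f' := fun T x => fderiv ℝ (f T) x)
    (g' := fun x => ((iso n K (slice β x) (descend β K Y x)).restrictScalars ℝ).comp (realEmb n))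
    hs (by positivity) (fun T hT x hx => ?_) (fun T hT x hx h => ?_)
    (fun x hx => (hB.descend_spec hY (hsB hx)).1) hx
  · obtain ⟨D, hD, -⟩ := hD T hT x hx
    exact hD.differentiableAt.hasFDerivAt
  · obtain ⟨D, hD, hD'⟩ := hD T hT x hx
    have hxB := hsB hx
    set A := blockLimit K Y x with hA
    set Z := Y (shift K T x) with hZ
    set P := Isomonodromy.lax K (slice β x) (realEmb n h) A with hP
    have e2 : (((iso n K (slice β x) (descend β K Y x)).restrictScalars ℝ).comp (realEmb n)) h =
        br P (descend β K Y x) := by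
      have h1 := iso_apply K (slice β x) (realEmb n h) (descend β K Y x)
      rw [← lax_delta, hB.delta_descend hY hxB] at h1
      exact h1
    change ‖fderiv ℝ (f T) x h - (((iso n K (slice β x) (descend β K Y x)).restrictScalars ℝ).comp
      (realEmb n)) h‖ ≤ _
    rw [e2, hD.fderiv, hD' h P rfl, add_sub_right_comm, ← br_sub_right]
    have h1 := (hB.descend_spec hY hxB).2 T hT
    have h2 := (hB.blockLimit_spec hY hxB).2 T hT
    have h2' := h2
    rw [norm_sub_rev] at h2'
    have h3 := hB.norm_eps_realEmb hxB hT h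
    have hPn : ‖P‖ ≤ L * ‖h‖ * M := (hB.norm_lax_realEmb hxB h A).trans
      (by gcongr; exact hB.norm_blockLimit_le hY hxB)
    have hZn : ‖Z‖ ≤ M := hB.norm x hxB T hT
    have hhK : ‖(h K : ℂ)‖ ≤ ‖h‖ := by
      rw [Complex.norm_real]; exact norm_le_pi_norm h K
    -- the four error terms: `f T` against its limit, the block against its limit (twice), and
    -- the deviation `epsCoeff`
    have b1 : ‖br P (f T x - descend β K Y x)‖ ≤ 2 * (L * ‖h‖ * M) * (C₂ * Real.exp (-T)) :=
      (norm_br_le _ _).trans (by gcongr)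
    have b2 : ‖(h K : ℂ) • br (A - delta K Z) Z‖ ≤ ‖h‖ * (2 * (C₁ * Real.exp (-T)) * M) := by
      rw [norm_smul]
      exact mul_le_mul hhK ((norm_br_le _ _).trans (by gcongr)) (norm_nonneg _) (norm_nonneg _)
    have b3 : ‖br (Isomonodromy.lax K (slice β x) (realEmb n h) (delta K Z - A)) Z‖ ≤
        2 * (L * ‖h‖ * (C₁ * Real.exp (-T))) * M := by
      refine (norm_br_le _ _).trans ?_
      gcongr
      exact (hB.norm_lax_realEmb hxB h _).trans (by gcongr)
    refine (norm_add_le _ _).trans ((add_le_add b1 ((hB.norm_powAd_le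
      (hB.conjTranspose_blockLimit hY hxB) (hB.norm_blockLimit_le hY hxB) (by simp) _).trans
      (mul_le_mul_of_nonneg_left ((norm_add_le _ _).trans (add_le_add ((norm_add_le _ _).trans
        (add_le_add b2 b3)) h3)) (by positivity)))).trans (le_of_eq ?_))
    ring

/-- The limit solution is a solution of level `K`. -/
theorem isSliceSol_descend (hβ : ∀ k, ∃ m : ℤ, β k = m * Real.pi) (hY : IsSliceSol β (K + 1) Y) :
    IsSliceSol β K (descend β K Y) := by
  refine ⟨fun x hx => ?_, fun x hx => ?_, fun x hx j => ?_⟩ <;>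
    obtain ⟨r, hr, T₀, c, L, M, κ, hB⟩ := exists_farBounds hβ hY hx <;>
    have hxB := Metric.mem_closedBall_self (x := x) hr.le
  · exact hB.hasSliceDeriv_descend hY Metric.isOpen_ball Metric.ball_subset_closedBall
      (Metric.mem_ball_self hr)
  · rw [hB.delta_descend hY hxB]
    exact hB.conjTranspose_blockLimit hY hxB
  · have hA := hB.conjTranspose_blockLimit hY hxB
    rcases le_total j (K : ℕ) with hj | hj
    · rw [← delta_delta hj, hB.delta_descend hY hxB]
      exact imagSpectrum_of_skew (skew_delta hA)
    · have hAd : delta j (blockLimit K Y x) = blockLimit K Y x := by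
        rw [← hB.delta_blockLimit hY hxB, delta_delta' hj]
      refine imagSpectrum_of_tendsto (((deltaL n j).continuous.tendsto _).comp
        (hB.descend_spec hY hxB).1) ?_
      filter_upwards [eventually_ge_atTop T₀] with T hT
      rw [Function.comp_apply, deltaL_apply, delta_powAd hAd, powAd_eq_ex]
      exact imagSpectrum_conj (ex_mul_neg _) (hY.spec _ (hB.mem_succ x hxB T hT) j)

/-- The solution of level `K + 1` is asymptotic to `z_K ^ {-ad A}` applied to the solution of level
`K`, locally uniformly in the first `K` coordinates. -/
theorem exists_asymptotic_descend (hβ : ∀ k, ∃ m : ℤ, β k = m * Real.pi)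
    (hY : IsSliceSol β (K + 1) Y) {x₀ : Fin n → ℝ} (hx₀ : x₀ ∈ tower β K) :
    ∃ r > 0, ∃ R C : ℝ, 0 ≤ C ∧ ∀ x, (∀ j : Fin n, (j : ℕ) < K → |x j - x₀ j| ≤ r) → R ≤ x K →
      x ∈ tower β (K + 1) ∧
      ‖Y x - powAd (-(slice β x K)) (delta K (descend β K Y x)) (descend β K Y x)‖ ≤
        C * Real.exp (-(x K)) := by
  obtain ⟨r, hr, T₀, c, L, M, κ, hB⟩ := exists_farBounds hβ hY hx₀
  have hc := hB.c_nonneg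
  have hM := hB.M_nonneg
  have hκ := hB.κ_nonneg
  refine ⟨r, hr, T₀ + x₀ K,
    κ ^ 2 * (κ ^ 2 * (4 * c * M ^ 3 + 2 * c * M ^ 2)) * Real.exp (x₀ K), by positivity,
    fun x hx hxR => ?_⟩
  -- replace the coordinates from the `K`-th on by those of `x₀` and shift back to `x K`
  set T := x K - x₀ K with hT
  have hTT : T₀ ≤ T := by linarith
  set x' : Fin n → ℝ := fun j => if (j : ℕ) < K then x j else x₀ j with hx'
  have hx'j : ∀ j : Fin n, (j : ℕ) < K → x' j = x j := fun j hj => if_pos hj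
  have hx'B : x' ∈ Metric.closedBall x₀ r := by
    rw [Metric.mem_closedBall, dist_pi_le_iff hr.le]
    intro j
    rw [Real.dist_eq]
    by_cases hj : (j : ℕ) < K
    · rw [hx'j j hj]; exact hx j hj
    · rw [show x' j = x₀ j from if_neg hj, sub_self, abs_zero]; exact hr.le
  have hx'K : shift K T x' K = x K := by
    rw [shift_self]; simp [hx', hT]
  have hcongr : ∀ j : Fin n, (j : ℕ) < K + 1 → shift K T x' j = x j := by
    intro j hj
    rcases Nat.lt_succ_iff_lt_or_eq.1 hj with h | h
    · rw [shift_of_lt h, hx'j j h]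
    · obtain rfl : j = K := Fin.ext h
      exact hx'K
  have hmem := hB.mem_succ x' hx'B T hTT
  have hxt : x ∈ tower β (K + 1) := tower_congr hcongr hmem
  have e1 : Y (shift K T x') = Y x := hY.congr hmem hcongr
  have e2 : descend β K Y x' = descend β K Y x :=
    (isSliceSol_descend hβ hY).congr (hB.mem x' hx'B) hx'j
  have e3 : slice β (shift K T x') K = slice β x K := by
    rw [slice, slice, hx'K]
  have h1 := (hB.descend_spec hY hx'B).2 T hTT
  have hA : blockLimit K Y x' = delta K (descend β K Y x) := by
    rw [← e2, hB.delta_descend hY hx'B]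
  have hAs := hB.conjTranspose_blockLimit hY hx'B
  have hAM := hB.norm_blockLimit_le hY hx'B
  rw [hA] at hAs hAM
  rw [e1, e2, e3, hA] at h1
  refine ⟨hxt, ?_⟩
  set A := delta K (descend β K Y x) with hAdef
  have e4 : Y x - powAd (-(slice β x K)) A (descend β K Y x) = powAd (-(slice β x K)) A
      (powAd (slice β x K) A (Y x) - descend β K Y x) := by
    rw [powAd_sub_right, powAd_neg_powAd]
  have hexp := hB.exp A hAs hAM (slice β x K) (by simp)
  have h2 : ‖powAd (-(slice β x K)) A (powAd (slice β x K) A (Y x) - descend β K Y x)‖ ≤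
      κ ^ 2 * ‖powAd (slice β x K) A (Y x) - descend β K Y x‖ := by
    refine (Isomonodromy.norm_powAd_le _ _ _).trans ?_
    rw [neg_smul, neg_neg]
    calc _ ≤ κ * ‖powAd (slice β x K) A (Y x) - descend β K Y x‖ * κ := by
          gcongr; exacts [hexp.2, hexp.1]
      _ = _ := by ring
  rw [e4]
  refine h2.trans ((mul_le_mul_of_nonneg_left h1 (by positivity)).trans (le_of_eq ?_))
  rw [hT, neg_sub, Real.exp_sub, Real.exp_neg]
  field_simp

end Descent

/-! ### Polynomials in `s` and exponentials of imaginary rate -/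

section ExpPoly

variable {n : ℕ}

/-- The functions `s ^ t * exp (c s)` with `c` purely imaginary. -/
def expMonomials : Submonoid (ℂ → ℂ) where
  carrier := {g | ∃ (c : ℂ) (t : ℕ), c.re = 0 ∧ g = fun s => s ^ t * Complex.exp (c * s)}
  one_mem' := ⟨0, 0, rfl, by ext s; simp⟩
  mul_mem' := by
    rintro _ _ ⟨c, t, hc, rfl⟩ ⟨c', t', hc', rfl⟩
    refine ⟨c + c', t + t', by simp [hc, hc'], ?_⟩
    ext s
    rw [Pi.mul_apply, add_mul, Complex.exp_add, pow_add]
    ring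

/-- The algebra spanned by the functions `s ^ t * exp (c s)` with `c` purely imaginary. -/
noncomputable def expPoly : Subalgebra ℂ (ℂ → ℂ) := Algebra.adjoin ℂ (expMonomials : Set (ℂ → ℂ))

theorem mem_expPoly_monomial {c : ℂ} (hc : c.re = 0) (t : ℕ) :
    (fun s : ℂ => s ^ t * Complex.exp (c * s)) ∈ expPoly :=
  Algebra.subset_adjoin ⟨c, t, hc, rfl⟩

theorem expPoly_induction {p : (ℂ → ℂ) → Prop}
    (mono : ∀ (c : ℂ) (t : ℕ), c.re = 0 → p fun s => s ^ t * Complex.exp (c * s))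
    (zero : p 0) (add : ∀ f g, p f → p g → p (f + g)) (smul : ∀ (a : ℂ) f, p f → p (a • f))
    {f : ℂ → ℂ} (hf : f ∈ expPoly) : p f := by
  have h : f ∈ Submodule.span ℂ (expMonomials : Set (ℂ → ℂ)) := by
    rw [← Submonoid.closure_eq expMonomials, ← Algebra.adjoin_eq_span]
    exact hf
  refine Submodule.span_induction ?_ zero (fun f g _ _ => add f g) (fun a f _ => smul a f) h
  rintro _ ⟨c, t, hc, rfl⟩
  exact mono c t hc

/-- The span in which formal primitives are sought. -/
noncomputable def primSpan : Submodule ℂ (ℂ → ℂ) :=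
  Submodule.span ℂ
    {g : ℂ → ℂ | ∃ (c : ℂ) (t : ℕ), (c ≠ 0 ∨ t ≠ 0) ∧ g = fun s => s ^ t * Complex.exp (c * s)}

/-- The equation `F' = m F + s ^ t exp (c s)` is solved by integration by parts, with induction on
`t`. As `c` is imaginary and `m ≥ 1`, the exponent `c - m` never vanishes, and no logarithmic
primitive occurs. -/
theorem exists_exp_primitive_monomial {c : ℂ} (hc : c.re = 0) {m : ℕ} (hm : 1 ≤ m) (t : ℕ) :
    ∃ F ∈ expPoly, (fun s => Complex.exp (-(m : ℂ) * s) * F s) ∈ primSpan ∧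
      ∀ s, HasDerivAt F (m * F s + s ^ t * Complex.exp (c * s)) s := by
  have hcm : c - m ≠ 0 := by
    intro h
    have := congrArg Complex.re h
    simp [hc] at this
    omega
  have hmono : ∀ t : ℕ, (fun s => Complex.exp (-(m : ℂ) * s) * (s ^ t * Complex.exp (c * s))) ∈
      primSpan := fun t => by
    refine Submodule.subset_span ⟨c - m, t, Or.inl hcm, ?_⟩
    ext s
    rw [mul_left_comm, ← Complex.exp_add]
    congr 2; ring
  have hd : ∀ (t : ℕ) (s : ℂ), HasDerivAt (fun s : ℂ => s ^ t * Complex.exp (c * s))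
      (t * s ^ (t - 1) * Complex.exp (c * s) + s ^ t * (Complex.exp (c * s) * c)) s := by
    intro t s
    refine (hasDerivAt_pow t s).mul ?_
    have h1 : HasDerivAt (fun s => c * s) c s := by simpa using (hasDerivAt_id s).const_mul c
    exact h1.cexp
  induction t with
  | zero =>
    refine ⟨(c - m)⁻¹ • fun s => s ^ 0 * Complex.exp (c * s),
      Subalgebra.smul_mem _ (mem_expPoly_monomial hc 0) _, ?_, fun s => ?_⟩
    · have := primSpan.smul_mem (c - m)⁻¹ (hmono 0)
      convert this using 1
      ext s; simp [mul_left_comm]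
    · refine ((hd 0 s).const_mul (c - m)⁻¹).congr_deriv ?_
      simp only [Pi.smul_apply, smul_eq_mul]
      field_simp
      push_cast
      ring
  | succ t ih =>
    obtain ⟨F, hF, hFp, hFd⟩ := ih
    refine ⟨(c - m)⁻¹ • ((fun s => s ^ (t + 1) * Complex.exp (c * s)) - ((t : ℂ) + 1) • F),
      Subalgebra.smul_mem _ (Subalgebra.sub_mem _ (mem_expPoly_monomial hc _)
        (Subalgebra.smul_mem _ hF _)) _, ?_, fun s => ?_⟩
    · have := primSpan.smul_mem (c - m)⁻¹
        (primSpan.sub_mem (hmono (t + 1)) (primSpan.smul_mem ((t : ℂ) + 1) hFp))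
      convert this using 1
      ext s; simp; ring
    · refine (((hd (t + 1) s).sub ((hFd s).const_mul ((t : ℂ) + 1))).const_mul
        (c - m)⁻¹).congr_deriv ?_
      simp only [Pi.smul_apply, Pi.sub_apply, smul_eq_mul]
      field_simp
      rw [Nat.add_sub_cancel]
      push_cast
      ring

/-- The equation `F' = m F + f` with `m ≥ 1` is solvable in exponential polynomials, and `z ^ {-m} F`
is then a formal primitive of `z ^ {-m} f`. -/
theorem exists_exp_primitive {f : ℂ → ℂ} (hf : f ∈ expPoly) {m : ℕ} (hm : 1 ≤ m) :
    ∃ F ∈ expPoly, (fun s => Complex.exp (-(m : ℂ) * s) * F s) ∈ primSpan ∧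
      ∀ s, HasDerivAt F (m * F s + f s) s := by
  refine expPoly_induction (p := fun f => ∃ F ∈ expPoly,
    (fun s => Complex.exp (-(m : ℂ) * s) * F s) ∈ primSpan ∧
      ∀ s, HasDerivAt F (m * F s + f s) s) (fun c t hc => exists_exp_primitive_monomial hc hm t)
    ⟨0, Subalgebra.zero_mem _, ?_, fun s => ?_⟩ ?_ ?_ hf
  · convert primSpan.zero_mem using 1
    ext s; simp
  · exact (hasDerivAt_const s (0 : ℂ)).congr_deriv (by simp)
  · rintro f g ⟨F, hF, hFp, hFd⟩ ⟨G, hG, hGp, hGd⟩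
    refine ⟨F + G, Subalgebra.add_mem _ hF hG, ?_, fun s => ?_⟩
    · convert primSpan.add_mem hFp hGp using 1
      ext s; simp [mul_add]
    · refine ((hFd s).add (hGd s)).congr_deriv ?_
      simp only [Pi.add_apply]; ring
  · rintro a f ⟨F, hF, hFp, hFd⟩
    refine ⟨a • F, Subalgebra.smul_mem _ hF a, ?_, fun s => ?_⟩
    · convert primSpan.smul_mem a hFp using 1
      ext s; simp [mul_left_comm]
    · refine ((hFd s).const_mul a).congr_deriv ?_
      simp only [Pi.smul_apply, smul_eq_mul]; ring

/-- Exponential polynomials with imaginary rates grow slower than exponentially. -/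
theorem tendsto_exp_mul_expPoly {f : ℂ → ℂ} (hf : f ∈ expPoly) {m : ℕ} (hm : 1 ≤ m) (s : ℂ) :
    Tendsto (fun r : ℝ => Complex.exp (-(m : ℂ) * r) * f (s + r)) atTop (𝓝 0) := by
  refine expPoly_induction (p := fun f => Tendsto
    (fun r : ℝ => Complex.exp (-(m : ℂ) * r) * f (s + r)) atTop (𝓝 0)) (fun c t hc => ?_) ?_ ?_ ?_ hf
  · have h1 : Tendsto (fun r : ℝ => r + ‖s‖) atTop atTop :=
      tendsto_atTop_add_const_right _ _ tendsto_id
    have h2 := ((Real.tendsto_pow_mul_exp_neg_atTop_nhds_zero t).comp h1).const_mul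
      (Real.exp ‖s‖ * Real.exp (c * s).re)
    rw [mul_zero] at h2
    refine squeeze_zero_norm' ?_ h2
    filter_upwards [eventually_ge_atTop 0] with r hr
    rw [norm_mul, norm_mul, norm_pow, Complex.norm_exp, Complex.norm_exp, Function.comp_apply]
    have e1 : (c * (s + r)).re = (c * s).re := by simp [mul_add, hc]
    have e2 : (-(m : ℂ) * r).re = -(m * r) := by simp
    have e3 : Real.exp (-(m * r)) ≤ Real.exp ‖s‖ * Real.exp (-(r + ‖s‖)) := by
      rw [← Real.exp_add, Real.exp_le_exp]
      have : (1 : ℝ) ≤ m := by exact_mod_cast hm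
      nlinarith
    have e4 : ‖s + (r : ℂ)‖ ≤ r + ‖s‖ := by
      refine (norm_add_le _ _).trans ?_
      rw [Complex.norm_real, Real.norm_of_nonneg hr, add_comm]
    rw [e1, e2]
    calc _ ≤ (Real.exp ‖s‖ * Real.exp (-(r + ‖s‖))) * ((r + ‖s‖) ^ t * Real.exp (c * s).re) := by
          gcongr
      _ = _ := by ring
  · simp
  · intro f g hf hg
    have := hf.add hg
    rw [add_zero] at this
    refine this.congr fun r => ?_
    simp only [Pi.add_apply]; ring
  · intro a f hf
    have := hf.const_mul a
    rw [mul_zero] at this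
    refine this.congr fun r => ?_
    simp only [Pi.smul_apply, smul_eq_mul]; ring

/-- Matrices of exponential polynomials. -/
def IsExpPoly (F : ℂ → Mat n) : Prop := ∀ i j, (fun s => F s i j) ∈ expPoly

theorem isExpPoly_const (X : Mat n) : IsExpPoly fun _ : ℂ => X := fun i j =>
  Subalgebra.algebraMap_mem expPoly (X i j)

theorem IsExpPoly.add {F G : ℂ → Mat n} (hF : IsExpPoly F) (hG : IsExpPoly G) :
    IsExpPoly fun s => F s + G s := fun i j => Subalgebra.add_mem _ (hF i j) (hG i j)

theorem IsExpPoly.sub {F G : ℂ → Mat n} (hF : IsExpPoly F) (hG : IsExpPoly G) :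
    IsExpPoly fun s => F s - G s := fun i j => Subalgebra.sub_mem _ (hF i j) (hG i j)

theorem IsExpPoly.smul {F : ℂ → Mat n} (hF : IsExpPoly F) (a : ℂ) :
    IsExpPoly fun s => a • F s := fun i j => Subalgebra.smul_mem _ (hF i j) a

theorem IsExpPoly.sum {ι : Type*} {t : Finset ι} {F : ι → ℂ → Mat n}
    (hF : ∀ i ∈ t, IsExpPoly (F i)) : IsExpPoly fun s => ∑ i ∈ t, F i s := fun i j => by
  have h := Subalgebra.sum_mem expPoly (t := t) (f := fun l s => F l s i j)
    fun l hl => hF l hl i j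
  convert h using 1
  ext s; simp [Matrix.sum_apply]

theorem IsExpPoly.mul {F G : ℂ → Mat n} (hF : IsExpPoly F) (hG : IsExpPoly G) :
    IsExpPoly fun s => F s * G s := fun i j => by
  have h := Subalgebra.sum_mem expPoly (t := Finset.univ)
    (f := fun (l : Fin n) => (fun s => F s i l) * fun s => G s l j)
    fun l _ => Subalgebra.mul_mem _ (hF i l) (hG l j)
  convert h using 1
  ext s; simp [Matrix.mul_apply]

theorem IsExpPoly.br {F G : ℂ → Mat n} (hF : IsExpPoly F) (hG : IsExpPoly G) :
    IsExpPoly fun s => br (F s) (G s) := (hF.mul hG).sub (hG.mul hF)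

theorem IsExpPoly.delta {F : ℂ → Mat n} (hF : IsExpPoly F) (k : ℕ) :
    IsExpPoly fun s => delta k (F s) := fun i j => by
  by_cases h : ((i : ℕ) < k ∧ (j : ℕ) < k) ∨ i = j
  · simpa [Isomonodromy.delta, h] using hF i j
  · have h0 : (fun s => Isomonodromy.delta k (F s) i j) = 0 := by
      ext s; simp [Isomonodromy.delta, h]
    rw [h0]; exact Subalgebra.zero_mem expPoly

theorem IsExpPoly.cross {F : ℂ → Mat n} (hF : IsExpPoly F) (k : ℕ) :
    IsExpPoly fun s => cross k (F s) := (hF.delta (k + 1)).sub (hF.delta k)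

theorem hasDerivAt_of_entries {f : ℂ → Mat n} {f' : Mat n} {s : ℂ}
    (h : ∀ i j, HasDerivAt (fun s => f s i j) (f' i j) s) : HasDerivAt f f' s := by
  have e : ∀ Y : Mat n, Y = ∑ i, ∑ j, Y i j • Matrix.single i j (1 : ℂ) := fun Y => by
    conv_lhs => rw [Matrix.matrix_eq_sum_single Y]
    simp [Matrix.smul_single]
  have h1 : HasDerivAt (fun w => ∑ i, ∑ j, f w i j • (Matrix.single i j (1 : ℂ) : Mat n)) _ s :=
    HasDerivAt.fun_sum fun i _ => HasDerivAt.fun_sum fun j _ =>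
      (h i j).smul_const (Matrix.single i j (1 : ℂ) : Mat n)
  have h2 : (fun w => ∑ i, ∑ j, f w i j • (Matrix.single i j (1 : ℂ) : Mat n)) = f := by
    ext1 w; exact (e (f w)).symm
  rw [h2, ← e f'] at h1
  exact h1

theorem HasDerivAt.entry {f : ℂ → Mat n} {f' : Mat n} {s : ℂ} (h : HasDerivAt f f' s)
    (i j : Fin n) : HasDerivAt (fun s => f s i j) (f' i j) s :=
  (LinearMap.toContinuousLinearMap (Matrix.entryLinearMap ℂ ℂ i j)).hasFDerivAt.comp_hasDerivAt s h

theorem exists_matrix_primitive {f : ℂ → Mat n} (hf : IsExpPoly f) {m : ℕ} (hm : 1 ≤ m) :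
    ∃ F : ℂ → Mat n, IsExpPoly F ∧
      (∀ i j, (fun s => Complex.exp (-(m : ℂ) * s) * F s i j) ∈ primSpan) ∧
      ∀ s, HasDerivAt F ((m : ℂ) • F s + f s) s := by
  choose F hF hFp hFd using fun i j => exists_exp_primitive (hf i j) hm
  exact ⟨fun s => Matrix.of fun i j => F i j s, fun i j => hF i j, fun i j => hFp i j,
    fun s => hasDerivAt_of_entries fun i j => hFd i j s⟩

theorem tendsto_exp_smul_of_isExpPoly {F : ℂ → Mat n} (hF : IsExpPoly F) {m : ℕ} (hm : 1 ≤ m)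
    (s : ℂ) : Tendsto (fun r : ℝ => Complex.exp (-(m : ℂ) * r) • F (s + r)) atTop (𝓝 0) := by
  have e : ∀ Y : Mat n, Y = ∑ i, ∑ j, Y i j • Matrix.single i j (1 : ℂ) := fun Y => by
    conv_lhs => rw [Matrix.matrix_eq_sum_single Y]
    simp [Matrix.smul_single]
  have h : Tendsto (fun r : ℝ => ∑ i, ∑ j, (Complex.exp (-(m : ℂ) * r) * F (s + r) i j) •
      (Matrix.single i j (1 : ℂ) : Mat n)) atTop
      (𝓝 (∑ i : Fin n, ∑ j : Fin n, (0 : ℂ) • (Matrix.single i j (1 : ℂ) : Mat n))) :=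
    tendsto_finsetSum _ fun i _ => tendsto_finsetSum _ fun j _ =>
      (tendsto_exp_mul_expPoly (hF i j) hm s).smul_const _
  simp only [zero_smul, Finset.sum_const_zero] at h
  refine h.congr fun r => ?_
  conv_rhs => rw [e (F (s + r)), Finset.smul_sum]
  simp only [Finset.smul_sum, smul_smul]

/-- The solution `F = -∫ exp (-m r) f (s + r) dr` of `F' = m F + f` is bounded by `B / m` if `f` is
bounded by `B`. -/
theorem norm_le_of_deriv_eq {F f : ℂ → Mat n} (hF : IsExpPoly F) {m : ℕ} (hm : 1 ≤ m)
    (hd : ∀ s, HasDerivAt F ((m : ℂ) • F s + f s) s) {s : ℂ} {B : ℝ}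
    (hB : ∀ r : ℝ, 0 ≤ r → ‖f (s + r)‖ ≤ B) : ‖F s‖ ≤ B / m := by
  have hm0 : (0 : ℝ) < m := by exact_mod_cast hm
  have hB0 : 0 ≤ B := (norm_nonneg _).trans (hB 0 le_rfl)
  set h : ℝ → Mat n := fun r => Complex.exp (-(m : ℂ) * r) • F (s + r) with hh
  have hd' : ∀ r : ℝ, HasDerivAt h (Complex.exp (-(m : ℂ) * r) • f (s + r)) r := by
    intro r
    have h1 : HasDerivAt (fun z : ℂ => Complex.exp (-(m : ℂ) * z) • F (s + z)) _ (r : ℂ) :=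
      (((hasDerivAt_id (r : ℂ)).const_mul (-(m : ℂ))).cexp).fun_smul
        ((hd (s + r)).comp_const_add s (r : ℂ))
    refine (h1.scomp r (Complex.ofRealCLM.hasDerivAt (x := r))).congr_deriv ?_
    simp only [id, mul_one, mul_smul, smul_add, neg_smul, smul_neg, Complex.ofRealCLM_apply,
      Complex.ofReal_one, one_smul]
    abel
  have key : ∀ t : ℝ, 0 ≤ t → ‖h t - h 0‖ ≤ B / m := by
    intro t ht
    have h1 := image_norm_le_of_norm_deriv_right_le_deriv_boundary
      (f := fun r => h r - h 0) (f' := fun r : ℝ => Complex.exp (-(m : ℂ) * r) • f (s + r))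
      (a := 0) (b := t)
      (B := fun r => B / m * (1 - Real.exp (-(m * r)))) (B' := fun r => B * Real.exp (-(m * r)))
      (fun x _ => ((hd' x).sub_const _).continuousAt.continuousWithinAt)
      (fun x _ => ((hd' x).sub_const _).hasDerivWithinAt) (by simp)
      (fun x => by
        have h2 : HasDerivAt (fun r : ℝ => -((m : ℝ) * r)) (-(m : ℝ)) x := by
          have h3 := ((hasDerivAt_id x).const_mul (m : ℝ)).neg
          rw [mul_one] at h3
          exact h3
        refine ((h2.exp.const_sub 1).const_mul (B / m)).congr_deriv ?_
        field_simp)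
      (fun x hx => by
        rw [norm_smul, Complex.norm_exp, mul_comm B]
        have : (-(m : ℂ) * x).re = -(m * x) := by simp
        rw [this]
        exact mul_le_mul_of_nonneg_left (hB x hx.1) (Real.exp_pos _).le) (right_mem_Icc.2 ht)
    refine h1.trans (mul_le_of_le_one_right (by positivity) ?_)
    linarith [Real.exp_pos (-((m : ℝ) * t))]
  have h0 : h 0 = F s := by simp [hh]
  -- `h` tends to `0` as `F` grows slower than exponentially, so the bound passes to the limit
  have hlim : Tendsto (fun t => ‖h t - h 0‖) atTop (𝓝 ‖0 - h 0‖) :=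
    ((tendsto_exp_smul_of_isExpPoly hF hm s).sub_const _).norm
  rw [zero_sub, norm_neg, h0] at hlim
  refine le_of_tendsto hlim ((eventually_ge_atTop 0).mono fun t ht => ?_)
  rw [← h0]
  exact key t ht

end ExpPoly

/-! ### Exponentials of matrices with imaginary spectrum -/

section ExpBounded

variable {n : ℕ}

/-- The linear map `X ↦ X v`. -/
noncomputable def mulVecL (v : Fin n → ℂ) : Mat n →L[ℂ] (Fin n → ℂ) :=
  LinearMap.toContinuousLinearMap
    { toFun := fun X => X *ᵥ v
      map_add' := fun X Y => Matrix.add_mulVec X Y v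
      map_smul' := fun c X => Matrix.smul_mulVec c X v }

theorem mulVecL_apply (v : Fin n → ℂ) (X : Mat n) : mulVecL v X = X *ᵥ v := rfl

theorem ex_smul_one (c : ℂ) : ex (c • (1 : Mat n)) = Complex.exp c • (1 : Mat n) := by
  have h := NormedSpace.algebraMap_exp_comm (𝔸 := Mat n) c
  rw [← Complex.exp_eq_exp_ℂ, Algebra.algebraMap_eq_smul_one, Algebra.algebraMap_eq_smul_one] at h
  exact h.symm

/-- The exponential on a generalized eigenvector. -/
theorem ex_smul_mulVec {A : Mat n} {c : ℂ} {k : ℕ} {v : Fin n → ℂ}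
    (hv : (A - c • 1) ^ k *ᵥ v = 0) (s : ℂ) :
    ex (s • A) *ᵥ v = Complex.exp (c * s) •
      ∑ t ∈ Finset.range k, ((t.factorial : ℂ)⁻¹ * s ^ t) • ((A - c • 1) ^ t *ᵥ v) := by
  set B := A - c • (1 : Mat n) with hB
  have e1 : s • A = (c * s) • (1 : Mat n) + s • B := by
    rw [hB, smul_sub, smul_smul, mul_comm c s]; abel
  have hc : Commute ((c * s) • (1 : Mat n)) (s • B) := (Commute.one_left _).smul_left _
  rw [e1, ex_add hc, ex_smul_one, smul_mul_assoc, one_mul, Matrix.smul_mulVec]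
  congr 1
  have h1 := (NormedSpace.exp_series_hasSum_exp' (𝕂 := ℂ) (s • B)).mapL (mulVecL v)
  simp only [mulVecL_apply, smul_pow, smul_smul, Matrix.smul_mulVec] at h1
  refine h1.unique (hasSum_sum_of_ne_finset_zero fun t ht => ?_)
  obtain ⟨j, rfl⟩ := Nat.exists_eq_add_of_le (not_lt.1 fun h => ht (Finset.mem_range.2 h))
  rw [add_comm k j, pow_add B, ← Matrix.mulVec_mulVec, hv, Matrix.mulVec_zero, smul_zero]

theorem exists_eigenvector {A : Mat n} {c : ℂ} {k : ℕ} {v : Fin n → ℂ}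
    (hv : (A - c • 1) ^ k *ᵥ v = 0) (hv0 : v ≠ 0) : ∃ x, x ≠ 0 ∧ (A - c • 1) *ᵥ x = 0 := by
  induction k with
  | zero => simp at hv; exact absurd hv hv0
  | succ k ih =>
    by_cases h : (A - c • 1) ^ k *ᵥ v = 0
    · exact ih h
    · exact ⟨_, h, by rw [Matrix.mulVec_mulVec, ← pow_succ', hv]⟩

/-- If `exp (r A)` is bounded for real `r`, then the eigenvalues of `A` are imaginary. -/
theorem re_eq_zero_of_bounded {A : Mat n} {κ : ℝ} (hκ : ∀ r : ℝ, ‖ex ((r : ℂ) • A)‖ ≤ κ) {c : ℂ}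
    {x : Fin n → ℂ} (hx0 : x ≠ 0) (hx : (A - c • 1) *ᵥ x = 0) : c.re = 0 := by
  by_contra hc
  have h1 : ∀ r : ℝ, Real.exp (c.re * r) * ‖x‖ ≤ ‖mulVecL x‖ * κ := by
    intro r
    have h2 := ex_smul_mulVec (k := 1) (by rwa [pow_one]) (r : ℂ) (A := A) (c := c) (v := x)
    simp only [Finset.range_one, Finset.sum_singleton, Nat.factorial_zero, Nat.cast_one, inv_one,
      pow_zero, mul_one, Matrix.one_mulVec, one_smul] at h2
    have h3 := (mulVecL x).le_opNorm (ex ((r : ℂ) • A))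
    rw [mulVecL_apply, h2, norm_smul, Complex.norm_exp] at h3
    have e : (c * r).re = c.re * r := by simp
    rw [e] at h3
    exact h3.trans (mul_le_mul_of_nonneg_left (hκ r) (norm_nonneg _))
  have hx : 0 < ‖x‖ := norm_pos_iff.2 hx0
  set D := ‖mulVecL x‖ * κ / ‖x‖ with hD
  have h2 := h1 (D / c.re)
  rw [mul_div_cancel₀ _ hc, ← le_div_iff₀ hx] at h2
  linarith [Real.add_one_le_exp D]

/-- If `exp (r A)` is bounded for real `r`, then the entries of `exp (s A)` are exponential
polynomials with imaginary rates. -/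
theorem isExpPoly_ex {A : Mat n} {κ : ℝ} (hκ : ∀ r : ℝ, ‖ex ((r : ℂ) • A)‖ ≤ κ) :
    IsExpPoly fun s => ex (s • A) := by
  -- the vectors `v` for which `exp (s A) v` is an exponential polynomial form a subspace, which
  -- contains the generalized eigenspaces
  let S : Submodule ℂ (Fin n → ℂ) :=
    { carrier := {v | ∀ i, (fun s : ℂ => (ex (s • A) *ᵥ v) i) ∈ expPoly}
      add_mem' := fun {v w} hv hw i => by
        convert Subalgebra.add_mem _ (hv i) (hw i) using 1
        ext s; simp [Matrix.mulVec_add]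
      zero_mem' := fun i => by
        convert Subalgebra.zero_mem expPoly using 1
        ext s; simp
      smul_mem' := fun c v hv i => by
        convert Subalgebra.smul_mem _ (hv i) c using 1
        ext s; simp [Matrix.mulVec_smul] }
  have hS : (⊤ : Submodule ℂ (Fin n → ℂ)) ≤ S := by
    rw [← Module.End.iSup_maxGenEigenspace_eq_top (Matrix.toLin' A)]
    refine iSup_le fun c v hv => ?_
    obtain ⟨k, hk⟩ := (Module.End.mem_maxGenEigenspace _ _ _).1 hv
    have hk' : (A - c • 1) ^ k *ᵥ v = 0 := by
      rw [← Matrix.toLin'_apply, Matrix.toLin'_pow, map_sub, map_smul, Matrix.toLin'_one]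
      exact hk
    by_cases hv0 : v = 0
    · rw [hv0]; exact S.zero_mem
    obtain ⟨x, hx0, hx⟩ := exists_eigenvector hk' hv0
    have hc := re_eq_zero_of_bounded hκ hx0 hx
    intro i
    have h1 : ∀ t ∈ Finset.range k, (fun s : ℂ => ((t.factorial : ℂ)⁻¹ *
        ((A - c • 1) ^ t *ᵥ v) i) * (s ^ t * Complex.exp (c * s))) ∈ expPoly := fun t _ =>
      Subalgebra.smul_mem _ (mem_expPoly_monomial hc t) _
    convert Subalgebra.sum_mem expPoly h1 using 1
    ext s
    rw [ex_smul_mulVec hk', Pi.smul_apply, Finset.sum_apply, Finset.sum_apply, Finset.smul_sum]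
    refine Finset.sum_congr rfl fun t _ => ?_
    simp only [Pi.smul_apply, smul_eq_mul]
    ring
  intro i j
  have h := hS (Submodule.mem_top (x := Pi.single j (1 : ℂ))) i
  convert h using 1
  ext s
  simp

theorem isExpPoly_ex_neg {A : Mat n} {κ : ℝ} (hκ : ∀ r : ℝ, ‖ex ((r : ℂ) • A)‖ ≤ κ) :
    IsExpPoly fun s => ex (-(s • A)) := by
  have h := isExpPoly_ex (A := -A) (κ := κ) fun r => by
    have := hκ (-r)
    rwa [Complex.ofReal_neg, neg_smul, ← smul_neg] at this
  simpa only [smul_neg] using h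

theorem IsExpPoly.powAd {A : Mat n} {κ : ℝ} (hκ : ∀ r : ℝ, ‖ex ((r : ℂ) • A)‖ ≤ κ) {F : ℂ → Mat n}
    (hF : IsExpPoly F) : IsExpPoly fun s => Isomonodromy.powAd s A (F s) :=
  ((isExpPoly_ex hκ).mul hF).mul (isExpPoly_ex_neg hκ)

theorem IsExpPoly.powAd_neg {A : Mat n} {κ : ℝ} (hκ : ∀ r : ℝ, ‖ex ((r : ℂ) • A)‖ ≤ κ)
    {F : ℂ → Mat n} (hF : IsExpPoly F) : IsExpPoly fun s => Isomonodromy.powAd (-s) A (F s) := by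
  have h := ((isExpPoly_ex_neg hκ).mul hF).mul (isExpPoly_ex hκ)
  convert h using 2
  rw [powAd_eq_ex, neg_smul, neg_neg]

theorem hasDerivAt_powAd_comp {A F' : Mat n} {F : ℂ → Mat n} {s : ℂ} (hF : HasDerivAt F F' s) :
    HasDerivAt (fun s => powAd s A (F s)) (br A (powAd s A (F s)) + powAd s A F') s := by
  have hn : ∀ s : ℂ, -(s • A) = s • (-A) := fun s => (smul_neg s A).symm
  have h := ((hasDerivAt_ex_smul A s).fun_mul hF).fun_mul (hasDerivAt_ex_smul (-A) s)
  simp only [← hn] at h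
  refine h.congr_deriv ?_
  have hc : Commute A (ex (-(s • A))) := commute_ex ((Commute.refl A).smul_right s).neg_right
  simp only [powAd_eq_ex, Isomonodromy.br, neg_mul, mul_neg, add_mul]
  rw [mul_assoc _ _ A, ← hc.eq]
  simp only [mul_assoc]
  abel

end ExpBounded

/-! ### The recursion for the terms of the series -/

section Recursion

variable {n : ℕ}

open Finset.HasAntidiagonal (antidiagonal)

/-- The terms `[U ^ p, C_i C_j]` of the recursion, as a function of the values `X i` of `φ_i`. -/
noncomputable def bSum (K : ℕ) (U : Mat n) (X : ℕ → Mat n) (m : ℕ) : Mat n :=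
  ∑ p ∈ Finset.Icc 1 m, ∑ ij ∈ antidiagonal (m - p),
    (-1 : ℂ) ^ p • br (U ^ p) (cross K (X ij.1) * cross K (X ij.2))

/-- The terms `[U ^ p C_i + C_i U ^ p, X_j]` of the recursion. -/
noncomputable def crossSum (K : ℕ) (U : Mat n) (X : ℕ → Mat n) (m : ℕ) : Mat n :=
  ∑ p ∈ Finset.Icc 1 m, ∑ ij ∈ antidiagonal (m - p),
    (-1 : ℂ) ^ p • br (U ^ p * cross K (X ij.1) + cross K (X ij.1) * U ^ p) (X ij.2)

/-- The right-hand side `a` of the recursion before conjugation by `z ^ A`. -/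
noncomputable def aSum (K : ℕ) (U : Mat n) (X : ℕ → Mat n) (m : ℕ) : Mat n :=
  (∑ ij ∈ (antidiagonal m).filter (fun ij => ij.1 < m), br (X ij.1) (delta K (X ij.2))) +
    crossSum K U X m

theorem powAd_sum_right {ι : Type*} (t : Finset ι) (f : ι → Mat n) (s : ℂ) (A : Mat n) :
    powAd s A (∑ i ∈ t, f i) = ∑ i ∈ t, powAd s A (f i) := by
  simp only [powAd_eq_ex, Finset.mul_sum, Finset.sum_mul]

theorem bTerm_eq (K : ℕ) (U : Mat n) (φ : ℕ → ℂ → Mat n) (m : ℕ) (s : ℂ) :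
    bTerm K U φ m s = bSum K U (fun i => φ i s) (m + 1) := rfl

theorem aTerm_eq (K : ℕ) (U A : Mat n) (φ : ℕ → ℂ → Mat n) (m : ℕ) (s : ℂ) :
    aTerm K U A φ m s = powAd s A (aSum K U (fun i => φ i s) (m + 1)) := by
  simp only [aSum, crossSum, powAd_add_right, powAd_sum_right, powAd_smul_right]
  rfl

theorem cross_apply (K : Fin n) (X : Mat n) (a b : Fin n) :
    cross K X a b = if (a = K ∧ b < K) ∨ (b = K ∧ a < K) then X a b else 0 := by
  simp only [cross, Matrix.sub_apply, delta, Fin.ext_iff, Fin.lt_def]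
  by_cases hab : (a : ℕ) = b
  · rw [if_pos (Or.inr hab), if_pos (Or.inr hab), sub_self, if_neg (by omega)]
  · by_cases h1 : (a : ℕ) < K ∧ (b : ℕ) < K
    · rw [if_pos (Or.inl (by omega)), if_pos (Or.inl h1), sub_self, if_neg (by omega)]
    · rw [if_neg (show ¬(((a : ℕ) < K ∧ (b : ℕ) < K) ∨ (a : ℕ) = b) by tauto), sub_zero]
      by_cases h2 : ((a : ℕ) = K ∧ (b : ℕ) < K) ∨ ((b : ℕ) = K ∧ (a : ℕ) < K)
      · rw [if_pos h2, if_pos (Or.inl (by omega))]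
      · rw [if_neg h2, if_neg (by omega)]

/-- A matrix `C` supported on the row and the column of index `K` exchanges the block with its
complement, so the block part of `C X` only involves the `cross` part of `X`. -/
theorem delta_cross_mul {K : Fin n} {C : Mat n} (hC : cross K C = C) (X : Mat n) :
    delta K (C * X) = C * cross K X := by
  have h0 : ∀ a b, ¬ ((a = K ∧ b < K) ∨ (b = K ∧ a < K)) → C a b = 0 := fun a b h => by
    rw [← hC, cross_apply, if_neg h]
  ext a b
  have : delta K (C * X) a b =
      ∑ l, (if ((a : ℕ) < K ∧ (b : ℕ) < K) ∨ a = b then C a l * X l b else 0) := by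
    simp only [delta, Matrix.mul_apply]
    split_ifs <;> simp
  rw [this, Matrix.mul_apply]
  refine Finset.sum_congr rfl fun l _ => ?_
  rw [cross_apply]
  by_cases h : (a = K ∧ l < K) ∨ (l = K ∧ a < K)
  · have : (((a : ℕ) < K ∧ (b : ℕ) < K) ∨ a = b) ↔ ((l = K ∧ b < K) ∨ (b = K ∧ l < K)) := by
      simp only [Fin.ext_iff, Fin.lt_def] at h ⊢
      omega
    simp only [this]
    split_ifs <;> simp
  · simp [h0 a l h]

theorem delta_mul_cross {K : Fin n} {C : Mat n} (hC : cross K C = C) (X : Mat n) :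
    delta K (X * C) = cross K X * C := by
  have h0 : ∀ a b, ¬ ((a = K ∧ b < K) ∨ (b = K ∧ a < K)) → C a b = 0 := fun a b h => by
    rw [← hC, cross_apply, if_neg h]
  ext a b
  have : delta K (X * C) a b =
      ∑ l, (if ((a : ℕ) < K ∧ (b : ℕ) < K) ∨ a = b then X a l * C l b else 0) := by
    simp only [delta, Matrix.mul_apply]
    split_ifs <;> simp
  rw [this, Matrix.mul_apply]
  refine Finset.sum_congr rfl fun l _ => ?_
  rw [cross_apply]
  by_cases h : (l = K ∧ b < K) ∨ (b = K ∧ l < K)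
  · have : (((a : ℕ) < K ∧ (b : ℕ) < K) ∨ a = b) ↔ ((a = K ∧ l < K) ∨ (l = K ∧ a < K)) := by
      simp only [Fin.ext_iff, Fin.lt_def] at h ⊢
      omega
    simp only [this]
    split_ifs <;> simp
  · simp [h0 l b h]

theorem cross_cross (K : Fin n) (X : Mat n) : cross K (cross K X) = cross K X := by
  ext a b
  rw [cross_apply, cross_apply]
  split_ifs <;> rfl

theorem cross_diagonal_mul (K : Fin n) (d : Fin n → ℂ) (X : Mat n) :
    cross K (Matrix.diagonal d * X) = Matrix.diagonal d * cross K X := by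
  ext a b
  rw [cross_apply, Matrix.diagonal_mul, Matrix.diagonal_mul, cross_apply]
  split_ifs <;> simp

theorem cross_mul_diagonal (K : Fin n) (d : Fin n → ℂ) (X : Mat n) :
    cross K (X * Matrix.diagonal d) = cross K X * Matrix.diagonal d := by
  ext a b
  rw [cross_apply, Matrix.mul_diagonal, Matrix.mul_diagonal, cross_apply]
  split_ifs <;> simp

theorem cross_add (K : ℕ) (X Y : Mat n) : cross K (X + Y) = cross K X + cross K Y := by
  simp only [cross, delta_add]; abel

theorem delta_diagonal (k : ℕ) (d : Fin n → ℂ) :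
    delta k (Matrix.diagonal d) = Matrix.diagonal d := by
  ext a b
  by_cases h : a = b <;> simp [delta, h]

theorem delta_bSum {K : Fin n} (d : Fin n → ℂ) (X : ℕ → Mat n) (m : ℕ) :
    delta K (bSum K (Matrix.diagonal d) X m) = bSum K (Matrix.diagonal d) X m := by
  simp only [bSum, delta_sum, delta_smul]
  refine Finset.sum_congr rfl fun p _ => Finset.sum_congr rfl fun ij _ => ?_
  rw [Matrix.diagonal_pow, delta_br (delta_diagonal _ _), delta_cross_mul (cross_cross _ _),
    cross_cross]

theorem sum_antidiagonal_br_eq_zero (X : ℕ → Mat n) (m : ℕ) :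
    ∑ ij ∈ antidiagonal m, br (X ij.1) (X ij.2) = 0 := by
  have h : ∑ ij ∈ antidiagonal m, br (X ij.1) (X ij.2) =
      ∑ ij ∈ antidiagonal m, br (X ij.2) (X ij.1) :=
    (Finset.Nat.sum_antidiagonal_swap (f := fun ij : ℕ × ℕ => br (X ij.1) (X ij.2))).symm
  have h2 : ∑ ij ∈ antidiagonal m, br (X ij.2) (X ij.1) =
      -∑ ij ∈ antidiagonal m, br (X ij.1) (X ij.2) := by
    rw [← Finset.sum_neg_distrib]
    exact Finset.sum_congr rfl fun ij _ => br_comm _ _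
  rw [h2, eq_neg_iff_add_eq_zero, ← two_smul ℂ] at h
  exact (smul_eq_zero.1 h).resolve_left two_ne_zero

theorem sum_antidiagonal_eq_filter_add {f : ℕ × ℕ → Mat n} (m : ℕ) :
    ∑ ij ∈ antidiagonal m, f ij =
      ∑ ij ∈ (antidiagonal m).filter (fun ij => ij.1 < m), f ij + f (m, 0) := by
  rw [← Finset.sum_filter_add_sum_filter_not (antidiagonal m) (fun ij : ℕ × ℕ => ij.1 < m)]
  congr 1
  have : (antidiagonal m).filter (fun ij : ℕ × ℕ => ¬ ij.1 < m) = {(m, 0)} := by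
    ext ⟨i, j⟩
    simp only [Finset.mem_filter, Finset.HasAntidiagonal.mem_antidiagonal, Finset.mem_singleton,
      Prod.mk.injEq]
    omega
  rw [this, Finset.sum_singleton]

/-- The block part of the recursion for `φ_m` is the recursion for `δ_K φ_m`. -/
theorem delta_aSum {K : Fin n} (d : Fin n → ℂ) (X : ℕ → Mat n) (m : ℕ) :
    delta K (aSum K (Matrix.diagonal d) X m) =
      br (delta K (X 0)) (delta K (X m)) + bSum K (Matrix.diagonal d) X m := by
  rw [aSum, delta_add]
  congr 1
  · have h1 := sum_antidiagonal_br_eq_zero (fun i => delta K (X i)) m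
    rw [sum_antidiagonal_eq_filter_add] at h1
    rw [delta_sum, br_comm (delta K (X 0)), ← eq_neg_of_add_eq_zero_left h1]
    refine Finset.sum_congr rfl fun ij _ => ?_
    rw [br_comm, delta_neg, delta_br (delta_delta le_rfl _), ← br_comm]
  · rw [crossSum, bSum, delta_sum]
    refine Finset.sum_congr rfl fun p _ => ?_
    rw [Matrix.diagonal_pow, delta_sum, ← Finset.smul_sum]
    simp only [delta_smul]
    rw [← Finset.smul_sum]
    congr 1
    set D := Matrix.diagonal (d ^ p) with hD
    set C := fun i => cross K (X i) with hC
    have hO : ∀ i, cross K (D * C i + C i * D) = D * C i + C i * D := fun i => by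
      rw [cross_add, cross_diagonal_mul, cross_mul_diagonal, hC, cross_cross]
    have h1 : ∀ i j, delta K (br (D * C i + C i * D) (X j)) =
        D * C i * C j + C i * D * C j - C j * D * C i - C j * C i * D := fun i j => by
      rw [br, delta_sub, delta_cross_mul (hO i), delta_mul_cross (hO i)]
      simp only [hC, add_mul, mul_add, mul_assoc]
      abel
    have h2 : ∀ i j, br D (C i * C j) = D * C i * C j - C i * C j * D := fun i j => by
      rw [br, ← mul_assoc]
    refine (Finset.sum_congr rfl fun ij _ => h1 ij.1 ij.2).trans
      (Eq.trans ?_ (Finset.sum_congr rfl fun ij _ => (h2 ij.1 ij.2).symm))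
    simp only [Finset.sum_sub_distrib, Finset.sum_add_distrib]
    -- exchanging `i` and `j` cancels the terms in which `D` stands between the two factors
    have s1 : ∑ ij ∈ antidiagonal (m - p), C ij.2 * D * C ij.1 =
        ∑ ij ∈ antidiagonal (m - p), C ij.1 * D * C ij.2 :=
      Finset.Nat.sum_antidiagonal_swap (f := fun ij : ℕ × ℕ => C ij.1 * D * C ij.2)
    have s2 : ∑ ij ∈ antidiagonal (m - p), C ij.2 * C ij.1 * D =
        ∑ ij ∈ antidiagonal (m - p), C ij.1 * C ij.2 * D :=
      Finset.Nat.sum_antidiagonal_swap (f := fun ij : ℕ × ℕ => C ij.1 * C ij.2 * D)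
    rw [s1, s2]
    abel

theorem bSum_congr {K : ℕ} {U : Mat n} {X X' : ℕ → Mat n} {m : ℕ} (h : ∀ i < m, X i = X' i) :
    bSum K U X m = bSum K U X' m := by
  refine Finset.sum_congr rfl fun p hp => Finset.sum_congr rfl fun ij hij => ?_
  have h1 := Finset.mem_Icc.1 hp
  have h2 := Finset.HasAntidiagonal.mem_antidiagonal.1 hij
  rw [h ij.1 (by omega), h ij.2 (by omega)]

theorem crossSum_congr {K : ℕ} {U : Mat n} {X X' : ℕ → Mat n} {m : ℕ} (h : ∀ i < m, X i = X' i) :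
    crossSum K U X m = crossSum K U X' m := by
  refine Finset.sum_congr rfl fun p hp => Finset.sum_congr rfl fun ij hij => ?_
  have h1 := Finset.mem_Icc.1 hp
  have h2 := Finset.HasAntidiagonal.mem_antidiagonal.1 hij
  rw [h ij.1 (by omega), h ij.2 (by omega)]

/-- The right-hand side of order `m` depends on `φ_m` through its block part alone. -/
theorem aSum_congr {K : ℕ} {U : Mat n} {X X' : ℕ → Mat n} {m : ℕ} (h : ∀ i < m, X i = X' i)
    (hm : delta K (X m) = delta K (X' m)) : aSum K U X m = aSum K U X' m := by
  rw [aSum, aSum, crossSum_congr h]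
  congr 1
  refine Finset.sum_congr rfl fun ij hij => ?_
  obtain ⟨h1, h2⟩ := Finset.mem_filter.1 hij
  have h3 := Finset.HasAntidiagonal.mem_antidiagonal.1 h1
  rw [h ij.1 h2]
  rcases Nat.lt_or_ge ij.2 m with h4 | h4
  · rw [h ij.2 h4]
  · rw [show ij.2 = m by omega, hm]

theorem isExpPoly_bSum {K : ℕ} {U : Mat n} {φ : ℕ → ℂ → Mat n} {m : ℕ}
    (h : ∀ i < m, IsExpPoly (φ i)) : IsExpPoly fun s => bSum K U (fun i => φ i s) m := by
  refine IsExpPoly.sum fun p hp => IsExpPoly.sum fun ij hij => ?_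
  have h1 := Finset.mem_Icc.1 hp
  have h2 := Finset.HasAntidiagonal.mem_antidiagonal.1 hij
  exact ((isExpPoly_const _).br (((h ij.1 (by omega)).cross K).mul
    ((h ij.2 (by omega)).cross K))).smul _

theorem isExpPoly_crossSum {K : ℕ} {U : Mat n} {φ : ℕ → ℂ → Mat n} {m : ℕ}
    (h : ∀ i < m, IsExpPoly (φ i)) : IsExpPoly fun s => crossSum K U (fun i => φ i s) m := by
  refine IsExpPoly.sum fun p hp => IsExpPoly.sum fun ij hij => ?_
  have h1 := Finset.mem_Icc.1 hp
  have h2 := Finset.HasAntidiagonal.mem_antidiagonal.1 hij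
  have hc := (h ij.1 (by omega)).cross K
  exact ((((isExpPoly_const (U ^ p)).mul hc).add (hc.mul (isExpPoly_const (U ^ p)))).br
    (h ij.2 (by omega))).smul _

theorem isExpPoly_aSum {K : ℕ} {U : Mat n} {φ : ℕ → ℂ → Mat n} {m : ℕ}
    (h : ∀ i ≤ m, IsExpPoly (φ i)) : IsExpPoly fun s => aSum K U (fun i => φ i s) m := by
  refine IsExpPoly.add (IsExpPoly.sum fun ij hij => ?_) (isExpPoly_crossSum fun i hi => h i hi.le)
  have h3 := Finset.HasAntidiagonal.mem_antidiagonal.1 (Finset.mem_filter.1 hij).1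
  exact (h ij.1 (by omega)).br ((h ij.2 (by omega)).delta K)

/-- The differential equations satisfied by the terms `φ_m` of the series of level `K + 1`. -/
structure IsRecursion (K : ℕ) (U A : Mat n) (φ : ℕ → ℂ → Mat n) (m : ℕ) : Prop where
  isExpPoly : IsExpPoly (φ m)
  delta_span : ∀ i j, (fun s => Complex.exp (-(m : ℂ) * s) * delta K (φ m s) i j) ∈ primSpan
  powAd_span : ∀ i j, (fun s => Complex.exp (-(m : ℂ) * s) * powAd s A (φ m s) i j) ∈ primSpan
  delta_deriv : ∀ s, HasDerivAt (fun s => delta K (φ m s))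
    ((m : ℂ) • delta K (φ m s) + bSum K U (fun i => φ i s) m) s
  powAd_deriv : ∀ s, HasDerivAt (fun s => powAd s A (φ m s))
    ((m : ℂ) • powAd s A (φ m s) + powAd s A (aSum K U (fun i => φ i s) m)) s

set_option maxHeartbeats 1000000 in
/-- One step of the recursion: the two prescriptions for `δ_K φ_m` and `φ_m` are compatible. -/
theorem exists_next_term {K : Fin n} {d : Fin n → ℂ} {A : Mat n} {κ : ℝ}
    (hκ : ∀ r : ℝ, ‖ex ((r : ℂ) • A)‖ ≤ κ) (hA : delta K A = A) {m : ℕ} (hm : 1 ≤ m)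
    {φ : ℕ → ℂ → Mat n} (h : ∀ i < m, IsExpPoly (φ i)) (h0 : ∀ s, delta K (φ 0 s) = A) :
    ∃ f : ℂ → Mat n, IsRecursion K (Matrix.diagonal d) A (Function.update φ m f) m := by
  set U := Matrix.diagonal d with hU
  -- the block part `δ_K Δ` of the new term comes first, since `aSum` involves it
  obtain ⟨Δ, hΔe, hΔp, hΔd⟩ := exists_matrix_primitive (isExpPoly_bSum (K := K) (U := U) h) hm
  set φ' := Function.update φ m Δ with hφ'
  have hφ'lt : ∀ i < m, φ' i = φ i := fun i hi => Function.update_of_ne hi.ne _ _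
  have hφ'm : φ' m = Δ := Function.update_self _ _ _
  have h' : ∀ i ≤ m, IsExpPoly (φ' i) := fun i hi => by
    rcases hi.lt_or_eq with h1 | rfl
    · rw [hφ'lt i h1]; exact h i h1
    · rw [hφ'm]; exact hΔe
  obtain ⟨W, hWe, hWp, hWd⟩ := exists_matrix_primitive
    ((isExpPoly_aSum (K := K) (U := U) h').powAd hκ) hm
  set f : ℂ → Mat n := fun s => powAd (-s) A (W s) with hf
  have hfe : IsExpPoly f := hWe.powAd_neg hκ
  have hWf : ∀ s, powAd s A (f s) = W s := fun s => powAd_powAd_neg s A (W s)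
  have hbd : ∀ s, delta K (bSum K U (fun i => φ i s) m) = bSum K U (fun i => φ i s) m :=
    fun s => delta_bSum d _ m
  have hδΔ : ∀ s, HasDerivAt (fun s => delta K (Δ s))
      ((m : ℂ) • delta K (Δ s) + bSum K U (fun i => φ i s) m) s := fun s => by
    refine ((deltaL n K).hasFDerivAt.comp_hasDerivAt s (hΔd s)).congr_deriv ?_
    rw [deltaL_apply, delta_add, delta_smul, hbd]
  have hδW : ∀ s, HasDerivAt (fun s => delta K (W s)) ((m : ℂ) • delta K (W s) +
      powAd s A (br A (delta K (Δ s)) + bSum K U (fun i => φ i s) m)) s := fun s => by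
    refine ((deltaL n K).hasFDerivAt.comp_hasDerivAt s (hWd s)).congr_deriv ?_
    rw [deltaL_apply, delta_add, delta_smul, delta_powAd hA, delta_aSum, hφ'm,
      hφ'lt 0 (by omega), h0]
    congr 3
    exact bSum_congr fun i hi => by rw [hφ'lt i hi]
  -- the difference of the two candidates for `z ^ {ad A} δ_K φ_m` solves `Q' = m Q`
  set Q : ℂ → Mat n := fun s => delta K (W s) - powAd s A (delta K (Δ s)) with hQ
  have hQe : IsExpPoly Q := (hWe.delta K).sub ((hΔe.delta K).powAd hκ)
  have hQd : ∀ s, HasDerivAt Q ((m : ℂ) • Q s + 0) s := fun s => by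
    refine ((hδW s).sub (hasDerivAt_powAd_comp (hδΔ s))).congr_deriv ?_
    rw [hQ, powAd_add_right, powAd_add_right, powAd_br, powAd_self, powAd_smul_right, smul_sub]
    abel
  have hQ0 : ∀ s, Q s = 0 := fun s => by
    have := norm_le_of_deriv_eq hQe hm hQd (s := s) (B := 0) (fun r _ => by simp)
    rwa [zero_div, norm_le_zero_iff] at this
  have hfΔ : ∀ s, delta K (f s) = delta K (Δ s) := fun s => by
    have h1 := sub_eq_zero.1 (hQ0 s)
    rw [hf, delta_powAd hA, h1, powAd_neg_powAd]
  have hlt : ∀ i < m, Function.update φ m f i = φ i := fun i hi => Function.update_of_ne hi.ne _ _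
  have hm' : Function.update φ m f m = f := Function.update_self _ _ _
  have hb : ∀ s, bSum K U (fun i => Function.update φ m f i s) m = bSum K U (fun i => φ i s) m :=
    fun s => bSum_congr fun i hi => by rw [hlt i hi]
  have ha : ∀ s, aSum K U (fun i => Function.update φ m f i s) m = aSum K U (fun i => φ' i s) m :=
    fun s => aSum_congr (fun i hi => by rw [hlt i hi, hφ'lt i hi]) (by rw [hm', hφ'm, hfΔ])
  refine ⟨f, ?_, ?_, ?_, ?_, ?_⟩
  · rwa [hm']
  · intro i j
    simp only [hm', hfΔ]
    by_cases hij : ((i : ℕ) < K ∧ (j : ℕ) < K) ∨ i = j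
    · simpa only [delta, if_pos hij] using hΔp i j
    · simp only [delta, if_neg hij, mul_zero]
      exact primSpan.zero_mem
  · intro i j
    simp only [hm', hWf]
    exact hWp i j
  · intro s
    simp only [hb, hm', hfΔ]
    exact hδΔ s
  · intro s
    simp only [ha, hm', hWf]
    exact hWd s

theorem IsRecursion.congr {K : ℕ} {U A : Mat n} {φ φ' : ℕ → ℂ → Mat n} {m : ℕ}
    (h : IsRecursion K U A φ m) (hφ : ∀ i ≤ m, φ i = φ' i) : IsRecursion K U A φ' m := by
  have hb : ∀ s, bSum K U (fun i => φ' i s) m = bSum K U (fun i => φ i s) m := fun s =>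
    bSum_congr fun i hi => by rw [hφ i hi.le]
  have ha : ∀ s, aSum K U (fun i => φ' i s) m = aSum K U (fun i => φ i s) m := fun s =>
    aSum_congr (fun i hi => by rw [hφ i hi.le]) (by rw [hφ m le_rfl])
  have hm := hφ m le_rfl
  refine ⟨hm ▸ h.isExpPoly, hm ▸ h.delta_span, hm ▸ h.powAd_span, fun s => ?_, fun s => ?_⟩
  · rw [hb, ← hm]; exact h.delta_deriv s
  · rw [ha, ← hm]; exact h.powAd_deriv s

/-- Sequences may be constructed by prescribing one value after the other. -/
theorem exists_of_update {α : Type*} {P : ℕ → (ℕ → α) → Prop} (G₀ : ℕ → α) (h0 : P 0 G₀)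
    (hstep : ∀ m G, P m G → ∃ f, P (m + 1) (Function.update G (m + 1) f)) :
    ∃ G : ℕ → ℕ → α, (∀ m, P m (G m)) ∧ (∀ m i, i ≤ m → G m i = G i i) ∧ G 0 = G₀ := by
  choose f hf using hstep
  let S : ∀ m, {G : ℕ → α // P m G} := fun m =>
    Nat.rec ⟨G₀, h0⟩ (fun m G => ⟨Function.update G.1 (m + 1) (f m G.1 G.2), hf m G.1 G.2⟩) m
  refine ⟨fun m => (S m).1, fun m => (S m).2, fun m i hi => ?_, rfl⟩
  induction m with
  | zero => rw [Nat.le_zero.1 hi]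
  | succ m ih =>
    rcases hi.lt_or_eq with h | rfl
    · rw [← ih (by omega)]
      exact Function.update_of_ne (by omega) _ _
    · rfl

/-- The terms of the series exist. -/
theorem exists_terms {K : Fin n} {d : Fin n → ℂ} {Φ' : Mat n} {κ : ℝ}
    (hκ : ∀ r : ℝ, ‖ex ((r : ℂ) • delta K Φ')‖ ≤ κ) :
    ∃ φ : ℕ → ℂ → Mat n, (∀ s, φ 0 s = powAd (-s) (delta K Φ') Φ') ∧
      IsExpPoly (φ 0) ∧ ∀ m, 1 ≤ m → IsRecursion K (Matrix.diagonal d) (delta K Φ') φ m := by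
  set A := delta K Φ' with hAdef
  have hA : delta K A = A := delta_delta le_rfl _
  set φ₀ : ℂ → Mat n := fun s => powAd (-s) A Φ' with hφ₀
  have hφ₀e : IsExpPoly φ₀ := (isExpPoly_const Φ').powAd_neg hκ
  have hφ₀δ : ∀ s, delta K (φ₀ s) = A := fun s => by
    rw [hφ₀, delta_powAd hA, ← hAdef, powAd_self]
  obtain ⟨G, hG, hGc, hG0⟩ := exists_of_update (α := ℂ → Mat n) (P := fun m G => G 0 = φ₀ ∧
      ∀ i, 1 ≤ i → i ≤ m → IsRecursion K (Matrix.diagonal d) A G i) (fun _ => φ₀)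
    ⟨rfl, fun i h1 h2 => by omega⟩ (fun m G hG => by
      obtain ⟨hG0, hG⟩ := hG
      obtain ⟨f, hf⟩ := exists_next_term (d := d) hκ hA (m := m + 1) (by omega) (φ := G)
        (fun i hi => by
          rcases Nat.eq_zero_or_pos i with rfl | h
          · rw [hG0]; exact hφ₀e
          · exact (hG i h (by omega)).isExpPoly) (fun s => by rw [hG0]; exact hφ₀δ s)
      refine ⟨f, ?_, fun i h1 h2 => ?_⟩
      · rw [Function.update_of_ne (by omega), hG0]
      · rcases h2.lt_or_eq with h | rfl
        · exact (hG i h1 (by omega)).congr fun j hj => (Function.update_of_ne (by omega) _ _).symm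
        · exact hf)
  refine ⟨fun i => G i i, fun s => ?_, ?_, fun m hm => ?_⟩
  · change G 0 0 s = _
    rw [hG0]
  · change IsExpPoly (G 0 0)
    rw [hG0]
    exact hφ₀e
  · exact ((hG m).2 m hm le_rfl).congr fun i hi => hGc m i hi

end Recursion

/-! ### Bounds for the terms of the series -/

section Bounds

variable {n : ℕ}

open Finset.HasAntidiagonal (antidiagonal)

/-- The terms given by the recursion are the terms of the series. -/
theorem isSeriesTerms_of_isRecursion {K : ℕ} {U Φ' : Mat n} {φ : ℕ → ℂ → Mat n}
    (h0 : ∀ s, φ 0 s = powAd (-s) (delta K Φ') Φ')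
    (h : ∀ m, 1 ≤ m → IsRecursion K U (delta K Φ') φ m) : IsSeriesTerms K U Φ' φ := by
  have key : ∀ (m : ℕ) (F f : ℂ → Mat n),
      (∀ i j, (fun s => Complex.exp (-((m + 1 : ℕ) : ℂ) * s) * F s i j) ∈ primSpan) →
      (∀ s, HasDerivAt F (((m + 1 : ℕ) : ℂ) • F s + f s) s) →
      IsFormalPrimitive (fun s => Complex.exp (-((m : ℂ) + 1) * s) • F s)
        (fun s => Complex.exp (-((m : ℂ) + 1) * s) • f s) := by
    intro m F f hp hd i j
    push_cast at hp hd
    refine ⟨hp i j, fun s => ?_⟩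
    have h1 : HasDerivAt (fun s : ℂ => Complex.exp (-((m : ℂ) + 1) * s))
        (Complex.exp (-((m : ℂ) + 1) * s) * -((m : ℂ) + 1)) s := by
      have h2 := (hasDerivAt_id s).const_mul (-((m : ℂ) + 1))
      rw [mul_one] at h2
      exact h2.cexp
    refine (h1.mul (HasDerivAt.entry (hd s) i j)).congr_deriv ?_
    simp only [Matrix.smul_apply, Matrix.add_apply, smul_eq_mul]
    ring
  refine ⟨h0, fun m => ?_, fun m => ?_⟩
  · simp only [bTerm_eq]
    exact key m _ _ (h (m + 1) (by omega)).delta_span (h (m + 1) (by omega)).delta_deriv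
  · simp only [aTerm_eq]
    exact key m _ _ (h (m + 1) (by omega)).powAd_span (h (m + 1) (by omega)).powAd_deriv

theorem norm_cross_le (K : ℕ) (X : Mat n) : ‖cross K X‖ ≤ 2 * ‖X‖ := by
  have h1 := norm_delta_le K X
  have h2 := norm_delta_le (K + 1) X
  calc ‖cross K X‖ ≤ ‖delta (K + 1) X‖ + ‖delta K X‖ := norm_sub_le _ _
    _ ≤ _ := by linarith

/-- A partial geometric sum of ratio `ρ / r ≤ 1 / 2`. -/
theorem sum_mul_pow_le {ρ r : ℝ} (hρ : 0 ≤ ρ) (hr : 0 < r) (hρr : 2 * ρ ≤ r) (m : ℕ) :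
    ∑ p ∈ Finset.Icc 1 m, ρ ^ p * r ^ (m - p) ≤ 2 * (ρ / r) * r ^ m := by
  have h : (∑ p ∈ Finset.Icc 1 m, ρ ^ p * r ^ (m - p)) * (r - ρ) = ρ * (r ^ m - ρ ^ m) := by
    induction m with
    | zero => simp
    | succ m ih =>
      rw [Finset.sum_Icc_succ_top (by omega), Nat.sub_self, pow_zero, mul_one]
      have : ∑ p ∈ Finset.Icc 1 m, ρ ^ p * r ^ (m + 1 - p) =
          r * ∑ p ∈ Finset.Icc 1 m, ρ ^ p * r ^ (m - p) := by
        rw [Finset.mul_sum]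
        refine Finset.sum_congr rfl fun p hp => ?_
        rw [Nat.succ_sub (Finset.mem_Icc.1 hp).2, pow_succ]
        ring
      rw [this, add_mul, mul_assoc, ih]
      ring
  have h1 : 0 ≤ ∑ p ∈ Finset.Icc 1 m, ρ ^ p * r ^ (m - p) :=
    Finset.sum_nonneg fun p _ => by positivity
  have h2 : 0 ≤ ρ * ρ ^ m := by positivity
  have e : 2 * (ρ / r) * r ^ m = 2 * (ρ * r ^ m) / r := by ring
  rw [e, le_div_iff₀ hr]
  nlinarith

/-- A double sum with the shape of `bSum` and `crossSum` of order `m` is at most `m r ^ m`, up to a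
factor `ρ / r` that is small for large `r`. -/
theorem norm_double_sum_le {f : ℕ → ℕ × ℕ → Mat n} {c D ρ r : ℝ} (hc : 0 ≤ c) (hρ : 0 ≤ ρ)
    (hr : 0 < r) (hρr : 2 * ρ ≤ r) {m : ℕ}
    (h : ∀ p ∈ Finset.Icc 1 m, ∀ ij ∈ antidiagonal (m - p),
      ‖f p ij‖ ≤ c * ρ ^ p * (D * r ^ ij.1) * (D * r ^ ij.2)) :
    ‖∑ p ∈ Finset.Icc 1 m, ∑ ij ∈ antidiagonal (m - p), f p ij‖ ≤
      m * (2 * c * D ^ 2 * (ρ / r) * r ^ m) := by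
  have h1 : ∀ p ∈ Finset.Icc 1 m, ‖∑ ij ∈ antidiagonal (m - p), f p ij‖ ≤
      m * c * D ^ 2 * (ρ ^ p * r ^ (m - p)) := by
    intro p hp
    have hp' := Finset.mem_Icc.1 hp
    refine (norm_sum_le_of_le _ (h p hp)).trans ?_
    have e : ∀ ij ∈ antidiagonal (m - p), c * ρ ^ p * (D * r ^ ij.1) * (D * r ^ ij.2) =
        c * D ^ 2 * (ρ ^ p * r ^ (m - p)) := fun ij hij => by
      rw [← Finset.HasAntidiagonal.mem_antidiagonal.1 hij, pow_add]
      ring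
    rw [Finset.sum_congr rfl e, Finset.sum_const, Finset.Nat.card_antidiagonal, nsmul_eq_mul]
    have hm : ((m - p + 1 : ℕ) : ℝ) ≤ m := by exact_mod_cast (by omega)
    calc _ ≤ (m : ℝ) * (c * D ^ 2 * (ρ ^ p * r ^ (m - p))) := by gcongr
      _ = _ := by ring
  refine (norm_sum_le_of_le _ h1).trans ?_
  rw [← Finset.mul_sum]
  calc _ ≤ m * c * D ^ 2 * (2 * (ρ / r) * r ^ m) := by
        gcongr
        exact sum_mul_pow_le hρ hr hρr m
    _ = _ := by ring

theorem norm_pow_le_pow {U : Mat n} {ρ : ℝ} (hU : ‖U‖ ≤ ρ) {p : ℕ} (hp : 1 ≤ p) :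
    ‖U ^ p‖ ≤ ρ ^ p :=
  (norm_pow_le' U hp).trans (pow_le_pow_left₀ (norm_nonneg _) hU p)

theorem norm_neg_one_pow_smul (p : ℕ) (X : Mat n) : ‖(-1 : ℂ) ^ p • X‖ = ‖X‖ := by
  rw [norm_smul, norm_pow, norm_neg, norm_one, one_pow, one_mul]

theorem norm_bSum_le {K : ℕ} {U : Mat n} {X : ℕ → Mat n} {D ρ r : ℝ} (hU : ‖U‖ ≤ ρ)
    (hr : 0 < r) (hρr : 2 * ρ ≤ r) {m : ℕ} (hX : ∀ i < m, ‖X i‖ ≤ D * r ^ i) :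
    ‖bSum K U X m‖ ≤ m * (16 * D ^ 2 * (ρ / r) * r ^ m) := by
  have hρ : 0 ≤ ρ := (norm_nonneg _).trans hU
  refine (norm_double_sum_le (c := 8) (D := D) (by norm_num) hρ hr hρr fun p hp ij hij => ?_).trans
    (by norm_num)
  have h1 := Finset.mem_Icc.1 hp
  have h2 := Finset.HasAntidiagonal.mem_antidiagonal.1 hij
  rw [norm_neg_one_pow_smul]
  have hi := hX ij.1 (by omega)
  have hj := hX ij.2 (by omega)
  have hi0 := (norm_nonneg _).trans hi
  calc _ ≤ 2 * ‖U ^ p‖ * ‖cross K (X ij.1) * cross K (X ij.2)‖ := norm_br_le _ _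
    _ ≤ 2 * ρ ^ p * ((2 * (D * r ^ ij.1)) * (2 * (D * r ^ ij.2))) := by
      gcongr
      · exact norm_pow_le_pow hU h1.1
      · refine (norm_mul_le _ _).trans ?_
        gcongr
        · exact (norm_cross_le _ _).trans (by linarith)
        · exact (norm_cross_le _ _).trans (by linarith)
    _ = _ := by ring

theorem norm_crossSum_le {K : ℕ} {U : Mat n} {X : ℕ → Mat n} {D ρ r : ℝ} (hU : ‖U‖ ≤ ρ)
    (hr : 0 < r) (hρr : 2 * ρ ≤ r) {m : ℕ} (hX : ∀ i < m, ‖X i‖ ≤ D * r ^ i) :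
    ‖crossSum K U X m‖ ≤ m * (16 * D ^ 2 * (ρ / r) * r ^ m) := by
  have hρ : 0 ≤ ρ := (norm_nonneg _).trans hU
  refine (norm_double_sum_le (c := 8) (D := D) (by norm_num) hρ hr hρr fun p hp ij hij => ?_).trans
    (by norm_num)
  have h1 := Finset.mem_Icc.1 hp
  have h2 := Finset.HasAntidiagonal.mem_antidiagonal.1 hij
  rw [norm_neg_one_pow_smul]
  have hi := hX ij.1 (by omega)
  have hj := hX ij.2 (by omega)
  have hi0 := (norm_nonneg _).trans hi
  have hp := norm_pow_le_pow hU h1.1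
  have hc : ‖cross K (X ij.1)‖ ≤ 2 * (D * r ^ ij.1) := (norm_cross_le _ _).trans (by linarith)
  calc _ ≤ 2 * ‖U ^ p * cross K (X ij.1) + cross K (X ij.1) * U ^ p‖ * ‖X ij.2‖ := norm_br_le _ _
    _ ≤ 2 * (ρ ^ p * (2 * (D * r ^ ij.1)) + (2 * (D * r ^ ij.1)) * ρ ^ p) * (D * r ^ ij.2) := by
      gcongr
      refine (norm_add_le _ _).trans (add_le_add ?_ ?_)
      · refine (norm_mul_le _ _).trans ?_
        gcongr
      · refine (norm_mul_le _ _).trans ?_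
        gcongr
    _ = _ := by ring

theorem norm_sum_br_le {K : ℕ} {X : ℕ → Mat n} {D r : ℝ} {m : ℕ}
    (hX : ∀ i ≤ m, ‖X i‖ ≤ D * r ^ i) :
    ‖∑ ij ∈ antidiagonal m, br (X ij.1) (delta K (X ij.2))‖ ≤ (m + 1) * (2 * D ^ 2 * r ^ m) := by
  have h : ∀ ij ∈ antidiagonal m, ‖br (X ij.1) (delta K (X ij.2))‖ ≤ 2 * D ^ 2 * r ^ m := by
    intro ij hij
    have h2 := Finset.HasAntidiagonal.mem_antidiagonal.1 hij
    have hi := hX ij.1 (by omega)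
    have hj := (norm_delta_le K _).trans (hX ij.2 (by omega))
    have hi0 := (norm_nonneg _).trans hi
    calc _ ≤ 2 * ‖X ij.1‖ * ‖delta K (X ij.2)‖ := norm_br_le _ _
      _ ≤ 2 * (D * r ^ ij.1) * (D * r ^ ij.2) := by gcongr
      _ = _ := by rw [← h2, pow_add]; ring
  refine (norm_sum_le_of_le _ h).trans ?_
  rw [Finset.sum_const, Finset.Nat.card_antidiagonal, nsmul_eq_mul]
  push_cast
  exact le_rfl

/-- The bound for the right-hand side of the recursion distinguishes the initial term from the
later ones, which are smaller by the factor `η / C₀`. -/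
theorem norm_aSum_le {K : ℕ} {U : Mat n} {X : ℕ → Mat n} {C₀ D ρ r η Δ : ℝ} (hU : ‖U‖ ≤ ρ)
    (hr : 0 < r) (hρr : 2 * ρ ≤ r) {m : ℕ} (h0 : ‖X 0‖ ≤ C₀)
    (hη : ∀ i, 1 ≤ i → i < m → ‖X i‖ ≤ η * r ^ i) (hX : ∀ i < m, ‖X i‖ ≤ D * r ^ i)
    (hΔ : ‖delta K (X m)‖ ≤ Δ * r ^ m) :
    ‖aSum K U X m‖ ≤ m * ((2 * C₀ * Δ + 2 * η ^ 2 + 16 * D ^ 2 * (ρ / r)) * r ^ m) := by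
  have hC0 := (norm_nonneg _).trans h0
  have hΔ0 := (norm_nonneg _).trans hΔ
  have hΔ1 : 0 ≤ Δ := nonneg_of_mul_nonneg_left hΔ0 (by positivity)
  have h : ∀ ij ∈ (antidiagonal m).filter (fun ij => ij.1 < m),
      ‖br (X ij.1) (delta K (X ij.2))‖ ≤ 2 * C₀ * Δ * r ^ m + 2 * η ^ 2 * r ^ m := by
    intro ij hij
    obtain ⟨h1, h2⟩ := Finset.mem_filter.1 hij
    have h3 := Finset.HasAntidiagonal.mem_antidiagonal.1 h1
    refine (norm_br_le _ _).trans ?_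
    rcases Nat.eq_zero_or_pos ij.1 with h4 | h4
    · have h5 : ij.2 = m := by omega
      rw [h4, h5]
      have : 0 ≤ 2 * η ^ 2 * r ^ m := by positivity
      calc _ ≤ 2 * C₀ * (Δ * r ^ m) := by gcongr
        _ ≤ _ := by linarith
    · have hi := hη ij.1 h4 (by omega)
      have hj := (norm_delta_le K _).trans (hη ij.2 (by omega) (by omega))
      have hi0 := (norm_nonneg _).trans hi
      have : 0 ≤ 2 * C₀ * Δ * r ^ m := by positivity
      calc _ ≤ 2 * (η * r ^ ij.1) * (η * r ^ ij.2) := by gcongr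
        _ = 2 * η ^ 2 * r ^ m := by rw [← h3, pow_add]; ring
        _ ≤ _ := by linarith
  have hcard : (((antidiagonal m).filter (fun ij : ℕ × ℕ => ij.1 < m)).card : ℝ) ≤ m := by
    have h1 : (antidiagonal m).filter (fun ij : ℕ × ℕ => ij.1 < m) ⊆ (antidiagonal m).erase (m, 0) := by
      intro ij hij
      obtain ⟨h1, h2⟩ := Finset.mem_filter.1 hij
      refine Finset.mem_erase.2 ⟨fun h => ?_, h1⟩
      rw [h] at h2
      exact lt_irrefl _ h2
    have h2 := Finset.card_le_card h1
    rw [Finset.card_erase_of_mem (by simp), Finset.Nat.card_antidiagonal] at h2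
    exact_mod_cast h2
  refine (norm_add_le _ _).trans ?_
  have h1 := norm_sum_le_of_le _ h
  rw [Finset.sum_const, nsmul_eq_mul] at h1
  have h2 := norm_crossSum_le (K := K) hU hr hρr hX
  have h3 := mul_le_mul_of_nonneg_right hcard
    (show 0 ≤ 2 * C₀ * Δ * r ^ m + 2 * η ^ 2 * r ^ m by positivity)
  calc _ ≤ m * (2 * C₀ * Δ * r ^ m + 2 * η ^ 2 * r ^ m) + m * (16 * D ^ 2 * (ρ / r) * r ^ m) :=
        add_le_add (h1.trans h3) h2
    _ = _ := by ring

/-- A bound for `exp (s A)` on strips from a bound on the real line. -/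
theorem exists_norm_ex_smul_le (κ M θ : ℝ) : ∃ κ' : ℝ, 1 ≤ κ' ∧ ∀ A : Mat n, ‖A‖ ≤ M →
    (∀ r : ℝ, ‖ex ((r : ℂ) • A)‖ ≤ κ) → ∀ s : ℂ, |s.im| ≤ θ →
      ‖ex (s • A)‖ ≤ κ' ∧ ‖ex (-(s • A))‖ ≤ κ' := by
  obtain ⟨B, hB0, hB⟩ := exists_norm_ex_le (n := n) (θ * M)
  refine ⟨max 1 (κ * B), le_max_left _ _, fun A hA hκ s hs => ?_⟩
  have key : ∀ s : ℂ, |s.im| ≤ θ → ‖ex (s • A)‖ ≤ max 1 (κ * B) := by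
    intro s hs
    refine le_trans ?_ (le_max_right _ _)
    conv_lhs => rw [← Complex.re_add_im s, ex_add_smul]
    refine (norm_mul_le _ _).trans (mul_le_mul (hκ _) (hB _ ?_) (norm_nonneg _)
      ((norm_nonneg _).trans (hκ 0)))
    rw [norm_smul, norm_mul, Complex.norm_I, mul_one, Complex.norm_real, Real.norm_eq_abs]
    exact mul_le_mul hs hA (norm_nonneg _) ((abs_nonneg _).trans hs)
  refine ⟨key s hs, ?_⟩
  rw [← neg_smul]
  exact key (-s) (by simpa using hs)

theorem norm_powAd_le_of_le {κ : ℝ} {A : Mat n} {s : ℂ} (h1 : ‖ex (s • A)‖ ≤ κ)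
    (h2 : ‖ex (-(s • A))‖ ≤ κ) (X : Mat n) : ‖powAd s A X‖ ≤ κ ^ 2 * ‖X‖ := by
  have h0 := (norm_nonneg _).trans h1
  calc _ ≤ ‖ex (s • A)‖ * ‖X‖ * ‖ex (-(s • A))‖ := norm_powAd_le s A X
    _ ≤ κ * ‖X‖ * κ := by gcongr
    _ = _ := by ring

/-- The terms of the series are bounded by a geometric sequence, uniformly on horizontal strips
and uniformly in the data. -/
theorem exists_norm_terms_le (κ M ρ θ : ℝ) : ∃ D r : ℝ, 0 < r ∧ 2 * ρ ≤ r ∧ ∀ (K : ℕ) (U Φ' : Mat n)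
    (φ : ℕ → ℂ → Mat n), ‖U‖ ≤ ρ → ‖Φ'‖ ≤ M → (∀ t : ℝ, ‖ex ((t : ℂ) • delta K Φ')‖ ≤ κ) →
      (∀ s, φ 0 s = powAd (-s) (delta K Φ') Φ') →
      (∀ m, 1 ≤ m → IsRecursion K U (delta K Φ') φ m) →
      ∀ m s, |s.im| ≤ θ → ‖φ m s‖ ≤ D * r ^ m := by
  obtain ⟨k, hk1, hk⟩ := exists_norm_ex_smul_le (n := n) κ M θ
  -- `C₀` bounds `φ_0` and `η r ^ m` bounds the later `φ_m`. The quadratic contribution of the latter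
  -- is `2 k ^ 4 η ^ 2 = η / 4`, which is what the choice of `η` is for.
  set C₀ := k ^ 2 * |M| with hC₀
  set η := 1 / (8 * k ^ 4) with hη
  set D := C₀ + η with hD
  have hk0 : 0 < k := by linarith
  have hC0 : 0 ≤ C₀ := by positivity
  have hη0 : 0 < η := by positivity
  have hD0 : 0 < D := by positivity
  -- `E * ρ / r ≤ η / 2` for the constant `E` collecting the terms with a factor `U ^ p`
  set E := k ^ 4 * (32 * C₀ * D ^ 2 + 16 * D ^ 2) with hE
  have hE0 : 0 ≤ E := by positivity
  set r := 2 * (|ρ| + 1) * (1 + E / η) with hr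
  have hr1 : 0 < r := by positivity
  have hρ' : ρ ≤ |ρ| + 1 := (le_abs_self ρ).trans (by linarith)
  have hρr : 2 * ρ ≤ r := by
    have : 0 ≤ 2 * (|ρ| + 1) * (E / η) := by positivity
    rw [hr]
    linarith
  have hEρ : E * (ρ / r) ≤ η / 2 := by
    rw [mul_div_assoc', div_le_iff₀ hr1]
    have e : η / 2 * r = (|ρ| + 1) * (η + E) := by rw [hr]; field_simp
    rw [e]
    have h1 : E * ρ ≤ E * (|ρ| + 1) := by gcongr
    nlinarith [abs_nonneg ρ]
  refine ⟨D, r, hr1, hρr, fun K U Φ' φ hU hΦ hκ h0 hrec => ?_⟩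
  set A := delta K Φ' with hA
  have hρ0 : 0 ≤ ρ := (norm_nonneg _).trans hU
  have hM : ‖Φ'‖ ≤ |M| := hΦ.trans (le_abs_self M)
  have hAM : ‖A‖ ≤ M := (norm_delta_le _ _).trans hΦ
  have hpow : ∀ s : ℂ, |s.im| ≤ θ → ∀ X : Mat n,
      ‖powAd s A X‖ ≤ k ^ 2 * ‖X‖ ∧ ‖powAd (-s) A X‖ ≤ k ^ 2 * ‖X‖ := fun s hs X => by
    have h1 := hk A hAM hκ s hs
    have h2 := hk A hAM hκ (-s) (by simpa using hs)
    exact ⟨norm_powAd_le_of_le h1.1 h1.2 X, norm_powAd_le_of_le h2.1 h2.2 X⟩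
  have hz : ∀ s : ℂ, |s.im| ≤ θ → ‖φ 0 s‖ ≤ C₀ := fun s hs => by
    rw [h0]
    exact ((hpow s hs _).2).trans (by rw [hC₀]; gcongr)
  have him : ∀ (s : ℂ) (t : ℝ), |s.im| ≤ θ → |(s + t).im| ≤ θ := fun s t h => by simpa using h
  -- inverting `d / ds - m` gains a factor `1 / m`, which compensates the number `m` of terms
  have main : ∀ m, 1 ≤ m → ∀ s : ℂ, |s.im| ≤ θ → ‖φ m s‖ ≤ η * r ^ m := by
    intro m
    induction m using Nat.strong_induction_on with
    | _ m ih =>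
      intro hm s hs
      have hm0 : (0 : ℝ) < m := by exact_mod_cast hm
      have hDi : ∀ s : ℂ, |s.im| ≤ θ → ∀ i < m, ‖φ i s‖ ≤ D * r ^ i := fun s hs i hi => by
        rcases Nat.eq_zero_or_pos i with rfl | h
        · rw [pow_zero, mul_one]
          exact (hz s hs).trans (by rw [hD]; linarith)
        · refine (ih i hi h s hs).trans ?_
          gcongr
          rw [hD]; linarith
      have hr' := hrec m hm
      have hδ : ∀ s : ℂ, |s.im| ≤ θ → ‖delta K (φ m s)‖ ≤ 16 * D ^ 2 * (ρ / r) * r ^ m := by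
        intro s hs
        have := norm_le_of_deriv_eq (hr'.isExpPoly.delta K) hm hr'.delta_deriv (s := s)
          (B := m * (16 * D ^ 2 * (ρ / r) * r ^ m))
          (fun t _ => norm_bSum_le hU hr1 hρr fun i hi => hDi _ (him s t hs) i hi)
        rwa [mul_div_cancel_left₀ _ hm0.ne'] at this
      have ha : ∀ s : ℂ, |s.im| ≤ θ → ‖aSum K U (fun i => φ i s) m‖ ≤
          m * ((2 * C₀ * (16 * D ^ 2 * (ρ / r)) + 2 * η ^ 2 + 16 * D ^ 2 * (ρ / r)) * r ^ m) :=
        fun s hs => norm_aSum_le hU hr1 hρr (hz s hs) (fun i h1 h2 => ih i h2 h1 s hs)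
          (hDi s hs) (hδ s hs)
      have hW := norm_le_of_deriv_eq (hr'.isExpPoly.powAd hκ) hm hr'.powAd_deriv (s := s)
        (B := m * (k ^ 2 * ((2 * C₀ * (16 * D ^ 2 * (ρ / r)) + 2 * η ^ 2 +
          16 * D ^ 2 * (ρ / r)) * r ^ m)))
        (fun t _ => by
          refine ((hpow _ (him s t hs) _).1).trans ?_
          have := mul_le_mul_of_nonneg_left (ha _ (him s t hs)) (sq_nonneg k)
          linarith)
      rw [mul_div_cancel_left₀ _ hm0.ne'] at hW
      have h2 := (hpow s hs (powAd s A (φ m s))).2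
      rw [powAd_neg_powAd] at h2
      have h3 : 2 * k ^ 4 * η ^ 2 = η / 4 := by rw [hη]; field_simp; norm_num
      calc ‖φ m s‖ ≤ k ^ 2 * (k ^ 2 * ((2 * C₀ * (16 * D ^ 2 * (ρ / r)) + 2 * η ^ 2 +
            16 * D ^ 2 * (ρ / r)) * r ^ m)) := h2.trans (by gcongr)
        _ = (2 * k ^ 4 * η ^ 2 + E * (ρ / r)) * r ^ m := by rw [hE]; ring
        _ ≤ η * r ^ m := by
          gcongr
          linarith
  intro m s hs
  rcases Nat.eq_zero_or_pos m with rfl | h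
  · rw [pow_zero, mul_one]
    exact (hz s hs).trans (by rw [hD]; linarith)
  · refine (main m h s hs).trans ?_
    gcongr
    rw [hD]; linarith

end Bounds

/-! ### The differential equation satisfied by the sum of the series -/

section Cauchy

variable {n : ℕ}

open Finset.HasAntidiagonal (antidiagonal)

/-- `crossSum` is homogeneous of weight `m`, where `U` has weight `1` and `X i` weight `i`. -/
theorem crossSum_smul (K : ℕ) (U : Mat n) (X : ℕ → Mat n) (x : ℂ) (m : ℕ) :
    crossSum K (x • U) (fun i => x ^ i • X i) m = x ^ m • crossSum K U X m := by
  simp only [crossSum, Finset.smul_sum]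
  refine Finset.sum_congr rfl fun p hp => Finset.sum_congr rfl fun ij hij => ?_
  have h1 := Finset.mem_Icc.1 hp
  have h2 := Finset.HasAntidiagonal.mem_antidiagonal.1 hij
  have hc : ∀ Y : Mat n, cross K (x ^ ij.1 • Y) = x ^ ij.1 • cross K Y := fun Y => by
    simp only [cross, delta_smul, smul_sub]
  rw [hc, smul_pow]
  simp only [smul_mul_smul_comm, br_smul_right]
  rw [mul_comm (x ^ ij.1) (x ^ p), ← smul_add, br_smul_left, smul_smul, smul_smul, smul_smul,
    show m = p + ij.1 + ij.2 by omega]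
  congr 1
  ring

/-- Two ways of summing over the triples `p + i + j = m`. -/
theorem sum_antidiagonal_assoc {M : Type*} [AddCommMonoid M] (f : ℕ → ℕ → ℕ → M) (m : ℕ) :
    ∑ pq ∈ antidiagonal m, ∑ ij ∈ antidiagonal pq.2, f pq.1 ij.1 ij.2 =
      ∑ qj ∈ antidiagonal m, ∑ pi ∈ antidiagonal qj.1, f pi.1 pi.2 qj.2 := by
  rw [Finset.sum_sigma', Finset.sum_sigma']
  refine Finset.sum_bij' (fun x _ => ⟨(x.1.1 + x.2.1, x.2.2), (x.1.1, x.2.1)⟩)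
    (fun x _ => ⟨(x.2.1, x.2.2 + x.1.2), (x.2.2, x.1.2)⟩) ?_ ?_ ?_ ?_ ?_
  · rintro ⟨⟨p, q⟩, ⟨i, j⟩⟩ h
    simp only [Finset.mem_sigma, Finset.HasAntidiagonal.mem_antidiagonal] at h ⊢
    exact ⟨by omega, trivial⟩
  · rintro ⟨⟨p, q⟩, ⟨i, j⟩⟩ h
    simp only [Finset.mem_sigma, Finset.HasAntidiagonal.mem_antidiagonal] at h ⊢
    exact ⟨by omega, trivial⟩
  · rintro ⟨⟨p, q⟩, ⟨i, j⟩⟩ h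
    simp only [Finset.mem_sigma, Finset.HasAntidiagonal.mem_antidiagonal] at h
    obtain ⟨-, rfl⟩ := h
    rfl
  · rintro ⟨⟨p, q⟩, ⟨i, j⟩⟩ h
    simp only [Finset.mem_sigma, Finset.HasAntidiagonal.mem_antidiagonal] at h
    obtain ⟨-, rfl⟩ := h
    rfl
  · rintro ⟨⟨p, q⟩, ⟨i, j⟩⟩ h
    rfl

/-- The powers `(-V) ^ p` with `p ≥ 1`. -/
noncomputable def negPow (V : Mat n) (p : ℕ) : Mat n := if p = 0 then 0 else (-1 : ℂ) ^ p • V ^ p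

/-- `crossSum` is the coefficient of a triple Cauchy product of series. -/
theorem crossSum_eq (K : ℕ) (V : Mat n) (a : ℕ → Mat n) (m : ℕ) :
    crossSum K V a m = ∑ qj ∈ antidiagonal m, br (∑ pi ∈ antidiagonal qj.1,
      (negPow V pi.1 * cross K (a pi.2) + cross K (a pi.2) * negPow V pi.1)) (a qj.2) := by
  simp only [br_sum_left]
  rw [← sum_antidiagonal_assoc (fun p i j =>
    br (negPow V p * cross K (a i) + cross K (a i) * negPow V p) (a j)),
    Finset.Nat.sum_antidiagonal_eq_sum_range_succ_mk, Finset.sum_range_eq_add_Ico _ (by omega),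
    Finset.sum_eq_zero, zero_add]
  · refine Finset.sum_congr (by ext; simp) fun p hp => Finset.sum_congr rfl fun ij _ => ?_
    have h1 := Finset.mem_Icc.1 hp
    rw [negPow, if_neg (by omega), smul_mul_assoc, mul_smul_comm, ← smul_add, br_smul_left]
  · intro ij _
    simp [negPow, br]

theorem hasSum_mul_antidiagonal {a b : ℕ → Mat n} (ha : Summable fun i => ‖a i‖)
    (hb : Summable fun i => ‖b i‖) : HasSum (fun m => ∑ ij ∈ antidiagonal m, a ij.1 * b ij.2)
      ((∑' i, a i) * ∑' i, b i) := by
  rw [tsum_mul_tsum_eq_tsum_sum_antidiagonal_of_summable_norm ha hb]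
  exact (summable_norm_sum_mul_antidiagonal_of_summable_norm ha hb).of_norm.hasSum

theorem hasSum_br_antidiagonal {a b : ℕ → Mat n} (ha : Summable fun i => ‖a i‖)
    (hb : Summable fun i => ‖b i‖) : HasSum (fun m => ∑ ij ∈ antidiagonal m, br (a ij.1) (b ij.2))
      (br (∑' i, a i) (∑' i, b i)) := by
  refine ((hasSum_mul_antidiagonal ha hb).sub (hasSum_mul_antidiagonal hb ha)).congr_fun ?_
  intro m
  simp only [br, Finset.sum_sub_distrib]
  congr 1
  exact Finset.Nat.sum_antidiagonal_swap (f := fun ij : ℕ × ℕ => b ij.1 * a ij.2)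

theorem norm_negPow_le {V : Mat n} {v : ℝ} (hV : ‖V‖ ≤ v) (p : ℕ) : ‖negPow V p‖ ≤ v ^ p := by
  have hv := (norm_nonneg _).trans hV
  rw [negPow]
  split_ifs with h
  · rw [norm_zero]; positivity
  · rw [norm_neg_one_pow_smul]
    exact norm_pow_le_pow hV (by omega)

theorem summable_norm_negPow {V : Mat n} (hV : ‖V‖ ≤ 1 / 2) : Summable fun p => ‖negPow V p‖ :=
  Summable.of_nonneg_of_le (fun _ => norm_nonneg _) (norm_negPow_le hV)
    (summable_geometric_of_lt_one (by norm_num) (by norm_num))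

/-- The geometric series: `∑_{p ≥ 1} (-V) ^ p = -V / (1 + V)` for small diagonal `V`. -/
theorem tsum_negPow {d : Fin n → ℂ} (hV : ‖(Matrix.diagonal d : Mat n)‖ ≤ 1 / 2) :
    ∑' p, negPow (Matrix.diagonal d) p = Matrix.diagonal fun i => -d i / (1 + d i) := by
  have hd : ∀ i, ‖d i‖ ≤ 1 / 2 := fun i => by
    have := norm_entry_le (Matrix.diagonal d) i i
    rw [Matrix.diagonal_apply_eq] at this
    exact this.trans hV
  have h1 : ∀ i, HasSum (fun p : ℕ => if p = 0 then 0 else (-d i) ^ p) (-d i / (1 + d i)) := by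
    intro i
    have h2 := hasSum_geometric_of_norm_lt_one (ξ := -d i)
      (by rw [norm_neg]; exact (hd i).trans_lt (by norm_num))
    have h3 := h2.update 0 0
    have h4 : (1 : ℂ) + d i ≠ 0 := fun h => by
      have h5 : d i = -1 := by linear_combination h
      have := hd i
      rw [h5, norm_neg, norm_one] at this
      norm_num at this
    have e : 0 - (-d i) ^ 0 + (1 - -d i)⁻¹ = -d i / (1 + d i) := by
      rw [sub_neg_eq_add]; field_simp; ring
    rw [e] at h3
    refine h3.congr_fun fun p => ?_
    by_cases hp : p = 0 <;> simp [hp]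
  refine HasSum.tsum_eq ?_
  have h2 := HasSum.matrix_diagonal (Pi.hasSum.2 h1)
  refine h2.congr_fun fun p => ?_
  rw [negPow]
  split_ifs with hp
  · ext i j
    by_cases hij : i = j <;> simp [Matrix.diagonal, hij]
  · rw [Matrix.diagonal_pow]
    ext i j
    by_cases hij : i = j
    · simp [hij, neg_pow (d j)]
    · simp [hij]

/-- The linear map `cross K`. -/
noncomputable def crossL (n K : ℕ) : Mat n →L[ℂ] Mat n := deltaL n (K + 1) - deltaL n K

theorem hasSum_crossSum {K : ℕ} {d : Fin n → ℂ} (hV : ‖(Matrix.diagonal d : Mat n)‖ ≤ 1 / 2)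
    {a : ℕ → Mat n} (ha : Summable fun i => ‖a i‖) :
    HasSum (fun m => crossSum K (Matrix.diagonal d) a m)
      (br ((Matrix.diagonal fun i => -d i / (1 + d i)) * cross K (∑' i, a i) +
        cross K (∑' i, a i) * Matrix.diagonal fun i => -d i / (1 + d i)) (∑' i, a i)) := by
  set V : Mat n := Matrix.diagonal d
  have hg := summable_norm_negPow hV
  have hc : Summable fun i => ‖cross K (a i)‖ :=
    Summable.of_nonneg_of_le (fun _ => norm_nonneg _) (fun i => norm_cross_le K (a i))
      (ha.mul_left 2)
  have hct : ∑' i, cross K (a i) = cross K (∑' i, a i) :=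
    ((crossL n K).map_tsum ha.of_norm).symm
  have h1 := hasSum_mul_antidiagonal hg hc
  have h2 := hasSum_mul_antidiagonal hc hg
  have s1 := summable_norm_sum_mul_antidiagonal_of_summable_norm hg hc
  have s2 := summable_norm_sum_mul_antidiagonal_of_summable_norm hc hg
  have e : ∀ m, ∑ pi ∈ antidiagonal m,
      (negPow V pi.1 * cross K (a pi.2) + cross K (a pi.2) * negPow V pi.1) =
      ∑ pi ∈ antidiagonal m, negPow V pi.1 * cross K (a pi.2) +
        ∑ pi ∈ antidiagonal m, cross K (a pi.1) * negPow V pi.2 := fun m => by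
    rw [Finset.sum_add_distrib]
    congr 1
    exact Finset.Nat.sum_antidiagonal_swap (f := fun ij : ℕ × ℕ => cross K (a ij.1) * negPow V ij.2)
  have hO : Summable fun m => ‖∑ pi ∈ antidiagonal m,
      (negPow V pi.1 * cross K (a pi.2) + cross K (a pi.2) * negPow V pi.1)‖ :=
    Summable.of_nonneg_of_le (fun _ => norm_nonneg _)
      (fun m => by rw [e m]; exact norm_add_le _ _) (s1.add s2)
  have h3 := hasSum_br_antidiagonal hO ha
  simp only [← crossSum_eq] at h3
  rwa [tsum_congr e, (h1.add h2).tsum_eq, hct, tsum_negPow hV] at h3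

theorem cum_single {l K : Fin n} : cum l (Pi.single K (1 : ℂ)) = if K ≤ l then 1 else 0 := by
  rw [cum_apply]
  simp [Pi.single_apply]

theorem tailSum_of_le {b K : Fin n} (h : K ≤ b) (w : Fin n → ℂ) : tailSum K w b = 0 := by
  rw [tailSum, Finset.sum_eq_zero]
  intro l hl
  have := (Finset.mem_filter.1 hl).2
  exact absurd (this.1.trans this.2) (not_lt.2 h)

/-- In the direction of `w K`, the exponentially small part of the coefficients of level `K + 1` is
multiplication by the entries of `-V / (1 + V)`, `V = U / z_K`, which is the sum of the geometric
series in the recursion. -/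
theorem had_epsCoeff_single {K : Fin n} (w : Fin n → ℂ) (Y : Mat n) :
    had (epsCoeff K w (Pi.single K 1)) Y =
      (Matrix.diagonal fun i => -(Complex.exp (-(w K)) * tailSum K w i) /
        (1 + Complex.exp (-(w K)) * tailSum K w i)) * cross K Y +
      cross K Y * Matrix.diagonal fun i => -(Complex.exp (-(w K)) * tailSum K w i) /
        (1 + Complex.exp (-(w K)) * tailSum K w i) := by
  have he : ∀ b, b < K → epsEntry K w (Pi.single K 1) b =
      -(Complex.exp (-(w K)) * tailSum K w b) / (1 + Complex.exp (-(w K)) * tailSum K w b) := by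
    intro b hb
    rw [epsEntry]
    congr 1
    rw [tailSum, ← mul_neg, ← Finset.sum_neg_distrib]
    congr 1
    refine Finset.sum_congr rfl fun l hl => ?_
    have := (Finset.mem_filter.1 hl).2.2
    rw [cum_single, cum_single, if_neg (not_le.2 this), if_pos le_rfl]
    ring
  ext a b
  rw [had_apply, Matrix.add_apply, Matrix.diagonal_mul, Matrix.mul_diagonal, cross_apply, epsCoeff]
  by_cases h1 : a = K ∧ b < K
  · rw [if_pos h1, if_pos (Or.inl h1), he b h1.2, h1.1, tailSum_of_le le_rfl]
    simp
    ring
  · rw [if_neg h1]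
    by_cases h2 : b = K ∧ a < K
    · rw [if_pos h2, if_pos (Or.inr h2), he a h2.2, h2.1, tailSum_of_le le_rfl]
      simp
    · rw [if_neg h2, if_neg (by tauto)]
      simp

end Cauchy

/-! ### Existence of a solution given by the series -/

section SeriesSolution

variable {n : ℕ}

open Finset.HasAntidiagonal (antidiagonal)

/-- All the terms satisfy one and the same differential equation. -/
theorem hasDerivAt_term {K : ℕ} {U Φ' : Mat n} {φ : ℕ → ℂ → Mat n}
    (h0 : ∀ s, φ 0 s = powAd (-s) (delta K Φ') Φ')
    (h : ∀ m, 1 ≤ m → IsRecursion K U (delta K Φ') φ m) (m : ℕ) (s : ℂ) :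
    HasDerivAt (φ m) ((m : ℂ) • φ m s +
      (∑ ij ∈ antidiagonal m, br (φ ij.1 s) (delta K (φ ij.2 s)) +
        crossSum K U (fun i => φ i s) m)) s := by
  set A := delta K Φ' with hAdef
  have hA : delta K A = A := delta_delta le_rfl _
  have hδ : ∀ s, delta K (φ 0 s) = A := fun s => by
    rw [h0, delta_powAd hA, ← hAdef, powAd_self]
  have hneg : ∀ (s : ℂ) (X : Mat n), powAd (-s) A X = powAd s (-A) X := fun s X => by
    rw [powAd_eq_ex, powAd_eq_ex, neg_smul, smul_neg]
  have hbr : ∀ X : Mat n, br (-A) X = br X A := fun X => by simp only [br]; noncomm_ring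
  rcases Nat.eq_zero_or_pos m with rfl | hm
  · have h1 : φ 0 = fun s => powAd s (-A) Φ' := by
      ext1 s; rw [h0, hneg]
    have h2 := hasDerivAt_powAd s (-A) Φ'
    rw [← h1] at h2
    refine h2.congr_deriv ?_
    rw [← hneg, ← h0, hbr]
    simp [crossSum, hδ]
  · have h1 : φ m = fun s => powAd s (-A) (powAd s A (φ m s)) := by
      ext1 s; rw [← hneg, powAd_neg_powAd]
    have h2 := hasDerivAt_powAd_comp (A := -A) ((h m hm).powAd_deriv s)
    rw [← h1] at h2
    refine h2.congr_deriv ?_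
    rw [← hneg, powAd_neg_powAd, ← hneg, powAd_add_right, powAd_neg_powAd, powAd_smul_right,
      powAd_neg_powAd, hbr, aSum, sum_antidiagonal_eq_filter_add, hδ]
    abel

theorem summable_succ_mul_geometric : Summable fun m : ℕ => ((m : ℝ) + 1) * (1 / 2) ^ m := by
  have h1 := summable_pow_mul_geometric_of_norm_lt_one (r := (1 / 2 : ℝ)) 1
    (by norm_num [abs_of_pos])
  have h2 := summable_geometric_of_lt_one (r := (1 / 2 : ℝ)) (by norm_num) (by norm_num)
  refine (h1.add h2).congr fun m => ?_
  ring

theorem UMat_congr {K : Fin n} {w w' : Fin n → ℂ} (h : ∀ j < K, w j = w' j) :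
    UMat w K = UMat w' K := by
  rw [UMat_eq, UMat_eq]
  congr 1
  ext b
  exact tailSum_congr h b

/-- The series converges far out and solves the equation of level `K + 1` in the direction of
`w K`, with the asymptotics prescribed by its leading term. The threshold and the constant are
uniform in the data. -/
theorem exists_series_solution (κ M ρ θ : ℝ) : ∃ T C : ℝ, ∀ (K : Fin n) (w : Fin n → ℂ)
    (Φ' : Mat n), ‖UMat w K‖ ≤ ρ → ‖Φ'‖ ≤ M → (∀ t : ℝ, ‖ex ((t : ℂ) • delta K Φ')‖ ≤ κ) →
    |(w K).im| ≤ θ → T ≤ (w K).re → ∃ S : ℝ → Mat n, HasSeriesValue K w Φ' (S 0) ∧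
      (∀ t : ℝ, 0 ≤ t → HasDerivAt S (br (had (epsCoeff K (w + (t : ℂ) • Pi.single K 1)
        (Pi.single K 1)) (S t) - delta K (S t)) (S t)) t) ∧
      ∀ t : ℝ, 0 ≤ t → ‖S t - powAd (-(w K + t)) (delta K Φ') Φ'‖ ≤
        C * Real.exp (-((w K).re + t)) := by
  obtain ⟨D, r, hr, hρr, hbd⟩ := exists_norm_terms_le (n := n) κ M ρ θ
  refine ⟨Real.log (2 * r) + 1, 2 * D * r, fun K w Φ' hU hΦ hκ him hre => ?_⟩
  obtain ⟨φ, h0, -, hrec⟩ := exists_terms (K := K) (d := tailSum K w) hκ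
  rw [← UMat_eq] at hrec
  set U := UMat w K with hUdef
  have hφ := hbd K U Φ' φ hU hΦ hκ h0 hrec
  have hρ0 : 0 ≤ ρ := (norm_nonneg _).trans hU
  set s : ℝ → ℂ := fun t => w K + t with hs
  have hsim : ∀ t, |(s t).im| ≤ θ := fun t => by simpa [hs] using him
  have hD0 : 0 ≤ D := by
    have := (norm_nonneg _).trans (hφ 0 (s 0) (hsim 0))
    simpa using this
  -- `x = 1 / z_K` along the ray; the choice of the threshold makes `r ‖x‖ ≤ 1 / 2`. The estimates
  -- are needed on an open interval containing `[0, ∞)`, whence the bound `-1 < t`.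
  set x : ℝ → ℂ := fun t => Complex.exp (-(s t)) with hx
  have hxn : ∀ t, ‖x t‖ = Real.exp (-((w K).re + t)) := fun t => by
    rw [hx, Complex.norm_exp]
    simp [hs]
  have hxr : ∀ t, -1 < t → r * ‖x t‖ ≤ 1 / 2 := fun t ht => by
    have h1 : Real.exp (-((w K).re + t)) ≤ Real.exp (-Real.log (2 * r)) :=
      Real.exp_le_exp.2 (by linarith)
    rw [Real.exp_neg (Real.log _), Real.exp_log (by positivity)] at h1
    rw [hxn]
    calc _ ≤ r * (2 * r)⁻¹ := by gcongr
      _ = _ := by field_simp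
  have hexp : ∀ (m : ℕ) (t : ℝ), Complex.exp (-(m : ℂ) * s t) = x t ^ m := fun m t => by
    rw [hx, ← Complex.exp_nat_mul]
    congr 1; ring
  set full : ℕ → ℂ → Mat n := fun m s =>
    ∑ ij ∈ antidiagonal m, br (φ ij.1 s) (delta K (φ ij.2 s)) + crossSum K U (fun i => φ i s) m
    with hfull
  -- the summands; the factor `x ^ m` cancels the term `m φ_m` in the derivative of `φ_m`
  set g : ℕ → ℝ → Mat n := fun m t => x t ^ m • φ m (s t) with hg
  set g' : ℕ → ℝ → Mat n := fun m t => x t ^ m • full m (s t) with hg'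
  have hgd : ∀ m (t : ℝ), HasDerivAt (g m) (g' m t) t := by
    intro m t
    have hsd : HasDerivAt s 1 t := by
      simpa [hs] using (Complex.ofRealCLM.hasDerivAt (x := t)).const_add (w K)
    have h1 : HasDerivAt (fun t => x t ^ m) (-(m : ℂ) * x t ^ m) t := by
      simp only [← hexp]
      refine ((hsd.const_mul (-(m : ℂ))).cexp).congr_deriv ?_
      ring
    have h2 : HasDerivAt (fun t => φ m (s t)) ((m : ℂ) • φ m (s t) + full m (s t)) t := by
      have := (hasDerivAt_term h0 hrec m (s t)).scomp t hsd
      rwa [one_smul] at this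
    refine (h1.fun_smul h2).congr_deriv ?_
    simp only [hg', smul_add, neg_mul, neg_smul, mul_smul]
    rw [smul_comm (x t ^ m) (m : ℂ)]
    abel
  have hxm : ∀ t, -1 < t → ∀ m : ℕ, ‖x t‖ ^ m * r ^ m ≤ (1 / 2) ^ m := fun t ht m => by
    rw [← mul_pow, mul_comm]
    exact pow_le_pow_left₀ (by positivity) (hxr t ht) m
  have hgn : ∀ m t, -1 < t → ‖g m t‖ ≤ D * (1 / 2) ^ m := by
    intro m t ht
    rw [hg, norm_smul, norm_pow]
    calc _ ≤ ‖x t‖ ^ m * (D * r ^ m) := by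
          gcongr
          exact hφ m _ (hsim t)
      _ = D * (‖x t‖ ^ m * r ^ m) := by ring
      _ ≤ _ := by
        gcongr
        exact hxm t ht m
  have hgn' : ∀ m t, -1 < t → ‖g' m t‖ ≤ 10 * D ^ 2 * (((m : ℝ) + 1) * (1 / 2) ^ m) := by
    intro m t ht
    rw [hg', norm_smul, norm_pow]
    have h1 := norm_sum_br_le (K := K) (X := fun i => φ i (s t)) (m := m)
      fun i _ => hφ i (s t) (hsim t)
    have h2 := norm_crossSum_le (K := K) (X := fun i => φ i (s t)) (m := m) hU hr hρr
      fun i _ => hφ i (s t) (hsim t)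
    have h3 : ρ / r ≤ 1 / 2 := by rw [div_le_iff₀ hr]; linarith
    have h4 : ‖full m (s t)‖ ≤ 10 * D ^ 2 * ((m : ℝ) + 1) * r ^ m := by
      refine (norm_add_le _ _).trans ((add_le_add h1 h2).trans ?_)
      have h5 : (m : ℝ) * (16 * D ^ 2 * (ρ / r) * r ^ m) ≤
          m * (16 * D ^ 2 * (1 / 2) * r ^ m) := by gcongr
      have h6 : 0 ≤ D ^ 2 * r ^ m := by positivity
      nlinarith
    calc _ ≤ ‖x t‖ ^ m * (10 * D ^ 2 * ((m : ℝ) + 1) * r ^ m) := by gcongr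
      _ = 10 * D ^ 2 * ((m : ℝ) + 1) * (‖x t‖ ^ m * r ^ m) := by ring
      _ ≤ 10 * D ^ 2 * ((m : ℝ) + 1) * (1 / 2) ^ m := by
        gcongr
        exact hxm t ht m
      _ = _ := by ring
  have hgeo : Summable fun m : ℕ => D * (1 / 2 : ℝ) ^ m :=
    (summable_geometric_of_lt_one (by norm_num) (by norm_num)).mul_left D
  have hgs : ∀ t, -1 < t → Summable fun m => ‖g m t‖ := fun t ht =>
    Summable.of_nonneg_of_le (fun _ => norm_nonneg _) (fun m => hgn m t ht) hgeo
  set S : ℝ → Mat n := fun t => ∑' m, g m t with hS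
  have hSd : ∀ t, -1 < t → HasDerivAt S (∑' m, g' m t) t := fun t ht =>
    hasDerivAt_tsum_of_isPreconnected (summable_succ_mul_geometric.mul_left (10 * D ^ 2))
      isOpen_Ioi isPreconnected_Ioi (fun m y _ => hgd m y) (fun m y hy => hgn' m y hy)
      (show (0 : ℝ) ∈ Ioi (-1) by simp) (hgs 0 (by norm_num)).of_norm ht
  -- the derivatives of the summands are the terms of a Cauchy product
  have hSsum : ∀ t, -1 < t → HasSum (fun m => g' m t)
      (br (had (epsCoeff K (w + (t : ℂ) • Pi.single K 1) (Pi.single K 1)) (S t) -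
        delta K (S t)) (S t)) := by
    intro t ht
    set w' := w + (t : ℂ) • (Pi.single K 1 : Fin n → ℂ) with hw'
    have hw'K : w' K = s t := by simp [hw', hs]
    have hw'j : ∀ j < K, w j = w' j := fun j hj => by simp [hw', hj.ne]
    have ha := hgs t ht
    have hd : Summable fun m => ‖delta K (g m t)‖ :=
      Summable.of_nonneg_of_le (fun _ => norm_nonneg _) (fun m => norm_delta_le K _) ha
    have hdt : ∑' m, delta K (g m t) = delta K (S t) := ((deltaL n K).map_tsum ha.of_norm).symm
    have h1 := hasSum_br_antidiagonal ha hd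
    rw [hdt] at h1
    have hV : x t • U = Matrix.diagonal fun i => Complex.exp (-(w' K)) * tailSum K w' i := by
      rw [hUdef, UMat_congr hw'j, UMat_eq, ← Matrix.diagonal_smul, hw'K]
      rfl
    have hVn : ‖(Matrix.diagonal fun i => Complex.exp (-(w' K)) * tailSum K w' i : Mat n)‖ ≤
        1 / 2 := by
      rw [← hV, norm_smul]
      have h3 := hxr t ht
      have h4 : ‖x t‖ * ‖U‖ ≤ ‖x t‖ * (r / 2) := by gcongr; linarith
      linarith
    have h2 := hasSum_crossSum (K := K) hVn ha
    rw [← had_epsCoeff_single, ← hV] at h2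
    have h3 := h1.add h2
    have e : br (S t) (delta K (S t)) + br (had (epsCoeff K w' (Pi.single K 1)) (S t)) (S t) =
        br (had (epsCoeff K w' (Pi.single K 1)) (S t) - delta K (S t)) (S t) := by
      rw [br_sub_left, br_comm (S t)]; abel
    rw [← e]
    refine h3.congr_fun fun m => ?_
    change x t ^ m • full m (s t) = _
    rw [crossSum_smul, hfull, smul_add, Finset.smul_sum]
    congr 1
    refine Finset.sum_congr rfl fun ij hij => ?_
    simp only [hg, delta_smul, br_smul_left, br_smul_right, smul_smul]
    rw [← Finset.HasAntidiagonal.mem_antidiagonal.1 hij, pow_add, mul_comm]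
  refine ⟨S, ⟨φ, isSeriesTerms_of_isRecursion h0 hrec, ?_⟩, fun t ht => ?_, fun t ht => ?_⟩
  · have h1 := (hgs 0 (by norm_num)).of_norm.hasSum
    refine h1.congr_fun fun m => ?_
    have e : s 0 = w K := by simp [hs]
    rw [← e, hexp]
  · rw [← (hSsum t (by linarith)).tsum_eq]
    exact hSd t (by linarith)
  · have ht' : -1 < t := by linarith
    have h1 := (hgs t ht').of_norm.tsum_eq_zero_add
    have h2 : g 0 t = powAd (-(w K + t)) (delta K Φ') Φ' := by
      simp only [hg, pow_zero, one_smul, h0, hs]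
    rw [hS]
    dsimp only
    rw [h1, h2, add_sub_cancel_left, ← hxn]
    have h3 := (hasSum_geometric_of_lt_one (r := (1 / 2 : ℝ)) (by norm_num)
      (by norm_num)).mul_left (D * r * ‖x t‖)
    refine (tsum_of_norm_bounded h3 fun m => ?_).trans (by norm_num; linarith)
    rw [hg, norm_smul, norm_pow]
    calc _ ≤ ‖x t‖ ^ (m + 1) * (D * r ^ (m + 1)) := by
          gcongr
          exact hφ _ _ (hsim t)
      _ = D * r * ‖x t‖ * (‖x t‖ ^ m * r ^ m) := by ring
      _ ≤ _ := by
        gcongr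
        exact hxm t ht' m

end SeriesSolution

/-! ### Uniqueness of the solution with given leading term -/

section UniqueAtInfinity

variable {n : ℕ}

/-- A function that tends to `0` inherits an exponential bound from its derivative, with a gain of a
factor `1 / p`. -/
theorem norm_le_exp_of_tendsto_zero {f f' : ℝ → Mat n} {B : ℝ} {p : ℕ} (hp : 1 ≤ p)
    (hf : ∀ t, 0 ≤ t → HasDerivAt f (f' t) t)
    (hB : ∀ t, 0 ≤ t → ‖f' t‖ ≤ B * Real.exp (-(p * t))) (h0 : Tendsto f atTop (𝓝 0)) {t : ℝ}
    (ht : 0 ≤ t) : ‖f t‖ ≤ B / p * Real.exp (-(p * t)) := by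
  have hp0 : (0 : ℝ) < p := by exact_mod_cast hp
  obtain ⟨L, hL, hb⟩ := exists_tendsto_of_norm_deriv_le_exp (f := fun τ => f ((p : ℝ)⁻¹ * τ))
    (f' := fun τ => (p : ℝ)⁻¹ • f' ((p : ℝ)⁻¹ * τ)) (T₀ := 0) (C := B / p)
    (fun τ hτ => by
      have h1 : HasDerivAt (fun τ : ℝ => (p : ℝ)⁻¹ * τ) (p : ℝ)⁻¹ τ := by
        simpa using (hasDerivAt_id τ).const_mul (p : ℝ)⁻¹
      exact (hf _ (by positivity)).scomp τ h1)
    (fun τ hτ => by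
      have h1 := hB ((p : ℝ)⁻¹ * τ) (by positivity)
      rw [mul_inv_cancel_left₀ hp0.ne'] at h1
      rw [norm_smul, Real.norm_of_nonneg (by positivity)]
      calc _ ≤ (p : ℝ)⁻¹ * (B * Real.exp (-τ)) := by gcongr
        _ = _ := by ring)
  have hL0 : L = 0 := tendsto_nhds_unique hL
    (h0.comp (tendsto_id.const_mul_atTop (by positivity : (0 : ℝ) < (p : ℝ)⁻¹)))
  have h1 := hb (p * t) (by positivity)
  rwa [hL0, sub_zero, inv_mul_cancel_left₀ hp0.ne'] at h1

theorem tendsto_zero_of_norm_le_exp {f : ℝ → Mat n} {C : ℝ}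
    (h : ∀ t, 0 ≤ t → ‖f t‖ ≤ C * Real.exp (-t)) : Tendsto f atTop (𝓝 0) := by
  have h1 := (Real.tendsto_exp_neg_atTop_nhds_zero).const_mul C
  rw [mul_zero] at h1
  exact squeeze_zero_norm' ((eventually_ge_atTop 0).mono h) h1

/-- Two solutions of the equation in the direction of the last coordinate with the same leading
asymptotics agree: the difference `d` of two solutions that is `O(exp (-q t))` is
`O(exp (-(q + 1) t) / (q + 1))`, first in the block, then in conjugated form. -/
theorem eq_of_asymptotic {K : ℕ} {c : ℝ → Fin n → Fin n → ℂ} {A Y : Mat n} {s : ℂ}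
    {y z : ℝ → Mat n} {e C κ : ℝ} (hY : delta K Y = A)
    (hc : ∀ t, 0 ≤ t → ∀ X : Mat n, ‖had (c t) X‖ ≤ e * Real.exp (-t) * ‖X‖) (he : 0 ≤ e)
    (hκ : ∀ t : ℝ, ‖ex ((s + t) • A)‖ ≤ κ ∧ ‖ex (-((s + t) • A))‖ ≤ κ)
    (hy : ∀ t, 0 ≤ t → HasDerivAt y (br (had (c t) (y t) - delta K (y t)) (y t)) t)
    (hz : ∀ t, 0 ≤ t → HasDerivAt z (br (had (c t) (z t) - delta K (z t)) (z t)) t)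
    (hya : ∀ t : ℝ, 0 ≤ t → ‖y t - powAd (-(s + t)) A Y‖ ≤ C * Real.exp (-t))
    (hza : ∀ t : ℝ, 0 ≤ t → ‖z t - powAd (-(s + t)) A Y‖ ≤ C * Real.exp (-t)) : y 0 = z 0 := by
  have hA : delta K A = A := by rw [← hY]; exact delta_delta le_rfl _
  have hκ0 : 0 ≤ κ := (norm_nonneg _).trans (hκ 0).1
  have hC0 : 0 ≤ C := by
    have := (norm_nonneg _).trans (hya 0 le_rfl)
    simpa using this
  have hp1 : ∀ (t : ℝ) (X : Mat n), ‖powAd (s + t) A X‖ ≤ κ ^ 2 * ‖X‖ := fun t X =>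
    norm_powAd_le_of_le (hκ t).1 (hκ t).2 X
  have hp2 : ∀ (t : ℝ) (X : Mat n), ‖powAd (-(s + t)) A X‖ ≤ κ ^ 2 * ‖X‖ := fun t X =>
    norm_powAd_le_of_le (by rw [neg_smul]; exact (hκ t).2)
      (by rw [neg_smul, neg_neg]; exact (hκ t).1) X
  set m := κ ^ 2 * ‖Y‖ + C with hm
  have hm0 : 0 ≤ m := by positivity
  have hbd : ∀ f : ℝ → Mat n, (∀ t : ℝ, 0 ≤ t → ‖f t - powAd (-(s + t)) A Y‖ ≤ C * Real.exp (-t)) →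
      ∀ t, 0 ≤ t → ‖f t‖ ≤ m := fun f hf t ht => by
    have h1 := hf t ht
    have h2 : Real.exp (-t) ≤ 1 := Real.exp_le_one_iff.2 (by linarith)
    have h3 := hp2 t Y
    have h4 := norm_sub_norm_le (f t) (powAd (-(s + t)) A Y)
    nlinarith
  have hym := hbd y hya
  have hzm := hbd z hza
  have hδ : ∀ t : ℝ, 0 ≤ t → ‖A - delta K (z t)‖ ≤ C * Real.exp (-t) := fun t ht => by
    have h1 := norm_delta_le K (z t - powAd (-(s + t)) A Y)
    rw [delta_sub, delta_powAd hA, hY, powAd_self] at h1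
    rw [norm_sub_rev]
    exact h1.trans (hza t ht)
  set d : ℝ → Mat n := fun t => y t - z t with hd
  -- the contribution of the coefficients `c`
  set ε : ℝ → Mat n := fun t => br (had (c t) (y t)) (y t) - br (had (c t) (z t)) (z t) with hε
  have hεn : ∀ t, 0 ≤ t → ‖ε t‖ ≤ 4 * e * m * (Real.exp (-t) * ‖d t‖) := fun t ht => by
    rw [hε]
    dsimp only
    rw [br_had_sub]
    have h1 := hc t ht (y t - z t)
    have h2 := hc t ht (z t)
    have h3 := hym t ht
    have h4 := hzm t ht
    have h5 := Real.exp_pos (-t)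
    calc _ ≤ 2 * ‖had (c t) (y t - z t)‖ * ‖y t‖ + 2 * ‖had (c t) (z t)‖ * ‖y t - z t‖ :=
          (norm_add_le _ _).trans (add_le_add (norm_br_le _ _) (norm_br_le _ _))
      _ ≤ 2 * (e * Real.exp (-t) * ‖y t - z t‖) * m +
          2 * (e * Real.exp (-t) * m) * ‖y t - z t‖ := by
        gcongr
        exact h2.trans (by gcongr)
      _ = _ := by rw [hd]; ring
  have hd' : ∀ t, 0 ≤ t → HasDerivAt d
      (ε t - br (delta K (d t)) (y t) - br (delta K (z t)) (d t)) t := fun t ht => by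
    refine ((hy t ht).sub (hz t ht)).congr_deriv ?_
    simp only [hε, hd, delta_sub, br_sub_left, br_sub_right]
    abel
  have hδd' : ∀ t, 0 ≤ t → HasDerivAt (fun t => delta K (d t)) (delta K (ε t)) t := fun t ht => by
    refine (((deltaL n K).restrictScalars ℝ).hasFDerivAt.comp_hasDerivAt t
      (hd' t ht)).congr_deriv ?_
    rw [ContinuousLinearMap.coe_restrictScalars', deltaL_apply, delta_sub, delta_sub, delta_br (delta_delta le_rfl _),
      delta_br (delta_delta le_rfl _)]
    simp only [hd, delta_sub, br_sub_left, br_sub_right, br_self]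
    rw [br_comm (delta K (z t)) (delta K (y t))]
    abel
  set g : ℝ → Mat n := fun t => powAd (s + t) A (d t) with hg
  have hg' : ∀ t : ℝ, 0 ≤ t → HasDerivAt g (powAd (s + t) A
      (br (A - delta K (z t)) (d t) - br (delta K (d t)) (y t) + ε t)) t := fun t ht => by
    have hsd : HasDerivAt (fun t : ℝ => s + (t : ℂ)) 1 t := by
      simpa using (Complex.ofRealCLM.hasDerivAt (x := t)).const_add s
    have h1 := (hasDerivAt_ex_smul A (s + t)).scomp t hsd
    have h2 := (hasDerivAt_ex_smul (-A) (s + t)).scomp t hsd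
    have h3 := (h1.fun_mul (hd' t ht)).fun_mul h2
    simp only [Function.comp_def, smul_neg, one_smul] at h3
    refine h3.congr_deriv ?_
    have hcm : Commute A (ex ((s + t) • A)) := commute_ex ((Commute.refl A).smul_right _)
    have hcm' : Commute A (ex (-((s + t) • A))) :=
      commute_ex ((Commute.refl A).smul_right _).neg_right
    simp only [powAd_eq_ex]
    rw [br_sub_left, hcm.eq]
    rw [show br A (d t) = A * d t - d t * A from rfl]
    simp only [neg_mul, mul_neg, add_mul, mul_add, mul_sub, sub_mul, mul_assoc]
    rw [hcm'.eq]
    abel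
  set P := κ ^ 2 * (κ ^ 2 * (2 * C + 2 * (4 * e * m) * m + 4 * e * m)) with hP
  have hd0 : ∀ t, 0 ≤ t → ‖d t‖ ≤ 2 * C * Real.exp (-t) := fun t ht => by
    have h1 : d t = (y t - powAd (-(s + t)) A Y) - (z t - powAd (-(s + t)) A Y) := by
      exact (sub_sub_sub_cancel_right _ _ _).symm
    rw [h1]
    refine (norm_sub_le _ _).trans ?_
    linarith [hya t ht, hza t ht]
  have hδ0 : Tendsto (fun t => delta K (d t)) atTop (𝓝 0) :=
    tendsto_zero_of_norm_le_exp fun t ht => (norm_delta_le _ _).trans (hd0 t ht)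
  have hg0 : Tendsto g atTop (𝓝 0) :=
    tendsto_zero_of_norm_le_exp (C := κ ^ 2 * (2 * C)) fun t ht => (hp1 t _).trans (by
      rw [mul_assoc (κ ^ 2)]
      exact mul_le_mul_of_nonneg_left (hd0 t ht) (sq_nonneg κ))
  -- each step gains a factor `exp (-t)` and a factor `1 / (q + 1)`: first for the block, in whose
  -- equation the brackets without `ε` cancel, then for the conjugated difference
  have step : ∀ q : ℕ, ∀ E : ℝ, 0 ≤ E →
      (∀ t, 0 ≤ t → ‖d t‖ ≤ E * Real.exp (-((q : ℝ) * t))) →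
      ∀ t, 0 ≤ t → ‖d t‖ ≤ P * E / ((q + 1 : ℕ) : ℝ) * Real.exp (-(((q + 1 : ℕ) : ℝ) * t)) := by
    intro q E hE hq t ht
    have hexp : ∀ t : ℝ, Real.exp (-t) * Real.exp (-((q : ℝ) * t)) =
        Real.exp (-(((q + 1 : ℕ) : ℝ) * t)) := fun t => by
      rw [← Real.exp_add]; push_cast; ring_nf
    have hde : ∀ t, 0 ≤ t → Real.exp (-t) * ‖d t‖ ≤
        E * Real.exp (-(((q + 1 : ℕ) : ℝ) * t)) := fun t ht => by
      rw [← hexp]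
      have := mul_le_mul_of_nonneg_left (hq t ht) (Real.exp_pos (-t)).le
      linarith
    have hεE : ∀ t, 0 ≤ t → ‖ε t‖ ≤
        4 * e * m * E * Real.exp (-(((q + 1 : ℕ) : ℝ) * t)) := fun t ht => by
      refine (hεn t ht).trans ?_
      rw [mul_assoc (4 * e * m)]
      exact mul_le_mul_of_nonneg_left (hde t ht) (by positivity)
    have hδE : ∀ t, 0 ≤ t → ‖delta K (d t)‖ ≤
        4 * e * m * E * Real.exp (-(((q + 1 : ℕ) : ℝ) * t)) := fun t ht => by
      refine (norm_le_exp_of_tendsto_zero (by omega) hδd'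
        (fun t ht => (norm_delta_le _ _).trans (hεE t ht)) hδ0 ht).trans ?_
      gcongr
      exact div_le_self (by positivity) (by exact_mod_cast Nat.succ_le_succ (Nat.zero_le q))
    have hgE := norm_le_exp_of_tendsto_zero (p := q + 1)
      (B := κ ^ 2 * (2 * C + 2 * (4 * e * m) * m + 4 * e * m) * E) (by omega) hg' (fun t ht => by
        refine (hp1 t _).trans ?_
        rw [mul_assoc (κ ^ 2), mul_assoc (κ ^ 2)]
        refine mul_le_mul_of_nonneg_left ?_ (sq_nonneg κ)
        have h1 : ‖br (A - delta K (z t)) (d t)‖ ≤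
            2 * C * (E * Real.exp (-(((q + 1 : ℕ) : ℝ) * t))) := by
          calc _ ≤ 2 * ‖A - delta K (z t)‖ * ‖d t‖ := norm_br_le _ _
            _ ≤ 2 * (C * Real.exp (-t)) * ‖d t‖ := by gcongr; exact hδ t ht
            _ = 2 * C * (Real.exp (-t) * ‖d t‖) := by ring
            _ ≤ _ := mul_le_mul_of_nonneg_left (hde t ht) (by positivity)
        have h2 : ‖br (delta K (d t)) (y t)‖ ≤
            2 * (4 * e * m * E * Real.exp (-(((q + 1 : ℕ) : ℝ) * t))) * m := by
          refine (norm_br_le _ _).trans ?_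
          gcongr
          · exact hδE t ht
          · exact hym t ht
        have h3 := hεE t ht
        have h4 := norm_add_le (br (A - delta K (z t)) (d t) - br (delta K (d t)) (y t)) (ε t)
        have h5 := norm_sub_le (br (A - delta K (z t)) (d t)) (br (delta K (d t)) (y t))
        linarith) hg0 ht
    have h1 : d t = powAd (-(s + t)) A (g t) := by rw [hg, powAd_neg_powAd]
    rw [h1]
    refine (hp2 t _).trans ((mul_le_mul_of_nonneg_left hgE (sq_nonneg κ)).trans (le_of_eq ?_))
    rw [hP]
    ring
  have hP0 : 0 ≤ P := by positivity
  have main : ∀ q : ℕ, ∀ t, 0 ≤ t →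
      ‖d t‖ ≤ 2 * C * (P ^ q / (q.factorial : ℝ)) * Real.exp (-((q : ℝ) * t)) := by
    intro q
    induction q with
    | zero =>
      intro t ht
      refine (hd0 t ht).trans ?_
      have : Real.exp (-t) ≤ 1 := Real.exp_le_one_iff.2 (by linarith)
      simp
      nlinarith
    | succ q ih =>
      intro t ht
      refine (step q _ (by positivity) ih t ht).trans (le_of_eq ?_)
      rw [Nat.factorial_succ, pow_succ]
      push_cast
      field_simp
  -- at `t = 0` only the factor `P ^ q / q!` remains
  have hlim : Tendsto (fun q : ℕ => 2 * C * (P ^ q / (q.factorial : ℝ))) atTop (𝓝 0) := by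
    simpa using (FloorSemiring.tendsto_pow_div_factorial_atTop P).const_mul (2 * C)
  have h0 : ‖d 0‖ ≤ 0 := ge_of_tendsto' hlim fun q => by simpa using main q 0 le_rfl
  exact sub_eq_zero.1 (norm_le_zero_iff.1 h0)

theorem norm_UMat_le {K : Fin n} {w : Fin n → ℂ} {μ : ℝ} (hμ : 0 ≤ μ)
    (hw : ∀ j < K, -μ ≤ (w j).re) :
    ‖UMat w K‖ ≤ n * Real.exp (n * μ) * ‖(1 : Mat n)‖ := by
  have h1 : UMat w K = had (fun a _ => tailSum K w a) 1 := by
    rw [UMat_eq]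
    ext a b
    by_cases h : a = b <;> simp [h]
  rw [h1]
  exact norm_had_le (fun a _ => norm_tailSum_le hμ hw a) (by positivity) _

/-- A solution of the equation of level `K + 1` in the direction of `w K` with the asymptotics
prescribed by `Φ'` is the sum of the series attached to `Φ'`. -/
theorem exists_hasSeriesValue (κ M θ : ℝ) {μ : ℝ} (hμ : 0 ≤ μ) : ∃ T : ℝ, ∀ (K : Fin n)
    (w : Fin n → ℂ) (Φ' : Mat n) (y : ℝ → Mat n) (C : ℝ), (∀ j < K, -μ ≤ (w j).re) → ‖Φ'‖ ≤ M →
    (∀ t : ℝ, ‖ex ((t : ℂ) • delta K Φ')‖ ≤ κ) → |(w K).im| ≤ θ → T ≤ (w K).re →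
    (∀ t : ℝ, 0 ≤ t → HasDerivAt y (br (had (epsCoeff K (w + (t : ℂ) • Pi.single K 1)
        (Pi.single K 1)) (y t) - delta K (y t)) (y t)) t) →
    (∀ t : ℝ, 0 ≤ t → ‖y t - powAd (-(w K + t)) (delta K Φ') Φ'‖ ≤ C * Real.exp (-t)) →
    HasSeriesValue K w Φ' (y 0) := by
  obtain ⟨T, C', hT⟩ := exists_series_solution (n := n) κ M
    (n * Real.exp (n * μ) * ‖(1 : Mat n)‖) θ
  obtain ⟨κ', hκ'1, hκ'⟩ := exists_norm_ex_smul_le (n := n) κ M θ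
  refine ⟨max T (max 0 (farBound n μ)), fun K w Φ' y C hw hΦ hκ him hre hy hya => ?_⟩
  have hre1 : T ≤ (w K).re := (le_max_left _ _).trans hre
  have hre2 : 0 ≤ (w K).re := ((le_max_left _ _).trans (le_max_right _ _)).trans hre
  have hre3 : farBound n μ ≤ (w K).re := ((le_max_right _ _).trans (le_max_right _ _)).trans hre
  obtain ⟨S, hS, hSd, hSa⟩ := hT K w Φ' (norm_UMat_le hμ hw) hΦ hκ him hre1
  have hC' : 0 ≤ C' := by
    have := (norm_nonneg _).trans (hSa 0 le_rfl)
    exact nonneg_of_mul_nonneg_left this (Real.exp_pos _)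
  rw [eq_of_asymptotic (K := K) (c := fun t => epsCoeff K (w + (t : ℂ) • Pi.single K 1)
    (Pi.single K 1)) (A := delta K Φ') (Y := Φ') (s := w K) (y := y) (z := S)
    (e := 2 * n * farBound n μ) (C := max C C') (κ := κ') rfl ?_ ?_ ?_ hy hSd ?_ ?_]
  · exact hS
  · intro t ht X
    have hwK : (w + (t : ℂ) • (Pi.single K 1 : Fin n → ℂ)) K = w K + t := by simp
    have h1 : ∀ a b, ‖epsCoeff K (w + (t : ℂ) • Pi.single K 1) (Pi.single K 1) a b‖ ≤
        2 * n * farBound n μ * Real.exp (-t) := fun a b => by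
      refine (norm_epsCoeff_le hμ (fun j hj => ?_) ?_ _ a b).trans ?_
      · simpa [hj.ne] using hw j hj
      · rw [hwK]
        simp only [Complex.add_re, Complex.ofReal_re]
        linarith
      · rw [hwK]
        have h2 : ‖(Pi.single K 1 : Fin n → ℂ)‖ ≤ 1 := by
          rw [Pi.norm_single, norm_one]
        have h3 : Real.exp (-(w K + t).re) ≤ Real.exp (-t) :=
          Real.exp_le_exp.2 (by simp only [Complex.add_re, Complex.ofReal_re]; linarith)
        have h4 := farBound_nonneg n μ
        calc _ ≤ 2 * n * farBound n μ * Real.exp (-t) * 1 := by gcongr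
          _ = _ := mul_one _
    have h4 := farBound_nonneg n μ
    exact norm_had_le h1 (by positivity) X
  · have h4 := farBound_nonneg n μ
    positivity
  · intro t
    exact hκ' _ ((norm_delta_le _ _).trans hΦ) hκ (w K + t) (by simpa using him)
  · intro t ht
    refine (hya t ht).trans ?_
    gcongr
    exact le_max_left _ _
  · intro t ht
    refine (hSa t ht).trans ?_
    have h3 : Real.exp (-((w K).re + t)) ≤ Real.exp (-t) := Real.exp_le_exp.2 (by linarith)
    calc _ ≤ C' * Real.exp (-t) := by gcongr
      _ ≤ _ := by
        gcongr
        exact le_max_right _ _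

end UniqueAtInfinity

/-! ### Continuation from the real slice -/

section Lift

variable {n : ℕ} {β : Fin n → ℝ} {k : ℕ} {Y : (Fin n → ℝ) → Mat n}

/-- The value at `w` of the continuation, along the segment in imaginary direction, of the solution
`Y` of level `k` on the real slice. -/
noncomputable def lift (β : Fin n → ℝ) (k : ℕ) (Y : (Fin n → ℝ) → Mat n) (w : Fin n → ℂ) : Mat n :=
  segValue (levelRegular u k) (iso n k) (slice β (reVec w)) (Y (reVec w)) w

/-- The points to which `Y` can be continued along the segment in imaginary direction. -/
def liftDomain (β : Fin n → ℝ) (k : ℕ) (Y : (Fin n → ℝ) → Mat n) : Set (Fin n → ℂ) :=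
  {w | reVec w ∈ tower β k ∧
    w ∈ segDomain (levelRegular u k) (iso n k) (slice β (reVec w)) (Y (reVec w))}

/-- The segment in imaginary direction that ends at `w`. -/
noncomputable def imSegment (β : Fin n → ℝ) (w : Fin n → ℂ) (t : ℝ) : Fin n → ℂ :=
  slice β (reVec w) + t • (w - slice β (reVec w))

theorem imSegment_one (w : Fin n → ℂ) : imSegment β w 1 = w := by simp [imSegment]

theorem imSegment_zero (w : Fin n → ℂ) : imSegment β w 0 = slice β (reVec w) := by simp [imSegment]

theorem reVec_imSegment (w : Fin n → ℂ) (t : ℝ) : reVec (imSegment β w t) = reVec w :=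
  reVec_segment β w t

theorem imSegment_im (w : Fin n → ℂ) (t : ℝ) (j : Fin n) :
    (imSegment β w t j).im = (1 - t) * β j + t * (w j).im := by
  simp [imSegment]; ring

theorem imSegment_re (w : Fin n → ℂ) (t : ℝ) (j : Fin n) : (imSegment β w t j).re = (w j).re :=
  congrFun (reVec_imSegment w t) j

theorem IsSegSol.lift_imSegment {w : Fin n → ℂ} {y : ℝ → Mat n}
    (hy : IsSegSol (levelRegular u k) (iso n k) (slice β (reVec w)) w y) (h0 : y 0 = Y (reVec w))
    {t : ℝ} (ht : t ∈ Icc (0 : ℝ) 1) : lift β k Y (imSegment β w t) = y t := by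
  have h1 := (hy.restrict ht).segValue_eq (isFlat_iso k)
  rw [mul_zero, mul_one, h0] at h1
  rw [lift, reVec_imSegment]
  exact h1

theorem IsSegSol.lift_eq {w : Fin n → ℂ} {y : ℝ → Mat n}
    (hy : IsSegSol (levelRegular u k) (iso n k) (slice β (reVec w)) w y) (h0 : y 0 = Y (reVec w)) :
    lift β k Y w = y 1 := by
  have := hy.lift_imSegment h0 (t := 1) (by simp)
  rwa [imSegment_one] at this

theorem isSegSol_lift {w : Fin n → ℂ} (hw : w ∈ liftDomain β k Y) :
    IsSegSol (levelRegular u k) (iso n k) (slice β (reVec w)) w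
      (fun t => lift β k Y (imSegment β w t)) ∧
      lift β k Y (imSegment β w 0) = Y (reVec w) := by
  obtain ⟨-, y, hy, h0⟩ := hw
  refine ⟨⟨hy.mem, fun t ht => ?_⟩, (hy.lift_imSegment h0 (by simp)).trans h0⟩
  rw [hy.lift_imSegment h0 ht]
  exact (hy.deriv t ht).congr (fun s hs => hy.lift_imSegment h0 hs) (hy.lift_imSegment h0 ht)

theorem hasFDerivAt_lift (hY : IsSliceSol β k Y) {w : Fin n → ℂ} (hw : w ∈ liftDomain β k Y) :
    HasFDerivAt (lift β k Y) (iso n k w (lift β k Y w)) w :=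
  hasFDerivAt_segValue_slice (isFlat_iso k) (isOpen_tower β k)
    (fun _ hx => slice_mem_levelRegular hx) hY.deriv hw.1 hw.2

theorem levelRegular_congr {w w' : Fin n → ℂ} (h : ∀ j : Fin n, (j : ℕ) < k → w j = w' j)
    (hw : w ∈ levelRegular u k) : w' ∈ levelRegular u k := fun a b ha hb hab => by
  rw [← u_congr h ha, ← u_congr h hb]
  exact hw a b ha hb hab

theorem iso_congr {w w' v v' : Fin n → ℂ} (h : ∀ j : Fin n, (j : ℕ) < k → w j = w' j)
    (hv : ∀ j : Fin n, (j : ℕ) < k → v j = v' j) (X : Mat n) : iso n k w X v = iso n k w' X v' := by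
  have h1 : iso n k w' X (v - v') = 0 := by
    rw [iso_apply, lax_eq_zero w' (fun j hj => by simp [hv j hj])]
    simp [br]
  rw [map_sub, sub_eq_zero] at h1
  rw [← h1, iso_apply, iso_apply, lax_congr h]

theorem imSegment_congr {w w' : Fin n → ℂ} {j : Fin n} (h : w j = w' j) (t : ℝ) :
    imSegment β w t j = imSegment β w' t j := by
  simp [imSegment, slice, h]

/-- The continuation of a solution of level `k` depends on the first `k` coordinates only. -/
theorem lift_congr (hY : IsSliceSol β k Y) {w w' : Fin n → ℂ}
    (h : ∀ j : Fin n, (j : ℕ) < k → w j = w' j) (hw : w ∈ liftDomain β k Y) :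
    w' ∈ liftDomain β k Y ∧ lift β k Y w' = lift β k Y w := by
  have hre : ∀ j : Fin n, (j : ℕ) < k → reVec w j = reVec w' j := fun j hj => by
    simp [h j hj]
  have hT := tower_congr hre hw.1
  have hYY := hY.congr hw.1 hre
  obtain ⟨hs, h0⟩ := isSegSol_lift hw
  set y := fun t => lift β k Y (imSegment β w t) with hy
  have hseg : ∀ t : ℝ, ∀ j : Fin n, (j : ℕ) < k → imSegment β w t j = imSegment β w' t j :=
    fun t j hj => imSegment_congr (h j hj) t
  have hs' : IsSegSol (levelRegular u k) (iso n k) (slice β (reVec w')) w' y :=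
    ⟨fun t ht => levelRegular_congr (hseg t) (hs.mem t ht), fun t ht => by
      have h1 := hs.deriv t ht
      exact h1.congr_deriv (iso_congr (hseg t) (fun j hj => by simp [slice, h j hj]) (y t))⟩
  have h0' : y 0 = Y (reVec w') := h0.trans hYY
  refine ⟨⟨hT, y, hs', h0'⟩, ?_⟩
  rw [hs'.lift_eq h0', hy]
  simp only [imSegment_one]

/-- At level `0` there is nothing to continue. -/
theorem lift_level_zero (w : Fin n → ℂ) :
    w ∈ liftDomain β 0 Y ∧ lift β 0 Y w = Y (reVec w) := by
  have hs : IsSegSol (levelRegular u 0) (iso n 0) (slice β (reVec w)) w (fun _ => Y (reVec w)) := by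
    refine ⟨fun t _ a b ha => absurd ha (Nat.not_lt_zero _), fun t _ => ?_⟩
    rw [iso_apply, lax_eq_zero _ fun j hj => absurd hj (Nat.not_lt_zero _)]
    simpa [br] using hasDerivWithinAt_const t (Icc (0 : ℝ) 1) (Y (reVec w))
  exact ⟨⟨by rw [tower_zero]; trivial, _, hs, rfl⟩, hs.lift_eq rfl⟩

/-- Far out in the direction of `w K`, regularity at level `K` implies regularity at level
`K + 1`. -/
theorem levelRegular_succ {K : Fin n} {w : Fin n → ℂ} (hw : w ∈ levelRegular u K)
    (h : ∀ b < K, 1 + Complex.exp (-(w K)) * tailSum K w b ≠ 0) : w ∈ levelRegular u (K + 1) := by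
  have key : ∀ b < K, u w K ≠ u w b := fun b hb h1 => by
    have h2 := u_sub_u hb w
    rw [h1, sub_self] at h2
    exact mul_ne_zero (Complex.exp_ne_zero _) (h b hb) h2.symm
  intro a b ha hb hab
  rcases Nat.lt_succ_iff_lt_or_eq.1 ha with ha' | ha'
  · rcases Nat.lt_succ_iff_lt_or_eq.1 hb with hb' | hb'
    · exact hw a b ha' hb' hab
    · rw [Fin.ext hb']
      exact (key a ha').symm
  · rw [Fin.ext ha']
    refine key b (lt_of_le_of_ne (Nat.lt_succ_iff.1 hb) fun h => hab ?_)
    rw [Fin.ext ha', h]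

/-- The points over a box in the real parts of the first `K` coordinates, with bounded imaginary
parts. -/
def tube (x : Fin n → ℝ) (r θ : ℝ) (K : ℕ) : Set (Fin n → ℂ) :=
  {w | ∀ j : Fin n, (j : ℕ) < K → |(w j).re - x j| ≤ r ∧ |(w j).im| ≤ θ}

/-- Moving the coordinates from the `K`-th on to the slice. -/
noncomputable def cutoff (β : Fin n → ℝ) (K : ℕ) (w : Fin n → ℂ) : Fin n → ℂ :=
  fun j => if (j : ℕ) < K then w j else β j * Complex.I

theorem cutoff_of_lt {K : ℕ} {w : Fin n → ℂ} {j : Fin n} (h : (j : ℕ) < K) :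
    w j = cutoff β K w j := by simp [cutoff, h]

/-- Modulo the coordinates that do not matter, a tube is compact. -/
theorem isCompact_cutoff_tube (x : Fin n → ℝ) (r θ : ℝ) (K : ℕ) :
    IsCompact {w | w ∈ tube x r θ K ∧ cutoff β K w = w} := by
  have h : {w | w ∈ tube x r θ K ∧ cutoff β K w = w} = Set.pi univ (fun j : Fin n =>
      if (j : ℕ) < K then Icc (x j - r) (x j + r) ×ℂ Icc (-θ) θ else {β j * Complex.I}) := by
    ext w
    simp only [tube, cutoff, mem_ofPred_eq, Set.mem_pi, mem_univ, true_implies, funext_iff]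
    constructor
    · rintro ⟨h1, h2⟩ j
      split_ifs with hj
      · have := h1 j hj
        rw [Complex.mem_reProdIm, mem_Icc, mem_Icc]
        rw [abs_le, abs_le] at this
        exact ⟨⟨by linarith, by linarith⟩, this.2⟩
      · have := h2 j
        rw [if_neg hj] at this
        exact this.symm
    · intro h1
      refine ⟨fun j hj => ?_, fun j => ?_⟩
      · have := h1 j
        rw [if_pos hj, Complex.mem_reProdIm, mem_Icc, mem_Icc] at this
        rw [abs_le, abs_le]
        exact ⟨⟨by linarith, by linarith⟩, this.2⟩
      · have := h1 j
        split_ifs with hj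
        · rfl
        · rw [if_neg hj] at this
          exact this.symm
  rw [h]
  refine isCompact_univ_pi fun j => ?_
  split_ifs
  · exact isCompact_Icc.reProdIm isCompact_Icc
  · exact isCompact_singleton

theorem imSegment_mem_tube {x : Fin n → ℝ} {r θ : ℝ} {K : ℕ} (hθ : ∀ j, |β j| ≤ θ)
    {w : Fin n → ℂ} (hw : w ∈ tube x r θ K) {t : ℝ} (ht : t ∈ Icc (0 : ℝ) 1) :
    imSegment β w t ∈ tube x r θ K := fun j hj => by
  refine ⟨by rw [imSegment_re]; exact (hw j hj).1, ?_⟩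
  rw [imSegment_im]
  have h1 := (hw j hj).2
  have h2 := hθ j
  have h3 : 0 ≤ 1 - t := by linarith [ht.2]
  calc _ ≤ |(1 - t) * β j| + |t * (w j).im| := abs_add_le _ _
    _ = (1 - t) * |β j| + t * |(w j).im| := by
      rw [abs_mul, abs_mul, abs_of_nonneg h3, abs_of_nonneg ht.1]
    _ ≤ (1 - t) * θ + t * θ := by
      gcongr
      exact ht.1
    _ = θ := by ring

theorem norm_sub_slice_le {θ : ℝ} {K : ℕ} (hθ0 : 0 ≤ θ) (hθ : ∀ j, |β j| ≤ θ) {w : Fin n → ℂ}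
    (hw : ∀ j : Fin n, (j : ℕ) < K → |(w j).im| ≤ θ) (hc : cutoff β K w = w) :
    ‖w - slice β (reVec w)‖ ≤ 2 * θ := by
  refine (pi_norm_le_iff_of_nonneg (by positivity)).2 fun j => ?_
  have e : (w - slice β (reVec w)) j = (((w j).im - β j : ℝ) : ℂ) * Complex.I := by
    apply Complex.ext <;> simp
  rw [e, norm_mul, Complex.norm_I, mul_one, Complex.norm_real, Real.norm_eq_abs]
  by_cases hj : (j : ℕ) < K
  · have h1 := hw j hj
    have h2 := abs_sub (w j).im (β j)
    linarith [hθ j]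
  · have : w j = β j * Complex.I := by
      rw [← hc]; simp [cutoff, hj]
    rw [this]
    simpa using hθ0

/-- Bounds for the continuation of a solution of level `K` over a tube. -/
theorem exists_tube_bounds {K : ℕ} (hY : IsSliceSol β K Y) {x : Fin n → ℝ} {r θ : ℝ} (hθ0 : 0 ≤ θ)
    (hθ : ∀ j, |β j| ≤ θ) (htube : tube x r θ K ⊆ liftDomain β K Y) :
    ∃ M L κ : ℝ, 0 ≤ M ∧ 0 ≤ L ∧ 0 ≤ κ ∧ ∀ w ∈ tube x r θ K, ‖lift β K Y w‖ ≤ M ∧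
      (∀ v X, ‖lax K w v X‖ ≤ L * ‖v‖ * ‖X‖) ∧
      ∀ t : ℝ, ‖ex ((t : ℂ) • delta K (lift β K Y w))‖ ≤ κ := by
  have hQ := isCompact_cutoff_tube (β := β) x r θ K
  set Q := {w | w ∈ tube x r θ K ∧ cutoff β K w = w} with hQdef
  have hQd : Q ⊆ liftDomain β K Y := fun w hw => htube hw.1
  have hQr : Q ⊆ levelRegular u K := fun w hw => segDomain_subset (hQd hw).2
  obtain ⟨M, hM⟩ := hQ.exists_bound_of_continuousOn (f := lift β K Y) fun w hw =>
    (hasFDerivAt_lift hY (hQd hw)).continuousAt.continuousWithinAt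
  obtain ⟨L, hL0, hL⟩ := exists_norm_lax_le hQ hQr
  have hcut : ∀ w ∈ tube x r θ K, cutoff β K w ∈ Q := fun w hw => by
    refine ⟨fun j hj => ?_, ?_⟩
    · rw [← cutoff_of_lt hj]; exact hw j hj
    · ext j
      by_cases hj : (j : ℕ) < K <;> simp [cutoff, hj]
  have hcc : ∀ w ∈ tube x r θ K, lift β K Y (cutoff β K w) = lift β K Y w := fun w hw =>
    (lift_congr hY (fun j hj => cutoff_of_lt hj) (htube hw)).2
  have hM' : ∀ w ∈ tube x r θ K, ‖lift β K Y w‖ ≤ max M 0 := fun w hw => by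
    rw [← hcc w hw]
    exact (hM _ (hcut w hw)).trans (le_max_left _ _)
  have hL' : ∀ w ∈ tube x r θ K, ∀ v X, ‖lax K w v X‖ ≤ L * ‖v‖ * ‖X‖ := fun w hw v X => by
    rw [lax_congr (w' := cutoff β K w) (fun j hj => cutoff_of_lt hj)]
    exact hL _ (hcut w hw) v X
  refine ⟨max M 0, L, (n + 1) * Real.exp (2 * (L * (2 * θ) * max M 0)), le_max_right _ _, hL0,
    by positivity, fun w hw => ⟨hM' w hw, hL' w hw, fun a => ?_⟩⟩
  rw [← hcc w hw]
  set q := cutoff β K w with hq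
  have hqQ := hcut w hw
  obtain ⟨hs, h0⟩ := isSegSol_lift (hQd hqQ)
  have hh := norm_sub_slice_le hθ0 hθ (fun j hj => (hqQ.1 j hj).2) hqQ.2
  set h := q - slice β (reVec q) with hhdef
  set y := fun t => lift β K Y (imSegment β q t) with hy
  have hmem : ∀ t ∈ Icc (0 : ℝ) 1, imSegment β q t ∈ tube x r θ K := fun t ht =>
    imSegment_mem_tube hθ hqQ.1 ht
  set P : ℝ → Mat n := fun t => lax K (imSegment β q t) h (y t) with hP
  have hPn : ∀ t ∈ Icc (0 : ℝ) 1, ‖P t‖ ≤ L * (2 * θ) * max M 0 := fun t ht => by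
    refine (hL' _ (hmem t ht) h (y t)).trans ?_
    gcongr
    exact hM' _ (hmem t ht)
  -- `exp (a δ_K y)` satisfies the same linear equation `g' = [P, g]` as `a δ_K y`, whose coefficient
  -- does not depend on `a`; at the slice it is unitary
  have hA : ∀ t ∈ Icc (0 : ℝ) 1, HasDerivWithinAt (fun t => (a : ℂ) • delta K (y t))
      (br (P t) ((a : ℂ) • delta K (y t))) (Icc 0 1) t := fun t ht => by
    have h1 : HasDerivWithinAt y (br (P t) (y t)) (Icc 0 1) t := by
      have h2 := hs.deriv t ht
      rw [iso_apply] at h2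
      exact h2
    have h2 := (((deltaL n K).restrictScalars ℝ).hasFDerivAt.comp_hasDerivWithinAt t h1).const_smul
      (a : ℂ)
    refine h2.congr_deriv ?_
    rw [ContinuousLinearMap.coe_restrictScalars', deltaL_apply, delta_br (delta_lax K _ _ _),
      br_smul_right]
  have hg : ∀ t ∈ Icc (0 : ℝ) 1, HasDerivWithinAt (fun t => ex ((a : ℂ) • delta K (y t)))
      (br (P t) (ex ((a : ℂ) • delta K (y t)))) (Icc 0 1) t := fun t ht => by
    have h1 := ((hasFDerivAt_ex ((a : ℂ) • delta K (y t))).restrictScalars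
      ℝ).comp_hasDerivWithinAt t (hA t ht)
    refine h1.congr_deriv ?_
    rw [ContinuousLinearMap.coe_restrictScalars', fderiv_ex_br]
  have hstart : ‖ex ((a : ℂ) • delta K (y 0))‖ ≤ n + 1 := by
    refine norm_ex_of_skew ?_
    rw [hy]
    dsimp only
    rw [h0, Matrix.conjTranspose_smul, hY.skew _ (hQd hqQ).1]
    simp
  have := norm_le_of_deriv_Icc (x := fun t => ex ((a : ℂ) • delta K (y t)))
    (K := 2 * (L * (2 * θ) * max M 0)) (ε := 0) (by positivity) le_rfl hg hstart (fun t ht => by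
      rw [add_zero]
      refine (norm_br_le _ _).trans ?_
      gcongr
      exact hPn t ht) 1 (by simp)
  rw [add_zero, hy] at this
  simpa only [imSegment_one] using this

end Lift

/-! ### Ascending to the next level -/

section Ascend

variable {n : ℕ} {β : Fin n → ℝ} {K : Fin n} {Y : (Fin n → ℝ) → Mat n}

/-- The leading term `z_K ^ {-ad A} Y_K`, `A = δ_K Y_K`, of the solution of level `K + 1` attached
to the solution `Y_K` of level `K`. -/
noncomputable def ascend (β : Fin n → ℝ) (K : Fin n) (Y : (Fin n → ℝ) → Mat n) (w : Fin n → ℂ) :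
    Mat n :=
  powAd (-(w K)) (delta K (lift β K Y w)) (lift β K Y w)

theorem delta_ascend (w : Fin n → ℂ) : delta K (ascend β K Y w) = delta K (lift β K Y w) := by
  rw [ascend, delta_powAd (delta_delta le_rfl _), powAd_self]

/-- The leading term satisfies the equation of level `K + 1` up to the exponentially small part of
the coefficients. -/
theorem exists_hasFDerivAt_ascend (hY : IsSliceSol β K Y) {w : Fin n → ℂ}
    (hw : w ∈ liftDomain β K Y) : ∃ D : (Fin n → ℂ) →L[ℝ] Mat n,
      HasFDerivAt (ascend β K Y) D w ∧ ∀ h, D h = iso n K w (ascend β K Y w) h -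
        h K • br (delta K (ascend β K Y w)) (ascend β K Y w) := by
  have hs : HasFDerivAt (fun w : Fin n → ℂ => -(w K))
      (-(ContinuousLinearMap.proj (R := ℂ) (φ := fun _ : Fin n => ℂ) K).restrictScalars ℝ) w :=
    ((ContinuousLinearMap.proj (R := ℂ) (φ := fun _ : Fin n => ℂ) K).restrictScalars
      ℝ).hasFDerivAt.neg
  have hL := (hasFDerivAt_lift hY hw).restrictScalars ℝ
  have hA := ((deltaL n K).restrictScalars ℝ).hasFDerivAt.comp w hL
  obtain ⟨D, hD, hDh⟩ := exists_hasFDerivAt_powAd hs hA hL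
  refine ⟨D, hD, fun h => ?_⟩
  have e : lax K w h (ascend β K Y w) = lax K w h (lift β K Y w) := by
    rw [← lax_delta, delta_ascend, lax_delta]
  rw [hDh h (lax K w h (lift β K Y w)), iso_apply, e, delta_ascend]
  · have e2 : iso n K w (lift β K Y w) h - br (lax K w h (lift β K Y w)) (lift β K Y w) = 0 := by
      rw [iso_apply, sub_self]
    change -(h K) • br (delta K (lift β K Y w)) (ascend β K Y w) +
      br (lax K w h (lift β K Y w)) (ascend β K Y w) + powAd (-(w K)) (delta K (lift β K Y w))
        (iso n K w (lift β K Y w) h - br (lax K w h (lift β K Y w)) (lift β K Y w)) = _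
    rw [e2, powAd_eq_ex _ _ 0, mul_zero, zero_mul, add_zero, neg_smul]
    abel
  · rw [ContinuousLinearMap.comp_apply, ContinuousLinearMap.coe_restrictScalars',
      ContinuousLinearMap.coe_restrictScalars', iso_apply, deltaL_apply,
      delta_br (delta_lax K _ _ _)]
    rfl

/-- Far out in the direction of `w K`, the coefficients of level `K + 1` have no pole. -/
theorem one_add_ne_zero_of_far {w : Fin n → ℂ} {μ : ℝ} (hμ : 0 ≤ μ)
    (hw : ∀ j < K, -μ ≤ (w j).re) (hK : farBound n μ ≤ (w K).re) (b : Fin n) :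
    1 + Complex.exp (-(w K)) * tailSum K w b ≠ 0 := fun h => by
  have h1 := half_le_re (norm_exp_mul_tailSum_le hμ hw hK b)
  rw [h] at h1
  norm_num at h1

theorem norm_iso_sub_le {k : ℕ} {w v : Fin n → ℂ} {L M : ℝ} (hL0 : 0 ≤ L)
    (hL : ∀ X : Mat n, ‖lax k w v X‖ ≤ L * ‖X‖) {X X' : Mat n} (hX : ‖X‖ ≤ M) (hX' : ‖X'‖ ≤ M) :
    ‖iso n k w X v - iso n k w X' v‖ ≤ 4 * L * M * ‖X - X'‖ := by
  rw [iso_apply, iso_apply]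
  exact norm_br_lax_sub_le hL0 hL hX hX'

theorem continuousOn_iso_comp {k : ℕ} {p : ℝ → Fin n → ℂ} {z : ℝ → Mat n} (hp : Continuous p)
    (hz : ContinuousOn z (Icc 0 1)) (hmem : ∀ t ∈ Icc (0 : ℝ) 1, p t ∈ levelRegular u k)
    (h : Fin n → ℂ) : ContinuousOn (fun t => iso n k (p t) (z t) h) (Icc 0 1) := fun t ht => by
  have h1 := ((isFlat_iso k).continuousAt (hmem t ht) (z t)).comp_continuousWithinAt
    (f := fun t => (p t, z t)) (hp.continuousWithinAt.prodMk (hz t ht))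
  exact h1.clm_apply continuousWithinAt_const

set_option maxHeartbeats 1000000 in
/-- Far out, the solution of level `K + 1` on the real slice continues along the segment in
imaginary direction, and stays exponentially close to its leading term. -/
theorem exists_ascent (hβ : ∀ k, ∃ m : ℤ, β k = m * Real.pi) (hY : IsSliceSol β (K + 1) Y)
    {x : Fin n → ℝ} (hx : x ∈ tower β K) {r θ : ℝ} (hr : 0 < r) (hθ0 : 0 ≤ θ)
    (hθ : ∀ j, |β j| ≤ θ) (htube : tube x r θ K ⊆ liftDomain β K (descend β K Y)) :
    ∃ r' > 0, r' ≤ r ∧ ∃ T C : ℝ, 0 ≤ C ∧ ∀ w ∈ tube x r' θ K, |(w K).im| ≤ θ → T ≤ (w K).re →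
      w ∈ liftDomain β (K + 1) Y ∧
      ‖lift β (K + 1) Y w - ascend β K (descend β K Y) w‖ ≤ C * Real.exp (-(w K).re) := by
  have hY' : IsSliceSol β K (descend β K Y) := isSliceSol_descend hβ hY
  obtain ⟨M, L, κ, hM0, hL0, hκ0, hbd⟩ := exists_tube_bounds hY' hθ0 hθ htube
  obtain ⟨κ', hκ'1, hκ'⟩ := exists_norm_ex_smul_le (n := n) κ M θ
  obtain ⟨r₁, hr₁, R, C₀, hC₀, has⟩ := exists_asymptotic_descend hβ hY hx
  set μ := ‖x‖ + r with hμ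
  have hμ0 : 0 ≤ μ := by positivity
  set c := 2 * n * farBound n μ with hc
  have hfar := farBound_nonneg n μ
  have hc0 : 0 ≤ c := by positivity
  set M₁ := κ' ^ 2 * M with hM₁
  set L₁ := (L + 1 + c) * (2 * θ) with hL₁
  set K' := 4 * L₁ * (M₁ + 1) with hK'
  set ε₀ := 2 * (c * (2 * θ) * M₁) * M₁ with hε₀
  have hM₁0 : 0 ≤ M₁ := by positivity
  have hL₁0 : 0 ≤ L₁ := by positivity
  have hε₀0 : 0 ≤ ε₀ := by positivity
  set C := (C₀ + ε₀) * Real.exp K' with hC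
  have hC0 : 0 ≤ C := by positivity
  refine ⟨min r r₁, lt_min hr hr₁, min_le_left _ _, max (max R 0) (max (farBound n μ) C), C, hC0,
    ?_⟩
  -- the coordinates beyond the `K`-th are irrelevant and may be put on the slice
  suffices key : ∀ w ∈ tube x (min r r₁) θ K, |(w K).im| ≤ θ →
      max (max R 0) (max (farBound n μ) C) ≤ (w K).re → cutoff β (K + 1) w = w →
      w ∈ liftDomain β (K + 1) Y ∧
      ‖lift β (K + 1) Y w - ascend β K (descend β K Y) w‖ ≤ C * Real.exp (-(w K).re) by
    intro w hw him hre
    have hag : ∀ j : Fin n, (j : ℕ) < K + 1 → w j = cutoff β (K + 1) w j := fun j hj =>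
      cutoff_of_lt hj
    have hK1 : (K : ℕ) < K + 1 := Nat.lt_succ_self _
    have hwt : w ∈ tube x r θ K := fun j hj =>
      ⟨((hw j hj).1).trans (min_le_left _ _), (hw j hj).2⟩
    obtain ⟨h1, h2⟩ := key (cutoff β (K + 1) w)
      (fun j hj => by rw [← hag j (by omega)]; exact hw j hj) (by rwa [← hag K hK1])
      (by rwa [← hag K hK1]) (by
        ext j
        by_cases hj : (j : ℕ) < K + 1 <;> simp [cutoff, hj])
    obtain ⟨h3, h4⟩ := lift_congr hY (fun j hj => (hag j hj).symm) h1
    refine ⟨h3, ?_⟩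
    have h5 := (lift_congr hY' (w := w) (w' := cutoff β (K + 1) w)
      (fun j hj => hag j (by omega)) (htube hwt)).2
    rw [ascend, ← hag K hK1, h5] at h2
    rw [h4]
    exact h2
  intro w hw him hre hcut
  have hre1 : R ≤ (w K).re := ((le_max_left _ _).trans (le_max_left _ _)).trans hre
  have hre2 : 0 ≤ (w K).re := ((le_max_right _ _).trans (le_max_left _ _)).trans hre
  have hre3 : farBound n μ ≤ (w K).re := ((le_max_left _ _).trans (le_max_right _ _)).trans hre
  have hre4 : C ≤ (w K).re := ((le_max_right _ _).trans (le_max_right _ _)).trans hre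
  have hwt : w ∈ tube x r θ K := fun j hj => ⟨((hw j hj).1).trans (min_le_left _ _), (hw j hj).2⟩
  have hwd := htube hwt
  set p := imSegment β w with hp
  set h := w - slice β (reVec w) with hh
  have hpc : Continuous p := continuous_segment _ _
  have hptube : ∀ t ∈ Icc (0 : ℝ) 1, p t ∈ tube x r θ K := fun t ht =>
    imSegment_mem_tube hθ hwt ht
  have hpd : ∀ t ∈ Icc (0 : ℝ) 1, p t ∈ liftDomain β K (descend β K Y) := fun t ht =>
    htube (hptube t ht)
  have hpK : ∀ t, (p t K).re = (w K).re := fun t => imSegment_re w t K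
  have hpim : ∀ t ∈ Icc (0 : ℝ) 1, |(-(p t K)).im| ≤ θ := fun t ht => by
    have h1 := imSegment_mem_tube (x := reVec w) (r := 0) (K := K + 1) hθ (w := w)
      (fun j hj => ⟨by simp, by
        rcases Nat.lt_succ_iff_lt_or_eq.1 hj with h | h
        · exact (hw j h).2
        · rw [Fin.ext h]; exact him⟩) ht K (Nat.lt_succ_self _)
    simpa using h1.2
  have hpμ : ∀ t ∈ Icc (0 : ℝ) 1, ∀ j < K, -μ ≤ (p t j).re := fun t ht j hj => by
    have h1 := (abs_le.1 (hptube t ht j hj).1).1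
    have h2 := (abs_le.1 ((Real.norm_eq_abs _).symm.le.trans (norm_le_pi_norm x j))).1
    rw [hμ]
    linarith
  have hhn : ‖h‖ ≤ 2 * θ := norm_sub_slice_le hθ0 hθ (K := K + 1) (fun j hj => by
    rcases Nat.lt_succ_iff_lt_or_eq.1 hj with h | h
    · exact (hw j h).2
    · rw [Fin.ext h]; exact him) hcut
  have hhK : ‖h K‖ ≤ 2 * θ := (norm_le_pi_norm h K).trans hhn
  have hne : ∀ t ∈ Icc (0 : ℝ) 1, ∀ b < K,
      1 + Complex.exp (-(p t K)) * tailSum K (p t) b ≠ 0 := fun t ht b _ =>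
    one_add_ne_zero_of_far hμ0 (hpμ t ht) (by rw [hpK]; exact hre3) b
  have hpr : ∀ t ∈ Icc (0 : ℝ) 1, p t ∈ levelRegular u K := fun t ht =>
    segDomain_subset (hpd t ht).2
  have hpr' : ∀ t ∈ Icc (0 : ℝ) 1, p t ∈ levelRegular u (K + 1) := fun t ht =>
    levelRegular_succ (hpr t ht) (hne t ht)
  have heps : ∀ t ∈ Icc (0 : ℝ) 1, ∀ X : Mat n, ‖had (epsCoeff K (p t) h) X‖ ≤
      c * (2 * θ) * Real.exp (-(w K).re) * ‖X‖ := fun t ht X => by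
    refine norm_had_le (fun a b => ?_) (by positivity) X
    refine (norm_epsCoeff_le hμ0 (hpμ t ht) (by rw [hpK]; exact hre3) h a b).trans ?_
    rw [hpK, ← hc]
    calc _ ≤ c * Real.exp (-(w K).re) * (2 * θ) := by gcongr
      _ = _ := by ring
  have hexp1 : Real.exp (-(w K).re) ≤ 1 := Real.exp_le_one_iff.2 (by linarith)
  have hlax : ∀ t ∈ Icc (0 : ℝ) 1, ∀ X : Mat n, ‖lax (K + 1) (p t) h X‖ ≤ L₁ * ‖X‖ := by
    intro t ht X
    rw [lax_succ (hne t ht)]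
    have h1 := (hbd _ (hptube t ht)).2.1 h X
    have h2 := heps t ht X
    have h3 : ‖h K • delta K X‖ ≤ 2 * θ * ‖X‖ := by
      rw [norm_smul]
      exact mul_le_mul hhK (norm_delta_le _ _) (norm_nonneg _) (by positivity)
    calc _ ≤ ‖lax K (p t) h X‖ + ‖h K • delta K X‖ + ‖had (epsCoeff K (p t) h) X‖ :=
          (norm_add_le _ _).trans (add_le_add (norm_sub_le _ _) le_rfl)
      _ ≤ L * (2 * θ) * ‖X‖ + 2 * θ * ‖X‖ + c * (2 * θ) * 1 * ‖X‖ := by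
        refine add_le_add (add_le_add (h1.trans ?_) h3) (h2.trans ?_)
        · gcongr
        · gcongr
      _ = _ := by rw [hL₁]; ring
  -- the leading term `z` along the segment solves the equation of level `K + 1` up to an error of
  -- size `exp (-Re w_K)`, and the solution starts exponentially close to it
  choose! D hD hDh using fun t (ht : t ∈ Icc (0 : ℝ) 1) => exists_hasFDerivAt_ascend hY' (hpd t ht)
  set z : ℝ → Mat n := fun t => ascend β K (descend β K Y) (p t) with hz
  have hzn : ∀ t ∈ Icc (0 : ℝ) 1, ‖z t‖ ≤ M₁ := fun t ht => by
    obtain ⟨h1, -, h3⟩ := hbd _ (hptube t ht)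
    have h4 := hκ' _ ((norm_delta_le K _).trans h1) h3 _ (hpim t ht)
    exact (norm_powAd_le_of_le h4.1 h4.2 _).trans (by rw [hM₁]; gcongr)
  have hzd : ∀ t ∈ Icc (0 : ℝ) 1, HasDerivWithinAt z
      (iso n K (p t) (z t) h - h K • br (delta K (z t)) (z t)) (Icc 0 1) t := fun t ht => by
    have h1 : HasDerivWithinAt p h (Icc 0 1) t := by
      have h2 := ((hasDerivAt_id t).smul_const h).const_add (slice β (reVec w))
      rw [one_smul] at h2
      exact h2.hasDerivWithinAt
    refine ((hD t ht).comp_hasDerivWithinAt t h1).congr_deriv ?_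
    rw [hDh t ht]
  have hzc : ContinuousOn z (Icc 0 1) := fun t ht => (hzd t ht).continuousWithinAt
  obtain ⟨hseg, hseg0⟩ := isSegSol_lift hwd
  obtain ⟨htow, hinit⟩ := has (reVec w) (fun j hj => by
    rw [reVec_apply]
    exact (hw j hj).1.trans (min_le_right _ _)) hre1
  obtain ⟨y, hy0, hyd, hyz⟩ := exists_solution_near_approx
    (v := fun t X => iso n (K + 1) (p t) X h) (z := z)
    (z' := fun t => iso n K (p t) (z t) h - h K • br (delta K (z t)) (z t)) (a := 1)
    (δ := C₀ * Real.exp (-(w K).re)) (ε := ε₀ * Real.exp (-(w K).re)) (K := K')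
    (Y (reVec w)) one_pos (by positivity) (by positivity) hzd
    (fun t ht X X' hX hX' => by
      have h1 := norm_iso_sub_le (X := z t + X) (X' := z t + X') hL₁0 (hlax t ht) (M := M₁ + 1)
        ((norm_add_le _ _).trans (add_le_add (hzn t ht) hX))
        ((norm_add_le _ _).trans (add_le_add (hzn t ht) hX'))
      rwa [add_sub_add_left_eq_sub] at h1)
    (fun X _ => by
      refine (continuousOn_iso_comp hpc (hzc.add continuousOn_const) hpr' h).sub
        ((continuousOn_iso_comp hpc hzc hpr h).sub (ContinuousOn.const_smul ?_ (h K)))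
      have h1 : ContinuousOn (fun t => delta K (z t)) (Icc 0 1) :=
        (deltaL n K).continuous.comp_continuousOn hzc
      exact (h1.mul hzc).sub (hzc.mul h1))
    (fun t ht => by
      rw [iso_succ (hne t ht), ← iso_apply, add_sub_cancel_left]
      refine (norm_br_le _ _).trans ?_
      have h1 := heps t ht (z t)
      have h2 := hzn t ht
      calc _ ≤ 2 * (c * (2 * θ) * Real.exp (-(w K).re) * M₁) * M₁ := by
            gcongr
            exact h1.trans (by gcongr)
        _ = _ := by rw [hε₀]; ring)
    (by
      have h1 : z 0 = powAd (-(slice β (reVec w) K)) (delta K (descend β K Y (reVec w)))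
          (descend β K Y (reVec w)) := by
        rw [hz]
        dsimp only
        rw [ascend, hp, hseg0, imSegment_zero]
      rw [h1]
      exact hinit)
    (by
      have h1 : C * Real.exp (-(w K).re) ≤ 1 := by
        rw [Real.exp_neg, ← div_eq_mul_inv, div_le_one (Real.exp_pos _)]
        linarith [Real.add_one_le_exp (w K).re]
      calc _ = C * Real.exp (-(w K).re) := by rw [hC]; ring
        _ ≤ 1 := h1)
  have hsol : IsSegSol (levelRegular u (K + 1)) (iso n (K + 1)) (slice β (reVec w)) w y :=
    ⟨hpr', hyd⟩
  refine ⟨⟨htow, y, hsol, hy0⟩, ?_⟩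
  rw [hsol.lift_eq hy0]
  have h1 := hyz 1 (by simp)
  have h2 : z 1 = ascend β K (descend β K Y) w := by
    rw [hz]
    dsimp only
    rw [hp, imSegment_one]
  rw [h2] at h1
  refine h1.trans (le_of_eq ?_)
  rw [hC]
  ring

end Ascend

/-! ### The region at infinity -/

section SeriesRegion

variable {n : ℕ} {β : Fin n → ℝ} {K : Fin n} {Y : (Fin n → ℝ) → Mat n}

/-- Far out, the continuation of a solution of level `K + 1` is the sum of the series attached to
the continuation of its limit of level `K`. -/
theorem exists_hasSeriesValue_lift (hβ : ∀ k, ∃ m : ℤ, β k = m * Real.pi)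
    (hY : IsSliceSol β (K + 1) Y) {x : Fin n → ℝ} (hx : x ∈ tower β K) {r θ : ℝ} (hr : 0 < r)
    (hθ0 : 0 ≤ θ) (hθ : ∀ j, |β j| ≤ θ)
    (htube : tube x r θ K ⊆ liftDomain β K (descend β K Y)) :
    ∃ r' > 0, ∃ T : ℝ, ∀ w ∈ tube x r' θ K, |(w K).im| ≤ θ → T ≤ (w K).re →
      w ∈ liftDomain β (K + 1) Y ∧
      HasSeriesValue K w (lift β K (descend β K Y) w) (lift β (K + 1) Y w) := by
  have hY' : IsSliceSol β K (descend β K Y) := isSliceSol_descend hβ hY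
  obtain ⟨M, L, κ, hM0, hL0, hκ0, hbd⟩ := exists_tube_bounds hY' hθ0 hθ htube
  obtain ⟨r', hr', hr'r, T, C, hC0, hasc⟩ := exists_ascent hβ hY hx hr hθ0 hθ htube
  set μ := ‖x‖ + r with hμ
  have hμ0 : 0 ≤ μ := by positivity
  obtain ⟨T', hT'⟩ := exists_hasSeriesValue (n := n) κ M θ hμ0
  refine ⟨r', hr', max (max T 0) (max (farBound n μ) T'), fun w hw him hre => ?_⟩
  have hre1 : T ≤ (w K).re := ((le_max_left _ _).trans (le_max_left _ _)).trans hre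
  have hre2 : 0 ≤ (w K).re := ((le_max_right _ _).trans (le_max_left _ _)).trans hre
  have hre3 : farBound n μ ≤ (w K).re := ((le_max_left _ _).trans (le_max_right _ _)).trans hre
  have hre4 : T' ≤ (w K).re := ((le_max_right _ _).trans (le_max_right _ _)).trans hre
  have hwt : w ∈ tube x r θ K := fun j hj => ⟨((hw j hj).1).trans hr'r, (hw j hj).2⟩
  have hwd := htube hwt
  obtain ⟨hb1, -, hb3⟩ := hbd w hwt
  have hwμ : ∀ j < K, -μ ≤ (w j).re := fun j hj => by
    have h1 := (abs_le.1 (hwt j hj).1).1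
    have h2 := (abs_le.1 ((Real.norm_eq_abs _).symm.le.trans (norm_le_pi_norm x j))).1
    rw [hμ]
    linarith
  -- the ray from `w` in the direction of the coordinate `K`
  set p : ℝ → Fin n → ℂ := fun t => w + (t : ℂ) • Pi.single K 1 with hp
  have hpK : ∀ t, p t K = w K + t := fun t => by simp [hp]
  have hpj : ∀ t (j : Fin n), (j : ℕ) < K → w j = p t j := fun t j hj => by
    have : j ≠ K := fun h => by simp [h] at hj
    simp [hp, this]
  have hp0 : p 0 = w := by simp [hp]
  have hpasc : ∀ t : ℝ, 0 ≤ t → p t ∈ liftDomain β (K + 1) Y ∧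
      ‖lift β (K + 1) Y (p t) - ascend β K (descend β K Y) (p t)‖ ≤
        C * Real.exp (-(p t K).re) := fun t ht =>
    hasc (p t) (fun j hj => by rw [← hpj t j hj]; exact hw j hj) (by rw [hpK]; simpa using him)
      (by rw [hpK]; simp; linarith)
  have hwd' : w ∈ liftDomain β (K + 1) Y := by
    have := (hpasc 0 le_rfl).1
    rwa [hp0] at this
  refine ⟨hwd', ?_⟩
  have key := hT' K w (lift β K (descend β K Y) w) (fun t => lift β (K + 1) Y (p t)) C hwμ hb1 hb3
    him hre4 (fun t ht => ?_) (fun t ht => ?_)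
  · simpa only [hp0] using key
  · have h1 : HasDerivAt p (Pi.single K 1) t := by
      have h2 := ((Complex.ofRealCLM.hasDerivAt (x := t)).smul_const
        (Pi.single K 1 : Fin n → ℂ)).const_add w
      rw [Complex.ofRealCLM_apply, Complex.ofReal_one, one_smul] at h2
      exact h2
    have h2 := ((hasFDerivAt_lift hY (hpasc t ht).1).restrictScalars ℝ).comp_hasDerivAt t h1
    refine h2.congr_deriv ?_
    have hne : ∀ b < K, 1 + Complex.exp (-(p t K)) * tailSum K (p t) b ≠ 0 := fun b _ =>
      one_add_ne_zero_of_far hμ0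
        (fun j hj => by rw [← hpj t j hj]; exact hwμ j hj) (by rw [hpK]; simp; linarith) b
    rw [ContinuousLinearMap.coe_restrictScalars', iso_succ hne, lax_eq_zero]
    · simp only [Pi.single_eq_same, one_smul, br_sub_left]
      rw [show br (0 : Mat n) (lift β (K + 1) Y (p t)) = 0 by simp [br]]
      abel
    · intro j hj
      have : j ≠ K := fun h => by simp [h] at hj
      simp [this]
  · have h1 := (hpasc t ht).2
    have h2 := (lift_congr hY' (hpj t) hwd).2
    rw [ascend, h2, hpK] at h1
    refine h1.trans ?_
    have h3 : Real.exp (-(w K + (t : ℂ)).re) ≤ Real.exp (-t) :=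
      Real.exp_le_exp.2 (by simp; linarith)
    gcongr

/-- The region `|Im w_j| < θ`, `Re w_j > R_j`, `j < k`, where the bounds `R_j` depend on the
real parts. -/
def region (k : ℕ) (θ : ℝ) (R : Fin n → (Fin n → ℝ) → ℝ) : Set (Fin n → ℂ) :=
  {w | ∀ j : Fin n, (j : ℕ) < k → |(w j).im| < θ ∧ R j (reVec w) < (w j).re}

/-- Solutions `Yr k` of the equations of the hierarchy on the real slice, each being the limit of
the next one. -/
structure IsSliceTower (β : Fin n → ℝ) (Yr : ℕ → (Fin n → ℝ) → Mat n) : Prop where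
  isSliceSol : ∀ k ≤ n, IsSliceSol β k (Yr k)
  descend_eq : ∀ K : Fin n, Yr K = descend β K (Yr (K + 1))

/-- All the continuations exist on a region at infinity, and there each of them is the sum of the
series attached to the previous one. -/
theorem exists_region {Yr : ℕ → (Fin n → ℝ) → Mat n} (hβ : ∀ k, ∃ m : ℤ, β k = m * Real.pi)
    (hYr : IsSliceTower β Yr) (k : ℕ) (hk : k ≤ n) (θ : ℝ) (hθ0 : 0 ≤ θ) (hθ : ∀ j, |β j| ≤ θ) :
    ∃ R : Fin n → (Fin n → ℝ) → ℝ, (∀ j, Continuous (R j)) ∧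
      (∀ j x x', (∀ i < j, x i = x' i) → R j x = R j x') ∧ ∀ w ∈ region k θ R,
        w ∈ liftDomain β k (Yr k) ∧ ∀ j : Fin n, (j : ℕ) < k →
          HasSeriesValue j w (lift β j (Yr j) w) (lift β (j + 1) (Yr (j + 1)) w) := by
  induction k generalizing θ with
  | zero =>
    exact ⟨fun _ _ => 0, fun _ => continuous_const, fun _ _ _ _ => rfl, fun w _ =>
      ⟨(lift_level_zero w).1, fun j hj => absurd hj (Nat.not_lt_zero _)⟩⟩
  | succ k ih =>
    obtain ⟨R, hRc, hRd, hR⟩ := ih (by omega) (θ + 1) (by linarith) fun j => by linarith [hθ j]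
    set K : Fin n := ⟨k, by omega⟩ with hK
    have hKk : (K : ℕ) = k := rfl
    -- the admissible values of the new bound over a given point; the other bounds are raised
    set E : (Fin n → ℝ) → Set ℝ := fun x => {a | ∀ w : Fin n → ℂ, (∀ j < K, (w j).re = x j) →
      (∀ j < K, R j x + 1 < x j) → (∀ j ≤ K, |(w j).im| < θ) → a < (w K).re →
      w ∈ liftDomain β (k + 1) (Yr (k + 1)) ∧
        HasSeriesValue K w (lift β k (Yr k) w) (lift β (k + 1) (Yr (k + 1)) w)} with hE
    have hEconv : ∀ x, Convex ℝ (E x) := fun x => by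
      refine OrdConnected.convex ⟨fun a ha b _ c hc w h1 h2 h3 h4 => ?_⟩
      exact ha w h1 h2 h3 (hc.1.trans_lt h4)
    have hEloc : ∀ x, ∃ a, ∀ᶠ x' in 𝓝 x, a ∈ E x' := by
      intro x
      by_cases hx : ∀ j < K, R j x < x j
      · have hnear : ∀ᶠ x' in 𝓝 x, ∀ j < K, R j x' < x' j := by
          rw [Filter.eventually_all]
          intro j
          by_cases hj : j < K
          · filter_upwards [((hRc j).continuousAt (x := x)).eventually_lt
              (continuous_apply j).continuousAt (hx j hj)] with x' hx' _
            exact hx'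
          · exact Eventually.of_forall fun _ h => absurd h hj
        obtain ⟨r, hr, hball⟩ := Metric.nhds_basis_closedBall.mem_iff.1 hnear
        -- near `x` the tube over the box is contained in the region of level `k`
        have htube : tube x r θ K ⊆ region k (θ + 1) R := by
          intro w hw j hj
          refine ⟨((hw j hj).2).trans_lt (by linarith), ?_⟩
          set x' : Fin n → ℝ := fun i => if i < K then (w i).re else x i with hx'
          have h1 : x' ∈ Metric.closedBall x r := by
            rw [Metric.mem_closedBall, dist_pi_le_iff hr.le]
            intro i
            by_cases hi : i < K
            · simpa [hx', hi, Real.dist_eq] using (hw i hi).1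
            · simp [hx', hi, hr.le]
          have hjK : j < K := hj
          have h2 := hball h1 j hjK
          rw [hRd j x' (reVec w) fun i hi => by simp [hx', hi.trans hjK]] at h2
          simpa [hx', hjK] using h2
        -- the point of the slice over `x` lies in this tube, so `x` belongs to the tower
        have hxT : x ∈ tower β K := by
          have h1 : slice β x ∈ tube x r θ K := fun j _ => by
            simpa using ⟨hr.le, hθ j⟩
          have := (hR _ (htube h1)).1.1
          rwa [reVec_slice] at this
        have hd := hYr.descend_eq K
        obtain ⟨r', hr', T, hT⟩ := exists_hasSeriesValue_lift (K := K) hβ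
          (hYr.isSliceSol (K + 1) hk) hxT hr hθ0 hθ
          (fun w hw => by rw [← hd]; exact (hR w (htube hw)).1)
        refine ⟨T, ?_⟩
        filter_upwards [Metric.closedBall_mem_nhds x hr'] with x' hx' w h1 _ h3 h4
        have hdist : ∀ j, |x' j - x j| ≤ r' := fun j =>
          ((Real.dist_eq _ _).symm.le.trans (dist_le_pi_dist x' x j)).trans hx'
        have := hT w (fun j hj => ⟨by rw [h1 j hj]; exact hdist j, (h3 j (le_of_lt hj)).le⟩)
          (h3 K le_rfl).le h4.le
        rwa [← hd] at this
      · push Not at hx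
        obtain ⟨j, hj, hjx⟩ := hx
        refine ⟨0, ?_⟩
        filter_upwards [(continuous_apply j).continuousAt.eventually_lt
          (((hRc j).add continuous_const).continuousAt (x := x))
          (show x j < R j x + 1 by linarith)] with x' hx' w _ h2 _ _
        exact absurd (h2 j hj) (not_lt.2 hx'.le)
    -- the sets of admissible values are convex, so locally constant choices glue to a continuous one
    obtain ⟨g, hg⟩ := exists_continuous_forall_mem_convex_of_local_const hEconv hEloc
    -- the new bound is made to depend on the previous coordinates only
    set trunc : (Fin n → ℝ) → Fin n → ℝ := fun x j => if j < K then x j else 0 with htr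
    have htrc : Continuous trunc := continuous_pi fun j => by
      by_cases hj : j < K
      · simpa [htr, hj] using continuous_apply j
      · simpa [htr, hj] using continuous_const
    refine ⟨fun j x => if j = K then g (trunc x) else R j x + 1, fun j => ?_, fun j x x' h => ?_,
      fun w hw => ?_⟩
    · by_cases hj : j = K
      · simp only [hj, if_true]
        exact g.continuous.comp htrc
      · simp only [hj, if_false]
        exact (hRc j).add continuous_const
    · by_cases hj : j = K
      · have : trunc x = trunc x' := by
          ext i
          by_cases hi : i < K
          · simp [htr, hi, h i (hj ▸ hi)]
          · simp [htr, hi]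
        simp [hj, this]
      · simp [hj, hRd j x x' h]
    · have hlt : ∀ j < K, R j (reVec w) + 1 < (w j).re := fun j hj => by
        have := (hw j (Nat.lt_succ_of_lt hj)).2
        simpa [hj.ne] using this
      have him : ∀ j ≤ K, |(w j).im| < θ := fun j hj => (hw j (Nat.lt_succ_of_le hj)).1
      have hwk : w ∈ region k (θ + 1) R := fun j hj =>
        ⟨(him j (le_of_lt hj)).trans (by linarith), (by linarith : R j (reVec w) <
          R j (reVec w) + 1).trans (hlt j hj)⟩
      have hgK : g (trunc (reVec w)) < (w K).re := by
        have := (hw K (Nat.lt_succ_self _)).2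
        simpa using this
      obtain ⟨h1, h2⟩ := hg (trunc (reVec w)) w (fun j hj => by simp [htr, hj])
        (fun j hj => by
          rw [hRd j (trunc (reVec w)) (reVec w) fun i hi => by simp [htr, hi.trans hj]]
          simpa [htr, hj] using hlt j hj) him hgK
      refine ⟨h1, fun j hj => ?_⟩
      rcases Nat.lt_succ_iff_lt_or_eq.1 hj with hj' | hj'
      · exact (hR w hwk).2 j hj'
      · have : j = K := Fin.ext hj'
        rw [this]
        exact h2

end SeriesRegion

/-! ### The shrinking solution -/

section Conclusion

variable {n : ℕ} {β : Fin n → ℝ}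

/-- The successive limits of a solution `Y` of level `n`: the function attached to `m` has
level `n - m`. -/
noncomputable def limits (β : Fin n → ℝ) (Y : (Fin n → ℝ) → Mat n) : ℕ → (Fin n → ℝ) → Mat n
  | 0 => Y
  | m + 1 => if h : n - (m + 1) < n then descend β ⟨n - (m + 1), h⟩ (limits β Y m)
    else limits β Y m

theorem limits_descend (Y : (Fin n → ℝ) → Mat n) (K : Fin n) :
    limits β Y (n - K) = descend β K (limits β Y (n - (K + 1))) := by
  have h : n - (K : ℕ) = n - (K + 1) + 1 := by omega
  have h' : n - (n - ((K : ℕ) + 1) + 1) = K := by omega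
  rw [h, limits, dif_pos (by omega)]
  congr 1
  exact Fin.ext h'

/-- A solution of level `n` on the real slice is the top of a tower of solutions. -/
theorem isSliceTower_limits (hβ : ∀ k, ∃ m : ℤ, β k = m * Real.pi) {Y : (Fin n → ℝ) → Mat n}
    (hY : IsSliceSol β n Y) : IsSliceTower β fun k => limits β Y (n - k) := by
  refine ⟨fun k hk => ?_, limits_descend Y⟩
  induction hk using Nat.decreasingInduction with
  | self => simpa [limits] using hY
  | of_succ k hk ih =>
    have := isSliceSol_descend (K := ⟨k, hk⟩) hβ ih
    rwa [← limits_descend Y ⟨k, hk⟩] at this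

theorem slice_reVec_mem_ball {c w : Fin n → ℂ} (hc : ∀ j, (c j).im = β j) {r : ℝ} (hr : 0 < r)
    (hw : w ∈ Metric.ball c r) : slice β (reVec w) ∈ Metric.ball c r := by
  rw [Metric.mem_ball, dist_pi_lt_iff hr] at hw ⊢
  intro j
  refine lt_of_le_of_lt ?_ (hw j)
  have e : slice β (reVec w) j - c j = (((w j - c j).re : ℝ) : ℂ) := by
    apply Complex.ext <;> simp [hc]
  rw [dist_eq_norm, dist_eq_norm, e, Complex.norm_real]
  exact Complex.abs_re_le_norm _

/-- A solution near the real component agrees with the continuation, in imaginary directions, of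
its restriction to the real slice. -/
theorem eventually_lift_eq {w₀ : Fin n → ℂ} (hreal : IsRealPoint w₀) (hinf : ReachesInfinity w₀)
    {Ω₁ : Set (Fin n → ℂ)} {Ψ : (Fin n → ℂ) → Mat n} (hΩ₁ : IsOpen Ω₁)
    (hreg : Ω₁ ⊆ levelRegular u n) (hΨ : ∀ w ∈ Ω₁, HasFDerivAt Ψ (iso n n w (Ψ w)) w)
    (hcomp : realComponent w₀ ⊆ Ω₁) {c : Fin n → ℂ} (hc : c ∈ realComponent w₀) :
    ∀ᶠ w in 𝓝 c, w ∈ liftDomain (fun k => (w₀ k).im) n (Ψ ∘ slice fun k => (w₀ k).im) ∧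
      lift (fun k => (w₀ k).im) n (Ψ ∘ slice fun k => (w₀ k).im) w = Ψ w := by
  set β : Fin n → ℝ := fun k => (w₀ k).im with hβ
  have hcβ : slice β (reVec c) = c := slice_reVec_eq hc.1
  have hcT : reVec c ∈ tower β n :=
    (mem_tower_iff_mem_realComponent hreal hinf _).2 (by rw [hcβ]; exact hc)
  obtain ⟨r, hr0, hball⟩ := Metric.eventually_nhds_iff_ball.1
    ((hΩ₁.eventually_mem (hcomp hc)).and
      (((isOpen_tower β n).preimage continuous_reVec).eventually_mem hcT))
  filter_upwards [Metric.ball_mem_nhds c hr0] with w hw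
  have hs := isSegSol_of_hasFDerivAt (V := Metric.ball c r) (fun v hv => hreg (hball v hv).1)
    (fun v hv => hΨ v (hball v hv).1) (p := slice β (reVec w)) (q := w) fun t ht =>
      (convex_ball _ _).add_smul_sub_mem (slice_reVec_mem_ball hc.1 hr0 hw) hw ht
  refine ⟨⟨(hball w hw).2, _, hs, by simp⟩, ?_⟩
  rw [hs.lift_eq (by simp)]
  simp

theorem isOpen_regionAtInfinity (θ : ℝ) {R : (k : Fin n) → (Fin (k : ℕ) → ℂ) → ℝ}
    (hR : ∀ k, Continuous (R k)) : IsOpen (regionAtInfinity θ R) := by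
  simp only [regionAtInfinity, Set.ofPred_forall]
  refine isOpen_iInter_of_finite fun k => ?_
  refine IsOpen.and (isOpen_lt ?_ continuous_const) (isOpen_lt ?_ ?_)
  · exact (Complex.continuous_im.comp (continuous_apply k)).abs
  · exact (hR k).comp (continuous_pi fun j => continuous_apply _)
  · exact Complex.continuous_re.comp (continuous_apply k)

/-- Bounds depending on the real parts of the previous coordinates give a region at infinity in the
sense of bounds depending on the previous complex coordinates. -/
theorem exists_regionAtInfinity_subset (θ : ℝ) {R : Fin n → (Fin n → ℝ) → ℝ}
    (hR : ∀ j, Continuous (R j)) (hR' : ∀ j x x', (∀ i < j, x i = x' i) → R j x = R j x') :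
    ∃ S : (k : Fin n) → (Fin (k : ℕ) → ℂ) → ℝ, (∀ k, Continuous (S k)) ∧
      regionAtInfinity θ S ⊆ region n θ R := by
  refine ⟨fun k z => R k fun j => if h : (j : ℕ) < k then (z ⟨j, h⟩).re else 0, fun k => ?_,
    fun w hw j _ => ⟨(hw j).1, ?_⟩⟩
  · refine (hR k).comp (continuous_pi fun j => ?_)
    by_cases h : (j : ℕ) < k
    · simp only [h, dif_pos]
      exact Complex.continuous_re.comp (continuous_apply _)
    · simp only [h, dif_neg, not_false_eq_true]
      exact continuous_const
  · refine lt_of_eq_of_lt (hR' j _ _ fun i hi => ?_) (hw j).2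
    simp [Fin.lt_def.1 hi]

/-- A solution near the real component that is skew-Hermitian on it restricts to a solution of
level `n` on the real slice. -/
theorem isSliceSol_comp_slice {w₀ : Fin n → ℂ} (hreal : IsRealPoint w₀)
    (hinf : ReachesInfinity w₀) {Ψ : (Fin n → ℂ) → Mat n}
    (hΨ : ∀ w ∈ realComponent w₀, HasFDerivAt Ψ (iso n n w (Ψ w)) w)
    (hskew : ∀ w ∈ realComponent w₀, (Ψ w)ᴴ = -Ψ w) :
    IsSliceSol (fun k => (w₀ k).im) n (Ψ ∘ slice fun k => (w₀ k).im) := by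
  have hmem := fun x => (mem_tower_iff_mem_realComponent hreal hinf x).1
  refine ⟨fun x hx => ?_, fun x hx => skew_delta (hskew _ (hmem x hx)),
    fun x hx j => imagSpectrum_of_skew (skew_delta (hskew _ (hmem x hx)))⟩
  exact ((hΨ _ (hmem x hx)).restrictScalars ℝ).comp x (hasFDerivAt_slice _ x)

/-- The solution is the sum of the iterated series attached to the bottom of the tower of its limits,
which is a constant since at level `0` the right-hand side of the equation vanishes. -/
theorem IsSolutionOn.isShrinkingAt (hn : 0 < n) {Ω : Set (Fin n → ℂ)}
    {Φ : (Fin n → ℂ) → Mat n} (hΦ : IsSolutionOn Ω Φ) {w₀ : Fin n → ℂ} (hw₀ : w₀ ∈ Ω)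
    (hreal : IsRealPoint w₀) (hinf : ReachesInfinity w₀) (hskew : (Φ w₀)ᴴ = -Φ w₀) :
    IsShrinkingAt w₀ Φ := by
  obtain ⟨Ω₁, Ψ, hΩ₁, hreg, hΨ, hcomp, hgerm, hsk⟩ :=
    exists_solution_near_component hΦ hw₀ hreal hskew
  set β : Fin n → ℝ := fun k => (w₀ k).im with hβ
  have hY := isSliceSol_comp_slice hreal hinf (fun w hw => hΨ w (hcomp hw)) hsk
  set Y : (Fin n → ℝ) → Mat n := Ψ ∘ slice β with hYdef
  have hYr := isSliceTower_limits hreal hY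
  set Yr : ℕ → (Fin n → ℝ) → Mat n := fun k => limits β Y (n - k) with hYrdef
  have htop : Yr n = Y := by simp [hYrdef, limits]
  have hY0 := hYr.isSliceSol 0 (Nat.zero_le _)
  have hx0 : ∀ x : Fin n → ℝ, x ∈ tower β 0 := fun x => by rw [tower_zero]; trivial
  refine ⟨Yr 0 0, boundaryCondition_of_imagSpectrum (hY0.spec 0 (hx0 0)), fun θ hθ => ?_⟩
  have hθ0 : 0 ≤ θ := (abs_nonneg _).trans (hθ ⟨0, hn⟩).le
  obtain ⟨R, hRc, hRd, hR⟩ := exists_region hreal hYr n le_rfl θ hθ0 fun j => (hθ j).le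
  obtain ⟨S, hSc, hS⟩ := exists_regionAtInfinity_subset θ hRc hRd
  have hnear := fun c (hc : c ∈ realComponent w₀) =>
    eventually_lift_eq hreal hinf hΩ₁ hreg hΨ hcomp hc
  -- the continuation is a solution on the interior of its domain, which contains the real component
  -- by the agreement with `Ψ`, and the region at infinity because that region is open
  refine ⟨S, hSc, interior (liftDomain β n Y), lift β n Y, ?_, fun c hc => ?_, ?_, ?_,
    fun w hw => ?_⟩
  · exact isSolutionOn_of_hasFDerivAt isOpen_interior
      (fun w hw => segDomain_subset (interior_subset hw).2)
      fun w hw => hasFDerivAt_lift hY (interior_subset hw)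
  · exact mem_interior_iff_mem_nhds.2 ((hnear c hc).mono fun w hw => hw.1)
  · refine interior_maximal (fun w hw => ?_) (isOpen_regionAtInfinity θ hSc)
    have := (hR w (hS hw)).1
    rwa [htop] at this
  · filter_upwards [hnear w₀ (self_mem_realComponent w₀), hgerm] with w h1 h2
    exact h1.2.trans h2
  · refine ⟨fun k => lift β k (Yr k) w, ?_, by simp only [htop], fun k => (hR w (hS hw)).2 k k.2⟩
    change lift β 0 (Yr 0) w = Yr 0 0
    rw [(lift_level_zero w).2]
    exact hY0.congr (hx0 _) fun j hj => absurd hj (Nat.not_lt_zero _)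

end Conclusion

end Isomonodromy

theorem mainTheorem10 (n : ℕ) (hn : 0 < n) (Ω : Set (Fin n → ℂ))
    (Φ : (Fin n → ℂ) → Matrix (Fin n) (Fin n) ℂ)
    (hΦ : Isomonodromy.IsSolutionOn Ω Φ)
    (w₀ : Fin n → ℂ) (hw₀ : w₀ ∈ Ω)
    (hreal : Isomonodromy.IsRealPoint w₀)
    (hinf : Isomonodromy.ReachesInfinity w₀)
    (hskew : (Φ w₀)ᴴ = -Φ w₀) :
    Isomonodromy.IsShrinkingAt w₀ Φ := by
  exact hΦ.isShrinkingAt hn hw₀ hreal hinf hskew
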